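/- **Proposition 5.1 (Coarse-grained Poincaré inequality with right-hand side).** *Setting.* Let $d\ge 1$. Let $\mathbf a:\mathbb R\times\mathbb R^d\to\mathbb R^{d\times d}$ be measurable with $e\cdot \mathbf a e>0$ for all $e\neq 0$. Let $\mathbf s$ and $\mathbf k$ be its symmetric and skew-symmetric parts, and suppose $\mathbf s,\mathbf s^{-1}\in L^1_{\rm loc}$ and $\mathbf s^{-1/2}\mathbf k\mathbf s^{-1/2}\in L^\infty_{\rm loc}$. For $k\in\mathbb Z$ put $\square_k=(-\tfrac12 3^{2k},\tfrac12 3^{2k})\times(-\tfrac12 3^k,\tfrac12 3^k)^d$ and $\mathcal Z_k=3^{2k}\mathbb Z\times 3^k\mathbb Z^d$. Write $(g)_V$ and $⨍_V g$ for the mean of $g$ over $V$, and $\|g\|_{\underline L^2(V)}=(⨍_V|g|^2)^{1/2}$. A solution of $\partial_t u-\nabla\cdot\mathbf a\nabla u=\nabla\cdot\mathbf f$ in a bounded open $D\subseteq\mathbb R\times\mathbb R^d$, where $\mathbf f\in L^1(D)^d$, is a function $u\in L^1(D)$ with weak spatial gradient $\nabla u\in L^1(D)^d$ such that $\int_D\nabla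 u\cdot\mathbf s\nabla u<\infty$ and $-\int_D u\,\partial_t\varphi+\int_D\nabla\varphi\cdot\mathbf a\nabla u=-\int_D\mathbf f\cdot\nabla\varphi$ for all $\varphi\in C_c^\infty(D)$. *Coarse-grained ellipticity.* For a parabolic cube $Q$ let $\mathcal A(Q)$ be the set of mean-zero solutions of $\partial_tu=\nabla\cdot\mathbf a\nabla u$ in $Q$, and set $$J(Q,p,q)=\sup_{u\in\mathcal A(Q)}⨍_Q\bigl(-\tfrac12\nabla u\cdot\mathbf s\nabla u-p\cdot\mathbf a\nabla u+q\cdot\nabla u\bigr).$$ The symmetric matrices $\mathbf s_*^{-1}(Q)$ and $\mathbf b(Q)$ are given by $J(Q,0,q)=\tfrac12 q\cdot\mathbf s_*^{-1}(Q)q$ and $J(Q,p,0)=\tfrac12p\cdot\mathbf b(Q)p$. With $|\cdot|$ the spectral norm, and values in $[0,\infty]$, $$\Lambda_{s,2}(\square_m)=\sum_{k\le m}3^{2s(k-m)}\max_{z\in\mathcal Z_k\cap\square_m}|\mathbf b(z+\square_k)|,\qquad \lambda_{s,2}(\square_m)=\Bigl(\sum_{k\le m}3^{2s(k-m)}\max_{z\in\mathcal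 Z_k\cap\square_m}|\mathbf s_*^{-1}(z+\square_k)|\Bigr)^{-1}.$$ *Norms.* For $D=I\times U$ let $m$ be the smallest integer with $D\subseteq\square_m$, and let $\mathcal Z_j(D)=\{z\in\mathcal Z_j:(z+\square_j)\cap D\ne\emptyset\}$. For $\mathbb R^d$-valued functions define $$\|g\|_{\underline B^s_{2,2}(D)}=3^{-sm}|(g)_D|+\Bigl(\sum_{j\le m}3^{-2sj}\,\frac1{\#\mathcal Z_{j-1}(D)}\sum_{z\in\mathcal Z_{j-1}(D)}\|g-(g)_{(z+\square_j)\cap D}\|^2_{\underline L^2((z+\square_j)\cap D)}\Bigr)^{1/2},$$ $$\|F\|_{\underline{\hat B}^{-s}_{2,2}(D)}=\sup\Bigl\{⨍_D F\cdot g:\ g \text{ smooth up to the boundary of } D,\ \|g\|_{\underline B^s_{2,2}(D)}\le1\Bigr\}.$$ *Statement.* Let $0<s<\tfrac12$ and $0<\epsilon<s$, let $I=(0,T)$ with $0<T<\infty$, and let $U\subset\mathbb R^d$ be a bounded Lipschitz domain. There is a constant $C<\infty$, depending only on $d,s,\epsilon$ and the shape of $I\times U$, such that for every $\mathbf a$ as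 above, every $\mathbf f\in L^1(I\times U)^d$ and every solution $u$ of $\partial_tu-\nabla\cdot\mathbf a\nabla u=\nabla\cdot\mathbf f$ in $I\times U$, $$\|\nabla u\|_{\underline{\hat B}^{-s}_{2,2}(I\times U)}\le C3^{sm}\lambda_{s-\epsilon,2}^{-1/2}(\square_m)\|\mathbf s^{1/2}\nabla u\|_{\underline L^2(I\times U)}+C3^{2sm}\lambda^{-1}_{s-\epsilon,2}(\square_m)\|\mathbf f\|_{\underline B^s_{2,2}(I\times U)}$$ and $$\|\mathbf a\nabla u\|_{\underline{\hat B}^{-s}_{2,2}(I\times U)}\le C3^{sm}\Lambda_{s,2}^{1/2}(\square_m)\|\mathbf s^{1/2}\nabla u\|_{\underline L^2(I\times U)}+C\frac{\Lambda_{s,2}^{1/2}(\square_m)}{\lambda^{1/2}_{s-\epsilon,2}(\square_m)}3^{2sm}\|\mathbf f\|_{\underline B^s_{2,2}(I\times U)}.$$ The constant does not depend on the size of the domain: for all $r>0$ the same $C$ works when $I\times U$ is replaced by $(0,r^2T)\times rU$, with $m$ replaced accordingly. (Right-hand sides may be infinite, with $0\cdot\infty=0$.) -/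

import Mathlib

open MeasureTheory Set
open scoped ENNReal NNReal ContDiff Pointwise

noncomputable section

namespace CoarseParabolic

/-- Physical space `ℝ^d` with its Euclidean norm. -/
abbrev Space (d : ℕ) : Type := EuclideanSpace ℝ (Fin d)

/-- Space-time points `(t, x)`, carrying Lebesgue measure. -/
abbrev SpaceTime (d : ℕ) : Type := ℝ × Space d

/-! ### Coefficient fields -/

/-- The symmetric part `(A + Aᵗ) / 2`. -/
def symPart {d : ℕ} (A : Matrix (Fin d) (Fin d) ℝ) : Matrix (Fin d) (Fin d) ℝ :=
  (1 / 2 : ℝ) • (A + A.transpose)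

/-- The skew-symmetric part `(A - Aᵗ) / 2`. -/
def skewPart {d : ℕ} (A : Matrix (Fin d) (Fin d) ℝ) : Matrix (Fin d) (Fin d) ℝ :=
  (1 / 2 : ℝ) • (A - A.transpose)

/-- The bilinear form `v · A w`. -/
def bil {d : ℕ} (A : Matrix (Fin d) (Fin d) ℝ) (v w : Space d) : ℝ :=
  inner ℝ v (Matrix.toEuclideanLin A w)

/-- The class `Ω` of coefficient fields: `a` is measurable with `e · a e > 0` for `e ≠ 0`, its
symmetric part `s` and `s⁻¹` are locally integrable, and `s^{-1/2} k s^{-1/2}` is locally bounded,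
where `k` is the skew-symmetric part. The last condition is written as the bound
`|v · k w| ≤ M |s^{1/2} v| |s^{1/2} w|`, which says that the spectral norm of
`s^{-1/2} k s^{-1/2}` is at most `M`. -/
structure IsCoefficientField {d : ℕ} (a : SpaceTime d → Matrix (Fin d) (Fin d) ℝ) : Prop where
  measurable : ∀ i j, Measurable fun z => a z i j
  pos : ∀ z, ∀ e : Space d, e ≠ 0 → 0 < bil (a z) e e
  locallyIntegrable_sym : ∀ i j, LocallyIntegrable (fun z => symPart (a z) i j) volume
  locallyIntegrable_sym_inv : ∀ i j, LocallyIntegrable (fun z => (symPart (a z))⁻¹ i j) volume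
  locallyBounded_skew : ∀ K : Set (SpaceTime d), IsCompact K →
    ∃ M : ℝ, ∀ᵐ z ∂(volume.restrict K), ∀ v w : Space d,
      |bil (skewPart (a z)) v w| ≤
        M * (√(bil (symPart (a z)) v v) * √(bil (symPart (a z)) w w))

/-! ### Domains -/

/-- Bounded Lipschitz domains: bounded, open, connected (non-empty) sets which, in a ball around
each boundary point, are the part lying above the graph of a Lipschitz function over the hyperplane
orthogonal to some unit vector `n`. -/
structure IsBoundedLipschitzDomain {d : ℕ} (U : Set (Space d)) : Prop where
  isOpen : IsOpen U
  isConnected : IsConnected U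
  isBounded : Bornology.IsBounded U
  boundary : ∀ x ∈ frontier U, ∃ ρ : ℝ, 0 < ρ ∧ ∃ n : Space d, ‖n‖ = 1 ∧
    ∃ (K : ℝ≥0) (γ : Space d → ℝ), LipschitzWith K γ ∧
      ∀ y ∈ Metric.ball x ρ, (y ∈ U ↔ γ (y - (inner ℝ n y : ℝ) • n) < inner ℝ n y)

/-- The parabolic cube `z + □_k`, where
`□_k = (-3^{2k}/2, 3^{2k}/2) × (-3^k/2, 3^k/2)^d`. -/
def cube {d : ℕ} (z : SpaceTime d) (k : ℤ) : Set (SpaceTime d) :=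
  {y | |y.1 - z.1| < (3 : ℝ) ^ (2 * k) / 2 ∧ ∀ i, |y.2 i - z.2 i| < (3 : ℝ) ^ k / 2}

/-- The space-time lattice `Z_k = 3^{2k} ℤ × 3^k ℤ^d`. -/
def lattice (d : ℕ) (k : ℤ) : Set (SpaceTime d) :=
  {z | (∃ i : ℤ, z.1 = (3 : ℝ) ^ (2 * k) * i) ∧ ∀ l, ∃ j : ℤ, z.2 l = (3 : ℝ) ^ k * j}

/-- The lattice points `z ∈ Z_k` whose cube `z + □_k` meets `D`. -/
def latticeNear {d : ℕ} (k : ℤ) (D : Set (SpaceTime d)) : Set (SpaceTime d) :=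
  {z | z ∈ lattice d k ∧ (cube z k ∩ D).Nonempty}

/-! ### Weak solutions -/

/-- Smooth functions with compact support in `D`. -/
def IsTestFunction {d : ℕ} (D : Set (SpaceTime d)) (φ : SpaceTime d → ℝ) : Prop :=
  ContDiff ℝ ∞ φ ∧ HasCompactSupport φ ∧ tsupport φ ⊆ D

/-- The time derivative. -/
def timeDeriv {d : ℕ} (φ : SpaceTime d → ℝ) (z : SpaceTime d) : ℝ :=
  deriv (fun t => φ (t, z.2)) z.1

/-- The spatial gradient. -/
def spaceGrad {d : ℕ} (φ : SpaceTime d → ℝ) (z : SpaceTime d) : Space d :=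
  gradient (fun x => φ (z.1, x)) z.2

/-- `G` is the weak spatial gradient of `u` in `D`, both being integrable on `D`. -/
structure IsWeakGradient {d : ℕ} (D : Set (SpaceTime d)) (u : SpaceTime d → ℝ)
    (G : SpaceTime d → Space d) : Prop where
  integrableOn : IntegrableOn u D
  integrableOn_grad : IntegrableOn G D
  integral_eq : ∀ φ, IsTestFunction D φ →
    ∫ z in D, u z • spaceGrad φ z = -∫ z in D, φ z • G z

/-- `u`, with weak spatial gradient `G = ∇u` of finite energy `∫_D ∇u · s∇u`, solves
`∂_t u - ∇ · a∇u = ∇ · f` in `D` in the weak sense. -/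
structure IsWeakSolution {d : ℕ} (a : SpaceTime d → Matrix (Fin d) (Fin d) ℝ)
    (f : SpaceTime d → Space d) (D : Set (SpaceTime d)) (u : SpaceTime d → ℝ)
    (G : SpaceTime d → Space d) : Prop where
  isWeakGradient : IsWeakGradient D u G
  energy : IntegrableOn (fun z => bil (symPart (a z)) (G z) (G z)) D
  equation : ∀ φ, IsTestFunction D φ →
    -(∫ z in D, u z * timeDeriv φ z) + ∫ z in D, bil (a z) (spaceGrad φ z) (G z) =
      -∫ z in D, (inner ℝ (f z) (spaceGrad φ z) : ℝ)

/-! ### Coarse-grained matrices and ellipticity constants -/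

/-- The values over the solution space `A(D)` (solutions `u` of `∂_t u = ∇ · a∇u` in `D` with
finite energy and zero mean) of the functional
`⨍_D (-½ ∇u · s∇u - p · a∇u + q · ∇u)`.
That `∂_t u` lies in the dual of the energy space is automatic for such `u`. -/
def coarseValues {d : ℕ} (a : SpaceTime d → Matrix (Fin d) (Fin d) ℝ) (D : Set (SpaceTime d))
    (p q : Space d) : Set ℝ :=
  {y | ∃ (u : SpaceTime d → ℝ) (G : SpaceTime d → Space d),
    IsWeakSolution a 0 D u G ∧ (⨍ z in D, u z) = 0 ∧
    y = ⨍ z in D, (-(1 / 2) * bil (symPart (a z)) (G z) (G z) - bil (a z) p (G z)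
      + inner ℝ q (G z))}

/-- The quantity `J(D, p, q)`: the supremum of the functional above. For a coefficient field in `Ω`
the set of values contains `0` and is bounded above. -/
def coarseJ {d : ℕ} (a : SpaceTime d → Matrix (Fin d) (Fin d) ℝ) (D : Set (SpaceTime d))
    (p q : Space d) : ℝ :=
  sSup (coarseValues a D p q)

/-- The `i`-th standard basis vector. -/
def basisVec {d : ℕ} (i : Fin d) : Space d := EuclideanSpace.single i 1

/-- The coarse-grained matrix `s_*⁻¹(D)`: the matrix of the quadratic form
`q ↦ 2 J(D, 0, q) = q · s_*⁻¹(D) q`, recovered by polarization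
(see `coarse_matrices_eq`). -/
def sStarInv {d : ℕ} (a : SpaceTime d → Matrix (Fin d) (Fin d) ℝ) (D : Set (SpaceTime d)) :
    Matrix (Fin d) (Fin d) ℝ :=
  Matrix.of fun i j => coarseJ a D 0 (basisVec i + basisVec j) - coarseJ a D 0 (basisVec i)
    - coarseJ a D 0 (basisVec j)

/-- The coarse-grained matrix `b(D) = (s + kᵗ s_*⁻¹ k)(D)`: the matrix of the quadratic form
`p ↦ 2 J(D, p, 0) = p · b(D) p`, recovered by polarization
(see `coarse_matrices_eq`). -/
def bMat {d : ℕ} (a : SpaceTime d → Matrix (Fin d) (Fin d) ℝ) (D : Set (SpaceTime d)) :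
    Matrix (Fin d) (Fin d) ℝ :=
  Matrix.of fun i j => coarseJ a D (basisVec i + basisVec j) 0 - coarseJ a D (basisVec i) 0
    - coarseJ a D (basisVec j) 0

lemma bil_add_self {d : ℕ} {M : Matrix (Fin d) (Fin d) ℝ} (hM : M.transpose = M) (i j : Fin d) :
    bil M (basisVec i + basisVec j) (basisVec i + basisVec j) =
      bil M (basisVec i) (basisVec i) + bil M (basisVec j) (basisVec j) + 2 * M i j := by
  have key : ∀ i j : Fin d, bil M (basisVec i) (basisVec j) = M i j := by
    intro i j
    simp [bil, basisVec, EuclideanSpace.inner_single_left, Matrix.toLpLin_apply]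
  have hs : M j i = M i j := by
    conv_lhs => rw [← hM]
    rfl
  have e : bil M (basisVec i + basisVec j) (basisVec i + basisVec j) =
      bil M (basisVec i) (basisVec i) + bil M (basisVec i) (basisVec j)
        + bil M (basisVec j) (basisVec i) + bil M (basisVec j) (basisVec j) := by
    simp only [bil, map_add, inner_add_left, inner_add_right]
    ring
  rw [e, key i j, key j i, hs]
  ring

/-- Any matrices `s`, `s_*` (symmetric) and `k` representing `J(D, ·, ·)` through
`J(D,p,q) = ½ p · s p + ½ (q + k p) · s_*⁻¹ (q + k p) - p · q` produce the two matrices above. -/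
lemma coarse_matrices_eq {d : ℕ} (a : SpaceTime d → Matrix (Fin d) (Fin d) ℝ)
    (D : Set (SpaceTime d)) (S Sstar K : Matrix (Fin d) (Fin d) ℝ)
    (hS : S.transpose = S) (hSstar : Sstar.transpose = Sstar)
    (hJ : ∀ p q : Space d, coarseJ a D p q = 1 / 2 * bil S p p
      + 1 / 2 * bil Sstar⁻¹ (q + Matrix.toEuclideanLin K p) (q + Matrix.toEuclideanLin K p)
      - inner ℝ p q) :
    sStarInv a D = Sstar⁻¹ ∧ bMat a D = S + K.transpose * Sstar⁻¹ * K := by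
  have hinv : (Sstar⁻¹).transpose = Sstar⁻¹ := by rw [Matrix.transpose_nonsing_inv, hSstar]
  have h1 : ∀ q : Space d, coarseJ a D 0 q = 1 / 2 * bil Sstar⁻¹ q q := by
    intro q
    rw [hJ]
    simp [bil]
  have hB : (S + K.transpose * Sstar⁻¹ * K).transpose = S + K.transpose * Sstar⁻¹ * K := by
    simp [Matrix.transpose_mul, hS, hinv, Matrix.mul_assoc]
  have hquad : ∀ p : Space d, bil (S + K.transpose * Sstar⁻¹ * K) p p =
      bil S p p + bil Sstar⁻¹ (Matrix.toEuclideanLin K p) (Matrix.toEuclideanLin K p) := by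
    intro p
    simp only [bil, EuclideanSpace.inner_eq_star_dotProduct, Matrix.toLpLin_apply, star_trivial,
      Matrix.add_mulVec, add_dotProduct]
    congr 1
    rw [← Matrix.mulVec_mulVec, ← Matrix.mulVec_mulVec, Matrix.mulVec_transpose,
      ← Matrix.dotProduct_mulVec]
  have h2 : ∀ p : Space d, coarseJ a D p 0 =
      1 / 2 * bil (S + K.transpose * Sstar⁻¹ * K) p p := by
    intro p
    rw [hJ, hquad]
    simp
    ring
  constructor
  · ext i j
    simp only [sStarInv, Matrix.of_apply, h1, bil_add_self hinv]
    ring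
  · ext i j
    simp only [bMat, Matrix.of_apply, h2, bil_add_self hB]
    ring

/-- The spectral norm of a matrix, as an extended non-negative number. -/
def specNorm {d : ℕ} (M : Matrix (Fin d) (Fin d) ℝ) : ℝ≥0∞ :=
  ‖Matrix.toEuclideanCLM (n := Fin d) (𝕜 := ℝ) M‖ₑ

/-- The upper coarse-grained ellipticity constant
`Λ_{s,q}(□_n) = (∑_{k ≤ n} 3^{sq(k-n)} max_{z ∈ Z_k ∩ □_n} |b(z + □_k)|^{q/2})^{2/q}`,
possibly infinite. -/
def LambdaUpper {d : ℕ} (a : SpaceTime d → Matrix (Fin d) (Fin d) ℝ) (s q : ℝ) (n : ℤ) : ℝ≥0∞ :=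
  (∑' k : Set.Iic n, (3 : ℝ≥0∞) ^ (s * q * (((k : ℤ) : ℝ) - (n : ℝ))) *
    ⨆ z ∈ lattice d k ∩ cube 0 n, specNorm (bMat a (cube z k)) ^ (q / 2)) ^ (2 / q)

/-- The lower coarse-grained ellipticity constant
`λ_{s,q}(□_n) = (∑_{k ≤ n} 3^{sq(k-n)} max_{z ∈ Z_k ∩ □_n} |s_*⁻¹(z + □_k)|^{q/2})^{-2/q}`,
which is `0` when the sum diverges. -/
def lambdaLower {d : ℕ} (a : SpaceTime d → Matrix (Fin d) (Fin d) ℝ) (s q : ℝ) (n : ℤ) : ℝ≥0∞ :=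
  (∑' k : Set.Iic n, (3 : ℝ≥0∞) ^ (s * q * (((k : ℤ) : ℝ) - (n : ℝ))) *
    ⨆ z ∈ lattice d k ∩ cube 0 n, specNorm (sStarInv a (cube z k)) ^ (q / 2)) ^ (-(2 / q))

/-! ### Volume-normalized norms -/

/-- `‖s^{1/2} G‖_{L²(D)} = (⨍_D G · s G)^{1/2}`, with a volume-normalized integral. -/
def energyNorm {d : ℕ} (a : SpaceTime d → Matrix (Fin d) (Fin d) ℝ) (D : Set (SpaceTime d))
    (G : SpaceTime d → Space d) : ℝ≥0∞ :=
  (⨍⁻ z, ENNReal.ofReal (bil (symPart (a z)) (G z) (G z)) ∂(volume.restrict D)) ^ (1 / 2 : ℝ)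

/-- The squared normalized deviation `⨍_V |g - (g)_V|²` of `g` from its mean over `V`. -/
def meanSqDev {d : ℕ} (V : Set (SpaceTime d)) (g : SpaceTime d → Space d) : ℝ≥0∞ :=
  ⨍⁻ z, ‖g z - ⨍ y in V, g y‖ₑ ^ 2 ∂(volume.restrict V)

/-- The Besov semi-norm `[g]_{B^s_{2,2}(D)}`, the square root of
`∑_{j ≤ m} 3^{-2sj} (average over z of ⨍_V |g - (g)_V|², where V = (z + □_j) ∩ D)`,
`z` running over the points of `Z_{j-1}` whose cube `z + □_{j-1}` meets `D`. -/
def besovSeminorm {d : ℕ} (m : ℤ) (D : Set (SpaceTime d)) (s : ℝ) (g : SpaceTime d → Space d) :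
    ℝ≥0∞ :=
  (∑' j : Set.Iic m, (3 : ℝ≥0∞) ^ (-(2 * s * ((j : ℤ) : ℝ))) *
    ((∑' z : latticeNear ((j : ℤ) - 1) D, meanSqDev (cube (z : SpaceTime d) j ∩ D) g) /
      ((latticeNear ((j : ℤ) - 1) D).encard : ℝ≥0∞))) ^ (1 / 2 : ℝ)

/-- The Besov norm `‖g‖_{B^s_{2,2}(D)} = 3^{-sm} |(g)_D| + [g]_{B^s_{2,2}(D)}`. -/
def besovNorm {d : ℕ} (m : ℤ) (D : Set (SpaceTime d)) (s : ℝ) (g : SpaceTime d → Space d) :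
    ℝ≥0∞ :=
  (3 : ℝ≥0∞) ^ (-(s * (m : ℝ))) * ‖⨍ z in D, g z‖ₑ + besovSeminorm m D s g

/-- The dual norm `‖F‖_{B̂^{-s}_{2,2}(D)}`: the supremum of `⨍_D F · g` over all `g`, smooth up to
the boundary of `D` (restrictions to `D` of smooth maps), with `‖g‖_{B^s_{2,2}(D)} ≤ 1`. -/
def besovDualNorm {d : ℕ} (m : ℤ) (D : Set (SpaceTime d)) (s : ℝ) (F : SpaceTime d → Space d) :
    ℝ≥0∞ :=
  ⨆ (g : SpaceTime d → Space d) (_ : ContDiff ℝ ∞ g) (_ : besovNorm m D s g ≤ 1),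
    ENNReal.ofReal (⨍ z in D, (inner ℝ (F z) (g z) : ℝ))

end CoarseParabolic

end

/-!
The estimate is proved by duality. A smooth `g` is the limit of its averages over the triadic
cubes contained in `D = I × U`, so the pairing of `g` with `F = ∇u` or `F = a∇u` telescopes into a
sum, over all triadic cubes `Q ⊆ D`, of the increment of `g` at `Q` times `∫_Q F`. By
Cauchy-Schwarz (`enorm_integral_inner_cubeProj_sq_le`) it then suffices to bound `∫_Q F` for each
such `Q`, in terms of the energy of `u` and of the oscillation of `f` in `Q`, and to bound the
weighted sum of the squared increments of `g`.

*Means over cubes.* If `f` is constant on `Q`, then `u` solves the homogeneous equation in `Q`,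
and the definition of `s_*⁻¹(Q)` and `b(Q)` as maximal values of `J` gives, by polarization, the
bound of `∫_Q ∇u` and `∫_Q a∇u` by the energy (`norm_integral_grad_sq_le`,
`norm_integral_flux_sq_le`). In general one subtracts a corrector: a solution with right-hand side
`f - (f)_Q` whose gradient (respectively flux) has mean zero. Its existence (`exists_isCorrector`)
is a Lions-type argument, by a limit of Galerkin approximations: the equation is tested with
smooth compactly supported functions, plus linear functions `p · x` if the mean of the flux is
prescribed, and the solution is sought in their closure. Neither initial values nor uniqueness are
needed.

The energy of the corrector must be controlled by the multiscale sum of the `s_*⁻¹`, times the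
oscillation of `f`. For right-hand sides that are constant on triadic cubes of a given scale this
is shown by induction on the number of scales (`exists_isCorrector_cubeProj`): the energy
inequality bounds the energy by the pairing of the right-hand side with the gradient, which
telescopes as above, and the means of the gradient over the smaller cubes are controlled by the
induction hypothesis. The constants do not depend on the number of scales, because the quadratic
inequality for the energy is absorbed at each stage and the local oscillations are summable. A
weak limit yields the general case (`exists_isCorrector_cell`).

*Increments.* For a cube whose parent lies in `D`, the increment is controlled by the Besov
seminorm at once. The other cubes are the maximal triadic cubes in `D`, whose averages are
compared with those over larger and larger pieces of `D`. As the boundary layer of width `3^k` has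
a volume of order `3^k`, this is a Hardy inequality, valid for `s < 1 / 2` (`exists_incSum_le`).
It uses the geometry of `D` only through `IsRegularDomain`, whose constant is the same for all the
parabolic dilations of a Lipschitz cylinder (`exists_isRegularDomain`).

*Conclusion.* The two parts combine to `exists_besovDualNorm_le` and `exists_coarse_poincare`. The
multiscale sum of the coarse-grained matrices, a prefactor of the right-hand side, does not vanish
(`sStarInv_bMat_ne_zero`), so that an infinite contribution of `f` to the right-hand side is not
lost in a product `0 * ⊤`, and only the case where this contribution is finite has to be treated.
Finally `λ_s⁻¹ ≤ λ_{s-ε}⁻¹`, so the estimates hold with exponent `s` itself.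
-/

noncomputable section

namespace CoarseParabolic

open Filter Topology

universe u

/-! ### Solvability of non-symmetric forms -/

section Hilbert

/-- Weak compactness of balls, along an ultrafilter. -/
lemma exists_tendsto_inner_of_norm_le {H ι : Type*} [NormedAddCommGroup H] [InnerProductSpace ℝ H]
    [CompleteSpace H] (U : Ultrafilter ι) (h : ι → H) (M : ℝ) (hM : ∀ i, ‖h i‖ ≤ M) :
    ∃ x : H, ∀ y, Tendsto (fun i => inner ℝ (h i) y) U (𝓝 (inner ℝ x y)) := by
  have hc := WeakDual.isCompact_closedBall (𝕜 := ℝ) (E := H) 0 M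
  set w : ι → WeakDual ℝ H := fun i =>
    WeakDual.toStrongDual.symm (InnerProductSpace.toDual ℝ H (h i)) with hw
  have hmem : ∀ i, w i ∈ WeakDual.toStrongDual ⁻¹' Metric.closedBall (0 : StrongDual ℝ H) M := by
    intro i
    simp [hw, hM i]
  obtain ⟨x, -, hx⟩ := hc.ultrafilter_le_nhds (U.map w) (by
    rw [le_principal_iff]
    exact Filter.mem_map.2 (Filter.univ_mem' hmem))
  refine ⟨(InnerProductSpace.toDual ℝ H).symm (WeakDual.toStrongDual x), fun y => ?_⟩
  have h1 : Tendsto w U (𝓝 x) := hx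
  have h2 := ((WeakDual.eval_continuous (𝕜 := ℝ) (E := H) y).tendsto x).comp h1
  rw [InnerProductSpace.toDual_symm_apply]
  exact h2

/-- If `h i` converges weakly to `x`, and `‖h i‖²` converges to `e`, then `‖x‖² ≤ e`. -/
lemma norm_sq_le_of_tendsto_inner {H ι : Type*} [NormedAddCommGroup H] [InnerProductSpace ℝ H]
    {l : Filter ι} [l.NeBot] {h : ι → H} {x : H} {e : ℝ}
    (hx : Tendsto (fun i => inner ℝ (h i) x) l (𝓝 (inner ℝ x x)))
    (he : Tendsto (fun i => ‖h i‖ ^ 2) l (𝓝 e)) : ‖x‖ ^ 2 ≤ e := by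
  have h1 : Tendsto (fun i => ‖h i‖ ^ 2 - 2 * inner ℝ (h i) x + ‖x‖ ^ 2) l
      (𝓝 (e - 2 * inner ℝ x x + ‖x‖ ^ 2)) := (he.sub (hx.const_mul 2)).add_const _
  have h2 := ge_of_tendsto' h1 (b := 0) (fun i => by
    rw [← norm_sub_sq_real]; positivity)
  rw [real_inner_self_eq_norm_sq] at h2
  linarith

variable {S : Type u} [AddCommGroup S] [Module ℝ S]

/-- A non-symmetric form `B` whose diagonal controls a functional `L` is solvable on
finite-dimensional spaces. -/
lemma exists_eq_of_finiteDimensional [FiniteDimensional ℝ S] (B : S →ₗ[ℝ] S →ₗ[ℝ] ℝ)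
    (L : S →ₗ[ℝ] ℝ) (hL : ∀ x, B x x = 0 → L x = 0) : ∃ h, ∀ y, B h y = L y := by
  have hmem : L ∈ (LinearMap.ker B.flip).dualAnnihilator := by
    rw [Submodule.mem_dualAnnihilator]
    intro y hy
    apply hL
    have := LinearMap.congr_fun (LinearMap.mem_ker.1 hy) y
    simpa using this
  rw [← LinearMap.range_dualMap_eq_dualAnnihilator_ker] at hmem
  obtain ⟨ξ, hξ⟩ := hmem
  refine ⟨(Module.evalEquiv ℝ S).symm ξ, fun y => ?_⟩
  rw [← hξ]
  exact Module.apply_evalEquiv_symm_apply ℝ S (B.flip y) ξ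

/-- The Galerkin method, with an energy inequality: no continuity of `B` in the second variable is
assumed. -/
lemma exists_galerkin_limit {H : Type*} [NormedAddCommGroup H] [InnerProductSpace ℝ H]
    [CompleteSpace H] (j : S →ₗ[ℝ] H) (B : S →ₗ[ℝ] S →ₗ[ℝ] ℝ) (hB : ∀ x, B x x = ‖j x‖ ^ 2)
    (N : S → H) (hN : ∀ x y, B x y = inner ℝ (j x) (N y)) (l : H) :
    ∃ h : H, (∀ y, inner ℝ h (N y) = inner ℝ l (j y)) ∧ ‖h‖ ^ 2 ≤ inner ℝ l h := by
  classical
  -- on the span of `F` the equation is solvable, and may be tested with its own solution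
  have hfin : ∀ F : Finset S, ∃ x : S, ∀ y ∈ F, B x y = inner ℝ l (j y) ∧
      ‖j x‖ ^ 2 = inner ℝ l (j x) := by
    intro F
    let W := Submodule.span ℝ (F : Set S)
    let B' : W →ₗ[ℝ] W →ₗ[ℝ] ℝ := B.compl₁₂ W.subtype W.subtype
    let L' : W →ₗ[ℝ] ℝ := (innerₛₗ ℝ l ∘ₗ j) ∘ₗ W.subtype
    obtain ⟨x, hx⟩ := exists_eq_of_finiteDimensional B' L' (by
      intro x hx
      have hx' : ‖j x‖ ^ 2 = 0 := by rw [← hB]; exact hx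
      have : j x = 0 := by simpa using hx'
      simp [L', this])
    refine ⟨x, fun y hy => ⟨hx ⟨y, Submodule.subset_span hy⟩, ?_⟩⟩
    rw [← hB]; exact hx x
  -- `hfin` for `insert 0 F`, so that the energy identity holds also when `F` is empty
  have hfin' : ∀ F : Finset S, ∃ x : S, (∀ y ∈ F, B x y = inner ℝ l (j y)) ∧
      ‖j x‖ ^ 2 = inner ℝ l (j x) := by
    intro F
    obtain ⟨x, hx⟩ := hfin (insert 0 F)
    exact ⟨x, fun y hy => (hx y (Finset.mem_insert_of_mem hy)).1,
      (hx 0 (Finset.mem_insert_self _ _)).2⟩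
  choose x hx hx2 using hfin'
  have hbd : ∀ F, ‖j (x F)‖ ≤ ‖l‖ := by
    intro F
    have h1 := (hx2 F).trans_le (real_inner_le_norm l (j (x F)))
    by_contra! h
    have h0 := norm_nonneg l
    nlinarith
  -- an ultrafilter on the finite sets of test elements replaces a sequence of Galerkin spaces: `S`
  -- need not be separable
  let U : Ultrafilter (Finset S) := Ultrafilter.of atTop
  have hU : (U : Filter (Finset S)) ≤ atTop := Ultrafilter.of_le _
  obtain ⟨h, hh⟩ := exists_tendsto_inner_of_norm_le U (fun F => j (x F)) ‖l‖ hbd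
  refine ⟨h, fun y => ?_, ?_⟩
  · refine tendsto_nhds_unique (hh (N y)) ?_
    refine (tendsto_const_nhds).congr' ?_
    have : ∀ᶠ F in (U : Filter (Finset S)), y ∈ F :=
      hU ((eventually_ge_atTop {y}).mono fun F hF => by simpa using hF)
    filter_upwards [this] with F hF
    rw [← hN, hx F y hF]
  · refine norm_sq_le_of_tendsto_inner (hh h) (e := inner ℝ l h) ?_
    have := hh l
    simp only [hx2]
    simpa only [real_inner_comm] using this

/-- The separated completion of a semi-definite form. -/
lemma exists_hilbert_completion {S : Type u} [AddCommGroup S] [Module ℝ S]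
    (E : S →ₗ[ℝ] S →ₗ[ℝ] ℝ) (hsymm : ∀ x y, E x y = E y x)
    (hnn : ∀ x, 0 ≤ E x x) : ∃ (H : Type u) (_ : NormedAddCommGroup H) (_ : InnerProductSpace ℝ H)
      (_ : CompleteSpace H) (j : S →ₗ[ℝ] H), DenseRange j ∧ ∀ x y, inner ℝ (j x) (j y) = E x y := by
  let c : PreInnerProductSpace.Core ℝ S :=
    { inner := fun x y => E x y
      conj_inner_symm := fun x y => by simp [hsymm]
      re_inner_nonneg := fun x => by simpa using hnn x
      add_left := fun x y z => by simp
      smul_left := fun x y r => by simp }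
  let : SeminormedAddCommGroup S := InnerProductSpace.Core.toSeminormedAddCommGroup (𝕜 := ℝ)
  let : InnerProductSpace ℝ S := InnerProductSpace.ofCore c
  refine ⟨UniformSpace.Completion S, inferInstance, inferInstance, inferInstance,
    (UniformSpace.Completion.toComplₗᵢ (𝕜 := ℝ) (E := S)).toLinearMap, ?_, ?_⟩
  · exact UniformSpace.Completion.denseRange_coe
  · intro x y
    change inner ℝ ((x : UniformSpace.Completion S)) (y : UniformSpace.Completion S) = E x y
    rw [UniformSpace.Completion.inner_coe]
    rfl

/-- `φ` is a sequence, Cauchy for the energy `E`, along which `B (φ n)` converges to `L`. -/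
structure IsApproxSolution (E B : S →ₗ[ℝ] S →ₗ[ℝ] ℝ) (L : S →ₗ[ℝ] ℝ) (φ : ℕ → S) : Prop where
  cauchy : ∀ ε > 0, ∃ N, ∀ m ≥ N, ∀ n ≥ N, E (φ m - φ n) (φ m - φ n) < ε
  tendsto : ∀ y, Tendsto (fun n => B (φ n) y) atTop (𝓝 (L y))

/-- Riesz representation for functionals on a dense subspace. -/
lemma exists_riesz {H : Type*} [NormedAddCommGroup H] [InnerProductSpace ℝ H] [CompleteSpace H]
    (j : S →ₗ[ℝ] H) (hj : DenseRange j) (L : S →ₗ[ℝ] ℝ) (C : ℝ) (hC : ∀ x, |L x| ≤ C * ‖j x‖) :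
    ∃ l : H, ∀ x, L x = inner ℝ l (j x) := by
  refine ⟨(InnerProductSpace.toDual ℝ H).symm (L.extendOfNorm j), fun x => ?_⟩
  rw [InnerProductSpace.toDual_symm_apply,
    LinearMap.extendOfNorm_eq hj ⟨C, fun x => by simpa using hC x⟩]

/-- Elements of the completion are limits of sequences which are Cauchy for the form. -/
lemma DenseRange.exists_cauchy_seq {H : Type*} [NormedAddCommGroup H] [InnerProductSpace ℝ H]
    (E : S →ₗ[ℝ] S →ₗ[ℝ] ℝ) (j : S →ₗ[ℝ] H) (hj : DenseRange j)
    (hjE : ∀ x y, inner ℝ (j x) (j y) = E x y) (h : H) :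
    ∃ φ : ℕ → S, Tendsto (fun n => j (φ n)) atTop (𝓝 h) ∧
      ∀ ε > 0, ∃ N, ∀ m ≥ N, ∀ n ≥ N, E (φ m - φ n) (φ m - φ n) < ε := by
  have hd : h ∈ closure (range j) := hj h
  obtain ⟨x, hx, hlim⟩ := mem_closure_iff_seq_limit.1 hd
  choose φ hφ using hx
  have hlim' : Tendsto (fun n => j (φ n)) atTop (𝓝 h) := by simpa only [hφ] using hlim
  refine ⟨φ, hlim', fun ε hε => ?_⟩
  obtain ⟨N, hN⟩ := Metric.cauchySeq_iff.1 hlim'.cauchySeq (√ε) (Real.sqrt_pos.2 hε)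
  refine ⟨N, fun m hm n hn => ?_⟩
  have := hN m hm n hn
  rw [dist_eq_norm, ← map_sub] at this
  rw [← hjE, real_inner_self_eq_norm_sq]
  exact (Real.lt_sqrt (norm_nonneg _)).1 this

/-- Existence for forms `B` which agree on the diagonal with the energy `E` but are continuous only
in the first variable, as `(u, w) ↦ -∫ u ∂_t w + ∫ ∇w · a∇u` is. Only the inequality `e ≤ l` between
the energy and the work of the right-hand side survives the weak limit. -/
theorem exists_isApproxSolution (E B : S →ₗ[ℝ] S →ₗ[ℝ] ℝ) (hsymm : ∀ x y, E x y = E y x)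
    (hnn : ∀ x, 0 ≤ E x x) (hB : ∀ x, B x x = E x x)
    (hBb : ∀ y, ∃ C, ∀ x, |B x y| ≤ C * √(E x x)) (L : S →ₗ[ℝ] ℝ) (M : ℝ)
    (hL : ∀ x, |L x| ≤ M * √(E x x)) :
    ∃ φ, IsApproxSolution E B L φ ∧ ∃ e l, Tendsto (fun n => E (φ n) (φ n)) atTop (𝓝 e) ∧
      Tendsto (fun n => L (φ n)) atTop (𝓝 l) ∧ e ≤ l := by
  obtain ⟨H, _, _, _, j, hj, hjE⟩ := exists_hilbert_completion E hsymm hnn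
  have hn : ∀ x, √(E x x) = ‖j x‖ := fun x => by
    rw [← hjE, real_inner_self_eq_norm_sq, Real.sqrt_sq (norm_nonneg _)]
  simp only [hn] at hBb hL
  obtain ⟨l, hl⟩ := exists_riesz j hj L M hL
  have : ∀ y, ∃ Ny : H, ∀ x, B x y = inner ℝ Ny (j x) := fun y => by
    obtain ⟨C, hC⟩ := hBb y
    exact exists_riesz j hj (B.flip y) C hC
  choose N hN using this
  obtain ⟨h, h1, h2⟩ := exists_galerkin_limit j B
    (fun x => by rw [hB, ← hjE, real_inner_self_eq_norm_sq]) N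
    (fun x y => by rw [hN, real_inner_comm]) l
  obtain ⟨φ, hφ, hc⟩ := DenseRange.exists_cauchy_seq E j hj hjE h
  refine ⟨φ, ⟨hc, fun y => ?_⟩, ‖h‖ ^ 2, inner ℝ l h, ?_, ?_, h2⟩
  · rw [hl, ← h1, real_inner_comm]
    simp only [hN]
    exact tendsto_const_nhds.inner hφ
  · simp only [← hjE, real_inner_self_eq_norm_sq]
    exact hφ.norm.pow 2
  · simp only [hl]
    exact tendsto_const_nhds.inner hφ

/-- Approximate solutions with bounded energies for a weakly convergent sequence of right-hand
sides have a limit. -/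
theorem IsApproxSolution.exists_limit (E B : S →ₗ[ℝ] S →ₗ[ℝ] ℝ) (hsymm : ∀ x y, E x y = E y x)
    (hnn : ∀ x, 0 ≤ E x x) (hBb : ∀ y, ∃ C, ∀ x, |B x y| ≤ C * √(E x x))
    (L : S →ₗ[ℝ] ℝ) (Ls : ℕ → S →ₗ[ℝ] ℝ) (hLs : ∀ y, Tendsto (fun k => Ls k y) atTop (𝓝 (L y)))
    (P : ℝ) (φ : ℕ → ℕ → S) (hφ : ∀ k, IsApproxSolution E B (Ls k) (φ k))
    (hP : ∀ k, ∀ δ > 0, ∀ᶠ n in atTop, E (φ k n) (φ k n) ≤ P + δ) :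
    ∃ ψ, IsApproxSolution E B L ψ ∧ ∀ δ > 0, ∀ᶠ n in atTop, E (ψ n) (ψ n) ≤ P + δ := by
  obtain ⟨H, _, _, _, j, hj, hjE⟩ := exists_hilbert_completion E hsymm hnn
  have hn : ∀ x, √(E x x) = ‖j x‖ := fun x => by
    rw [← hjE, real_inner_self_eq_norm_sq, Real.sqrt_sq (norm_nonneg _)]
  simp only [hn] at hBb
  have hsq : ∀ x, E x x = ‖j x‖ ^ 2 := fun x => by rw [← hjE, real_inner_self_eq_norm_sq]
  have : ∀ y, ∃ Ny : H, ∀ x, B x y = inner ℝ Ny (j x) := fun y => by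
    obtain ⟨C, hC⟩ := hBb y
    exact exists_riesz j hj (B.flip y) C hC
  choose N hN using this
  have hlim : ∀ k, ∃ h : H, Tendsto (fun n => j (φ k n)) atTop (𝓝 h) := by
    intro k
    apply cauchySeq_tendsto_of_complete
    rw [Metric.cauchySeq_iff]
    intro ε hε
    obtain ⟨n₀, h₀⟩ := (hφ k).cauchy (ε ^ 2) (by positivity)
    refine ⟨n₀, fun m hm n hn => ?_⟩
    have := h₀ m hm n hn
    rw [hsq] at this
    rw [dist_eq_norm, ← map_sub]
    exact lt_of_pow_lt_pow_left₀ 2 hε.le this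
  choose h hh using hlim
  have hhP : ∀ k, ‖h k‖ ^ 2 ≤ P := by
    intro k
    refine le_of_forall_pos_le_add fun δ hδ => ?_
    refine le_of_tendsto ((hh k).norm.pow 2) ?_
    filter_upwards [hP k δ hδ] with n hn
    rwa [← hsq]
  have hhN : ∀ k y, inner ℝ (h k) (N y) = Ls k y := by
    intro k y
    have h1 : Tendsto (fun n => B (φ k n) y) atTop (𝓝 (inner ℝ (N y) (h k))) := by
      simp only [hN]
      exact tendsto_const_nhds.inner (hh k)
    rw [real_inner_comm]
    exact tendsto_nhds_unique h1 ((hφ k).tendsto y)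
  -- a weak limit of the limits `h k` solves the limiting equation, and its norm is no larger
  let U : Ultrafilter ℕ := Ultrafilter.of atTop
  have hU : (U : Filter ℕ) ≤ atTop := Ultrafilter.of_le _
  have hb : ∀ k, ‖h k‖ ≤ √P := fun k => Real.le_sqrt_of_sq_le (hhP k)
  obtain ⟨x, hx⟩ := exists_tendsto_inner_of_norm_le U h (√P) hb
  have hP0 : 0 ≤ P := (sq_nonneg _).trans (hhP 0)
  have hxP : ‖x‖ ^ 2 ≤ P := by
    have h1 : ‖x‖ ^ 2 ≤ √P * ‖x‖ := by
      rw [← real_inner_self_eq_norm_sq]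
      refine le_of_tendsto' (hx x) fun k => ?_
      exact (real_inner_le_norm _ _).trans (by gcongr; exact hb k)
    have h2 : ‖x‖ ≤ √P := by
      by_contra! hlt
      have := Real.sqrt_nonneg P
      nlinarith
    have := Real.sq_sqrt hP0
    nlinarith [norm_nonneg x]
  obtain ⟨ψ, hψ, hc⟩ := DenseRange.exists_cauchy_seq E j hj hjE x
  refine ⟨ψ, ⟨hc, fun y => ?_⟩, fun δ hδ => ?_⟩
  · have h1 : inner ℝ x (N y) = L y :=
      tendsto_nhds_unique (hx (N y)) (by simpa only [hhN] using (hLs y).mono_left hU)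
    rw [← h1, real_inner_comm]
    simp only [hN]
    exact tendsto_const_nhds.inner hψ
  · have h1 : Tendsto (fun n => E (ψ n) (ψ n)) atTop (𝓝 (‖x‖ ^ 2)) := by
      simp only [hsq]; exact hψ.norm.pow 2
    exact h1.eventually_le_const (by linarith)

end Hilbert

/-! ### Pointwise algebra of coefficient matrices -/

section Pointwise

variable {d : ℕ}

/-- The sum of the absolute values of the entries of a matrix. -/
def entrySum (A : Matrix (Fin d) (Fin d) ℝ) : ℝ := ∑ i, ∑ j, |A i j|

lemma entrySum_nonneg (A : Matrix (Fin d) (Fin d) ℝ) : 0 ≤ entrySum A :=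
  Finset.sum_nonneg fun _ _ => Finset.sum_nonneg fun _ _ => abs_nonneg _

lemma bil_eq_sum (A : Matrix (Fin d) (Fin d) ℝ) (v w : Space d) :
    bil A v w = ∑ i, ∑ j, v i * A i j * w j := by
  simp only [bil, PiLp.inner_apply, Matrix.toLpLin_apply, Matrix.mulVec, dotProduct,
    RCLike.inner_apply, conj_trivial, Finset.sum_mul]
  exact Finset.sum_congr rfl fun i _ => Finset.sum_congr rfl fun j _ => by ring

lemma bil_add_left (A : Matrix (Fin d) (Fin d) ℝ) (v v' w : Space d) :
    bil A (v + v') w = bil A v w + bil A v' w := by simp [bil, inner_add_left]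

lemma bil_add_right (A : Matrix (Fin d) (Fin d) ℝ) (v w w' : Space d) :
    bil A v (w + w') = bil A v w + bil A v w' := by simp [bil, inner_add_right]

lemma bil_sub_left (A : Matrix (Fin d) (Fin d) ℝ) (v v' w : Space d) :
    bil A (v - v') w = bil A v w - bil A v' w := by simp [bil, inner_sub_left]

lemma bil_sub_right (A : Matrix (Fin d) (Fin d) ℝ) (v w w' : Space d) :
    bil A v (w - w') = bil A v w - bil A v w' := by simp [bil, inner_sub_right]

lemma bil_smul_left (A : Matrix (Fin d) (Fin d) ℝ) (c : ℝ) (v w : Space d) :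
    bil A (c • v) w = c * bil A v w := by simp [bil, inner_smul_left]

lemma bil_smul_right (A : Matrix (Fin d) (Fin d) ℝ) (c : ℝ) (v w : Space d) :
    bil A v (c • w) = c * bil A v w := by simp [bil, inner_smul_right]

lemma bil_zero_left (A : Matrix (Fin d) (Fin d) ℝ) (w : Space d) : bil A 0 w = 0 := by simp [bil]

lemma bil_zero_right (A : Matrix (Fin d) (Fin d) ℝ) (w : Space d) : bil A w 0 = 0 := by simp [bil]

lemma bil_symPart_self (A : Matrix (Fin d) (Fin d) ℝ) (v : Space d) :
    bil (symPart A) v v = bil A v v := by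
  have h : ∑ i, ∑ j, v i * A j i * v j = ∑ i, ∑ j, v i * A i j * v j := by
    rw [Finset.sum_comm]
    exact Finset.sum_congr rfl fun i _ => Finset.sum_congr rfl fun j _ => by ring
  calc bil (symPart A) v v
      = 1 / 2 * (∑ i, ∑ j, v i * A i j * v j + ∑ i, ∑ j, v i * A j i * v j) := by
        rw [bil_eq_sum, ← Finset.sum_add_distrib, Finset.mul_sum]
        refine Finset.sum_congr rfl fun i _ => ?_
        rw [← Finset.sum_add_distrib, Finset.mul_sum]
        refine Finset.sum_congr rfl fun j _ => ?_
        simp only [symPart, Matrix.smul_apply, Matrix.add_apply, Matrix.transpose_apply,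
          smul_eq_mul]
        ring
    _ = bil A v v := by rw [h, bil_eq_sum]; ring

lemma bil_symPart_comm (A : Matrix (Fin d) (Fin d) ℝ) (v w : Space d) :
    bil (symPart A) v w = bil (symPart A) w v := by
  rw [bil_eq_sum, bil_eq_sum, Finset.sum_comm]
  refine Finset.sum_congr rfl fun i _ => Finset.sum_congr rfl fun j _ => ?_
  simp only [symPart, Matrix.smul_apply, Matrix.add_apply, Matrix.transpose_apply,
          smul_eq_mul]
  ring

lemma bil_eq_symPart_add_skewPart (A : Matrix (Fin d) (Fin d) ℝ) (v w : Space d) :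
    bil A v w = bil (symPart A) v w + bil (skewPart A) v w := by
  simp only [bil_eq_sum, ← Finset.sum_add_distrib]
  refine Finset.sum_congr rfl fun i _ => Finset.sum_congr rfl fun j _ => ?_
  simp only [symPart, skewPart, Matrix.smul_apply, Matrix.add_apply, Matrix.sub_apply,
    Matrix.transpose_apply, smul_eq_mul]
  ring

lemma abs_bil_le (A : Matrix (Fin d) (Fin d) ℝ) (v w : Space d) :
    |bil A v w| ≤ entrySum A * (‖v‖ * ‖w‖) := by
  rw [bil_eq_sum, entrySum, Finset.sum_mul]
  refine (Finset.abs_sum_le_sum_abs _ _).trans (Finset.sum_le_sum fun i _ => ?_)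
  rw [Finset.sum_mul]
  refine (Finset.abs_sum_le_sum_abs _ _).trans (Finset.sum_le_sum fun j _ => ?_)
  have h1 : |v i| ≤ ‖v‖ := PiLp.norm_apply_le v i
  have h2 : |w j| ≤ ‖w‖ := PiLp.norm_apply_le w j
  rw [abs_mul, abs_mul]
  calc |v i| * |A i j| * |w j| = |A i j| * (|v i| * |w j|) := by ring
    _ ≤ |A i j| * (‖v‖ * ‖w‖) := by gcongr

variable {A : Matrix (Fin d) (Fin d) ℝ} (hA : ∀ e : Space d, e ≠ 0 → 0 < bil A e e)
include hA

lemma bil_symPart_self_nonneg (v : Space d) : 0 ≤ bil (symPart A) v v := by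
  rw [bil_symPart_self]
  rcases eq_or_ne v 0 with rfl | h
  · simp [bil]
  · exact (hA v h).le

lemma bil_symPart_sq_le (v w : Space d) :
    bil (symPart A) v w ^ 2 ≤ bil (symPart A) v v * bil (symPart A) w w := by
  have h : ∀ t : ℝ, 0 ≤ bil (symPart A) v v * (t * t) + (2 * bil (symPart A) v w) * t
      + bil (symPart A) w w := fun t => by
    have := bil_symPart_self_nonneg hA (t • v + w)
    rw [bil_add_left, bil_add_right, bil_add_right, bil_smul_left, bil_smul_left, bil_smul_right,
      bil_smul_right, bil_symPart_comm A w v] at this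
    linarith
  have := discrim_le_zero h
  rw [discrim] at this
  linarith

lemma abs_bil_symPart_le (v w : Space d) :
    |bil (symPart A) v w| ≤ √(bil (symPart A) v v) * √(bil (symPart A) w w) := by
  rw [← Real.sqrt_mul (bil_symPart_self_nonneg hA v)]
  exact Real.abs_le_sqrt (bil_symPart_sq_le hA v w)

lemma bil_symPart_sub_self_le (v w : Space d) : bil (symPart A) (v - w) (v - w) ≤
    2 * bil (symPart A) v v + 2 * bil (symPart A) w w := by
  have := bil_symPart_self_nonneg hA (v + w)
  rw [bil_add_left, bil_add_right, bil_add_right] at this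
  rw [bil_sub_left, bil_sub_right, bil_sub_right]
  linarith

/-- Cauchy-Schwarz for `v = s^{1/2} s^{-1/2} v`: the inverse weight controls `|v|²`. -/
lemma norm_sq_le_entrySum_inv_mul (v : Space d) :
    ‖v‖ ^ 2 ≤ entrySum (symPart A)⁻¹ * bil (symPart A) v v := by
  have hdet : IsUnit (symPart A).det := by
    rw [isUnit_iff_ne_zero]
    intro h0
    obtain ⟨x, hx, hx0⟩ := Matrix.exists_mulVec_eq_zero_iff.2 h0
    have h1 : bil (symPart A) (WithLp.toLp 2 x) (WithLp.toLp 2 x) = 0 := by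
      simp [bil, Matrix.toLpLin_apply, hx0]
    rw [bil_symPart_self] at h1
    exact (hA _ (by simpa using hx)).ne' h1
  set w : Space d := Matrix.toEuclideanLin (symPart A)⁻¹ v with hw
  have hsw : Matrix.toEuclideanLin (symPart A) w = v := by
    simp [hw, Matrix.toLpLin_apply, Matrix.mulVec_mulVec, Matrix.mul_nonsing_inv _ hdet]
  have h1 : bil (symPart A) v w = ‖v‖ ^ 2 := by
    rw [bil, hsw, real_inner_self_eq_norm_sq]
  have h2 : bil (symPart A) w w = bil (symPart A)⁻¹ v v := by
    rw [bil, hsw, bil, real_inner_comm]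
  have h3 := bil_symPart_sq_le hA v w
  have h4 := (le_abs_self _).trans (abs_bil_le (symPart A)⁻¹ v v)
  rw [h1, h2] at h3
  have h5 := bil_symPart_self_nonneg hA v
  rcases eq_or_ne v 0 with rfl | hv
  · simp [bil]
  have hpos : 0 < ‖v‖ ^ 2 := by positivity
  have h6 : ‖v‖ ^ 2 * ‖v‖ ^ 2 ≤ (entrySum (symPart A)⁻¹ * bil (symPart A) v v) * ‖v‖ ^ 2 := by
    nlinarith [mul_le_mul_of_nonneg_left h4 h5]
  exact le_of_mul_le_mul_right h6 hpos

end Pointwise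

/-! ### Weights and integrability -/

section Weights

variable {d : ℕ} {a : SpaceTime d → Matrix (Fin d) (Fin d) ℝ}

/-- Quantitative integrability of a coefficient field on a set `Q`: the weight `ν` bounds `|s⁻¹|`,
`μ` bounds `|s|`, and `M` bounds `1 + |s^{-1/2} k s^{-1/2}|`. -/
structure Weights (a : SpaceTime d → Matrix (Fin d) (Fin d) ℝ) (Q : Set (SpaceTime d))
    (ν μ : SpaceTime d → ℝ) (M : ℝ) : Prop where
  integrable_inv : IntegrableOn ν Q
  integrable : IntegrableOn μ Q
  nonneg_inv : ∀ z, 0 ≤ ν z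
  nonneg : ∀ z, 0 ≤ μ z
  nonneg_const : 0 ≤ M
  norm_sq_le : ∀ z, ∀ v : Space d, ‖v‖ ^ 2 ≤ ν z * bil (symPart (a z)) v v
  le_norm_sq : ∀ z, ∀ v : Space d, bil (symPart (a z)) v v ≤ μ z * ‖v‖ ^ 2
  abs_bil_le : ∀ᵐ z ∂(volume.restrict Q), ∀ v w : Space d,
    |bil (a z) v w| ≤ M * (√(bil (symPart (a z)) v v) * √(bil (symPart (a z)) w w))

lemma IsCoefficientField.exists_weights (ha : IsCoefficientField a) {Q : Set (SpaceTime d)}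
    (hQ : Bornology.IsBounded Q) : ∃ ν μ M, Weights a Q ν μ M := by
  have hK : IsCompact (closure Q) := hQ.isCompact_closure
  obtain ⟨M, hM⟩ := ha.locallyBounded_skew _ hK
  refine ⟨fun z => entrySum (symPart (a z))⁻¹, fun z => entrySum (symPart (a z)), 1 + |M|, ?_⟩
  refine ⟨?_, ?_, fun z => entrySum_nonneg _, fun z => entrySum_nonneg _, by positivity,
    fun z v => norm_sq_le_entrySum_inv_mul (ha.pos z) v, fun z v => ?_, ?_⟩
  · refine integrable_finsetSum _ fun i _ => integrable_finsetSum _ fun j _ => ?_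
    exact (((ha.locallyIntegrable_sym_inv i j).integrableOn_isCompact hK).mono_set
      subset_closure).abs
  · refine integrable_finsetSum _ fun i _ => integrable_finsetSum _ fun j _ => ?_
    exact (((ha.locallyIntegrable_sym i j).integrableOn_isCompact hK).mono_set
      subset_closure).abs
  · have := (le_abs_self _).trans (abs_bil_le (symPart (a z)) v v)
    rwa [← sq] at this
  · filter_upwards [ae_restrict_of_ae_restrict_of_subset subset_closure hM] with z hz v w
    rw [bil_eq_symPart_add_skewPart, add_mul, one_mul]
    refine (abs_add_le _ _).trans (add_le_add (abs_bil_symPart_le (ha.pos z) v w) ?_)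
    exact (hz v w).trans (by gcongr; exact le_abs_self M)

lemma measurable_symPart (ha : IsCoefficientField a) (i j : Fin d) :
    Measurable fun z => symPart (a z) i j := by
  simp only [symPart, Matrix.smul_apply, Matrix.add_apply, Matrix.transpose_apply]
  exact ((ha.measurable i j).add (ha.measurable j i)).const_smul (1 / 2 : ℝ)

lemma aestronglyMeasurable_bil_of {b : SpaceTime d → Matrix (Fin d) (Fin d) ℝ}
    (hb : ∀ i j, Measurable fun z => b z i j) {μ : Measure (SpaceTime d)}
    {F G : SpaceTime d → Space d} (hF : AEStronglyMeasurable F μ)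
    (hG : AEStronglyMeasurable G μ) : AEStronglyMeasurable (fun z => bil (b z) (F z) (G z)) μ := by
  simp only [bil_eq_sum]
  have hc : ∀ {H : SpaceTime d → Space d} (_ : AEStronglyMeasurable H μ) (i : Fin d),
      AEStronglyMeasurable (fun z => H z i) μ := fun hH i =>
    (EuclideanSpace.proj (𝕜 := ℝ) i).continuous.comp_aestronglyMeasurable hH
  refine Finset.aestronglyMeasurable_fun_sum _ fun i _ =>
    Finset.aestronglyMeasurable_fun_sum _ fun j _ => ?_
  exact ((hc hF i).mul (hb i j).aestronglyMeasurable).mul (hc hG j)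

lemma aestronglyMeasurable_bil (ha : IsCoefficientField a) {μ : Measure (SpaceTime d)}
    {F G : SpaceTime d → Space d} (hF : AEStronglyMeasurable F μ)
    (hG : AEStronglyMeasurable G μ) : AEStronglyMeasurable (fun z => bil (a z) (F z) (G z)) μ :=
  aestronglyMeasurable_bil_of ha.measurable hF hG

lemma aestronglyMeasurable_bil_symPart (ha : IsCoefficientField a) {μ : Measure (SpaceTime d)}
    {F G : SpaceTime d → Space d} (hF : AEStronglyMeasurable F μ)
    (hG : AEStronglyMeasurable G μ) :
    AEStronglyMeasurable (fun z => bil (symPart (a z)) (F z) (G z)) μ :=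
  aestronglyMeasurable_bil_of (measurable_symPart ha) hF hG

/-- The flux `a G`. -/
def flux (a : SpaceTime d → Matrix (Fin d) (Fin d) ℝ) (G : SpaceTime d → Space d)
    (z : SpaceTime d) : Space d := Matrix.toEuclideanLin (a z) (G z)

lemma inner_flux (G : SpaceTime d → Space d) (z : SpaceTime d) (v : Space d) :
    inner ℝ v (flux a G z) = bil (a z) v (G z) := rfl

lemma aestronglyMeasurable_flux (ha : IsCoefficientField a) {μ : Measure (SpaceTime d)}
    {G : SpaceTime d → Space d} (hG : AEStronglyMeasurable G μ) :
    AEStronglyMeasurable (flux a G) μ := by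
  have : flux a G = fun z => ∑ i, bil (a z) (basisVec i) (G z) • (basisVec i : Space d) := by
    ext z j
    simp [flux, bil, basisVec, EuclideanSpace.inner_single_left, Pi.single_apply]
  rw [this]
  refine Finset.aestronglyMeasurable_fun_sum _ fun i _ => ?_
  exact (aestronglyMeasurable_bil ha aestronglyMeasurable_const hG).smul_const _

/-- The energy density `G · s G`. -/
def edens (a : SpaceTime d → Matrix (Fin d) (Fin d) ℝ) (G : SpaceTime d → Space d)
    (z : SpaceTime d) : ℝ := bil (symPart (a z)) (G z) (G z)

lemma IsCoefficientField.edens_nonneg (ha : IsCoefficientField a) (G : SpaceTime d → Space d)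
    (z : SpaceTime d) : 0 ≤ edens a G z := bil_symPart_self_nonneg (ha.pos z) _

variable {Q : Set (SpaceTime d)} {ν μ : SpaceTime d → ℝ} {M : ℝ}

lemma Weights.norm_flux_sq_le (ha : IsCoefficientField a) (hw : Weights a Q ν μ M)
    (G : SpaceTime d → Space d) :
    ∀ᵐ z ∂(volume.restrict Q), ‖flux a G z‖ ^ 2 ≤ M ^ 2 * μ z * edens a G z := by
  filter_upwards [hw.abs_bil_le] with z hz
  have h1 := hz (flux a G z) (G z)
  rw [← inner_flux, real_inner_self_eq_norm_sq, abs_of_nonneg (by positivity)] at h1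
  have he := ha.edens_nonneg G z
  have h2 : √(bil (symPart (a z)) (flux a G z) (flux a G z)) ≤ √(μ z) * ‖flux a G z‖ := by
    rw [← Real.sqrt_sq (norm_nonneg (flux a G z)), ← Real.sqrt_mul (hw.nonneg z)]
    exact Real.sqrt_le_sqrt (hw.le_norm_sq z _)
  have h3 : ‖flux a G z‖ ^ 2 ≤ (M * (√(μ z) * √(edens a G z))) * ‖flux a G z‖ := by
    refine h1.trans ?_
    have := mul_le_mul_of_nonneg_left
      (mul_le_mul_of_nonneg_right h2 (Real.sqrt_nonneg (edens a G z))) hw.nonneg_const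
    refine this.trans (le_of_eq ?_)
    ring
  have h4 : ‖flux a G z‖ ≤ M * (√(μ z) * √(edens a G z)) := by
    rcases (norm_nonneg (flux a G z)).eq_or_lt with h0 | h0
    · rw [← h0]
      have := hw.nonneg_const
      positivity
    · exact le_of_mul_le_mul_right (by rwa [sq] at h3) h0
  calc ‖flux a G z‖ ^ 2 ≤ (M * (√(μ z) * √(edens a G z))) ^ 2 := by gcongr
    _ = M ^ 2 * μ z * edens a G z := by
      rw [mul_pow, mul_pow, Real.sq_sqrt (hw.nonneg z), Real.sq_sqrt he]; ring

/-- Cauchy–Schwarz in the form `(∫ |F|)² ≤ ∫ w ∫ e` when `|F|² ≤ w e`. -/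
lemma integrable_of_norm_sq_le {α E : Type*} [MeasurableSpace α] [NormedAddCommGroup E]
    {m : Measure α} {F : α → E} {w e : α → ℝ} (hF : AEStronglyMeasurable F m)
    (hw : Integrable w m) (he : Integrable e m) (hw0 : ∀ z, 0 ≤ w z) (he0 : ∀ z, 0 ≤ e z)
    (h : ∀ᵐ z ∂m, ‖F z‖ ^ 2 ≤ w z * e z) :
    Integrable F m ∧ ∫ z, ‖F z‖ ∂m ≤ √(∫ z, w z ∂m) * √(∫ z, e z ∂m) := by
  have hle : ∀ᵐ z ∂m, ‖F z‖ ≤ √(w z) * √(e z) := by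
    filter_upwards [h] with z hz
    rw [← Real.sqrt_mul (hw0 z)]
    exact Real.le_sqrt_of_sq_le hz
  have hL : ∀ {g : α → ℝ}, Integrable g m → (∀ z, 0 ≤ g z) →
      MemLp (fun z => √(g z)) (ENNReal.ofReal 2) m := by
    intro g hg hg0
    rw [ENNReal.ofReal_ofNat]
    rw [memLp_two_iff_integrable_sq (hg.1.aemeasurable.sqrt.aestronglyMeasurable)]
    simpa only [Real.sq_sqrt (hg0 _)] using hg
  have hint : Integrable (fun z => √(w z) * √(e z)) m := by
    have h1 := hL hw hw0
    have h2 := hL he he0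
    rw [ENNReal.ofReal_ofNat] at h1 h2
    exact MemLp.integrable_mul h1 h2
  refine ⟨hint.mono' hF hle, ?_⟩
  have hFi : Integrable F m := hint.mono' hF hle
  refine (integral_mono_ae hFi.norm hint hle).trans ?_
  have := integral_mul_le_Lp_mul_Lq_of_nonneg (μ := m) (p := 2) (q := 2)
    (Real.HolderConjugate.two_two) (f := fun z => √(w z)) (g := fun z => √(e z))
    (ae_of_all _ fun z => Real.sqrt_nonneg _) (ae_of_all _ fun z => Real.sqrt_nonneg _)
    (hL hw hw0) (hL he he0)
  simpa only [Real.rpow_two, Real.sq_sqrt (hw0 _), Real.sq_sqrt (he0 _), ← Real.sqrt_eq_rpow]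
    using this

/-- Fields of finite energy are integrable, since `s⁻¹` is. -/
lemma Weights.integrable_of_energy (ha : IsCoefficientField a) (hw : Weights a Q ν μ M)
    {G : SpaceTime d → Space d} (hG : AEStronglyMeasurable G (volume.restrict Q))
    (he : IntegrableOn (edens a G) Q) :
    IntegrableOn G Q ∧ ∫ z in Q, ‖G z‖ ≤ √(∫ z in Q, ν z) * √(∫ z in Q, edens a G z) :=
  integrable_of_norm_sq_le hG hw.integrable_inv he hw.nonneg_inv (ha.edens_nonneg G)
    (ae_of_all _ fun z => hw.norm_sq_le z (G z))

lemma Weights.integrable_flux (ha : IsCoefficientField a) (hw : Weights a Q ν μ M)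
    {G : SpaceTime d → Space d} (hG : AEStronglyMeasurable G (volume.restrict Q))
    (he : IntegrableOn (edens a G) Q) :
    IntegrableOn (flux a G) Q ∧
      ∫ z in Q, ‖flux a G z‖ ≤ M * √(∫ z in Q, μ z) * √(∫ z in Q, edens a G z) := by
  have := integrable_of_norm_sq_le (aestronglyMeasurable_flux ha hG)
    (hw.integrable.const_mul (M ^ 2)) he (fun z => mul_nonneg (sq_nonneg _) (hw.nonneg z))
    (ha.edens_nonneg G) (hw.norm_flux_sq_le ha G)
  refine ⟨this.1, this.2.trans (le_of_eq ?_)⟩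
  rw [integral_const_mul, Real.sqrt_mul (sq_nonneg _), Real.sqrt_sq hw.nonneg_const]

/-- The mixed energy `F · s G` of two fields of finite energy is integrable. -/
lemma integrableOn_bil_symPart (ha : IsCoefficientField a) {F G : SpaceTime d → Space d}
    (hF : AEStronglyMeasurable F (volume.restrict Q))
    (hG : AEStronglyMeasurable G (volume.restrict Q))
    (heF : IntegrableOn (edens a F) Q) (heG : IntegrableOn (edens a G) Q) :
    IntegrableOn (fun z => bil (symPart (a z)) (F z) (G z)) Q := by
  refine (integrable_of_norm_sq_le (aestronglyMeasurable_bil_symPart ha hF hG) heF heG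
    (ha.edens_nonneg F) (ha.edens_nonneg G) (ae_of_all _ fun z => ?_)).1
  rw [Real.norm_eq_abs, sq_abs]
  exact bil_symPart_sq_le (ha.pos z) _ _

lemma integrableOn_edens_combination (ha : IsCoefficientField a) {F G : SpaceTime d → Space d}
    (hF : AEStronglyMeasurable F (volume.restrict Q))
    (hG : AEStronglyMeasurable G (volume.restrict Q))
    (heF : IntegrableOn (edens a F) Q) (heG : IntegrableOn (edens a G) Q) (c : ℝ) :
    IntegrableOn (edens a (F + c • G)) Q := by
  have h := (heF.add ((integrableOn_bil_symPart ha hF hG heF heG).const_mul (2 * c))).add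
    (heG.const_mul (c ^ 2))
  refine h.congr (ae_of_all _ fun z => ?_)
  simp only [edens, Pi.add_apply, Pi.smul_apply, bil_add_left, bil_add_right, bil_smul_left,
    bil_smul_right, bil_symPart_comm (a z) (G z) (F z)]
  ring

end Weights

/-! ### Test functions and weak solutions -/

section TestFunctions

variable {d : ℕ}

instance isAddHaarMeasure_volume_spaceTime (d : ℕ) :
    (volume : Measure (SpaceTime d)).IsAddHaarMeasure :=
  inferInstanceAs ((volume : Measure ℝ).prod (volume : Measure (Space d))).IsAddHaarMeasure

lemma hasFDerivAt_slice {φ : SpaceTime d → ℝ} {z : SpaceTime d} (h : DifferentiableAt ℝ φ z) :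
    HasFDerivAt (fun x => φ (z.1, x))
      ((fderiv ℝ φ z).comp (ContinuousLinearMap.inr ℝ ℝ (Space d))) z.2 := by
  have h1 : HasFDerivAt (fun x : Space d => (z.1, x)) (ContinuousLinearMap.inr ℝ ℝ (Space d)) z.2 :=
    hasFDerivAt_prodMk_right z.1 z.2
  exact HasFDerivAt.comp z.2 (f := fun x : Space d => (z.1, x)) (g := φ) h.hasFDerivAt h1

lemma spaceGrad_eq {φ : SpaceTime d → ℝ} {z : SpaceTime d} (h : DifferentiableAt ℝ φ z) :
    spaceGrad φ z = (InnerProductSpace.toDual ℝ (Space d)).symm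
      ((fderiv ℝ φ z).comp (ContinuousLinearMap.inr ℝ ℝ (Space d))) := by
  rw [spaceGrad, gradient, (hasFDerivAt_slice h).fderiv]

lemma inner_spaceGrad {φ : SpaceTime d → ℝ} {z : SpaceTime d} (h : DifferentiableAt ℝ φ z)
    (v : Space d) : inner ℝ (spaceGrad φ z) v = fderiv ℝ φ z (0, v) := by
  rw [spaceGrad_eq h, InnerProductSpace.toDual_symm_apply]
  simp

lemma timeDeriv_eq {φ : SpaceTime d → ℝ} {z : SpaceTime d} (h : DifferentiableAt ℝ φ z) :
    timeDeriv φ z = fderiv ℝ φ z (1, 0) := by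
  have h1 : HasDerivAt (fun t : ℝ => (t, z.2)) ((1 : ℝ), (0 : Space d)) z.1 :=
    (hasDerivAt_id z.1).prodMk (hasDerivAt_const z.1 z.2)
  exact (HasFDerivAt.comp_hasDerivAt z.1 (f := fun t : ℝ => (t, z.2)) (l := φ)
    h.hasFDerivAt h1).deriv

variable {D : Set (SpaceTime d)} {φ ψ : SpaceTime d → ℝ}

namespace IsTestFunction

lemma differentiable (h : IsTestFunction D φ) : Differentiable ℝ φ :=
  h.1.differentiable (by simp)

lemma zero : IsTestFunction D 0 := by
  refine ⟨contDiff_const, HasCompactSupport.zero, ?_⟩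
  simp [tsupport]

lemma add (h : IsTestFunction D φ) (h' : IsTestFunction D ψ) : IsTestFunction D (φ + ψ) :=
  ⟨h.1.add h'.1, h.2.1.add h'.2.1, (tsupport_add φ ψ).trans (union_subset h.2.2 h'.2.2)⟩

lemma smul (h : IsTestFunction D φ) (c : ℝ) : IsTestFunction D (c • φ) := by
  refine ⟨h.1.const_smul c, h.2.1.smul_left (f := fun _ => c), ?_⟩
  exact (closure_mono (Function.support_const_smul_subset c φ)).trans h.2.2

lemma mono {D' : Set (SpaceTime d)} (h : IsTestFunction D φ) (hD : D ⊆ D') :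
    IsTestFunction D' φ := ⟨h.1, h.2.1, h.2.2.trans hD⟩

lemma continuous_fderiv (h : IsTestFunction D φ) : Continuous (fderiv ℝ φ) :=
  h.1.continuous_fderiv (by simp)

lemma spaceGrad_eq' (h : IsTestFunction D φ) : spaceGrad φ = fun z =>
    (InnerProductSpace.toDual ℝ (Space d)).symm
      ((fderiv ℝ φ z).comp (ContinuousLinearMap.inr ℝ ℝ (Space d))) :=
  funext fun z => spaceGrad_eq (h.differentiable z)

lemma continuous_spaceGrad (h : IsTestFunction D φ) : Continuous (spaceGrad φ) := by
  rw [h.spaceGrad_eq']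
  exact (LinearIsometryEquiv.continuous _).comp (h.continuous_fderiv.clm_comp continuous_const)

lemma continuous_timeDeriv (h : IsTestFunction D φ) : Continuous (timeDeriv φ) := by
  have : timeDeriv φ = fun z => fderiv ℝ φ z (1, 0) :=
    funext fun z => timeDeriv_eq (h.differentiable z)
  rw [this]
  exact h.continuous_fderiv.clm_apply continuous_const

lemma spaceGrad_eq_zero (h : IsTestFunction D φ) {z : SpaceTime d} (hz : z ∉ tsupport φ) :
    spaceGrad φ z = 0 := by
  have : fderiv ℝ φ z = 0 := by
    by_contra h0
    exact hz (support_fderiv_subset ℝ h0)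
  rw [h.spaceGrad_eq']
  simp [this]

lemma timeDeriv_eq_zero (h : IsTestFunction D φ) {z : SpaceTime d} (hz : z ∉ tsupport φ) :
    timeDeriv φ z = 0 := by
  have : fderiv ℝ φ z = 0 := by
    by_contra h0
    exact hz (support_fderiv_subset ℝ h0)
  rw [timeDeriv_eq (h.differentiable z), this]
  rfl

lemma hasCompactSupport_spaceGrad (h : IsTestFunction D φ) : HasCompactSupport (spaceGrad φ) :=
  HasCompactSupport.intro h.2.1 fun _ hz => h.spaceGrad_eq_zero hz

lemma hasCompactSupport_timeDeriv (h : IsTestFunction D φ) : HasCompactSupport (timeDeriv φ) :=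
  HasCompactSupport.intro h.2.1 fun _ hz => h.timeDeriv_eq_zero hz

lemma spaceGrad_add (h : IsTestFunction D φ) (h' : IsTestFunction D ψ) :
    spaceGrad (φ + ψ) = spaceGrad φ + spaceGrad ψ := by
  rw [(h.add h').spaceGrad_eq', h.spaceGrad_eq', h'.spaceGrad_eq']
  ext1 z
  simp [fderiv_add (h.differentiable z) (h'.differentiable z)]

lemma spaceGrad_smul (h : IsTestFunction D φ) (c : ℝ) :
    spaceGrad (c • φ) = c • spaceGrad φ := by
  rw [(h.smul c).spaceGrad_eq', h.spaceGrad_eq']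
  ext1 z
  simp [fderiv_const_smul (h.differentiable z)]

lemma timeDeriv_add (h : IsTestFunction D φ) (h' : IsTestFunction D ψ) :
    timeDeriv (φ + ψ) = timeDeriv φ + timeDeriv ψ := by
  ext1 z
  rw [Pi.add_apply, timeDeriv_eq ((h.add h').differentiable z), timeDeriv_eq (h.differentiable z),
    timeDeriv_eq (h'.differentiable z), fderiv_add (h.differentiable z) (h'.differentiable z)]
  rfl

lemma timeDeriv_smul (h : IsTestFunction D φ) (c : ℝ) :
    timeDeriv (c • φ) = c • timeDeriv φ := by
  ext1 z
  rw [Pi.smul_apply, timeDeriv_eq ((h.smul c).differentiable z), timeDeriv_eq (h.differentiable z),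
    fderiv_const_smul (h.differentiable z)]
  rfl

lemma setIntegral_eq {E : Type*} [NormedAddCommGroup E] [NormedSpace ℝ E]
    (h : IsTestFunction D φ) {F : SpaceTime d → E} (hF : ∀ z ∉ tsupport φ, F z = 0) :
    ∫ z in D, F z = ∫ z, F z :=
  setIntegral_eq_integral_of_forall_compl_eq_zero fun z hz => hF z fun hz' => hz (h.2.2 hz')

/-- The integral of a directional derivative of a test function vanishes. -/
lemma integral_fderiv (h : IsTestFunction D φ) (v : SpaceTime d) :
    ∫ z, fderiv ℝ φ z v = 0 := by
  have hc : HasCompactSupport fun z => fderiv ℝ φ z v := by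
    refine HasCompactSupport.intro h.2.1 fun z hz => ?_
    by_contra h0
    exact hz (support_fderiv_subset ℝ fun h1 => h0 (by simp [h1]))
  have hi : Integrable (fun z => fderiv ℝ φ z v) :=
    (h.continuous_fderiv.clm_apply continuous_const).integrable_of_hasCompactSupport hc
  have := integral_mul_fderiv_eq_neg_fderiv_mul_of_integrable (μ := (volume : Measure (SpaceTime d)))
    (f := fun _ : SpaceTime d => (1 : ℝ)) (g := φ) (v := v) (by simp) (by simpa using hi)
    (by simpa using h.1.continuous.integrable_of_hasCompactSupport h.2.1)
    (fun _ _ => by fun_prop) (fun z _ => h.differentiable z)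
  simpa using this

lemma integral_spaceGrad (h : IsTestFunction D φ) : ∫ z in D, spaceGrad φ z = 0 := by
  rw [h.setIntegral_eq fun z hz => h.spaceGrad_eq_zero hz]
  have hi : Integrable (spaceGrad φ) :=
    h.continuous_spaceGrad.integrable_of_hasCompactSupport h.hasCompactSupport_spaceGrad
  refine ext_inner_right ℝ fun v => ?_
  rw [inner_zero_left, real_inner_comm, ← integral_inner hi, ← h.integral_fderiv (0, v)]
  exact integral_congr_ae (ae_of_all _ fun z => by
    dsimp only
    rw [real_inner_comm, inner_spaceGrad (h.differentiable _)])

end IsTestFunction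

lemma integrableOn_inner {F ψ : SpaceTime d → Space d} (hF : IntegrableOn F D) (hψ : Continuous ψ)
    (hc : HasCompactSupport ψ) : IntegrableOn (fun z => (inner ℝ (F z) (ψ z) : ℝ)) D := by
  obtain ⟨C, hC⟩ := hψ.bounded_above_of_compact_support hc
  refine (hF.norm.mul_const C).mono' (hF.1.inner hψ.aestronglyMeasurable) (ae_of_all _ fun z => ?_)
  exact (norm_inner_le_norm _ _).trans (by gcongr; exact hC z)

lemma integrableOn_mul {F ψ : SpaceTime d → ℝ} (hF : IntegrableOn F D) (hψ : Continuous ψ)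
    (hc : HasCompactSupport ψ) : IntegrableOn (fun z => F z * ψ z) D := by
  obtain ⟨C, hC⟩ := hψ.bounded_above_of_compact_support hc
  refine (hF.norm.mul_const C).mono' (hF.1.mul hψ.aestronglyMeasurable) (ae_of_all _ fun z => ?_)
  rw [norm_mul]
  gcongr
  exact hC z

lemma integrableOn_smul {F : SpaceTime d → ℝ} {ψ : SpaceTime d → Space d} (hF : IntegrableOn F D)
    (hψ : Continuous ψ) (hc : HasCompactSupport ψ) : IntegrableOn (fun z => F z • ψ z) D := by
  obtain ⟨C, hC⟩ := hψ.bounded_above_of_compact_support hc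
  refine (hF.norm.mul_const C).mono' (hF.1.smul hψ.aestronglyMeasurable) (ae_of_all _ fun z => ?_)
  rw [norm_smul]
  gcongr
  exact hC z

lemma integrableOn_smul' {F : SpaceTime d → Space d} {ψ : SpaceTime d → ℝ} (hF : IntegrableOn F D)
    (hψ : Continuous ψ) (hc : HasCompactSupport ψ) : IntegrableOn (fun z => ψ z • F z) D := by
  obtain ⟨C, hC⟩ := hψ.bounded_above_of_compact_support hc
  refine (hF.norm.const_mul C).mono' (hψ.aestronglyMeasurable.smul hF.1) (ae_of_all _ fun z => ?_)
  rw [norm_smul]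
  gcongr
  exact hC z

end TestFunctions

section Solutions

variable {d : ℕ} {a : SpaceTime d → Matrix (Fin d) (Fin d) ℝ} {D : Set (SpaceTime d)}
  {f f' G G' : SpaceTime d → Space d} {u u' : SpaceTime d → ℝ}

lemma IsWeakSolution.integrableOn_flux (ha : IsCoefficientField a) (hD : Bornology.IsBounded D)
    (h : IsWeakSolution a f D u G) : IntegrableOn (flux a G) D := by
  obtain ⟨ν, μ, M, hw⟩ := ha.exists_weights hD
  exact (hw.integrable_flux ha h.isWeakGradient.integrableOn_grad.1 h.energy).1

lemma IsWeakGradient.add_smul (h : IsWeakGradient D u G) (h' : IsWeakGradient D u' G') (c : ℝ) :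
    IsWeakGradient D (u + c • u') (G + c • G') where
  integrableOn := h.integrableOn.add (h'.integrableOn.smul c)
  integrableOn_grad := h.integrableOn_grad.add (h'.integrableOn_grad.smul c)
  integral_eq φ hφ := by
    have e1 := integrableOn_smul h.integrableOn hφ.continuous_spaceGrad
      hφ.hasCompactSupport_spaceGrad
    have e2 := integrableOn_smul h'.integrableOn hφ.continuous_spaceGrad
      hφ.hasCompactSupport_spaceGrad
    have e3 := integrableOn_smul' h.integrableOn_grad hφ.1.continuous hφ.2.1
    have e4 := integrableOn_smul' h'.integrableOn_grad hφ.1.continuous hφ.2.1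
    have l : ∫ z in D, (u + c • u') z • spaceGrad φ z =
        (∫ z in D, u z • spaceGrad φ z) + c • ∫ z in D, u' z • spaceGrad φ z := by
      rw [← integral_smul, ← integral_add e1 (e2.fun_smul c)]
      exact integral_congr_ae (ae_of_all _ fun z => by
        simp [_root_.add_smul, smul_smul])
    have r : ∫ z in D, φ z • (G + c • G') z =
        (∫ z in D, φ z • G z) + c • ∫ z in D, φ z • G' z := by
      rw [← integral_smul, ← integral_add e3 (e4.fun_smul c)]
      exact integral_congr_ae (ae_of_all _ fun z => by
        simp [smul_add, smul_smul, mul_comm])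
    rw [l, r, h.integral_eq φ hφ, h'.integral_eq φ hφ]
    rw [smul_neg, neg_add]

lemma IsWeakSolution.add_smul (ha : IsCoefficientField a) (hD : Bornology.IsBounded D)
    (hf : IntegrableOn f D) (hf' : IntegrableOn f' D)
    (h : IsWeakSolution a f D u G) (h' : IsWeakSolution a f' D u' G') (c : ℝ) :
    IsWeakSolution a (f + c • f') D (u + c • u') (G + c • G') where
  isWeakGradient := h.isWeakGradient.add_smul h'.isWeakGradient c
  energy := integrableOn_edens_combination ha h.isWeakGradient.integrableOn_grad.1
    h'.isWeakGradient.integrableOn_grad.1 h.energy h'.energy c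
  equation φ hφ := by
    have t1 := integrableOn_mul h.isWeakGradient.integrableOn hφ.continuous_timeDeriv
      hφ.hasCompactSupport_timeDeriv
    have t2 := integrableOn_mul h'.isWeakGradient.integrableOn hφ.continuous_timeDeriv
      hφ.hasCompactSupport_timeDeriv
    have g1 := integrableOn_inner (h.integrableOn_flux ha hD) hφ.continuous_spaceGrad
      hφ.hasCompactSupport_spaceGrad
    have g2 := integrableOn_inner (h'.integrableOn_flux ha hD) hφ.continuous_spaceGrad
      hφ.hasCompactSupport_spaceGrad
    have r1 := integrableOn_inner hf hφ.continuous_spaceGrad hφ.hasCompactSupport_spaceGrad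
    have r2 := integrableOn_inner hf' hφ.continuous_spaceGrad hφ.hasCompactSupport_spaceGrad
    have l1 : ∫ z in D, (u + c • u') z * timeDeriv φ z =
        (∫ z in D, u z * timeDeriv φ z) + c * ∫ z in D, u' z * timeDeriv φ z := by
      rw [← integral_const_mul, ← integral_add t1 (t2.const_mul c)]
      exact integral_congr_ae (ae_of_all _ fun z => by simp; ring)
    have l2 : ∫ z in D, bil (a z) (spaceGrad φ z) ((G + c • G') z) =
        (∫ z in D, bil (a z) (spaceGrad φ z) (G z)) +
          c * ∫ z in D, bil (a z) (spaceGrad φ z) (G' z) := by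
      have comm : ∀ (F : SpaceTime d → Space d) z, (inner ℝ (flux a F z) (spaceGrad φ z) : ℝ) =
          bil (a z) (spaceGrad φ z) (F z) := fun F z => real_inner_comm _ _
      simp only [comm] at g1 g2
      rw [← integral_const_mul, ← integral_add g1 (g2.const_mul c)]
      exact integral_congr_ae (ae_of_all _ fun z => by simp [bil_add_right, bil_smul_right])
    have l3 : ∫ z in D, (inner ℝ ((f + c • f') z) (spaceGrad φ z) : ℝ) =
        (∫ z in D, (inner ℝ (f z) (spaceGrad φ z) : ℝ)) +
          c * ∫ z in D, (inner ℝ (f' z) (spaceGrad φ z) : ℝ) := by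
      rw [← integral_const_mul, ← integral_add r1 (r2.const_mul c)]
      exact integral_congr_ae (ae_of_all _ fun z => by simp [inner_add_left, inner_smul_left])
    rw [l1, l2, l3]
    have q1 := h.equation φ hφ
    have q2 := h'.equation φ hφ
    linear_combination q1 + c * q2

lemma IsWeakSolution.sub (ha : IsCoefficientField a) (hD : Bornology.IsBounded D)
    (hf : IntegrableOn f D) (hf' : IntegrableOn f' D)
    (h : IsWeakSolution a f D u G) (h' : IsWeakSolution a f' D u' G') :
    IsWeakSolution a (f - f') D (u - u') (G - G') := by
  have := h.add_smul ha hD hf hf' h' (-1)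
  simpa only [neg_smul, one_smul, ← sub_eq_add_neg] using this

lemma IsWeakSolution.mono {D' : Set (SpaceTime d)} (h : IsWeakSolution a f D u G) (hD : D' ⊆ D) :
    IsWeakSolution a f D' u G := by
  have key : ∀ {E : Type} [NormedAddCommGroup E] [NormedSpace ℝ E] {φ : SpaceTime d → ℝ}
      (_ : IsTestFunction D' φ) {F : SpaceTime d → E} (_ : ∀ z ∉ tsupport φ, F z = 0),
      ∫ z in D', F z = ∫ z in D, F z := fun hφ F h0 => by
    rw [hφ.setIntegral_eq h0, (hφ.mono hD).setIntegral_eq h0]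
  refine ⟨⟨h.isWeakGradient.integrableOn.mono_set hD, h.isWeakGradient.integrableOn_grad.mono_set hD,
    fun φ hφ => ?_⟩, h.energy.mono_set hD, fun φ hφ => ?_⟩
  · rw [key hφ fun z hz => by simp [hφ.spaceGrad_eq_zero hz],
      key hφ fun z hz => by simp [image_eq_zero_of_notMem_tsupport hz],
      h.isWeakGradient.integral_eq φ (hφ.mono hD)]
  · rw [key hφ fun z hz => by simp [hφ.timeDeriv_eq_zero hz],
      key hφ fun z hz => by simp [hφ.spaceGrad_eq_zero hz, bil_zero_left],
      key hφ fun z hz => by simp [hφ.spaceGrad_eq_zero hz], h.equation φ (hφ.mono hD)]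

/-- The right-hand side enters only through its pairings with gradients of test functions; in
particular, additive constants in it do not matter. -/
lemma IsWeakSolution.congr_rhs (h : IsWeakSolution a f D u G)
    (hff' : ∀ φ, IsTestFunction D φ → ∫ z in D, (inner ℝ (f z) (spaceGrad φ z) : ℝ) =
      ∫ z in D, (inner ℝ (f' z) (spaceGrad φ z) : ℝ)) : IsWeakSolution a f' D u G :=
  ⟨h.isWeakGradient, h.energy, fun φ hφ => by rw [h.equation φ hφ, hff' φ hφ]⟩

lemma isWeakSolution_const (hD : Bornology.IsBounded D) (c : ℝ) :
    IsWeakSolution a 0 D (fun _ => c) 0 := by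
  have hfin : volume D < ⊤ := hD.measure_lt_top
  refine ⟨⟨integrableOn_const hfin.ne, integrableOn_zero, fun φ hφ => ?_⟩, ?_, fun φ hφ => ?_⟩
  · rw [integral_smul, hφ.integral_spaceGrad]
    simp
  · simp [bil_zero_left]
  · rw [integral_const_mul, hφ.setIntegral_eq fun z hz => hφ.timeDeriv_eq_zero hz]
    simp_rw [timeDeriv_eq (hφ.differentiable _), hφ.integral_fderiv]
    simp [bil_zero_right]

end Solutions

/-! ### Coarse-grained matrices and homogeneous solutions -/

section Polarization


variable {d : ℕ} {S : Type u} [AddCommGroup S] [Module ℝ S]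

/-- On a pre-Hilbert space, `sup_x (-½ ‖x‖² + T q x)` is half the squared dual norm of `T q`, a
quadratic form in `q`; hence its polarization `M` controls `T`. -/
lemma sq_le_of_polarization (E : S →ₗ[ℝ] S →ₗ[ℝ] ℝ) (hsymm : ∀ x y, E x y = E y x)
    (hnn : ∀ x, 0 ≤ E x x) (T : Space d →ₗ[ℝ] S →ₗ[ℝ] ℝ) (hT : ∀ q, ∃ C, ∀ x, |T q x| ≤ C * √(E x x))
    (J : Space d → ℝ) (hJ : ∀ q, J q = sSup {y | ∃ x, y = -(1 / 2) * E x x + T q x})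
    (q : Space d) (x : S) :
    T q x ^ 2 ≤ ‖Matrix.toEuclideanCLM (n := Fin d) (𝕜 := ℝ) (Matrix.of fun i j =>
      J (basisVec i + basisVec j) - J (basisVec i) - J (basisVec j))‖ * ‖q‖ ^ 2 * E x x := by
  obtain ⟨H, _, _, _, j, hj, hjE⟩ := exists_hilbert_completion E hsymm hnn
  have hsq : ∀ x, E x x = ‖j x‖ ^ 2 := fun x => by rw [← hjE, real_inner_self_eq_norm_sq]
  have : ∀ q, ∃ l : H, ∀ x, T q x = inner ℝ l (j x) := fun q => by
    obtain ⟨C, hC⟩ := hT q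
    exact exists_riesz j hj (T q) C fun x => by
      simpa [hsq, Real.sqrt_sq (norm_nonneg _)] using hC x
  choose v hv using this
  -- the Riesz representative `v q` of `T q` is linear in `q`
  have hvlin : ∀ q : Space d, v q = ∑ i, q i • v (basisVec i) := by
    intro q
    have hq : q = ∑ i, q i • basisVec i := by
      ext k
      simp [basisVec, Pi.single_apply]
    refine hj.eq_of_inner_left ℝ ?_
    intro x
    rw [← hv, sum_inner]
    conv_lhs => rw [hq]
    simp [inner_smul_left, hv]
  have hvadd : ∀ p q, v (p + q) = v p + v q := by
    intro p q
    refine hj.eq_of_inner_left ℝ ?_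
    intro x
    rw [← hv, inner_add_left, ← hv, ← hv]
    simp
  -- complete the square
  have hJv : ∀ q, J q = 1 / 2 * ‖v q‖ ^ 2 := by
    intro q
    rw [hJ]
    refine IsLUB.csSup_eq ⟨?_, ?_⟩ ⟨_, 0, rfl⟩
    · rintro _ ⟨x, rfl⟩
      rw [hsq, hv]
      have := norm_sub_sq_real (v q) (j x)
      nlinarith [sq_nonneg ‖v q - j x‖]
    · intro b hb
      obtain ⟨w, hw, hlim⟩ := mem_closure_iff_seq_limit.1 (hj (v q))
      choose φ hφ using hw
      have h1 : Tendsto (fun n => -(1 / 2) * ‖w n‖ ^ 2 + inner ℝ (v q) (w n)) atTop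
          (𝓝 (-(1 / 2) * ‖v q‖ ^ 2 + inner ℝ (v q) (v q))) :=
        ((hlim.norm.pow 2).const_mul _).add (tendsto_const_nhds.inner hlim)
      have h2 := le_of_tendsto' h1 (b := b) fun n => hb ⟨φ n, by rw [hsq, hv, hφ]⟩
      rw [real_inner_self_eq_norm_sq] at h2
      linarith
  set Mx : Matrix (Fin d) (Fin d) ℝ := Matrix.of fun i j =>
      J (basisVec i + basisVec j) - J (basisVec i) - J (basisVec j) with hMx
  -- `M` is the Gram matrix of the representatives of the basis vectors
  have hM : ∀ i k, Mx i k = inner ℝ (v (basisVec i)) (v (basisVec k)) := by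
    intro i k
    rw [hMx, Matrix.of_apply, hJv, hJv, hJv, hvadd, norm_add_sq_real]
    ring
  have hquad : ‖v q‖ ^ 2 = inner ℝ q (Matrix.toEuclideanCLM (n := Fin d) (𝕜 := ℝ) Mx q) := by
    have : bil Mx q q = inner ℝ q (Matrix.toEuclideanCLM (n := Fin d) (𝕜 := ℝ) Mx q) := rfl
    rw [← this, bil_eq_sum, ← real_inner_self_eq_norm_sq, hvlin q, sum_inner]
    refine Finset.sum_congr rfl fun i _ => ?_
    rw [inner_sum]
    refine Finset.sum_congr rfl fun k _ => ?_
    rw [inner_smul_left, inner_smul_right, hM]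
    simp
    ring
  have hle : ‖v q‖ ^ 2 ≤ ‖Matrix.toEuclideanCLM (n := Fin d) (𝕜 := ℝ) Mx‖ * ‖q‖ ^ 2 := by
    rw [hquad]
    refine (real_inner_le_norm _ _).trans ?_
    calc ‖q‖ * ‖Matrix.toEuclideanCLM (n := Fin d) (𝕜 := ℝ) Mx q‖
        ≤ ‖q‖ * (‖Matrix.toEuclideanCLM (n := Fin d) (𝕜 := ℝ) Mx‖ * ‖q‖) := by
          gcongr
          exact ContinuousLinearMap.le_opNorm _ _
      _ = _ := by ring
  calc T q x ^ 2 = (inner ℝ (v q) (j x)) ^ 2 := by rw [hv]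
    _ ≤ (‖v q‖ * ‖j x‖) ^ 2 := by
      rw [← sq_abs]
      gcongr
      exact abs_real_inner_le_norm _ _
    _ = ‖v q‖ ^ 2 * E x x := by rw [hsq]; ring
    _ ≤ _ := by
      gcongr
      exact hnn x

end Polarization

section CoarseMatrices

variable {d : ℕ} {a : SpaceTime d → Matrix (Fin d) (Fin d) ℝ} {Q : Set (SpaceTime d)}

/-- The space of mean-zero homogeneous solutions in `Q`, as pairs `(u, ∇u)`. -/
def solutionSpace (ha : IsCoefficientField a) (hQ : Bornology.IsBounded Q) :
    Submodule ℝ ((SpaceTime d → ℝ) × (SpaceTime d → Space d)) where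
  carrier := {w | IsWeakSolution a 0 Q w.1 w.2 ∧ (⨍ z in Q, w.1 z) = 0}
  zero_mem' := by
    refine ⟨?_, by simp⟩
    have := isWeakSolution_const (a := a) hQ 0
    exact this
  add_mem' := by
    rintro w w' ⟨h1, h2⟩ ⟨h1', h2'⟩
    refine ⟨?_, ?_⟩
    · have := h1.add_smul (f := 0) (f' := 0) ha hQ integrableOn_zero integrableOn_zero h1' 1
      simpa using this
    · rw [setAverage_eq] at *
      have := integral_add h1.isWeakGradient.integrableOn h1'.isWeakGradient.integrableOn
      simp only [Prod.fst_add, Pi.add_apply]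
      rw [this, smul_add, h2, h2', add_zero]
  smul_mem' := by
    rintro c w ⟨h1, h2⟩
    refine ⟨?_, ?_⟩
    · have := (isWeakSolution_const (a := a) hQ 0).add_smul (f := 0) (f' := 0) ha hQ integrableOn_zero
        integrableOn_zero h1 c
      have e : (fun _ : SpaceTime d => (0 : ℝ)) = 0 := rfl
      simpa [e] using this
    · rw [setAverage_eq] at *
      simp only [Prod.smul_fst, Pi.smul_apply]
      rw [integral_smul, smul_comm, h2, smul_zero]

variable (ha : IsCoefficientField a) (hQ : Bornology.IsBounded Q)

/-- The normalized energy form `⨍_Q ∇u · s∇v` on the space of solutions. -/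
def energyForm : solutionSpace ha hQ →ₗ[ℝ] solutionSpace ha hQ →ₗ[ℝ] ℝ :=
  have hi : ∀ w w' : solutionSpace ha hQ,
      Integrable (fun z => bil (symPart (a z)) (w.1.2 z) (w'.1.2 z)) (volume.restrict Q) :=
    fun w w' => integrableOn_bil_symPart ha w.2.1.isWeakGradient.integrableOn_grad.1
      w'.2.1.isWeakGradient.integrableOn_grad.1 w.2.1.energy w'.2.1.energy
  LinearMap.mk₂ ℝ (fun w w' => ⨍ z in Q, bil (symPart (a z)) (w.1.2 z) (w'.1.2 z))
    (fun w w' v => by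
      simp only [setAverage_eq, ← smul_add]
      rw [← integral_add (hi w v) (hi w' v)]
      simp [bil_add_left])
    (fun c w v => by
      simp only [setAverage_eq, Submodule.coe_smul, Prod.smul_snd, Pi.smul_apply,
        bil_smul_left, integral_const_mul, smul_eq_mul]
      ring)
    (fun v w w' => by
      simp only [setAverage_eq, ← smul_add]
      rw [← integral_add (hi v w) (hi v w')]
      simp [bil_add_right])
    (fun c v w => by
      simp only [setAverage_eq, Submodule.coe_smul, Prod.smul_snd, Pi.smul_apply,
        bil_smul_right, integral_const_mul, smul_eq_mul]
      ring)

/-- The pairing `⨍_Q q · F` of a vector with a field `F` depending linearly on a solution. -/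
def pairingForm (F : (SpaceTime d → Space d) →ₗ[ℝ] (SpaceTime d → Space d))
    (hF : ∀ w : solutionSpace ha hQ, IntegrableOn (F w.1.2) Q) :
    Space d →ₗ[ℝ] solutionSpace ha hQ →ₗ[ℝ] ℝ :=
  have hi : ∀ (q : Space d) (w : solutionSpace ha hQ),
      Integrable (fun z => (inner ℝ q (F w.1.2 z) : ℝ)) (volume.restrict Q) :=
    fun q w => (hF w).const_inner q
  LinearMap.mk₂ ℝ (fun q w => ⨍ z in Q, (inner ℝ q (F w.1.2 z) : ℝ))
    (fun q q' w => by
      simp only [setAverage_eq, ← smul_add]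
      rw [← integral_add (hi q w) (hi q' w)]
      simp [inner_add_left])
    (fun c q w => by
      simp only [setAverage_eq, inner_smul_left, integral_const_mul, conj_trivial, smul_eq_mul]
      ring)
    (fun q w w' => by
      simp only [setAverage_eq, ← smul_add]
      rw [← integral_add (hi q w) (hi q w')]
      simp [inner_add_right])
    (fun c q w => by
      simp only [setAverage_eq, Submodule.coe_smul, Prod.smul_snd, map_smul, Pi.smul_apply,
        inner_smul_right, integral_const_mul, smul_eq_mul]
      ring)

/-- The flux `G ↦ a G` as a linear map. -/
def fluxₗ (a : SpaceTime d → Matrix (Fin d) (Fin d) ℝ) :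
    (SpaceTime d → Space d) →ₗ[ℝ] (SpaceTime d → Space d) where
  toFun := flux a
  map_add' G G' := by ext1 z; simp [flux]
  map_smul' c G := by ext1 z; simp [flux]

/-- The bound by the coarse-grained matrix of the mean of a field `F` which depends linearly on a
homogeneous solution, when `J` is the corresponding variational quantity. -/
lemma norm_integral_sq_le_aux (hQ0 : volume Q ≠ 0)
    (F : (SpaceTime d → Space d) →ₗ[ℝ] (SpaceTime d → Space d))
    (K : ℝ) (hF : ∀ w : solutionSpace ha hQ, IntegrableOn (F w.1.2) Q ∧
      ∫ z in Q, ‖F w.1.2 z‖ ≤ K * √(∫ z in Q, edens a w.1.2 z))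
    (J : Space d → ℝ) (hJ : ∀ q, J q = sSup {y | ∃ w : solutionSpace ha hQ,
      y = ⨍ z in Q, (-(1 / 2) * edens a w.1.2 z + inner ℝ q (F w.1.2 z))})
    {u : SpaceTime d → ℝ} {G : SpaceTime d → Space d} (h : IsWeakSolution a 0 Q u G) :
    ‖∫ z in Q, F G z‖ ^ 2 ≤ volume.real Q *
      ‖Matrix.toEuclideanCLM (n := Fin d) (𝕜 := ℝ) (Matrix.of fun i j =>
      J (basisVec i + basisVec j) - J (basisVec i) - J (basisVec j))‖ *
        ∫ z in Q, edens a G z := by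
  have hV : 0 < volume.real Q := ENNReal.toReal_pos hQ0 hQ.measure_lt_top.ne
  have hE : ∀ w : solutionSpace ha hQ, energyForm ha hQ w w =
      (volume.real Q)⁻¹ * ∫ z in Q, edens a w.1.2 z := fun w => by
    simp [energyForm, setAverage_eq, edens]
  have hTe : ∀ q (w : solutionSpace ha hQ), pairingForm ha hQ F (fun w => (hF w).1) q w =
      (volume.real Q)⁻¹ * ∫ z in Q, (inner ℝ q (F w.1.2 z) : ℝ) := fun q w => by
    simp [pairingForm, setAverage_eq]
  have hpos : ∀ w : solutionSpace ha hQ, 0 ≤ ∫ z in Q, edens a w.1.2 z := fun w =>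
    integral_nonneg (ha.edens_nonneg _)
  -- the mean-zero representative of `u`
  let w₀ : solutionSpace ha hQ := ⟨(u - fun _ => ⨍ z in Q, u z, G), by
    refine ⟨?_, ?_⟩
    · have := h.sub (f := 0) (f' := 0) ha hQ integrableOn_zero integrableOn_zero
        (isWeakSolution_const (a := a) hQ (⨍ z in Q, u z))
      simpa using this
    · have := integral_sub h.isWeakGradient.integrableOn
        (integrableOn_const (s := Q) (μ := (volume : Measure (SpaceTime d)))
          (C := ⨍ z in Q, u z) hQ.measure_lt_top.ne)
      rw [setAverage_eq]
      simp only [Pi.sub_apply]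
      rw [this, setIntegral_const, setAverage_eq, smul_smul, mul_inv_cancel₀ hV.ne', one_smul,
        sub_self, smul_zero]⟩
  -- pairing the field with its own integral bounds `‖q‖⁴` by a multiple of `‖q‖²`
  set q : Space d := ∫ z in Q, F G z with hq
  have key := sq_le_of_polarization (energyForm ha hQ)
    (fun x y => by simp [energyForm, bil_symPart_comm])
    (fun x => by rw [hE]; have := hpos x; positivity)
    (pairingForm ha hQ F (fun w => (hF w).1)) (fun q => by
      refine ⟨‖q‖ * K * √((volume.real Q)⁻¹), fun w => ?_⟩
      rw [hE, hTe, Real.sqrt_mul (by positivity), abs_mul, abs_of_pos (by positivity : 0 <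
        (volume.real Q)⁻¹)]
      have h1 : |∫ z in Q, (inner ℝ q (F w.1.2 z) : ℝ)| ≤ ‖q‖ * ∫ z in Q, ‖F w.1.2 z‖ := by
        rw [← integral_const_mul]
        exact norm_integral_le_of_norm_le ((hF w).1.norm.const_mul _)
          (ae_of_all _ fun z => norm_inner_le_norm (𝕜 := ℝ) q _)
      calc (volume.real Q)⁻¹ * |∫ z in Q, (inner ℝ q (F w.1.2 z) : ℝ)|
          ≤ (volume.real Q)⁻¹ * (‖q‖ * (K * √(∫ z in Q, edens a w.1.2 z))) := by
            gcongr
            exact h1.trans (by gcongr; exact (hF w).2)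
        _ = ‖q‖ * K * √((volume.real Q)⁻¹) *
              (√((volume.real Q)⁻¹) * √(∫ z in Q, edens a w.1.2 z)) := by
            rw [show ∀ x y z t : ℝ, x * y * z * (z * t) = x * y * (z * z) * t by intros; ring,
              Real.mul_self_sqrt (by positivity)]
            ring)
    J (fun q => by
      rw [hJ]
      congr 1
      ext y
      refine exists_congr fun w => ?_
      have hen : IntegrableOn (edens a w.1.2) Q := w.2.1.energy
      rw [hE, hTe, setAverage_eq, integral_add (hen.const_mul _)
        ((hF w).1.const_inner q), integral_const_mul, smul_eq_mul]
      constructor <;> (rintro rfl; ring)) q w₀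
  rw [hE, hTe, integral_inner (hF w₀).1, real_inner_self_eq_norm_sq] at key
  change ((volume.real Q)⁻¹ * ‖q‖ ^ 2) ^ 2 ≤ _ * ‖q‖ ^ 2 * ((volume.real Q)⁻¹ *
    ∫ z in Q, edens a G z) at key
  rcases eq_or_ne q 0 with h0 | h0
  · rw [h0]
    have := hpos w₀
    change 0 ≤ ∫ z in Q, edens a G z at this
    simp only [norm_zero, ne_eq, OfNat.ofNat_ne_zero, not_false_eq_true, zero_pow]
    positivity
  · have hq2 : 0 < ‖q‖ ^ 2 := by positivity
    refine le_of_mul_le_mul_right ?_ hq2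
    have := mul_le_mul_of_nonneg_left key (sq_nonneg (volume.real Q))
    have e1 : volume.real Q ^ 2 * ((volume.real Q)⁻¹ * ‖q‖ ^ 2) ^ 2 = ‖q‖ ^ 2 * ‖q‖ ^ 2 := by
      field_simp
    rw [e1] at this
    refine this.trans (le_of_eq ?_)
    field_simp

include ha hQ in
/-- The mean of the gradient of a homogeneous solution is controlled by `s_*⁻¹`. -/
theorem norm_integral_grad_sq_le (hQ0 : volume Q ≠ 0) {u : SpaceTime d → ℝ}
    {G : SpaceTime d → Space d} (h : IsWeakSolution a 0 Q u G) :
    ‖∫ z in Q, G z‖ₑ ^ 2 ≤ volume Q * specNorm (sStarInv a Q) *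
      ENNReal.ofReal (∫ z in Q, edens a G z) := by
  obtain ⟨ν, μ, M, hw⟩ := ha.exists_weights hQ
  have key := norm_integral_sq_le_aux ha hQ hQ0 LinearMap.id (√(∫ z in Q, ν z))
    (fun w => hw.integrable_of_energy ha w.2.1.isWeakGradient.integrableOn_grad.1 w.2.1.energy)
    (fun q => coarseJ a Q 0 q) (fun q => by
      rw [coarseJ, coarseValues]
      congr 1
      ext y
      constructor
      · rintro ⟨u, G, h1, h2, rfl⟩
        exact ⟨⟨(u, G), h1, h2⟩, by simp [edens, bil_zero_left]⟩
      · rintro ⟨w, rfl⟩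
        exact ⟨w.1.1, w.1.2, w.2.1, w.2.2, by simp [edens, bil_zero_left]⟩) h
  have := ENNReal.ofReal_le_ofReal key
  rw [ENNReal.ofReal_mul (by positivity), ENNReal.ofReal_mul (by positivity),
    ENNReal.ofReal_pow (norm_nonneg _), ofReal_norm, ofReal_norm,
    ofReal_measureReal hQ.measure_lt_top.ne] at this
  exact this

include ha hQ in
/-- The mean of the flux of a homogeneous solution is controlled by `b`. -/
theorem norm_integral_flux_sq_le (hQ0 : volume Q ≠ 0) {u : SpaceTime d → ℝ}
    {G : SpaceTime d → Space d} (h : IsWeakSolution a 0 Q u G) :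
    ‖∫ z in Q, flux a G z‖ₑ ^ 2 ≤ volume Q * specNorm (bMat a Q) *
      ENNReal.ofReal (∫ z in Q, edens a G z) := by
  obtain ⟨ν, μ, M, hw⟩ := ha.exists_weights hQ
  have key := norm_integral_sq_le_aux ha hQ hQ0 (-fluxₗ a) (M * √(∫ z in Q, μ z))
    (fun w => by
      have := hw.integrable_flux ha w.2.1.isWeakGradient.integrableOn_grad.1 w.2.1.energy
      refine ⟨this.1.neg, ?_⟩
      simpa [fluxₗ] using this.2)
    (fun p => coarseJ a Q p 0) (fun p => by
      rw [coarseJ, coarseValues]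
      congr 1
      ext y
      constructor
      · rintro ⟨u, G, h1, h2, rfl⟩
        exact ⟨⟨(u, G), h1, h2⟩, by simp [edens, fluxₗ, inner_flux, sub_eq_add_neg]⟩
      · rintro ⟨w, rfl⟩
        exact ⟨w.1.1, w.1.2, w.2.1, w.2.2, by
          simp [edens, fluxₗ, inner_flux, sub_eq_add_neg]⟩) h
  have e : ∫ z in Q, (-fluxₗ a) G z = -∫ z in Q, flux a G z := by
    rw [← integral_neg]; rfl
  rw [e, norm_neg] at key
  have := ENNReal.ofReal_le_ofReal key
  rw [ENNReal.ofReal_mul (by positivity), ENNReal.ofReal_mul (by positivity),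
    ENNReal.ofReal_pow (norm_nonneg _), ofReal_norm, ofReal_norm,
    ofReal_measureReal hQ.measure_lt_top.ne] at this
  exact this

end CoarseMatrices

/-! ### Completeness of the energy space -/

section Completeness

/-- Completeness of `L¹`, with a subsequence converging almost everywhere. -/
lemma exists_tendsto_integral_norm_sub {α E : Type*} [MeasurableSpace α] [NormedAddCommGroup E]
    [CompleteSpace E] {m : Measure α} {F : ℕ → α → E} (hF : ∀ n, Integrable (F n) m)
    (hc : ∀ ε > 0, ∃ N, ∀ k ≥ N, ∀ n ≥ N, ∫ z, ‖F k z - F n z‖ ∂m < ε) :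
    ∃ G, Integrable G m ∧ Tendsto (fun n => ∫ z, ‖F n z - G z‖ ∂m) atTop (𝓝 0) ∧
      ∃ ns : ℕ → ℕ, StrictMono ns ∧ ∀ᵐ z ∂m, Tendsto (fun i => F (ns i) z) atTop (𝓝 (G z)) := by
  have hdist : ∀ {f g : α → E} (hf : Integrable f m) (hg : Integrable g m),
      dist (hf.toL1 f) (hg.toL1 g) = ∫ z, ‖f z - g z‖ ∂m := fun {f g} hf hg => by
    rw [dist_eq_norm, ← Integrable.toL1_sub f g hf hg, L1.norm_of_fun_eq_integral_norm]
    rfl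
  have hcs : CauchySeq fun n => (hF n).toL1 (F n) := by
    rw [Metric.cauchySeq_iff]
    intro ε hε
    obtain ⟨N, hN⟩ := hc ε hε
    exact ⟨N, fun k hk n hn => by rw [hdist]; exact hN k hk n hn⟩
  obtain ⟨g, hg⟩ := cauchySeq_tendsto_of_complete hcs
  have hgi : Integrable g m := L1.integrable_coeFn g
  have hlim : Tendsto (fun n => ∫ z, ‖F n z - g z‖ ∂m) atTop (𝓝 0) := by
    rw [tendsto_iff_dist_tendsto_zero] at hg
    refine hg.congr fun n => ?_
    have : g = hgi.toL1 g := (Integrable.toL1_coeFn g hgi).symm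
    conv_lhs => rw [this]
    exact hdist _ _
  refine ⟨g, hgi, hlim, ?_⟩
  have h1 : Tendsto (fun n => eLpNorm (F n - ⇑g) 1 m) atTop (𝓝 0) := by
    have : ∀ n, eLpNorm (F n - ⇑g) 1 m = ENNReal.ofReal (∫ z, ‖F n z - g z‖ ∂m) := fun n => by
      rw [eLpNorm_one_eq_lintegral_enorm]
      exact (ofReal_integral_norm_eq_lintegral_enorm ((hF n).sub hgi)).symm
    simp only [this]
    simpa using ENNReal.tendsto_ofReal hlim
  exact (tendstoInMeasure_of_tendsto_eLpNorm one_ne_zero (fun n => (hF n).1) hgi.1 h1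
    ).exists_seq_tendsto_ae

variable {d : ℕ} {a : SpaceTime d → Matrix (Fin d) (Fin d) ℝ} {Q : Set (SpaceTime d)}

lemma continuous_bil_self (A : Matrix (Fin d) (Fin d) ℝ) :
    Continuous fun v : Space d => bil A v v := by
  have : Continuous (Matrix.toEuclideanLin A) := LinearMap.continuous_of_finiteDimensional _
  exact continuous_id.inner this

lemma tendsto_edens {ι : Type*} {l : Filter ι} {G : ι → SpaceTime d → Space d}
    {H : SpaceTime d → Space d} {z : SpaceTime d} (h : Tendsto (fun i => G i z) l (𝓝 (H z))) :
    Tendsto (fun i => edens a (G i) z) l (𝓝 (edens a H z)) :=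
  ((continuous_bil_self (symPart (a z))).tendsto (H z)).comp h

lemma integrableOn_edens_sub (ha : IsCoefficientField a) {F G : SpaceTime d → Space d}
    (hF : AEStronglyMeasurable F (volume.restrict Q))
    (hG : AEStronglyMeasurable G (volume.restrict Q))
    (heF : IntegrableOn (edens a F) Q) (heG : IntegrableOn (edens a G) Q) :
    IntegrableOn (edens a (F - G)) Q := by
  have := integrableOn_edens_combination ha hF hG heF heG (-1)
  simpa only [neg_smul, one_smul, ← sub_eq_add_neg] using this

/-- Fields of finite energy form a complete space. -/
theorem exists_energy_limit (ha : IsCoefficientField a) (hQ : Bornology.IsBounded Q)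
    {G : ℕ → SpaceTime d → Space d} (hG : ∀ n, AEStronglyMeasurable (G n) (volume.restrict Q))
    (he : ∀ n, IntegrableOn (edens a (G n)) Q)
    (hc : ∀ ε > 0, ∃ N, ∀ k ≥ N, ∀ n ≥ N, ∫ z in Q, edens a (G k - G n) z < ε) :
    ∃ H, IntegrableOn H Q ∧ IntegrableOn (edens a H) Q ∧
      Tendsto (fun n => ∫ z in Q, edens a (G n - H) z) atTop (𝓝 0) := by
  obtain ⟨ν, μ, M, hw⟩ := ha.exists_weights hQ
  have hGi : ∀ n, IntegrableOn (G n) Q := fun n => (hw.integrable_of_energy ha (hG n) (he n)).1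
  have hdiff : ∀ k n, IntegrableOn (edens a (G k - G n)) Q := fun k n =>
    integrableOn_edens_sub ha (hG k) (hG n) (he k) (he n)
  obtain ⟨H, hH, -, ns, hns, hae⟩ := exists_tendsto_integral_norm_sub hGi (by
    intro ε hε
    set c := √(∫ z in Q, ν z) with hcdef
    have hc0 : 0 ≤ c := Real.sqrt_nonneg _
    obtain ⟨N, hN⟩ := hc ((ε / (c + 1)) ^ 2) (by positivity)
    refine ⟨N, fun k hk n hn => ?_⟩
    have h1 := (hw.integrable_of_energy ha ((hG k).sub (hG n)) (hdiff k n)).2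
    have h2 : √(∫ z in Q, edens a (G k - G n) z) ≤ ε / (c + 1) := by
      rw [Real.sqrt_le_left (by positivity)]
      exact (hN k hk n hn).le
    calc ∫ z in Q, ‖G k z - G n z‖ ≤ c * (ε / (c + 1)) := h1.trans (by gcongr)
      _ = ε * (c / (c + 1)) := by ring
      _ < ε * 1 := by
        gcongr
        rw [div_lt_one (by positivity)]
        linarith
      _ = ε := mul_one _)
  have hmeas : ∀ n, AEStronglyMeasurable (edens a (G n - H)) (volume.restrict Q) := fun n =>
    aestronglyMeasurable_bil_symPart ha ((hG n).sub hH.1) ((hG n).sub hH.1)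
  -- Fatou along the subsequence bounds the energy of `G n - H` by the Cauchy condition
  have hfatou : ∀ ε > 0, ∃ N, ∀ n ≥ N,
      ∫⁻ z in Q, ENNReal.ofReal (edens a (G n - H) z) ≤ ENNReal.ofReal ε := by
    intro ε hε
    obtain ⟨N, hN⟩ := hc ε hε
    refine ⟨N, fun n hn => ?_⟩
    have h1 : ∫⁻ z in Q, ENNReal.ofReal (edens a (G n - H) z) ≤
        ∫⁻ z in Q, liminf (fun i => ENNReal.ofReal (edens a (G n - G (ns i)) z)) atTop := by
      refine lintegral_mono_ae ?_
      filter_upwards [hae] with z hz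
      have h2 : Tendsto (fun i => edens a (G n - G (ns i)) z) atTop (𝓝 (edens a (G n - H) z)) :=
        tendsto_edens (tendsto_const_nhds.sub hz)
      exact (ENNReal.tendsto_ofReal h2).liminf_eq.ge
    refine h1.trans ((lintegral_liminf_le' fun i => ?_).trans ?_)
    · exact (hdiff n (ns i)).1.aemeasurable.ennreal_ofReal
    · refine liminf_le_of_le (by isBoundedDefault) fun b hb => ?_
      obtain ⟨i, hi1, hi2⟩ := (hb.and ((hns.tendsto_atTop).eventually_ge_atTop N)).exists
      refine hi1.trans ?_
      rw [← ofReal_integral_eq_lintegral_ofReal (hdiff n (ns i))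
        (ae_of_all _ fun z => ha.edens_nonneg _ z)]
      exact ENNReal.ofReal_le_ofReal (hN n hn _ hi2).le
  have hint : ∃ n, IntegrableOn (edens a (G n - H)) Q := by
    obtain ⟨N, hN⟩ := hfatou 1 one_pos
    refine ⟨N, hmeas N, ?_⟩
    rw [hasFiniteIntegral_iff_ofReal (ae_of_all _ fun z => ha.edens_nonneg _ z)]
    exact (hN N le_rfl).trans_lt (by simp)
  have heH : IntegrableOn (edens a H) Q := by
    obtain ⟨n, hn⟩ := hint
    have := integrableOn_edens_sub ha (hG n) ((hG n).sub hH.1) (he n) hn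
    simpa using this
  refine ⟨H, hH, heH, ?_⟩
  rw [Metric.tendsto_atTop]
  intro ε hε
  obtain ⟨N, hN⟩ := hfatou (ε / 2) (by positivity)
  refine ⟨N, fun n hn => ?_⟩
  have hi := integrableOn_edens_sub ha (hG n) hH.1 (he n) heH
  have h1 := hN n hn
  rw [← ofReal_integral_eq_lintegral_ofReal hi (ae_of_all _ fun z => ha.edens_nonneg _ z),
    ENNReal.ofReal_le_ofReal_iff (by positivity)] at h1
  rw [Real.dist_eq, sub_zero, abs_of_nonneg (integral_nonneg (ha.edens_nonneg _))]
  linarith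

/-- Convergence in energy implies convergence of the energies. -/
lemma tendsto_energy (ha : IsCoefficientField a)
    {G : ℕ → SpaceTime d → Space d} {H : SpaceTime d → Space d}
    (hG : ∀ n, AEStronglyMeasurable (G n) (volume.restrict Q))
    (hH : AEStronglyMeasurable H (volume.restrict Q))
    (he : ∀ n, IntegrableOn (edens a (G n)) Q) (heH : IntegrableOn (edens a H) Q)
    (hlim : Tendsto (fun n => ∫ z in Q, edens a (G n - H) z) atTop (𝓝 0)) :
    Tendsto (fun n => ∫ z in Q, edens a (G n) z) atTop (𝓝 (∫ z in Q, edens a H z)) := by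
  have hd : ∀ n, IntegrableOn (edens a (G n - H)) Q := fun n =>
    integrableOn_edens_sub ha (hG n) hH (he n) heH
  have hx := fun n => integrable_of_norm_sq_le
    (aestronglyMeasurable_bil_symPart ha hH ((hG n).sub hH)) heH (hd n)
    (ha.edens_nonneg H) (ha.edens_nonneg _) (ae_of_all _ fun z => by
      rw [Real.norm_eq_abs, sq_abs]
      exact bil_symPart_sq_le (ha.pos z) _ _)
  have hcross : Tendsto (fun n => ∫ z in Q, bil (symPart (a z)) (H z) ((G n - H) z)) atTop
      (𝓝 0) := by
    refine squeeze_zero_norm (fun n => (norm_integral_le_integral_norm _).trans (hx n).2) ?_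
    have := (hlim.sqrt).const_mul (√(∫ z in Q, edens a H z))
    simpa using this
  have heq : ∀ n, ∫ z in Q, edens a (G n) z = (∫ z in Q, edens a H z) +
      2 * (∫ z in Q, bil (symPart (a z)) (H z) ((G n - H) z)) +
      ∫ z in Q, edens a (G n - H) z := by
    intro n
    have h1 := integral_add heH ((hx n).1.const_mul 2)
    have h2 := integral_add (heH.add ((hx n).1.const_mul 2)) (hd n)
    rw [integral_const_mul] at h1
    rw [← h1]
    refine Eq.trans ?_ h2
    refine integral_congr_ae (ae_of_all _ fun z => ?_)
    simp only [edens, Pi.add_apply, Pi.sub_apply, bil_sub_left, bil_sub_right, bil_symPart_comm (a z) (H z) (G n z)]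
    ring
  simp only [heq]
  have := (tendsto_const_nhds (x := ∫ z in Q, edens a H z)).add (hcross.const_mul 2) |>.add hlim
  simpa using this

end Completeness

/-! ### Poincaré inequality for test functions -/

section Poincare

variable {d : ℕ} {Q : Set (SpaceTime d)}

lemma IsTestFunction.comp_zero {φ : SpaceTime d → ℝ} (h : IsTestFunction Q φ) {θ : ℝ → ℝ}
    (hθ : ContDiff ℝ ∞ θ) (h0 : θ 0 = 0) : IsTestFunction Q (θ ∘ φ) :=
  ⟨hθ.comp h.1, h.2.1.comp_left h0, (tsupport_comp_subset h0 φ).trans h.2.2⟩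

/-- The absolute value of a test function is compared with a smooth function of it. -/
lemma contDiff_sqrt_sq_add {η : ℝ} (hη : 0 < η) : ContDiff ℝ ∞ fun s : ℝ => √(s ^ 2 + η ^ 2) - η :=
  (ContDiff.sqrt (by fun_prop) fun s => by positivity).sub contDiff_const

lemma hasDerivAt_sqrt_sq_add {η : ℝ} (hη : 0 < η) (s : ℝ) :
    HasDerivAt (fun s : ℝ => √(s ^ 2 + η ^ 2) - η) (s / √(s ^ 2 + η ^ 2)) s := by
  have h1 : HasDerivAt (fun s : ℝ => s ^ 2 + η ^ 2) (2 * s) s := by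
    simpa using (hasDerivAt_pow 2 s).add_const (η ^ 2)
  have h2 := (h1.sqrt (by positivity)).sub_const η
  rwa [mul_div_mul_left _ _ two_ne_zero] at h2

/-- Poincaré's inequality in `L¹`: integrate `∂_i x_i = 1` by parts against `|φ|`. -/
lemma IsTestFunction.integral_abs_le {φ : SpaceTime d → ℝ} (h : IsTestFunction Q φ)
    (hQ : Bornology.IsBounded Q) (i : Fin d) {R : ℝ} (hR : ∀ z ∈ Q, ‖z.2‖ ≤ R) (hR0 : 0 ≤ R) :
    ∫ z in Q, |φ z| ≤ R * ∫ z in Q, ‖spaceGrad φ z‖ := by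
  have hfin : volume Q ≠ ⊤ := hQ.measure_lt_top.ne
  have hgi : Integrable (spaceGrad φ) :=
    h.continuous_spaceGrad.integrable_of_hasCompactSupport h.hasCompactSupport_spaceGrad
  have hφi : Integrable φ := h.1.continuous.integrable_of_hasCompactSupport h.2.1
  -- `|φ|` is replaced by the smooth function `√(φ² + η²) - η`, which vanishes where `φ` does
  have key : ∀ η : ℝ, 0 < η → ∫ z in Q, |φ z| ≤
      (R * ∫ z in Q, ‖spaceGrad φ z‖) + η * volume.real Q := by
    intro η hη
    set θ : ℝ → ℝ := fun s => √(s ^ 2 + η ^ 2) - η with hθ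
    have hχ : IsTestFunction Q (θ ∘ φ) := h.comp_zero (contDiff_sqrt_sq_add hη) (by
      simp [hθ, Real.sqrt_sq hη.le])
    have hχi : Integrable (θ ∘ φ) := hχ.1.continuous.integrable_of_hasCompactSupport hχ.2.1
    set v : SpaceTime d := (0, basisVec i) with hv
    have hχ' : ∀ z, fderiv ℝ (θ ∘ φ) z v = φ z / √(φ z ^ 2 + η ^ 2) * fderiv ℝ φ z v := by
      intro z
      have := (hasDerivAt_sqrt_sq_add hη (φ z)).comp_hasFDerivAt z (h.differentiable z).hasFDerivAt
      rw [this.fderiv]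
      simp
    let ℓ : SpaceTime d →L[ℝ] ℝ :=
      (EuclideanSpace.proj (𝕜 := ℝ) i).comp (ContinuousLinearMap.snd ℝ ℝ (Space d))
    have hℓ : ∀ z, fderiv ℝ ℓ z v = 1 := fun z => by
      simp [ℓ, hv, basisVec]
    have hc : HasCompactSupport fun z => fderiv ℝ (θ ∘ φ) z v := by
      refine HasCompactSupport.intro hχ.2.1 fun z hz => ?_
      by_contra h0
      exact hz (support_fderiv_subset ℝ fun h1 => h0 (by simp [h1]))
    have hX : Integrable fun z => fderiv ℝ (θ ∘ φ) z v * ℓ z :=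
      ((hχ.continuous_fderiv.clm_apply continuous_const).mul
        ℓ.continuous).integrable_of_hasCompactSupport (hc.mul_right (f' := ℓ))
    have hparts := integral_mul_fderiv_eq_neg_fderiv_mul_of_integrable
      (μ := (volume : Measure (SpaceTime d))) (f := θ ∘ φ) (g := ℓ) (v := v)
      hX
      (by simpa only [hℓ, mul_one] using hχi)
      ((hχ.1.continuous.mul ℓ.continuous).integrable_of_hasCompactSupport
        (hχ.2.1.mul_right (f' := ℓ)))
      (fun z _ => hχ.differentiable z) (fun z _ => ℓ.differentiableAt)
    simp only [hℓ, mul_one, hχ'] at hparts hX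
    have hle : ∫ z, (θ ∘ φ) z ≤ R * ∫ z in Q, ‖spaceGrad φ z‖ := by
      rw [hparts, ← integral_const_mul,
        h.setIntegral_eq fun z hz => by simp [h.spaceGrad_eq_zero hz], ← integral_neg]
      refine integral_mono hX.neg (hgi.norm.const_mul R) fun z => ?_
      by_cases hz : z ∈ tsupport φ
      · have e1 : |fderiv ℝ φ z v| ≤ ‖spaceGrad φ z‖ := by
          rw [hv, ← inner_spaceGrad (h.differentiable z)]
          refine (abs_real_inner_le_norm _ _).trans ?_
          simp [basisVec]
        have e2 : |ℓ z| ≤ R := (PiLp.norm_apply_le z.2 i).trans (hR z (h.2.2 hz))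
        have e3 : |φ z / √(φ z ^ 2 + η ^ 2)| ≤ 1 := by
          rw [abs_div, abs_of_pos (by positivity : 0 < √(φ z ^ 2 + η ^ 2)),
            div_le_one (by positivity)]
          exact Real.abs_le_sqrt (by nlinarith [sq_nonneg η])
        refine (neg_le_abs _).trans ?_
        rw [abs_mul, abs_mul]
        calc |φ z / √(φ z ^ 2 + η ^ 2)| * |fderiv ℝ φ z v| * |ℓ z|
            ≤ 1 * ‖spaceGrad φ z‖ * R := by gcongr
          _ = R * ‖spaceGrad φ z‖ := by ring
      · have : φ z = 0 := image_eq_zero_of_notMem_tsupport hz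
        simp only [this, zero_div, zero_mul, neg_zero]
        positivity
    have hθφ : ∀ z, |φ z| ≤ θ (φ z) + η := fun z => by
      simp only [hθ, sub_add_cancel]
      exact Real.abs_le_sqrt (by nlinarith [sq_nonneg η])
    calc ∫ z in Q, |φ z| ≤ ∫ z in Q, ((θ ∘ φ) z + η) :=
          integral_mono hφi.integrableOn.abs (hχi.integrableOn.add (integrableOn_const hfin)) hθφ
      _ = (∫ z, (θ ∘ φ) z) + η * volume.real Q := by
          rw [integral_add hχi.integrableOn (integrableOn_const hfin), setIntegral_const,
            hχ.setIntegral_eq fun z hz => image_eq_zero_of_notMem_tsupport hz, smul_eq_mul,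
            mul_comm η]
      _ ≤ _ := by gcongr
  refine le_of_forall_pos_le_add fun ε hε => ?_
  have hV : 0 ≤ volume.real Q := measureReal_nonneg
  refine (key (ε / (volume.real Q + 1)) (by positivity)).trans ?_
  gcongr
  calc ε / (volume.real Q + 1) * volume.real Q = ε * (volume.real Q / (volume.real Q + 1)) := by
        ring
    _ ≤ ε * 1 := by
        gcongr
        rw [div_le_one (by positivity)]
        linarith
    _ = ε := mul_one ε

end Poincare

/-! ### Trial functions -/

section Correctors

variable {d : ℕ}

/-- The space of test functions in `Q`. -/
def testSpace (Q : Set (SpaceTime d)) : Submodule ℝ (SpaceTime d → ℝ) where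
  carrier := {φ | IsTestFunction Q φ}
  zero_mem' := IsTestFunction.zero
  add_mem' h h' := h.add h'
  smul_mem' c _ h := h.smul c

/-- Test functions in `Q`, plus the linear functions `p · x` with `p ∈ V`. -/
abbrev TrialSpace (Q : Set (SpaceTime d)) (V : Submodule ℝ (Space d)) : Type := testSpace Q × V

variable {Q : Set (SpaceTime d)} {V : Submodule ℝ (Space d)}

namespace TrialSpace

/-- The value of a trial function. -/
def val (w : TrialSpace Q V) (z : SpaceTime d) : ℝ := w.1.1 z + inner ℝ (w.2 : Space d) z.2

/-- The spatial gradient of a trial function. -/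
def grad (w : TrialSpace Q V) (z : SpaceTime d) : Space d := spaceGrad w.1.1 z + w.2

/-- The time derivative of a trial function. -/
def dt (w : TrialSpace Q V) : SpaceTime d → ℝ := timeDeriv w.1.1

lemma isTestFunction (w : TrialSpace Q V) : IsTestFunction Q w.1.1 := w.1.2

lemma val_add (w w' : TrialSpace Q V) : val (w + w') = val w + val w' := by
  ext1 z
  simp [val, inner_add_left]
  ring

lemma val_smul (c : ℝ) (w : TrialSpace Q V) : val (c • w) = c • val w := by
  ext1 z
  simp [val, inner_smul_left]
  ring

lemma val_sub (w w' : TrialSpace Q V) : val (w - w') = val w - val w' := by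
  ext1 z
  simp [val, inner_sub_left]
  ring

lemma grad_add (w w' : TrialSpace Q V) : grad (w + w') = grad w + grad w' := by
  ext1 z
  have := congrFun (w.isTestFunction.spaceGrad_add w'.isTestFunction) z
  simp only [Pi.add_apply] at this
  simp only [grad, Prod.fst_add, Submodule.coe_add, this, Prod.snd_add, Pi.add_apply]
  abel

lemma grad_smul (c : ℝ) (w : TrialSpace Q V) : grad (c • w) = c • grad w := by
  ext1 z
  have := congrFun (w.isTestFunction.spaceGrad_smul c) z
  simp only [Pi.smul_apply] at this
  simp only [grad, Prod.smul_fst, Submodule.coe_smul, this, Prod.smul_snd, Pi.smul_apply, smul_add]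

lemma grad_sub (w w' : TrialSpace Q V) : grad (w - w') = grad w - grad w' := by
  rw [eq_sub_iff_add_eq, ← grad_add, sub_add_cancel]

lemma dt_add (w w' : TrialSpace Q V) : dt (w + w') = dt w + dt w' :=
  w.isTestFunction.timeDeriv_add w'.isTestFunction

lemma dt_smul (c : ℝ) (w : TrialSpace Q V) : dt (c • w) = c • dt w :=
  w.isTestFunction.timeDeriv_smul c

lemma continuous_grad (w : TrialSpace Q V) : Continuous (grad w) :=
  w.isTestFunction.continuous_spaceGrad.add continuous_const

lemma continuous_val (w : TrialSpace Q V) : Continuous (val w) :=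
  w.isTestFunction.1.continuous.add (continuous_const.inner continuous_snd)

lemma continuous_dt (w : TrialSpace Q V) : Continuous (dt w) :=
  w.isTestFunction.continuous_timeDeriv

lemma exists_norm_grad_le (w : TrialSpace Q V) : ∃ C, 0 ≤ C ∧ ∀ z, ‖grad w z‖ ≤ C := by
  obtain ⟨C, hC⟩ := w.isTestFunction.continuous_spaceGrad.bounded_above_of_compact_support
    w.isTestFunction.hasCompactSupport_spaceGrad
  refine ⟨C + ‖(w.2 : Space d)‖, ?_, fun z => (norm_add_le _ _).trans (by gcongr; exact hC z)⟩
  have := (norm_nonneg _).trans (hC 0)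
  positivity

lemma exists_abs_dt_le (w : TrialSpace Q V) : ∃ C, 0 ≤ C ∧ ∀ z, |dt w z| ≤ C := by
  obtain ⟨C, hC⟩ := w.isTestFunction.continuous_timeDeriv.bounded_above_of_compact_support
    w.isTestFunction.hasCompactSupport_timeDeriv
  exact ⟨C, (norm_nonneg _).trans (hC 0), hC⟩

lemma integrableOn_val (hQ : Bornology.IsBounded Q) (w : TrialSpace Q V) :
    IntegrableOn (val w) Q :=
  ((continuous_val w).continuousOn.integrableOn_compact hQ.isCompact_closure).mono_set
    subset_closure

lemma integrableOn_grad (hQ : Bornology.IsBounded Q) (w : TrialSpace Q V) :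
    IntegrableOn (grad w) Q :=
  ((continuous_grad w).continuousOn.integrableOn_compact hQ.isCompact_closure).mono_set
    subset_closure

/-- The integral of the time derivative against the trial function itself vanishes, since
`(φ + p · x) ∂_t φ = ∂_t (φ (φ / 2 + p · x))`. -/
lemma integral_val_mul_dt (w : TrialSpace Q V) : ∫ z in Q, val w z * dt w z = 0 := by
  have hφ := w.isTestFunction
  set φ := w.1.1 with hφdef
  set g : SpaceTime d → ℝ := fun z => (1 / 2) * φ z + inner ℝ (w.2 : Space d) z.2 with hg
  have hgs : ContDiff ℝ ∞ g := (contDiff_const.mul hφ.1).add (contDiff_const.inner ℝ contDiff_snd)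
  have hχ : IsTestFunction Q (φ * g) :=
    ⟨hφ.1.mul hgs, hφ.2.1.mul_right, (tsupport_mul_subset_left).trans hφ.2.2⟩
  have h1 : ∀ z, val w z * dt w z = fderiv ℝ (φ * g) z (1, 0) := by
    intro z
    have hd : HasFDerivAt g ((1 / 2 : ℝ) • fderiv ℝ φ z +
        (innerSL ℝ (w.2 : Space d)).comp (ContinuousLinearMap.snd ℝ ℝ (Space d))) z :=
      ((hφ.differentiable z).hasFDerivAt.const_mul (1 / 2)).add
        (((innerSL ℝ (w.2 : Space d)).comp
          (ContinuousLinearMap.snd ℝ ℝ (Space d))).hasFDerivAt (x := z))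
    rw [((hφ.differentiable z).hasFDerivAt.mul hd).fderiv, dt, timeDeriv_eq (hφ.differentiable z)]
    simp [val, hg, ← hφdef]
    ring
  simp only [h1]
  rw [hχ.setIntegral_eq fun z hz => ?_, hχ.integral_fderiv]
  have : fderiv ℝ (φ * g) z = 0 := by
    by_contra h0
    exact hz (support_fderiv_subset ℝ h0)
  simp [this]

lemma integral_grad (hQ : Bornology.IsBounded Q) (w : TrialSpace Q V) :
    ∫ z in Q, grad w z = volume.real Q • (w.2 : Space d) := by
  have h1 : IntegrableOn (spaceGrad w.1.1) Q :=
    (w.isTestFunction.continuous_spaceGrad.integrable_of_hasCompactSupport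
      w.isTestFunction.hasCompactSupport_spaceGrad).integrableOn
  simp only [grad]
  rw [integral_add h1 (integrableOn_const hQ.measure_lt_top.ne),
    w.isTestFunction.integral_spaceGrad, zero_add, setIntegral_const]

/-- Poincaré's inequality for trial functions. -/
lemma exists_poincare (hd : 0 < d) (hQ : Bornology.IsBounded Q) (hQm : MeasurableSet Q) :
    ∃ C, 0 ≤ C ∧ ∀ w : TrialSpace Q V, ∫ z in Q, |val w z| ≤ C * ∫ z in Q, ‖grad w z‖ := by
  obtain ⟨R, hR0, hR⟩ := hQ.exists_pos_norm_le
  have hR' : ∀ z ∈ Q, ‖z.2‖ ≤ R := fun z hz => (norm_snd_le z).trans (hR z hz)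
  have hfin : volume Q ≠ ⊤ := hQ.measure_lt_top.ne
  refine ⟨3 * R, by positivity, fun w => ?_⟩
  have hgi := integrableOn_grad hQ w
  have hp : volume.real Q * ‖(w.2 : Space d)‖ ≤ ∫ z in Q, ‖grad w z‖ := by
    have := norm_integral_le_integral_norm (μ := volume.restrict Q) (grad w)
    rwa [integral_grad hQ, norm_smul, Real.norm_of_nonneg measureReal_nonneg] at this
  have hφi : IntegrableOn w.1.1 Q :=
    (w.isTestFunction.1.continuous.integrable_of_hasCompactSupport w.isTestFunction.2.1).integrableOn
  have hsi : IntegrableOn (spaceGrad w.1.1) Q :=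
    (w.isTestFunction.continuous_spaceGrad.integrable_of_hasCompactSupport
      w.isTestFunction.hasCompactSupport_spaceGrad).integrableOn
  have h1 := w.isTestFunction.integral_abs_le hQ ⟨0, hd⟩ hR' hR0.le
  have h2 : ∫ z in Q, ‖spaceGrad w.1.1 z‖ ≤
      (∫ z in Q, ‖grad w z‖) + ‖(w.2 : Space d)‖ * volume.real Q := by
    calc ∫ z in Q, ‖spaceGrad w.1.1 z‖ ≤ ∫ z in Q, (‖grad w z‖ + ‖(w.2 : Space d)‖) := by
          refine integral_mono hsi.norm (hgi.norm.add (integrableOn_const hfin)) fun z => ?_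
          have := norm_sub_le (grad w z) (w.2 : Space d)
          simpa [grad] using this
      _ = _ := by
          rw [integral_add hgi.norm (integrableOn_const hfin), setIntegral_const, smul_eq_mul,
            mul_comm]
  have h3 : ∫ z in Q, |val w z| ≤ (∫ z in Q, |w.1.1 z|) + R * ‖(w.2 : Space d)‖ * volume.real Q := by
    calc ∫ z in Q, |val w z| ≤ ∫ z in Q, (|w.1.1 z| + R * ‖(w.2 : Space d)‖) := by
          refine setIntegral_mono_on (integrableOn_val hQ w).abs
            (hφi.abs.add (integrableOn_const hfin)) hQm fun z hz => ?_
          refine (abs_add_le _ _).trans (add_le_add le_rfl ?_)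
          refine (abs_real_inner_le_norm _ _).trans ?_
          rw [mul_comm]
          exact mul_le_mul_of_nonneg_right (hR' z hz) (norm_nonneg _)
      _ = _ := by
          rw [integral_add hφi.abs (integrableOn_const hfin), setIntegral_const, smul_eq_mul,
            mul_comm (volume.real Q)]
  nlinarith

end TrialSpace

end Correctors

/-! ### Existence of correctors -/

section CorrectorExistence

variable {d : ℕ} {a : SpaceTime d → Matrix (Fin d) (Fin d) ℝ} {Q : Set (SpaceTime d)}
  {V : Submodule ℝ (Space d)}

open TrialSpace

lemma integrableOn_edens_of_bounded (ha : IsCoefficientField a) (hQ : Bornology.IsBounded Q)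
    {F : SpaceTime d → Space d} (hF : AEStronglyMeasurable F (volume.restrict Q)) {C : ℝ}
    (hC : ∀ z, ‖F z‖ ≤ C) : IntegrableOn (edens a F) Q := by
  obtain ⟨ν, μ, M, hw⟩ := ha.exists_weights hQ
  refine (hw.integrable.mul_const (C ^ 2)).mono' (aestronglyMeasurable_bil_symPart ha hF hF)
    (ae_of_all _ fun z => ?_)
  rw [Real.norm_of_nonneg (ha.edens_nonneg F z)]
  refine (hw.le_norm_sq z (F z)).trans ?_
  have := hw.nonneg z
  gcongr
  exact hC z

lemma TrialSpace.integrableOn_edens (ha : IsCoefficientField a) (hQ : Bornology.IsBounded Q)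
    (w : TrialSpace Q V) : IntegrableOn (edens a (grad w)) Q := by
  obtain ⟨C, -, hC⟩ := exists_norm_grad_le w
  exact integrableOn_edens_of_bounded ha hQ (continuous_grad w).aestronglyMeasurable hC

lemma integrableOn_bil_grad (ha : IsCoefficientField a) (hQ : Bornology.IsBounded Q)
    {G : SpaceTime d → Space d} (hG : AEStronglyMeasurable G (volume.restrict Q))
    (he : IntegrableOn (edens a G) Q) (w : TrialSpace Q V) :
    IntegrableOn (fun z => bil (a z) (grad w z) (G z)) Q := by
  obtain ⟨ν, μ, M, hw⟩ := ha.exists_weights hQ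
  obtain ⟨C, -, hC⟩ := exists_norm_grad_le w
  refine ((hw.integrable_flux ha hG he).1.norm.const_mul C).mono'
    (aestronglyMeasurable_bil ha (continuous_grad w).aestronglyMeasurable hG)
    (ae_of_all _ fun z => ?_)
  rw [← inner_flux]
  exact (norm_inner_le_norm _ _).trans (by gcongr; exact hC z)

lemma integrableOn_mul_dt {h : SpaceTime d → ℝ} (hh : IntegrableOn h Q) (w : TrialSpace Q V) :
    IntegrableOn (fun z => h z * dt w z) Q := by
  obtain ⟨C, -, hC⟩ := exists_abs_dt_le w
  refine (hh.norm.mul_const C).mono' (hh.1.mul (continuous_dt w).aestronglyMeasurable)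
    (ae_of_all _ fun z => ?_)
  rw [norm_mul]
  gcongr
  exact hC z

lemma integrableOn_inner_grad {f : SpaceTime d → Space d} (hf : IntegrableOn f Q)
    (w : TrialSpace Q V) : IntegrableOn (fun z => (inner ℝ (f z) (grad w z) : ℝ)) Q := by
  obtain ⟨C, -, hC⟩ := exists_norm_grad_le w
  refine (hf.norm.mul_const C).mono' (hf.1.inner (continuous_grad w).aestronglyMeasurable)
    (ae_of_all _ fun z => ?_)
  exact (norm_inner_le_norm _ _).trans (by gcongr; exact hC z)

/-- The energy form on trial functions. -/
def trialEnergy (ha : IsCoefficientField a) (hQ : Bornology.IsBounded Q)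
    (V : Submodule ℝ (Space d)) : TrialSpace Q V →ₗ[ℝ] TrialSpace Q V →ₗ[ℝ] ℝ :=
  have hi : ∀ w w' : TrialSpace Q V,
      Integrable (fun z => bil (symPart (a z)) (grad w z) (grad w' z)) (volume.restrict Q) :=
    fun w w' => integrableOn_bil_symPart ha (continuous_grad w).aestronglyMeasurable
      (continuous_grad w').aestronglyMeasurable (w.integrableOn_edens ha hQ)
      (w'.integrableOn_edens ha hQ)
  LinearMap.mk₂ ℝ (fun w w' => ∫ z in Q, bil (symPart (a z)) (grad w z) (grad w' z))
    (fun w w' v => by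
      rw [← integral_add (hi w v) (hi w' v)]
      simp only [grad_add, Pi.add_apply, bil_add_left])
    (fun c w v => by
      simp only [grad_smul, Pi.smul_apply, bil_smul_left, integral_const_mul, smul_eq_mul])
    (fun v w w' => by
      rw [← integral_add (hi v w) (hi v w')]
      simp only [grad_add, Pi.add_apply, bil_add_right])
    (fun c v w => by
      simp only [grad_smul, Pi.smul_apply, bil_smul_right, integral_const_mul, smul_eq_mul])

lemma trialEnergy_self (ha : IsCoefficientField a) (hQ : Bornology.IsBounded Q)
    (w : TrialSpace Q V) : trialEnergy ha hQ V w w = ∫ z in Q, edens a (grad w) z := rfl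

/-- The weak form `-∫ u ∂_t w + ∫ ∇w · a∇u` of the parabolic operator. -/
def parabolicForm (ha : IsCoefficientField a) (hQ : Bornology.IsBounded Q)
    (V : Submodule ℝ (Space d)) : TrialSpace Q V →ₗ[ℝ] TrialSpace Q V →ₗ[ℝ] ℝ :=
  have h1 : ∀ w w' : TrialSpace Q V,
      Integrable (fun z => bil (a z) (grad w' z) (grad w z)) (volume.restrict Q) :=
    fun w w' => integrableOn_bil_grad ha hQ (continuous_grad w).aestronglyMeasurable
      (w.integrableOn_edens ha hQ) w'
  have h2 : ∀ w w' : TrialSpace Q V,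
      Integrable (fun z => val w z * dt w' z) (volume.restrict Q) :=
    fun w w' => integrableOn_mul_dt (integrableOn_val hQ w) w'
  LinearMap.mk₂ ℝ (fun w w' => -(∫ z in Q, val w z * dt w' z) +
      ∫ z in Q, bil (a z) (grad w' z) (grad w z))
    (fun w w' v => by
      simp only [val_add, grad_add, Pi.add_apply, bil_add_right, add_mul]
      rw [integral_add (h1 w v) (h1 w' v), integral_add (h2 w v) (h2 w' v)]
      ring)
    (fun c w v => by
      simp only [val_smul, grad_smul, Pi.smul_apply, bil_smul_right, integral_const_mul,
        smul_eq_mul, mul_assoc]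
      ring)
    (fun v w w' => by
      simp only [dt_add, grad_add, Pi.add_apply, bil_add_left, mul_add]
      rw [integral_add (h1 v w) (h1 v w'), integral_add (h2 v w) (h2 v w')]
      ring)
    (fun c v w => by
      simp only [dt_smul, grad_smul, Pi.smul_apply, bil_smul_left, integral_const_mul,
        smul_eq_mul, mul_left_comm _ c]
      ring)

/-- The functional `w ↦ -∫ f · ∇w`. -/
def rhsForm {f : SpaceTime d → Space d} (hf : IntegrableOn f Q) (V : Submodule ℝ (Space d)) :
    TrialSpace Q V →ₗ[ℝ] ℝ where
  toFun w := -∫ z in Q, (inner ℝ (f z) (grad w z) : ℝ)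
  map_add' w w' := by
    simp only [grad_add, Pi.add_apply, inner_add_right]
    rw [integral_add (integrableOn_inner_grad hf w) (integrableOn_inner_grad hf w')]
    ring
  map_smul' c w := by
    simp only [grad_smul, Pi.smul_apply, inner_smul_right, integral_const_mul, smul_eq_mul,
      RingHom.id_apply]
    ring

/-- Solutions, in a closure of trial functions, of the weak equation with right-hand side `∇ · f`.
For `V = ⊥` this is a zero-Dirichlet problem on the lateral boundary; allowing the linear functions
`p · x` as trial and test functions makes the mean flux prescribed instead. -/
structure IsCorrector (a : SpaceTime d → Matrix (Fin d) (Fin d) ℝ) (f : SpaceTime d → Space d)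
    (Q : Set (SpaceTime d)) (V : Submodule ℝ (Space d)) (h : SpaceTime d → ℝ)
    (G : SpaceTime d → Space d) : Prop where
  integrableOn : IntegrableOn h Q
  integrableOn_grad : IntegrableOn G Q
  energy : IntegrableOn (edens a G) Q
  approx : ∃ φ : ℕ → TrialSpace Q V,
    Tendsto (fun n => ∫ z in Q, ‖val (φ n) z - h z‖) atTop (𝓝 0) ∧
    Tendsto (fun n => ∫ z in Q, edens a (grad (φ n) - G) z) atTop (𝓝 0)
  equation : ∀ w : TrialSpace Q V,
    -(∫ z in Q, h z * dt w z) + ∫ z in Q, bil (a z) (grad w z) (G z) =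
      -∫ z in Q, (inner ℝ (f z) (grad w z) : ℝ)

/-- A right-hand side `f` which defines a bounded functional on the energy space, since
`(f · v)² ≤ ρ v · s v` with `ρ` integrable. -/
def HasDualWeight (a : SpaceTime d → Matrix (Fin d) (Fin d) ℝ) (Q : Set (SpaceTime d))
    (f : SpaceTime d → Space d) : Prop :=
  ∃ ρ : SpaceTime d → ℝ, IntegrableOn ρ Q ∧ (∀ z, 0 ≤ ρ z) ∧ ∀ᵐ z ∂(volume.restrict Q),
    ∀ v : Space d, (inner ℝ (f z) v : ℝ) ^ 2 ≤ ρ z * bil (symPart (a z)) v v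

/-- A right-hand side with a dual weight pairs with fields of finite energy, by Cauchy-Schwarz. -/
lemma HasDualWeight.integral_inner_le (ha : IsCoefficientField a) {f : SpaceTime d → Space d}
    (hf : IntegrableOn f Q) (h : HasDualWeight a Q f) : ∃ K, 0 ≤ K ∧ ∀ G : SpaceTime d → Space d,
      AEStronglyMeasurable G (volume.restrict Q) → IntegrableOn (edens a G) Q →
      IntegrableOn (fun z => (inner ℝ (f z) (G z) : ℝ)) Q ∧
        |∫ z in Q, (inner ℝ (f z) (G z) : ℝ)| ≤ K * √(∫ z in Q, edens a G z) := by
  obtain ⟨ρ, hρ, hρ0, hle⟩ := h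
  refine ⟨√(∫ z in Q, ρ z), Real.sqrt_nonneg _, fun G hG he => ?_⟩
  have := integrable_of_norm_sq_le (hf.1.inner hG) hρ he hρ0 (ha.edens_nonneg G) (by
    filter_upwards [hle] with z hz
    rw [Real.norm_eq_abs, sq_abs]
    exact hz _)
  exact ⟨this.1, (norm_integral_le_integral_norm _).trans this.2⟩

lemma HasDualWeight.of_bounded (ha : IsCoefficientField a) (hQ : Bornology.IsBounded Q)
    {f : SpaceTime d → Space d} {C : ℝ} (hC : ∀ z, ‖f z‖ ≤ C) : HasDualWeight a Q f := by
  obtain ⟨ν, μ, M, hw⟩ := ha.exists_weights hQ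
  refine ⟨fun z => C ^ 2 * ν z, hw.integrable_inv.const_mul _,
    fun z => mul_nonneg (sq_nonneg _) (hw.nonneg_inv z), ae_of_all _ fun z v => ?_⟩
  calc (inner ℝ (f z) v : ℝ) ^ 2 ≤ (‖f z‖ * ‖v‖) ^ 2 := by
        rw [← sq_abs]
        gcongr
        exact abs_real_inner_le_norm _ _
    _ = ‖f z‖ ^ 2 * ‖v‖ ^ 2 := by ring
    _ ≤ C ^ 2 * (ν z * bil (symPart (a z)) v v) := by
        gcongr
        · exact hC z
        · exact hw.norm_sq_le z v
    _ = _ := by ring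

lemma HasDualWeight.flux_const (ha : IsCoefficientField a) (hQ : Bornology.IsBounded Q)
    (p : Space d) : HasDualWeight a Q (flux a fun _ => p) := by
  obtain ⟨ν, μ, M, hw⟩ := ha.exists_weights hQ
  refine ⟨fun z => (M ^ 2 * ‖p‖ ^ 2) * μ z, hw.integrable.const_mul _,
    fun z => mul_nonneg (by positivity) (hw.nonneg z), ?_⟩
  filter_upwards [hw.abs_bil_le] with z hz v
  rw [real_inner_comm, inner_flux]
  have hv := bil_symPart_self_nonneg (ha.pos z) v
  have hp := bil_symPart_self_nonneg (ha.pos z) p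
  calc bil (a z) v p ^ 2 ≤
        (M * (√(bil (symPart (a z)) v v) * √(bil (symPart (a z)) p p))) ^ 2 := by
        rw [← sq_abs]
        gcongr
        exact hz v p
    _ = M ^ 2 * (bil (symPart (a z)) v v * bil (symPart (a z)) p p) := by
        rw [mul_pow, mul_pow, Real.sq_sqrt hv, Real.sq_sqrt hp]
    _ ≤ M ^ 2 * (bil (symPart (a z)) v v * (μ z * ‖p‖ ^ 2)) := by
        gcongr
        exact hw.le_norm_sq z p
    _ = _ := by ring

section Forms

variable (ha : IsCoefficientField a) (hQ : Bornology.IsBounded Q)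

include ha hQ in
/-- Convergence of values in `L¹` and of gradients in energy passes to the weak form. -/
lemma tendsto_weakForm {h : ℕ → SpaceTime d → ℝ} {h' : SpaceTime d → ℝ}
    {G : ℕ → SpaceTime d → Space d} {G' : SpaceTime d → Space d}
    (hh : ∀ n, IntegrableOn (h n) Q) (hh' : IntegrableOn h' Q)
    (hG : ∀ n, AEStronglyMeasurable (G n) (volume.restrict Q))
    (hG' : AEStronglyMeasurable G' (volume.restrict Q))
    (he : ∀ n, IntegrableOn (edens a (G n)) Q) (he' : IntegrableOn (edens a G') Q)
    (hlim : Tendsto (fun n => ∫ z in Q, ‖h n z - h' z‖) atTop (𝓝 0))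
    (hlimG : Tendsto (fun n => ∫ z in Q, edens a (G n - G') z) atTop (𝓝 0))
    (w : TrialSpace Q V) :
    Tendsto (fun n => -(∫ z in Q, h n z * dt w z) + ∫ z in Q, bil (a z) (grad w z) (G n z)) atTop
      (𝓝 (-(∫ z in Q, h' z * dt w z) + ∫ z in Q, bil (a z) (grad w z) (G' z))) := by
  obtain ⟨ν, μ, M, hw⟩ := ha.exists_weights hQ
  obtain ⟨C, hC0, hC⟩ := exists_abs_dt_le w
  obtain ⟨C', hC0', hC'⟩ := exists_norm_grad_le w
  have t1 : Tendsto (fun n => ∫ z in Q, h n z * dt w z) atTop (𝓝 (∫ z in Q, h' z * dt w z)) := by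
    rw [tendsto_iff_norm_sub_tendsto_zero]
    refine squeeze_zero (fun _ => norm_nonneg _) (fun n => ?_) (by simpa using hlim.const_mul C)
    rw [← integral_sub (integrableOn_mul_dt (hh n) w) (integrableOn_mul_dt hh' w),
      ← integral_const_mul]
    refine norm_integral_le_of_norm_le (((hh n).sub hh').norm.const_mul C) (ae_of_all _ fun z => ?_)
    rw [← sub_mul, norm_mul, mul_comm]
    gcongr
    · exact hC z
    · rfl
  have t2 : Tendsto (fun n => ∫ z in Q, bil (a z) (grad w z) (G n z)) atTop
      (𝓝 (∫ z in Q, bil (a z) (grad w z) (G' z))) := by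
    rw [tendsto_iff_norm_sub_tendsto_zero]
    refine squeeze_zero (fun _ => norm_nonneg _) (fun n => ?_)
      (g := fun n => C' * (M * √(∫ z in Q, μ z) * √(∫ z in Q, edens a (G n - G') z)))
      (by simpa using (hlimG.sqrt.const_mul (M * √(∫ z in Q, μ z))).const_mul C')
    have hd := hw.integrable_flux ha ((hG n).sub hG')
      (integrableOn_edens_sub ha (hG n) hG' (he n) he')
    rw [← integral_sub (integrableOn_bil_grad ha hQ (hG n) (he n) w)
      (integrableOn_bil_grad ha hQ hG' he' w)]
    refine (norm_integral_le_of_norm_le (hd.1.norm.const_mul C') (ae_of_all _ fun z => ?_)).trans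
      (by rw [integral_const_mul]; gcongr; exact hd.2)
    rw [← bil_sub_right]
    have : bil (a z) (grad w z) (G n z - G' z) = inner ℝ (grad w z) (flux a (G n - G') z) := rfl
    rw [this]
    exact (norm_inner_le_norm _ _).trans (by gcongr; exact hC' z)
  exact t1.neg.add t2

/-- The time derivative drops out on the diagonal, as `w ∂_t w` is a total derivative. -/
lemma parabolicForm_self (w : TrialSpace Q V) :
    parabolicForm ha hQ V w w = trialEnergy ha hQ V w w := by
  rw [trialEnergy_self]
  change -(∫ z in Q, val w z * dt w z) + ∫ z in Q, bil (a z) (grad w z) (grad w z) = _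
  rw [integral_val_mul_dt, neg_zero, zero_add]
  simp only [edens, bil_symPart_self]

/-- The time derivative falls on the fixed test function, so by the Poincaré inequality the form is
continuous for the energy norm in its first variable. -/
lemma parabolicForm_bounded (hd : 0 < d) (hQm : MeasurableSet Q) (w' : TrialSpace Q V) :
    ∃ C, ∀ w, |parabolicForm ha hQ V w w'| ≤ C * √(trialEnergy ha hQ V w w) := by
  obtain ⟨ν, μ, M, hw⟩ := ha.exists_weights hQ
  obtain ⟨C, hC0, hC⟩ := exists_abs_dt_le w'
  obtain ⟨C', hC0', hC'⟩ := exists_norm_grad_le w'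
  obtain ⟨P, hP0, hP⟩ := exists_poincare (V := V) hd hQ hQm
  refine ⟨C * (P * √(∫ z in Q, ν z)) + C' * (M * √(∫ z in Q, μ z)), fun w => ?_⟩
  rw [trialEnergy_self]
  have he := w.integrableOn_edens ha hQ
  have hm := (continuous_grad w).aestronglyMeasurable (μ := volume.restrict Q)
  have h1 := hw.integrable_of_energy ha hm he
  have h2 := hw.integrable_flux ha hm he
  change |-(∫ z in Q, val w z * dt w' z) + ∫ z in Q, bil (a z) (grad w' z) (grad w z)| ≤ _
  refine (abs_add_le _ _).trans ?_
  rw [abs_neg, add_mul]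
  refine add_le_add ?_ ?_
  · calc |∫ z in Q, val w z * dt w' z| ≤ ∫ z in Q, C * |val w z| := by
          rw [← Real.norm_eq_abs]
          refine norm_integral_le_of_norm_le ((integrableOn_val hQ w).abs.const_mul C)
            (ae_of_all _ fun z => ?_)
          rw [norm_mul, mul_comm]
          gcongr
          · exact hC z
          · rfl
      _ ≤ C * (P * (√(∫ z in Q, ν z) * √(∫ z in Q, edens a (grad w) z))) := by
          rw [integral_const_mul]
          gcongr
          exact (hP w).trans (by gcongr; exact h1.2)
      _ = _ := by ring
  · calc |∫ z in Q, bil (a z) (grad w' z) (grad w z)| ≤ ∫ z in Q, C' * ‖flux a (grad w) z‖ := by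
          rw [← Real.norm_eq_abs]
          refine norm_integral_le_of_norm_le (h2.1.norm.const_mul C') (ae_of_all _ fun z => ?_)
          rw [← inner_flux]
          exact (norm_inner_le_norm _ _).trans (by gcongr; exact hC' z)
      _ ≤ C' * (M * √(∫ z in Q, μ z) * √(∫ z in Q, edens a (grad w) z)) := by
          rw [integral_const_mul]
          gcongr
          exact h2.2
      _ = _ := by ring

lemma trialEnergy_comm (w w' : TrialSpace Q V) :
    trialEnergy ha hQ V w w' = trialEnergy ha hQ V w' w := by
  change ∫ z in Q, _ = ∫ z in Q, _
  simp only [bil_symPart_comm]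

lemma trialEnergy_nonneg (w : TrialSpace Q V) : 0 ≤ trialEnergy ha hQ V w w :=
  integral_nonneg (ha.edens_nonneg _)

/-- An approximate solution converges to a corrector. -/
theorem IsApproxSolution.exists_isCorrector (hd : 0 < d) (hQm : MeasurableSet Q)
    {f : SpaceTime d → Space d} (hf : IntegrableOn f Q) {φ : ℕ → TrialSpace Q V}
    (hφ : IsApproxSolution (trialEnergy ha hQ V) (parabolicForm ha hQ V) (rhsForm hf V) φ) :
    ∃ h G, IsCorrector a f Q V h G ∧
      Tendsto (fun n => ∫ z in Q, edens a (grad (φ n) - G) z) atTop (𝓝 0) := by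
  obtain ⟨ν, μ, M, hw⟩ := ha.exists_weights hQ
  obtain ⟨P, hP0, hP⟩ := exists_poincare (V := V) hd hQ hQm
  have hm := fun n => (continuous_grad (φ n)).aestronglyMeasurable (μ := volume.restrict Q)
  have he := fun n => (φ n).integrableOn_edens ha hQ
  have hcauchy : ∀ ε > 0, ∃ N, ∀ k ≥ N, ∀ n ≥ N,
      ∫ z in Q, edens a (grad (φ k) - grad (φ n)) z < ε := by
    intro ε hε
    obtain ⟨N, hN⟩ := hφ.cauchy ε hε
    refine ⟨N, fun k hk n hn => ?_⟩
    rw [← grad_sub]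
    exact hN k hk n hn
  obtain ⟨G, hG, heG, hlimG⟩ := exists_energy_limit ha hQ hm he hcauchy
  obtain ⟨h, hh, hlimh, -⟩ := exists_tendsto_integral_norm_sub (m := volume.restrict Q)
    (F := fun n => val (φ n)) (fun n => integrableOn_val hQ (φ n)) (by
      intro ε hε
      set c := P * √(∫ z in Q, ν z) with hcdef
      have hc0 : 0 ≤ c := by positivity
      obtain ⟨N, hN⟩ := hcauchy ((ε / (c + 1)) ^ 2) (by positivity)
      refine ⟨N, fun k hk n hn => ?_⟩
      have h1 := (hw.integrable_of_energy ha ((hm k).sub (hm n))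
        (integrableOn_edens_sub ha (hm k) (hm n) (he k) (he n))).2
      have h2 : √(∫ z in Q, edens a (grad (φ k) - grad (φ n)) z) ≤ ε / (c + 1) := by
        rw [Real.sqrt_le_left (by positivity)]
        exact (hN k hk n hn).le
      have h3 := hP (φ k - φ n)
      rw [val_sub, grad_sub] at h3
      calc ∫ z in Q, ‖val (φ k) z - val (φ n) z‖
          ≤ P * (√(∫ z in Q, ν z) * (ε / (c + 1))) := by
            refine h3.trans ?_
            gcongr
            exact h1.trans (by gcongr)
        _ = ε * (c / (c + 1)) := by rw [hcdef]; ring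
        _ < ε * 1 := by
          gcongr
          rw [div_lt_one (by positivity)]
          linarith
        _ = ε := mul_one _)
  refine ⟨h, G, ⟨hh, hG, heG, ⟨φ, hlimh, hlimG⟩, fun w => ?_⟩, hlimG⟩
  exact tendsto_nhds_unique (tendsto_weakForm ha hQ (fun n => integrableOn_val hQ (φ n)) hh hm hG.1
    he heG hlimh hlimG w) (hφ.tendsto w)

include ha hQ in
/-- Existence of correctors, with the energy inequality. -/
theorem exists_isCorrector (hd : 0 < d) (hQm : MeasurableSet Q) (V : Submodule ℝ (Space d))
    {f : SpaceTime d → Space d} (hf : IntegrableOn f Q) (hfw : HasDualWeight a Q f) :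
    ∃ h G, IsCorrector a f Q V h G ∧
      ∫ z in Q, edens a G z ≤ -∫ z in Q, (inner ℝ (f z) (G z) : ℝ) := by
  obtain ⟨K, hK0, hK⟩ := hfw.integral_inner_le ha hf
  obtain ⟨φ, hφ, e, l, h1, h2, hel⟩ := exists_isApproxSolution (trialEnergy ha hQ V)
    (parabolicForm ha hQ V) (trialEnergy_comm ha hQ) (trialEnergy_nonneg ha hQ)
    (parabolicForm_self ha hQ) (parabolicForm_bounded ha hQ hd hQm) (rhsForm hf V) K (fun w => by
      have := (hK (grad w) (continuous_grad w).aestronglyMeasurable (w.integrableOn_edens ha hQ)).2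
      change |-∫ z in Q, (inner ℝ (f z) (grad w z) : ℝ)| ≤ _
      rwa [abs_neg])
  obtain ⟨h, G, hc, hlim⟩ := hφ.exists_isCorrector ha hQ hd hQm hf
  have hm := fun n => (continuous_grad (φ n)).aestronglyMeasurable (μ := volume.restrict Q)
  have he := fun n => (φ n).integrableOn_edens ha hQ
  refine ⟨h, G, hc, ?_⟩
  have e1 : ∫ z in Q, edens a G z = e := tendsto_nhds_unique
    (tendsto_energy ha hm hc.integrableOn_grad.1 he hc.energy hlim) h1
  have e2 : -∫ z in Q, (inner ℝ (f z) (G z) : ℝ) = l := by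
    refine tendsto_nhds_unique ?_ h2
    refine Tendsto.neg (f := fun n => ∫ z in Q, (inner ℝ (f z) (grad (φ n) z) : ℝ)) ?_
    rw [tendsto_iff_norm_sub_tendsto_zero]
    refine squeeze_zero (fun _ => norm_nonneg _) (fun n => ?_)
      (by simpa using hlim.sqrt.const_mul K)
    have hd := hK (grad (φ n) - G) ((hm n).sub hc.integrableOn_grad.1)
      (integrableOn_edens_sub ha (hm n) hc.integrableOn_grad.1 (he n) hc.energy)
    rw [← integral_sub (hK _ (hm n) (he n)).1 (hK _ hc.integrableOn_grad.1 hc.energy).1]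
    simp only [← inner_sub_right]
    exact hd.2
  rw [e1, e2]
  exact hel

include ha hQ in
/-- Correctors of bounded energy pass to the limit under weak convergence of the right-hand
sides. -/
theorem exists_isCorrector_limit (hd : 0 < d) (hQm : MeasurableSet Q)
    {f : SpaceTime d → Space d} (hf : IntegrableOn f Q) {fs : ℕ → SpaceTime d → Space d}
    (hfs : ∀ k, IntegrableOn (fs k) Q) {h : ℕ → SpaceTime d → ℝ} {G : ℕ → SpaceTime d → Space d}
    (hc : ∀ k, IsCorrector a (fs k) Q V (h k) (G k)) {P : ℝ}
    (hP : ∀ k, ∫ z in Q, edens a (G k) z ≤ P)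
    (hlim : ∀ w : TrialSpace Q V, Tendsto (fun k => ∫ z in Q, (inner ℝ (fs k z) (grad w z) : ℝ))
      atTop (𝓝 (∫ z in Q, (inner ℝ (f z) (grad w z) : ℝ)))) :
    ∃ h' G', IsCorrector a f Q V h' G' ∧ ∫ z in Q, edens a G' z ≤ P := by
  choose φ hφ1 hφ2 using fun k => (hc k).approx
  have hm := fun w : TrialSpace Q V =>
    (continuous_grad w).aestronglyMeasurable (μ := volume.restrict Q)
  have he := fun w : TrialSpace Q V => w.integrableOn_edens ha hQ
  have hen : ∀ k, Tendsto (fun n => ∫ z in Q, edens a (grad (φ k n)) z) atTop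
      (𝓝 (∫ z in Q, edens a (G k) z)) := fun k =>
    tendsto_energy ha (fun n => hm (φ k n)) (hc k).integrableOn_grad.1 (fun n => he (φ k n))
      (hc k).energy (hφ2 k)
  have happ : ∀ k, IsApproxSolution (trialEnergy ha hQ V) (parabolicForm ha hQ V)
      (rhsForm (hfs k) V) (φ k) := by
    intro k
    refine ⟨fun ε hε => ?_, fun w => ?_⟩
    · have h1 := (hφ2 k).eventually_lt_const (u := ε / 4) (by positivity)
      obtain ⟨N, hN⟩ := eventually_atTop.1 h1
      refine ⟨N, fun m hm' n hn => ?_⟩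
      rw [trialEnergy_self, grad_sub]
      have hd' := fun n => integrableOn_edens_sub ha (hm (φ k n)) (hc k).integrableOn_grad.1
        (he (φ k n)) (hc k).energy
      calc ∫ z in Q, edens a (grad (φ k m) - grad (φ k n)) z
          ≤ ∫ z in Q, (2 * edens a (grad (φ k m) - G k) z + 2 * edens a (grad (φ k n) - G k) z) := by
            refine integral_mono (integrableOn_edens_sub ha (hm _) (hm _) (he _) (he _))
              (((hd' m).const_mul 2).add ((hd' n).const_mul 2)) fun z => ?_
            have := bil_symPart_sub_self_le (ha.pos z) (grad (φ k m) z - G k z)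
              (grad (φ k n) z - G k z)
            simpa [edens] using this
        _ = 2 * (∫ z in Q, edens a (grad (φ k m) - G k) z) +
              2 * ∫ z in Q, edens a (grad (φ k n) - G k) z := by
            rw [integral_add ((hd' m).const_mul 2) ((hd' n).const_mul 2), integral_const_mul,
              integral_const_mul]
        _ < ε := by linarith [hN m hm', hN n hn]
    · have := tendsto_weakForm ha hQ (fun n => integrableOn_val hQ (φ k n)) (hc k).integrableOn
        (fun n => hm (φ k n)) (hc k).integrableOn_grad.1 (fun n => he (φ k n)) (hc k).energy
        (hφ1 k) (hφ2 k) w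
      rw [(hc k).equation w] at this
      exact this
  obtain ⟨ψ, hψ, hψP⟩ := IsApproxSolution.exists_limit (trialEnergy ha hQ V)
    (parabolicForm ha hQ V) (trialEnergy_comm ha hQ) (trialEnergy_nonneg ha hQ)
    (parabolicForm_bounded ha hQ hd hQm) (rhsForm hf V) (fun k => rhsForm (hfs k) V)
    (fun w => (hlim w).neg) P φ happ (fun k δ hδ => by
      refine (hen k).eventually_le_const ?_
      linarith [hP k])
  obtain ⟨h', G', hc', hl'⟩ := hψ.exists_isCorrector ha hQ hd hQm hf
  refine ⟨h', G', hc', le_of_forall_pos_le_add fun δ hδ => ?_⟩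
  exact le_of_tendsto (tendsto_energy ha (fun n => hm (ψ n)) hc'.integrableOn_grad.1
    (fun n => he (ψ n)) hc'.energy hl') (hψP δ hδ)

end Forms

namespace IsCorrector

variable {f : SpaceTime d → Space d} {h : SpaceTime d → ℝ} {G : SpaceTime d → Space d}

/-- Testing with `p · x`: for `p ∈ V` the mean flux in direction `p` is that of `-f`. -/
lemma flux_eq (hc : IsCorrector a f Q V h G) {p : Space d} (hp : p ∈ V) :
    ∫ z in Q, bil (a z) p (G z) = -∫ z in Q, (inner ℝ (f z) p : ℝ) := by
  have h0 : spaceGrad (0 : SpaceTime d → ℝ) = 0 := by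
    have := (IsTestFunction.zero (D := Q)).spaceGrad_smul 0
    simpa using this
  have h1 : timeDeriv (0 : SpaceTime d → ℝ) = 0 := by
    have := (IsTestFunction.zero (D := Q)).timeDeriv_smul 0
    simpa using this
  have := hc.equation (0, ⟨p, hp⟩)
  simpa [grad, dt, h0, h1] using this

lemma tendsto_integral_norm_grad (ha : IsCoefficientField a) (hQ : Bornology.IsBounded Q)
    (hc : IsCorrector a f Q V h G) {φ : ℕ → TrialSpace Q V}
    (hφ : Tendsto (fun n => ∫ z in Q, edens a (grad (φ n) - G) z) atTop (𝓝 0)) :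
    Tendsto (fun n => ∫ z in Q, ‖grad (φ n) z - G z‖) atTop (𝓝 0) := by
  obtain ⟨ν, μ, M, hw⟩ := ha.exists_weights hQ
  have hm := fun n => (continuous_grad (φ n)).aestronglyMeasurable (μ := volume.restrict Q)
  refine squeeze_zero (fun n => integral_nonneg fun _ => norm_nonneg _) (fun n =>
    (hw.integrable_of_energy ha ((hm n).sub hc.integrableOn_grad.1)
      (integrableOn_edens_sub ha (hm n) hc.integrableOn_grad.1
        ((φ n).integrableOn_edens ha hQ) hc.energy)).2)
    (by simpa using hφ.sqrt.const_mul (√(∫ z in Q, ν z)))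

/-- The gradient of a corrector of Dirichlet type has mean zero. -/
lemma integral_grad_eq_zero (ha : IsCoefficientField a) (hQ : Bornology.IsBounded Q)
    (hc : IsCorrector a f Q ⊥ h G) : ∫ z in Q, G z = 0 := by
  obtain ⟨φ, -, hφ⟩ := hc.approx
  have h1 := hc.tendsto_integral_norm_grad ha hQ hφ
  have h2 : ∀ n, ∫ z in Q, grad (φ n) z = 0 := fun n => by
    rw [integral_grad hQ]
    have : ((φ n).2 : Space d) = 0 := (Submodule.mem_bot ℝ).1 (φ n).2.2
    rw [this, smul_zero]
  have h3 : ∀ n, ‖∫ z in Q, G z‖ ≤ ∫ z in Q, ‖grad (φ n) z - G z‖ := fun n => by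
    have := norm_integral_le_integral_norm (μ := volume.restrict Q) (fun z => grad (φ n) z - G z)
    rwa [integral_sub (TrialSpace.integrableOn_grad hQ (φ n)) hc.integrableOn_grad, h2, zero_sub,
      norm_neg] at this
  exact norm_le_zero_iff.1 (ge_of_tendsto' h1 h3)

lemma _root_.CoarseParabolic.TrialSpace.integral_val_smul (hQ : Bornology.IsBounded Q)
    (w : TrialSpace Q V) {φ : SpaceTime d → ℝ} (hφ : IsTestFunction Q φ) :
    ∫ z in Q, val w z • spaceGrad φ z = -∫ z in Q, φ z • grad w z := by
  set ℓ : SpaceTime d → ℝ := fun z => inner ℝ (w.2 : Space d) z.2 with hℓ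
  have hℓs : ContDiff ℝ ∞ ℓ := contDiff_const.inner ℝ contDiff_snd
  have hvs : ContDiff ℝ ∞ (val w) := w.isTestFunction.1.add hℓs
  have hχ : IsTestFunction Q (φ * val w) :=
    ⟨hφ.1.mul hvs, hφ.2.1.mul_right, tsupport_mul_subset_left.trans hφ.2.2⟩
  have hg : ∀ z, spaceGrad (φ * val w) z = val w z • spaceGrad φ z + φ z • grad w z := by
    intro z
    refine ext_inner_right ℝ fun v => ?_
    have hd : HasFDerivAt (val w) (fderiv ℝ w.1.1 z +
        (innerSL ℝ (w.2 : Space d)).comp (ContinuousLinearMap.snd ℝ ℝ (Space d))) z :=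
      (w.isTestFunction.differentiable z).hasFDerivAt.add
        (((innerSL ℝ (w.2 : Space d)).comp
          (ContinuousLinearMap.snd ℝ ℝ (Space d))).hasFDerivAt (x := z))
    rw [inner_spaceGrad (hχ.differentiable z), inner_add_left, inner_smul_left, inner_smul_left,
      inner_spaceGrad (hφ.differentiable z), grad, inner_add_left,
      inner_spaceGrad (w.isTestFunction.differentiable z),
      ((hφ.differentiable z).hasFDerivAt.mul hd).fderiv]
    simp
    ring
  have h0 := hχ.integral_spaceGrad
  simp only [hg] at h0
  rw [integral_add (integrableOn_smul (integrableOn_val hQ w) hφ.continuous_spaceGrad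
    hφ.hasCompactSupport_spaceGrad) (integrableOn_smul' (TrialSpace.integrableOn_grad hQ w)
    hφ.1.continuous hφ.2.1)] at h0
  exact eq_neg_of_add_eq_zero_left h0

lemma isWeakSolution (ha : IsCoefficientField a) (hQ : Bornology.IsBounded Q)
    (hc : IsCorrector a f Q V h G) : IsWeakSolution a f Q h G := by
  refine ⟨⟨hc.integrableOn, hc.integrableOn_grad, fun φ hφ => ?_⟩, hc.energy, fun φ hφ => ?_⟩
  · obtain ⟨ψ, hψ1, hψ2⟩ := hc.approx
    have hψ3 := hc.tendsto_integral_norm_grad ha hQ hψ2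
    obtain ⟨C, hC⟩ := hφ.continuous_spaceGrad.bounded_above_of_compact_support
      hφ.hasCompactSupport_spaceGrad
    obtain ⟨C', hC'⟩ := hφ.1.continuous.bounded_above_of_compact_support hφ.2.1
    have t1 : Tendsto (fun n => ∫ z in Q, val (ψ n) z • spaceGrad φ z) atTop
        (𝓝 (∫ z in Q, h z • spaceGrad φ z)) := by
      rw [tendsto_iff_norm_sub_tendsto_zero]
      refine squeeze_zero (fun _ => norm_nonneg _) (fun n => ?_)
        (by simpa using hψ1.const_mul C)
      rw [← integral_sub (integrableOn_smul (integrableOn_val hQ (ψ n)) hφ.continuous_spaceGrad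
        hφ.hasCompactSupport_spaceGrad) (integrableOn_smul hc.integrableOn hφ.continuous_spaceGrad
        hφ.hasCompactSupport_spaceGrad), ← integral_const_mul]
      refine norm_integral_le_of_norm_le
        (((integrableOn_val hQ (ψ n)).sub hc.integrableOn).norm.const_mul C)
        (ae_of_all _ fun z => ?_)
      rw [← sub_smul, norm_smul, mul_comm]
      exact mul_le_mul_of_nonneg_right (hC z) (norm_nonneg _)
    have t2 : Tendsto (fun n => ∫ z in Q, φ z • grad (ψ n) z) atTop
        (𝓝 (∫ z in Q, φ z • G z)) := by
      rw [tendsto_iff_norm_sub_tendsto_zero]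
      refine squeeze_zero (fun _ => norm_nonneg _) (fun n => ?_)
        (by simpa using hψ3.const_mul C')
      rw [← integral_sub (integrableOn_smul' (TrialSpace.integrableOn_grad hQ (ψ n)) hφ.1.continuous
        hφ.2.1) (integrableOn_smul' hc.integrableOn_grad hφ.1.continuous hφ.2.1),
        ← integral_const_mul]
      refine norm_integral_le_of_norm_le
        (((TrialSpace.integrableOn_grad hQ (ψ n)).sub hc.integrableOn_grad).norm.const_mul C')
        (ae_of_all _ fun z => ?_)
      rw [← smul_sub, norm_smul]
      exact mul_le_mul_of_nonneg_right (hC' z) (norm_nonneg _)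
    simp only [integral_val_smul hQ _ hφ] at t1
    exact tendsto_nhds_unique t1 t2.neg
  · have := hc.equation (⟨φ, hφ⟩, 0)
    simpa [grad, dt] using this

end IsCorrector

end CorrectorExistence

/-! ### Non-degeneracy of the coarse-grained matrices -/

section Nondegenerate

open TrialSpace

variable {d : ℕ} {a : SpaceTime d → Matrix (Fin d) (Fin d) ℝ} {Q : Set (SpaceTime d)}

/-- The linear function `p · x` solves the equation with right-hand side `-∇ · (a p)`. -/
lemma isWeakSolution_linear (ha : IsCoefficientField a) (hQ : Bornology.IsBounded Q)
    (p : Space d) : IsWeakSolution a (-flux a fun _ => p) Q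
      (fun z => inner ℝ p z.2) (fun _ => p) := by
  set w : TrialSpace Q ⊤ := (0, ⟨p, Submodule.mem_top⟩) with hw
  have h0 : spaceGrad (0 : SpaceTime d → ℝ) = 0 := by
    have := (IsTestFunction.zero (D := Q)).spaceGrad_smul 0
    simpa using this
  have hv : val w = fun z => inner ℝ p z.2 := by ext1 z; simp [val, hw]
  have hg : grad w = fun _ => p := by ext1 z; simp [grad, hw, h0]
  refine ⟨⟨?_, ?_, fun φ hφ => ?_⟩, ?_, fun φ hφ => ?_⟩
  · rw [← hv]; exact integrableOn_val hQ w
  · rw [← hg]; exact integrableOn_grad hQ w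
  · have := w.integral_val_smul hQ hφ
    rw [hv, hg] at this
    exact this
  · have := w.integrableOn_edens ha hQ
    rw [hg] at this
    exact this
  · have h1 := integral_val_mul_dt (V := ⊤) ((⟨φ, hφ⟩, ⟨p, Submodule.mem_top⟩) : TrialSpace Q ⊤)
    have h2 := integral_val_mul_dt (V := ⊤) ((⟨φ, hφ⟩, 0) : TrialSpace Q ⊤)
    have e1 : ∀ z, val ((⟨φ, hφ⟩, ⟨p, Submodule.mem_top⟩) : TrialSpace Q ⊤) z =
        φ z + inner ℝ p z.2 := fun z => rfl
    have e2 : ∀ z, val ((⟨φ, hφ⟩, 0) : TrialSpace Q ⊤) z = φ z := fun z => by simp [val]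
    have e3 : ∀ p' : (⊤ : Submodule ℝ (Space d)),
      dt ((⟨φ, hφ⟩, p') : TrialSpace Q ⊤) = timeDeriv φ := fun p' => rfl
    simp only [e1, e2, e3, add_mul] at h1 h2
    have i1 : IntegrableOn (fun z => φ z * timeDeriv φ z) Q :=
      integrableOn_mul (hφ.1.continuous.integrable_of_hasCompactSupport hφ.2.1).integrableOn
        hφ.continuous_timeDeriv hφ.hasCompactSupport_timeDeriv
    have i2 : IntegrableOn (fun z : SpaceTime d => (inner ℝ p z.2 : ℝ) * timeDeriv φ z) Q := by
      have := integrableOn_val hQ w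
      rw [hv] at this
      exact integrableOn_mul this hφ.continuous_timeDeriv hφ.hasCompactSupport_timeDeriv
    rw [integral_add i1 i2, h2, zero_add] at h1
    rw [h1, neg_zero, zero_add, ← integral_neg]
    refine integral_congr_ae (ae_of_all _ fun z => ?_)
    simp only [Pi.neg_apply, inner_neg_left, neg_neg]
    rw [real_inner_comm, inner_flux]

/-- Solutions with affine Dirichlet data show that the coarse-grained matrices do not vanish. -/
theorem sStarInv_bMat_ne_zero (ha : IsCoefficientField a) (hQ : Bornology.IsBounded Q)
    (hQm : MeasurableSet Q) (hd : 0 < d) (hQ0 : volume Q ≠ 0) :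
    specNorm (sStarInv a Q) ≠ 0 ∧ specNorm (bMat a Q) ≠ 0 := by
  set p : Space d := basisVec ⟨0, hd⟩ with hp
  have hp0 : p ≠ 0 := by
    intro h
    have := congrArg norm h
    simp [hp, basisVec] at this
  have hlin := isWeakSolution_linear ha hQ p
  have hfi : IntegrableOn (flux a fun _ => p) Q := hlin.integrableOn_flux ha hQ
  obtain ⟨ν, μ, M, hw⟩ := ha.exists_weights hQ
  have hfw := HasDualWeight.flux_const ha hQ p
  obtain ⟨h, G, hc, hE⟩ := exists_isCorrector ha hQ hd hQm ⊥ hfi hfw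
  obtain ⟨K, -, hK⟩ := hfw.integral_inner_le ha hfi
  have hsol := hc.isWeakSolution ha hQ
  -- `p · x` plus its corrector is a homogeneous solution, whose gradient has mean `p`
  have hsum := hlin.add_smul ha hQ hfi.neg hfi hsol 1
  simp only [one_smul, neg_add_cancel] at hsum
  set H : SpaceTime d → Space d := (fun _ => p) + G with hH
  have hVpos : 0 < volume.real Q := ENNReal.toReal_pos hQ0 hQ.measure_lt_top.ne
  have hpi : IntegrableOn (fun _ : SpaceTime d => p) Q := hlin.isWeakGradient.integrableOn_grad
  have hmean : ∫ z in Q, H z = volume.real Q • p := by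
    have := integral_add hpi hc.integrableOn_grad
    rw [hc.integral_grad_eq_zero ha hQ, setIntegral_const, add_zero] at this
    exact this
  have hmean0 : ∫ z in Q, H z ≠ 0 := by
    rw [hmean]
    exact smul_ne_zero hVpos.ne' hp0
  refine ⟨fun h0 => ?_, fun h0 => ?_⟩
  · have := norm_integral_grad_sq_le ha hQ hQ0 hsum
    rw [h0] at this
    simp at this
    exact hmean0 this
  · have hz := norm_integral_flux_sq_le ha hQ hQ0 hsum
    rw [h0] at hz
    simp only [mul_zero, zero_mul, nonpos_iff_eq_zero, ne_eq, OfNat.ofNat_ne_zero,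
      not_false_eq_true, pow_eq_zero_iff, enorm_eq_zero] at hz
    have hFi := hsum.integrableOn_flux ha hQ
    have hGm := hc.integrableOn_grad.1
    -- test the flux with `p`, and the equation of the corrector with the corrector
    have i1 : IntegrableOn (fun z => bil (a z) p (H z)) Q := by
      have := hFi.const_inner (𝕜 := ℝ) p
      exact this
    have i2 : IntegrableOn (fun z => (inner ℝ (flux a (fun _ => p) z) (G z) : ℝ)) Q :=
      (hK G hGm hc.energy).1
    have e1 : ∫ z in Q, bil (a z) p (H z) = 0 := by
      have := integral_inner (𝕜 := ℝ) hFi p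
      rw [hz, inner_zero_right] at this
      exact this
    have e2 : ∫ z in Q, edens a H z ≤ 0 := by
      have hpt : ∀ z, edens a H z ≤ bil (a z) p (H z) + ((inner ℝ (flux a (fun _ => p) z) (G z) : ℝ)
          + edens a G z) := fun z => by
        rw [real_inner_comm, inner_flux]
        have h1 : edens a H z = bil (a z) (H z) (H z) := bil_symPart_self _ _
        have h2 : edens a G z = bil (a z) (G z) (G z) := bil_symPart_self _ _
        rw [h1, h2]
        simp only [hH, Pi.add_apply, bil_add_left, bil_add_right]
        linarith
      calc ∫ z in Q, edens a H z ≤ ∫ z in Q, (bil (a z) p (H z) +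
            ((inner ℝ (flux a (fun _ => p) z) (G z) : ℝ) + edens a G z)) :=
            integral_mono hsum.energy (i1.add (i2.add hc.energy)) hpt
        _ = 0 + ((∫ z in Q, (inner ℝ (flux a (fun _ => p) z) (G z) : ℝ)) +
              ∫ z in Q, edens a G z) := by
            have h1 := integral_add i1 (i2.add hc.energy)
            have h2 := integral_add i2 hc.energy
            rw [e1] at h1
            rw [← h2]
            exact h1
        _ ≤ 0 := by linarith
    have h3 := (hw.integrable_of_energy ha hsum.isWeakGradient.integrableOn_grad.1 hsum.energy).2
    change ∫ z in Q, ‖H z‖ ≤ _ * √(∫ z in Q, edens a H z) at h3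
    rw [Real.sqrt_eq_zero'.2 e2, mul_zero] at h3
    exact hmean0 (norm_le_zero_iff.1 ((norm_integral_le_integral_norm _).trans h3))

end Nondegenerate

/-! ### Triadic parabolic cubes -/

section Cubes

/-- Indices of the triadic cubes of a given scale. -/
abbrev Idx (d : ℕ) : Type := ℤ × (Fin d → ℤ)

variable {d : ℕ}

/-- The centre of the cube of scale `k` and index `i`. -/
def ctr (k : ℤ) (i : Idx d) : SpaceTime d :=
  ((3 : ℝ) ^ (2 * k) * i.1, WithLp.toLp 2 fun l => (3 : ℝ) ^ k * i.2 l)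

/-- The triadic cube of scale `k` and index `i`. -/
def cell (k : ℤ) (i : Idx d) : Set (SpaceTime d) := cube (ctr k i) k

/-- The index of the cube of scale `k + 1` containing the cube of scale `k` and index `i`. -/
def par (i : Idx d) : Idx d := ((i.1 + 4) / 9, fun l => (i.2 l + 1) / 3)

/-- The index of the cube of scale `k` containing `y`, outside the faces of the cubes. -/
def idx (k : ℤ) (y : SpaceTime d) : Idx d :=
  (⌊y.1 / (3 : ℝ) ^ (2 * k) + 1 / 2⌋, fun l => ⌊y.2 l / (3 : ℝ) ^ k + 1 / 2⌋)

lemma floor_eq_of_abs_sub_lt {c y : ℝ} (hc : 0 < c) {i : ℤ} (h : |y - c * i| < c / 2) :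
    ⌊y / c + 1 / 2⌋ = i := by
  rw [abs_lt] at h
  have e : y = c * (y / c) := by field_simp
  rw [Int.floor_eq_iff]
  constructor
  · by_contra! hh
    nlinarith
  · by_contra! hh
    nlinarith

lemma abs_sub_lt_of_floor {c y : ℝ} (hc : 0 < c) (h : ∀ n : ℤ, y ≠ c * (n + 1 / 2)) :
    |y - c * ⌊y / c + 1 / 2⌋| < c / 2 := by
  have e : y = c * (y / c) := by field_simp
  have h1 := Int.floor_le (y / c + 1 / 2)
  have h2 := Int.lt_floor_add_one (y / c + 1 / 2)
  set n := ⌊y / c + 1 / 2⌋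
  have h3 : (n : ℝ) ≠ y / c + 1 / 2 := by
    intro hn
    apply h (n - 1)
    push_cast
    rw [hn]
    field_simp
    ring
  have h4 : (n : ℝ) < y / c + 1 / 2 := lt_of_le_of_ne h1 h3
  rw [abs_lt]
  constructor <;> nlinarith

lemma abs_sub_lt_of_ediv {c y : ℝ} (hc : 0 < c) {i : ℤ} (b : ℕ) (h : |y - c * i| < c / 2) :
    |y - ((2 * b + 1 : ℕ) : ℝ) * c * ((i + b) / (2 * b + 1 : ℕ) : ℤ)| <
      ((2 * b + 1 : ℕ) : ℝ) * c / 2 := by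
  set q : ℤ := (i + b) / (2 * b + 1 : ℕ)
  have h1 : q * (2 * b + 1 : ℕ) ≤ i + b := Int.ediv_mul_le _ (by omega)
  have h2 : i + b < (q + 1) * (2 * b + 1 : ℕ) := Int.lt_ediv_add_one_mul_self _ (by omega)
  have h1' : (q : ℝ) * (2 * b + 1) ≤ i + b := by exact_mod_cast h1
  have h2' : (i : ℝ) + b + 1 ≤ (q + 1) * (2 * b + 1) := by exact_mod_cast h2
  push_cast
  rw [abs_lt] at h ⊢
  constructor <;> nlinarith

lemma pow_pos' (k : ℤ) : 0 < (3 : ℝ) ^ k := by positivity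

lemma mem_cell {k : ℤ} {i : Idx d} {y : SpaceTime d} : y ∈ cell k i ↔
    |y.1 - (3 : ℝ) ^ (2 * k) * i.1| < (3 : ℝ) ^ (2 * k) / 2 ∧
      ∀ l, |y.2 l - (3 : ℝ) ^ k * i.2 l| < (3 : ℝ) ^ k / 2 := Iff.rfl

lemma idx_eq_of_mem {k : ℤ} {i : Idx d} {y : SpaceTime d} (h : y ∈ cell k i) : idx k y = i := by
  rw [mem_cell] at h
  exact Prod.ext (floor_eq_of_abs_sub_lt (by positivity) h.1)
    (funext fun l => floor_eq_of_abs_sub_lt (by positivity) (h.2 l))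

lemma isOpen_cube (z : SpaceTime d) (k : ℤ) : IsOpen (cube z k) := by
  have : cube z k = {y : SpaceTime d | |y.1 - z.1| < (3 : ℝ) ^ (2 * k) / 2} ∩
      ⋂ l, {y : SpaceTime d | |y.2 l - z.2 l| < (3 : ℝ) ^ k / 2} := by
    ext y; simp [cube]
  rw [this]
  refine (isOpen_lt (by fun_prop) (by fun_prop)).inter (isOpen_iInter_of_finite fun l =>
    isOpen_lt (by fun_prop) (by fun_prop))

lemma isOpen_cell (k : ℤ) (i : Idx d) : IsOpen (cell k i) := isOpen_cube _ _

lemma measurableSet_cell (k : ℤ) (i : Idx d) : MeasurableSet (cell k i) :=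
  (isOpen_cell k i).measurableSet

lemma self_mem_cube (z : SpaceTime d) (k : ℤ) : z ∈ cube z k := by
  have h1 := pow_pos' (2 * k)
  have h2 := pow_pos' k
  exact ⟨by simpa using by linarith, fun l => by simpa using by linarith⟩

lemma ctr_mem_cell (k : ℤ) (i : Idx d) : ctr k i ∈ cell k i := self_mem_cube _ _

lemma disjoint_cell {k : ℤ} {i j : Idx d} (h : i ≠ j) : Disjoint (cell k i) (cell k j) :=
  Set.disjoint_left.2 fun _ hi hj => h ((idx_eq_of_mem hi).symm.trans (idx_eq_of_mem hj))

lemma cell_subset_par (k : ℤ) (i : Idx d) : cell k i ⊆ cell (k + 1) (par i) := by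
  intro y hy
  rw [mem_cell] at hy ⊢
  have e1 : (3 : ℝ) ^ (2 * (k + 1)) = ((2 * 4 + 1 : ℕ) : ℝ) * 3 ^ (2 * k) := by
    rw [mul_add, zpow_add₀ (by norm_num)]
    norm_num
    ring
  have e2 : (3 : ℝ) ^ (k + 1) = ((2 * 1 + 1 : ℕ) : ℝ) * 3 ^ k := by
    rw [zpow_add₀ (by norm_num)]
    norm_num
    ring
  rw [e1, e2]
  exact ⟨abs_sub_lt_of_ediv (by positivity) 4 hy.1,
    fun l => abs_sub_lt_of_ediv (by positivity) 1 (hy.2 l)⟩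

lemma idx_add_one_of_mem {k : ℤ} {i : Idx d} {y : SpaceTime d} (h : y ∈ cell k i) :
    idx (k + 1) y = par i := idx_eq_of_mem (cell_subset_par k i h)

lemma iterate_par_subset (k : ℤ) (n : ℕ) (i : Idx d) :
    cell k i ⊆ cell (k + n) (par^[n] i) := by
  induction n with
  | zero => simp
  | succ n ih =>
    rw [Function.iterate_succ_apply', Nat.cast_succ, ← add_assoc]
    exact ih.trans (cell_subset_par _ _)

/-- Triadic cubes are nested. -/
lemma cell_subset_of_inter {k n : ℤ} (hkn : k ≤ n) {i j : Idx d}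
    (h : (cell k i ∩ cell n j).Nonempty) : cell k i ⊆ cell n j := by
  obtain ⟨y, hy1, hy2⟩ := h
  obtain ⟨p, rfl⟩ := Int.le.dest hkn
  have h1 := iterate_par_subset k p i
  have h2 := idx_eq_of_mem (h1 hy1)
  rw [idx_eq_of_mem hy2] at h2
  rwa [h2]

lemma range_ctr (k : ℤ) : range (ctr (d := d) k) = lattice d k := by
  ext z
  constructor
  · rintro ⟨i, rfl⟩
    exact ⟨⟨i.1, rfl⟩, fun l => ⟨i.2 l, rfl⟩⟩
  · rintro ⟨⟨i, hi⟩, h⟩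
    choose j hj using h
    refine ⟨(i, j), Prod.ext hi.symm ?_⟩
    ext l
    exact (hj l).symm

lemma ctr_injective (k : ℤ) : Function.Injective (ctr (d := d) k) := fun i j h => by
  have h1 := idx_eq_of_mem (ctr_mem_cell k i)
  rw [h, idx_eq_of_mem (ctr_mem_cell k j)] at h1
  exact h1.symm

lemma volume_preserving_snd_apply (l : Fin d) :
    Measure.QuasiMeasurePreserving (fun y : SpaceTime d => y.2 l) volume volume := by
  have h1 : Measure.QuasiMeasurePreserving (Prod.snd : SpaceTime d → Space d) volume volume :=
    Measure.quasiMeasurePreserving_snd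
  have h2 := (PiLp.volume_preserving_ofLp (Fin d)).quasiMeasurePreserving
  have h3 := Measure.quasiMeasurePreserving_eval (fun _ : Fin d => (volume : Measure ℝ)) l
  exact (h3.comp h2).comp h1

lemma ae_ne_half_integer (c : ℝ) : ∀ᵐ y : ℝ, ∀ n : ℤ, y ≠ c * (n + 1 / 2) := by
  rw [ae_all_iff]
  intro n
  exact Measure.ae_ne _ _

/-- Almost every point lies in a triadic cube of each scale. -/
lemma ae_mem_cell : ∀ᵐ y : SpaceTime d, ∀ k, y ∈ cell k (idx k y) := by
  rw [ae_all_iff]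
  intro k
  have h1 : ∀ᵐ y : SpaceTime d, ∀ n : ℤ, y.1 ≠ (3 : ℝ) ^ (2 * k) * (n + 1 / 2) :=
    (Measure.quasiMeasurePreserving_fst (μ := (volume : Measure ℝ))
      (ν := (volume : Measure (Space d)))).ae (ae_ne_half_integer _)
  have h2 : ∀ᵐ y : SpaceTime d, ∀ l, ∀ n : ℤ, y.2 l ≠ (3 : ℝ) ^ k * (n + 1 / 2) := by
    rw [ae_all_iff]
    exact fun l => (volume_preserving_snd_apply l).ae (ae_ne_half_integer _)
  filter_upwards [h1, h2] with y hy1 hy2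
  rw [mem_cell]
  exact ⟨abs_sub_lt_of_floor (by positivity) hy1,
    fun l => abs_sub_lt_of_floor (by positivity) (hy2 l)⟩

lemma measurable_idx (k : ℤ) : Measurable (idx (d := d) k) := by
  unfold idx
  refine Measurable.prodMk ?_ (measurable_pi_lambda _ fun l => ?_)
  · exact Int.measurable_floor.comp (by fun_prop)
  · exact Int.measurable_floor.comp (by fun_prop)

lemma cube_eq_prod (z : SpaceTime d) (k : ℤ) : cube z k = Metric.ball z.1 ((3 : ℝ) ^ (2 * k) / 2) ×ˢ
    ((WithLp.ofLp : Space d → Fin d → ℝ) ⁻¹'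
      (univ.pi fun l => Metric.ball (z.2 l) ((3 : ℝ) ^ k / 2))) := by
  ext y
  simp [cube, Real.dist_eq]

/-- The common volume of the parabolic cubes of scale `k`. -/
def cubeVol (d : ℕ) (k : ℤ) : ℝ := (3 : ℝ) ^ (2 * k) * ((3 : ℝ) ^ k) ^ d

lemma cubeVol_pos (d : ℕ) (k : ℤ) : 0 < cubeVol d k := by unfold cubeVol; positivity

lemma cubeVol_add (d : ℕ) (k : ℤ) (n : ℕ) :
    cubeVol d (k + n) = (3 ^ (d + 2)) ^ n * cubeVol d k := by
  have e1 : (3 : ℝ) ^ (2 * (k + n)) = 3 ^ (2 * k) * (3 ^ n) ^ 2 := by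
    rw [mul_add, zpow_add₀ (by norm_num), ← pow_mul, mul_comm n 2, ← zpow_natCast]
    push_cast
    rfl
  have e2 : (3 : ℝ) ^ (k + n) = 3 ^ k * 3 ^ n := by
    rw [zpow_add₀ (by norm_num), zpow_natCast]
  rw [cubeVol, cubeVol, e1, e2]
  rw [mul_pow, ← pow_mul, ← pow_mul, ← pow_mul]
  ring

lemma cubeVol_add_one (d : ℕ) (k : ℤ) : cubeVol d (k + 1) = 3 ^ (d + 2) * cubeVol d k := by
  simpa using cubeVol_add d k 1

lemma volume_cube (z : SpaceTime d) (k : ℤ) : volume (cube z k) = ENNReal.ofReal (cubeVol d k) := by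
  rw [cube_eq_prod]
  have e : (volume : Measure (SpaceTime d)) = (volume : Measure ℝ).prod volume := rfl
  rw [e, Measure.prod_prod, (PiLp.volume_preserving_ofLp (Fin d)).measure_preimage
    (MeasurableSet.univ_pi fun l => measurableSet_ball).nullMeasurableSet, volume_pi_pi]
  simp only [Real.volume_ball]
  rw [Finset.prod_const, Finset.card_univ, Fintype.card_fin, ← ENNReal.ofReal_pow (by positivity),
    ← ENNReal.ofReal_mul (by positivity), cubeVol]
  congr 3 <;> ring

lemma volume_cell (k : ℤ) (i : Idx d) : volume (cell k i) = ENNReal.ofReal (cubeVol d k) :=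
  volume_cube _ _

lemma volume_real_cell (k : ℤ) (i : Idx d) : volume.real (cell k i) = cubeVol d k := by
  rw [Measure.real, volume_cell, ENNReal.toReal_ofReal (cubeVol_pos d k).le]

lemma volume_cell_ne_zero (k : ℤ) (i : Idx d) : volume (cell k i) ≠ 0 := by
  rw [volume_cell]
  simpa using cubeVol_pos d k

/-- The points of a cube are at distance at most `3^{2k} + 3^k √d` of each other. -/
lemma dist_le_of_mem_cube {z : SpaceTime d} {k : ℤ} {x y : SpaceTime d} (hx : x ∈ cube z k)
    (hy : y ∈ cube z k) :
    dist x.1 y.1 ≤ (3 : ℝ) ^ (2 * k) ∧ dist x.2 y.2 ≤ (3 : ℝ) ^ k * √d := by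
  constructor
  · have h1 := abs_lt.1 hx.1
    have h2 := abs_lt.1 hy.1
    rw [Real.dist_eq, abs_le]
    constructor <;> linarith
  · rw [EuclideanSpace.dist_eq]
    have h : ∑ l, dist (x.2 l) (y.2 l) ^ 2 ≤ ((3 : ℝ) ^ k * √d) ^ 2 := by
      calc ∑ l, dist (x.2 l) (y.2 l) ^ 2 ≤ ∑ _l : Fin d, ((3 : ℝ) ^ k) ^ 2 := by
            refine Finset.sum_le_sum fun l _ => ?_
            have h1 := abs_lt.1 (hx.2 l)
            have h2 := abs_lt.1 (hy.2 l)
            rw [Real.dist_eq]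
            refine pow_le_pow_left₀ (abs_nonneg _) ?_ 2
            rw [abs_le]
            constructor <;> linarith
        _ = _ := by
            rw [Finset.sum_const, Finset.card_univ, Fintype.card_fin, mul_pow,
              Real.sq_sqrt (by positivity), nsmul_eq_mul]
            ring
    exact (Real.sqrt_le_sqrt h).trans_eq (Real.sqrt_sq (by positivity))

lemma isBounded_cube (z : SpaceTime d) (k : ℤ) : Bornology.IsBounded (cube z k) := by
  refine Metric.isBounded_iff.2 ⟨max ((3 : ℝ) ^ (2 * k)) ((3 : ℝ) ^ k * √d), fun x hx y hy => ?_⟩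
  have := dist_le_of_mem_cube hx hy
  rw [Prod.dist_eq]
  exact max_le_max this.1 this.2

lemma isBounded_cell (k : ℤ) (i : Idx d) : Bornology.IsBounded (cell k i) := isBounded_cube _ _

lemma tendsto_zpow_atBot : Tendsto (fun k : ℤ => (3 : ℝ) ^ k) atBot (𝓝 0) := by
  have h := (tendsto_rpow_atBot_of_base_gt_one 3 (by norm_num)).comp
    (tendsto_intCast_atBot_iff.2 tendsto_id : Tendsto (fun k : ℤ => (k : ℝ)) atBot atBot)
  simpa [Function.comp_def] using h

/-- Neighbourhoods of `y` contain the cubes of small scale around `y`. -/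
lemma eventually_cell_subset {y : SpaceTime d} {V : Set (SpaceTime d)} (hV : V ∈ 𝓝 y) :
    ∀ᶠ k : ℤ in atBot, ∀ i : Idx d, y ∈ cell k i → cell k i ⊆ V := by
  obtain ⟨ε, hε, hb⟩ := Metric.mem_nhds_iff.1 hV
  have h1 : Tendsto (fun k : ℤ => (3 : ℝ) ^ (2 * k)) atBot (𝓝 0) := by
    have := tendsto_zpow_atBot.mul tendsto_zpow_atBot
    simp only [mul_zero] at this
    refine this.congr fun k => ?_
    rw [two_mul, zpow_add₀ (by norm_num)]
  have h2 : Tendsto (fun k : ℤ => (3 : ℝ) ^ k * √d) atBot (𝓝 0) := by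
    simpa using tendsto_zpow_atBot.mul_const (√d)
  filter_upwards [h1.eventually_lt_const hε, h2.eventually_lt_const hε] with k hk1 hk2 i hy x hx
  refine hb ?_
  have := dist_le_of_mem_cube hx hy
  rw [Metric.mem_ball, Prod.dist_eq]
  exact max_lt (this.1.trans_lt hk1) (this.2.trans_lt hk2)

lemma ae_mem_iUnion_cell (k : ℤ) (S : Set (SpaceTime d)) :
    (⋃ i, S ∩ cell k i : Set (SpaceTime d)) =ᵐ[volume] S := by
  rw [← inter_iUnion]
  have : (⋃ i, cell k i : Set (SpaceTime d)) =ᵐ[volume] univ := by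
    rw [eventuallyEq_univ]
    filter_upwards [ae_mem_cell] with y hy
    exact mem_iUnion.2 ⟨_, hy k⟩
  simpa using (ae_eq_refl S).inter this

lemma lintegral_eq_tsum_cell (k : ℤ) {S : Set (SpaceTime d)} (hS : MeasurableSet S)
    (f : SpaceTime d → ℝ≥0∞) : ∫⁻ z in S, f z = ∑' i, ∫⁻ z in S ∩ cell k i, f z := by
  rw [← setLIntegral_congr (ae_mem_iUnion_cell k S)]
  refine lintegral_iUnion (fun i => hS.inter (measurableSet_cell k i)) (fun i j h => ?_) _
  exact (disjoint_cell h).mono inter_subset_right inter_subset_right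

lemma hasSum_integral_cell {E : Type*} [NormedAddCommGroup E] [NormedSpace ℝ E] (k : ℤ)
    {S : Set (SpaceTime d)} (hS : MeasurableSet S) {f : SpaceTime d → E} (hf : IntegrableOn f S) :
    HasSum (fun i => ∫ z in S ∩ cell k i, f z) (∫ z in S, f z) := by
  rw [← setIntegral_congr_set (ae_mem_iUnion_cell k S)]
  refine hasSum_integral_iUnion (fun i => hS.inter (measurableSet_cell k i)) (fun i j h => ?_)
    (hf.congr_set_ae (ae_mem_iUnion_cell k S))
  exact (disjoint_cell h).mono inter_subset_right inter_subset_right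

end Cubes

/-! ### Averages over triadic cubes -/

section Averages

variable {d : ℕ} {S : Set (SpaceTime d)} {f h G : SpaceTime d → Space d}

open Classical in
/-- The average of `h` over the triadic cube of scale `k` around `y` if that cube lies in `S`, and
zero otherwise. -/
def cubeProj (S : Set (SpaceTime d)) (h : SpaceTime d → Space d) (k : ℤ) (y : SpaceTime d) :
    Space d :=
  if cell k (idx k y) ⊆ S then ⨍ z in cell k (idx k y), h z else 0

open Classical in
/-- The difference between the averages of `h` over a triadic cube and over its parent, the latter
being replaced by zero if the parent is not contained in `S`. -/
def cubeInc (S : Set (SpaceTime d)) (h : SpaceTime d → Space d) (k : ℤ) (i : Idx d) : Space d :=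
  (⨍ z in cell k i, h z) -
    if cell (k + 1) (par i) ⊆ S then ⨍ z in cell (k + 1) (par i), h z else 0

lemma measurable_cubeProj (S : Set (SpaceTime d)) (h : SpaceTime d → Space d) (k : ℤ) :
    Measurable (cubeProj S h k) := by
  classical
  have : Measurable (fun i : Idx d => if cell k i ⊆ S then ⨍ z in cell k i, h z else 0) :=
    measurable_of_countable _
  exact this.comp (measurable_idx k)

lemma norm_average_cell_le (hh : IntegrableOn h S) {k : ℤ} {i : Idx d} (hi : cell k i ⊆ S) :
    ‖⨍ z in cell k i, h z‖ ≤ (cubeVol d k)⁻¹ * ∫ z in S, ‖h z‖ := by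
  rw [setAverage_eq, volume_real_cell, norm_smul, norm_inv, Real.norm_of_nonneg (cubeVol_pos d k).le]
  have := cubeVol_pos d k
  gcongr
  exact (norm_integral_le_integral_norm _).trans
    (setIntegral_mono_set hh.norm (ae_of_all _ fun _ => norm_nonneg _) hi.eventuallyLE)

lemma norm_cubeProj_le (hh : IntegrableOn h S) (k : ℤ) (y : SpaceTime d) :
    ‖cubeProj S h k y‖ ≤ (cubeVol d k)⁻¹ * ∫ z in S, ‖h z‖ := by
  rw [cubeProj]
  split_ifs with hi
  · exact norm_average_cell_le hh hi
  · have := cubeVol_pos d k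
    rw [norm_zero]
    positivity

lemma integrableOn_cubeProj (hS : volume S ≠ ⊤) (hh : IntegrableOn h S) (k : ℤ) :
    IntegrableOn (cubeProj S h k) S :=
  haveI : IsFiniteMeasure (volume.restrict S) := ⟨by simpa using hS.lt_top⟩
  Integrable.of_bound
    (measurable_cubeProj S h k).aestronglyMeasurable _ (ae_of_all _ (norm_cubeProj_le hh k))

lemma integrableOn_inner_cubeProj (hh : IntegrableOn h S) (hG : IntegrableOn G S) (k : ℤ) :
    IntegrableOn (fun z => (inner ℝ (cubeProj S h k z) (G z) : ℝ)) S := by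
  refine (hG.norm.const_mul ((cubeVol d k)⁻¹ * ∫ z in S, ‖h z‖)).mono'
    ((measurable_cubeProj S h k).aestronglyMeasurable.inner hG.1) (ae_of_all _ fun z => ?_)
  refine (norm_inner_le_norm _ _).trans ?_
  gcongr
  exact norm_cubeProj_le hh k z

lemma cubeProj_of_mem {k : ℤ} {i : Idx d} (hi : cell k i ⊆ S) {y : SpaceTime d}
    (hy : y ∈ cell k i) : cubeProj S h k y = ⨍ z in cell k i, h z := by
  rw [cubeProj, idx_eq_of_mem hy, if_pos hi]

lemma cubeProj_of_mem' {k : ℤ} {i : Idx d} (hi : ¬ cell k i ⊆ S) {y : SpaceTime d}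
    (hy : y ∈ cell k i) : cubeProj S h k y = 0 := by
  rw [cubeProj, idx_eq_of_mem hy, if_neg hi]

lemma cubeProj_sub {k : ℤ} {i : Idx d} {y : SpaceTime d} (hy : y ∈ cell k i) :
    (cell k i ⊆ S → cubeProj S h k y - cubeProj S h (k + 1) y = cubeInc S h k i) ∧
      (¬ cell k i ⊆ S → cubeProj S h k y - cubeProj S h (k + 1) y = 0) := by
  have hy' := cell_subset_par k i hy
  constructor
  · intro hi
    rw [cubeProj_of_mem hi hy, cubeInc]
    by_cases hp : cell (k + 1) (par i) ⊆ S
    · rw [cubeProj_of_mem hp hy', if_pos hp]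
    · rw [cubeProj_of_mem' hp hy', if_neg hp]
  · intro hi
    have hp : ¬ cell (k + 1) (par i) ⊆ S := fun hp => hi ((cell_subset_par k i).trans hp)
    rw [cubeProj_of_mem' hi hy, cubeProj_of_mem' hp hy', sub_zero]

/-- Integrals against a function which is constant on the triadic cubes of one scale. -/
lemma enorm_integral_inner_le (hS : MeasurableSet S) (k : ℤ) {F : SpaceTime d → Space d}
    (hG : IntegrableOn G S) (hFG : IntegrableOn (fun z => (inner ℝ (F z) (G z) : ℝ)) S)
    (c : Idx d → Space d) (hc : ∀ i, cell k i ⊆ S → ∀ y ∈ cell k i, F y = c i)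
    (h0 : ∀ i, ¬ cell k i ⊆ S → ∀ y ∈ cell k i, F y = 0) :
    ‖∫ z in S, (inner ℝ (F z) (G z) : ℝ)‖ₑ ≤
      ∑' i, {i | cell k i ⊆ S}.indicator (fun i => ‖c i‖ₑ * ‖∫ z in cell k i, G z‖ₑ) i := by
  rw [← (hasSum_integral_cell k hS hFG).tsum_eq]
  refine (enorm_tsum_le_tsum_enorm).trans (ENNReal.tsum_le_tsum fun i => ?_)
  by_cases hi : cell k i ⊆ S
  · rw [indicator_of_mem (s := {i | cell k i ⊆ S}) hi, inter_eq_self_of_subset_right hi,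
      setIntegral_congr_fun (measurableSet_cell k i)
        (g := fun z => (inner ℝ (c i) (G z) : ℝ)) fun z hz => by simp only [hc i hi z hz],
      integral_inner (hG.mono_set hi)]
    rw [← enorm_norm (c i), ← enorm_norm (∫ z in cell k i, G z), ← enorm_mul]
    refine enorm_le_iff_norm_le.2 ?_
    rw [norm_mul, norm_norm, norm_norm]
    exact norm_inner_le_norm _ _
  · rw [setIntegral_congr_fun (hS.inter (measurableSet_cell k i))
        (g := fun z => 0) fun z hz => by simp only [h0 i hi z hz.2, inner_zero_left]]
    simp

/-- The triadic cubes of scale at least `k` which are contained in `S`. -/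
def cubesIn (S : Set (SpaceTime d)) (k : ℤ) : Set (ℤ × Idx d) :=
  {x | k ≤ x.1 ∧ cell x.1 x.2 ⊆ S}

/-- Telescoping over the scales. -/
lemma enorm_integral_inner_cubeProj_le (hS : MeasurableSet S) (hh : IntegrableOn h S)
    (hG : IntegrableOn G S) {N : ℤ} (hN : ∀ i, ¬ cell N i ⊆ S) (k : ℤ) (hk : k ≤ N) :
    ‖∫ z in S, (inner ℝ (cubeProj S h k z) (G z) : ℝ)‖ₑ ≤
      ∑' x, (cubesIn S k).indicator
        (fun x => ‖cubeInc S h x.1 x.2‖ₑ * ‖∫ z in cell x.1 x.2, G z‖ₑ) x := by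
  set T : ℤ → ℝ≥0∞ := fun l => ∑' i, {i | cell l i ⊆ S}.indicator
    (fun i => ‖cubeInc S h l i‖ₑ * ‖∫ z in cell l i, G z‖ₑ) i with hT
  have step : ∀ l, ‖∫ z in S, (inner ℝ (cubeProj S h l z) (G z) : ℝ)‖ₑ ≤
      T l + ‖∫ z in S, (inner ℝ (cubeProj S h (l + 1) z) (G z) : ℝ)‖ₑ := fun l => by
    have i1 := integrableOn_inner_cubeProj hh hG l
    have i2 := integrableOn_inner_cubeProj hh hG (l + 1)
    have i3 : IntegrableOn
        (fun z => (inner ℝ (cubeProj S h l z - cubeProj S h (l + 1) z) (G z) : ℝ)) S := by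
      simp only [inner_sub_left]
      exact i1.sub i2
    have e : ∫ z in S, (inner ℝ (cubeProj S h l z) (G z) : ℝ) =
        (∫ z in S, (inner ℝ (cubeProj S h l z - cubeProj S h (l + 1) z) (G z) : ℝ)) +
          ∫ z in S, (inner ℝ (cubeProj S h (l + 1) z) (G z) : ℝ) := by
      rw [← integral_add i3 i2]
      simp only [inner_sub_left, sub_add_cancel]
    rw [e]
    refine (enorm_add_le _ _).trans (add_le_add_left ?_ _)
    exact enorm_integral_inner_le hS l hG i3 _ (fun i hi y hy => (cubeProj_sub hy).1 hi)
      (fun i hi y hy => (cubeProj_sub hy).2 hi)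
  have ind : ∀ n : ℕ, ‖∫ z in S, (inner ℝ (cubeProj S h k z) (G z) : ℝ)‖ₑ ≤
      ∑ j ∈ Finset.range n, T (k + j) +
        ‖∫ z in S, (inner ℝ (cubeProj S h (k + n) z) (G z) : ℝ)‖ₑ := fun n => by
    induction n with
    | zero => simp
    | succ n ih =>
      refine ih.trans ?_
      rw [Finset.sum_range_succ, add_assoc, Nat.cast_succ, ← add_assoc k]
      gcongr
      exact step _
  obtain ⟨n, rfl⟩ := Int.le.dest hk
  refine (ind n).trans ?_
  -- no cube of scale `N` is contained in `S`, so that the coarsest projection vanishes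
  have e0 : ∫ z in S, (inner ℝ (cubeProj S h (k + n) z) (G z) : ℝ) = 0 := by
    rw [integral_congr_ae (g := fun _ => (0 : ℝ)) (ae_of_all _ fun z => ?_), integral_zero]
    simp only [cubeProj, if_neg (hN _), inner_zero_left]
  rw [e0, enorm_zero, add_zero, ENNReal.tsum_prod']
  have e1 : ∑ j ∈ Finset.range n, T (k + j) =
      ∑ l ∈ (Finset.range n).map ⟨fun j : ℕ => k + (j : ℤ), fun a b hab => by simpa using hab⟩,
        T l := by
    rw [Finset.sum_map]
    rfl
  rw [e1]
  refine le_trans (Finset.sum_le_sum fun l hl => ?_) (ENNReal.sum_le_tsum _)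
  refine ENNReal.tsum_le_tsum fun i => ?_
  have hkl : k ≤ l := by
    obtain ⟨j, -, rfl⟩ := Finset.mem_map.1 hl
    exact le_add_of_nonneg_right (Int.natCast_nonneg j)
  by_cases hi : cell l i ⊆ S
  · have : (l, i) ∈ cubesIn S k := ⟨hkl, hi⟩
    rw [indicator_of_mem this, indicator_of_mem (s := {i | cell l i ⊆ S}) hi]
  · rw [indicator_of_notMem (s := {i | cell l i ⊆ S}) hi]
    exact zero_le

lemma tsum_mul_sq_le {ι : Type*} (a b : ι → ℝ≥0∞) :
    (∑' x, a x * b x) ^ 2 ≤ (∑' x, a x ^ 2) * ∑' x, b x ^ 2 := by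
  have key : ∀ s : Finset ι, ∑ x ∈ s, a x * b x ≤
      ((∑' x, a x ^ 2) * ∑' x, b x ^ 2) ^ (1 / 2 : ℝ) := fun s => by
    have := ENNReal.inner_le_Lp_mul_Lq s a b (p := 2) (q := 2) (by constructor <;> norm_num)
    refine this.trans ?_
    rw [ENNReal.mul_rpow_of_nonneg _ _ (by norm_num)]
    simp only [ENNReal.rpow_two]
    gcongr
    · exact ENNReal.sum_le_tsum _
    · exact ENNReal.sum_le_tsum _
  have h : ∑' x, a x * b x ≤ ((∑' x, a x ^ 2) * ∑' x, b x ^ 2) ^ (1 / 2 : ℝ) := by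
    rw [ENNReal.tsum_eq_iSup_sum]
    exact iSup_le key
  calc _ ≤ (((∑' x, a x ^ 2) * ∑' x, b x ^ 2) ^ (1 / 2 : ℝ)) ^ 2 := by gcongr
    _ = _ := by
      rw [← ENNReal.rpow_two, ← ENNReal.rpow_mul]
      norm_num

/-- The weight `3^{2sk}` of the scale `k`. -/
def wt (s : ℝ) (k : ℤ) : ℝ≥0∞ := (3 : ℝ≥0∞) ^ (2 * s * (k : ℝ))

lemma wt_ne_zero (s : ℝ) (k : ℤ) : wt s k ≠ 0 :=
  (ENNReal.rpow_pos (by norm_num) (by norm_num)).ne'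

lemma wt_ne_top (s : ℝ) (k : ℤ) : wt s k ≠ ⊤ :=
  ENNReal.rpow_ne_top_of_ne_zero (by norm_num) (by norm_num)

/-- The sum of the weighted squares of the increments over all triadic cubes in `S`. -/
def incSum (s : ℝ) (S : Set (SpaceTime d)) (h : SpaceTime d → Space d) : ℝ≥0∞ :=
  ∑' x : ℤ × Idx d, {x : ℤ × Idx d | cell x.1 x.2 ⊆ S}.indicator
    (fun x => (wt s x.1)⁻¹ * ENNReal.ofReal (cubeVol d x.1) * ‖cubeInc S h x.1 x.2‖ₑ ^ 2) x

/-- The duality between increments and integrals over triadic cubes. -/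
theorem enorm_integral_inner_cubeProj_sq_le (s : ℝ) (hS : MeasurableSet S) (hh : IntegrableOn h S)
    (hG : IntegrableOn G S) {N : ℤ} (hN : ∀ i, ¬ cell N i ⊆ S) (k : ℤ) (hk : k ≤ N)
    (β : ℤ → ℝ≥0∞) (R : ℤ → Idx d → ℝ≥0∞) (B : ℝ≥0∞)
    (hR : ∀ l, ∑' i, {i | cell l i ⊆ S}.indicator (R l) i ≤ B)
    (hI : ∀ l i, k ≤ l → cell l i ⊆ S → cubeInc S h l i ≠ 0 → ‖∫ z in cell l i, G z‖ₑ ^ 2 ≤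
      ENNReal.ofReal (cubeVol d l) * β l * R l i) :
    ‖∫ z in S, (inner ℝ (cubeProj S h k z) (G z) : ℝ)‖ₑ ^ 2 ≤
      incSum s S h * (∑' l, wt s l * β l) * B := by
  set v : ℤ → ℝ≥0∞ := fun l => ENNReal.ofReal (cubeVol d l)
  set A : ℤ × Idx d → ℝ≥0∞ := {x : ℤ × Idx d | cell x.1 x.2 ⊆ S}.indicator
    (fun x => (wt s x.1)⁻¹ * v x.1 * ‖cubeInc S h x.1 x.2‖ₑ ^ 2) with hA
  set b : ℤ × Idx d → ℝ≥0∞ := {x : ℤ × Idx d | cell x.1 x.2 ⊆ S}.indicator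
    (fun x => wt s x.1 * β x.1 * R x.1 x.2) with hb
  have hb' : ∑' x, b x ≤ (∑' l, wt s l * β l) * B := by
    rw [ENNReal.tsum_prod', ← ENNReal.tsum_mul_right]
    refine ENNReal.tsum_le_tsum fun l => ?_
    refine le_trans (le_of_eq ?_) (mul_le_mul_right (hR l) (wt s l * β l))
    rw [← ENNReal.tsum_mul_left]
    refine tsum_congr fun i => ?_
    by_cases hi : cell l i ⊆ S
    · have h1 : (l, i) ∈ {x : ℤ × Idx d | cell x.1 x.2 ⊆ S} := hi
      rw [hb, indicator_of_mem h1, indicator_of_mem (s := {i | cell l i ⊆ S}) hi]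
    · have h1 : (l, i) ∉ {x : ℤ × Idx d | cell x.1 x.2 ⊆ S} := hi
      rw [hb, indicator_of_notMem h1, indicator_of_notMem (s := {i | cell l i ⊆ S}) hi, mul_zero]
  -- Cauchy-Schwarz, the weights `wt s l` and `(wt s l)⁻¹` being shared between the two factors
  calc ‖∫ z in S, (inner ℝ (cubeProj S h k z) (G z) : ℝ)‖ₑ ^ 2
      ≤ (∑' x, (A x) ^ (1 / 2 : ℝ) * (b x) ^ (1 / 2 : ℝ)) ^ 2 := by
        gcongr
        refine (enorm_integral_inner_cubeProj_le hS hh hG hN k hk).trans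
          (ENNReal.tsum_le_tsum fun x => ?_)
        by_cases hx : x ∈ cubesIn S k
        · have hx' : x ∈ {x : ℤ × Idx d | cell x.1 x.2 ⊆ S} := hx.2
          rw [indicator_of_mem hx, hA, hb, indicator_of_mem hx', indicator_of_mem hx']
          by_cases h0 : cubeInc S h x.1 x.2 = 0
          · simp [h0]
          · rw [← ENNReal.mul_rpow_of_nonneg _ _ (by norm_num)]
            have e : (wt s x.1)⁻¹ * v x.1 * ‖cubeInc S h x.1 x.2‖ₑ ^ 2 *
                (wt s x.1 * β x.1 * R x.1 x.2) =
                ‖cubeInc S h x.1 x.2‖ₑ ^ 2 * (v x.1 * β x.1 * R x.1 x.2) := by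
              calc _ = ((wt s x.1)⁻¹ * wt s x.1) * (‖cubeInc S h x.1 x.2‖ₑ ^ 2 *
                    (v x.1 * β x.1 * R x.1 x.2)) := by ring
                _ = _ := by rw [ENNReal.inv_mul_cancel (wt_ne_zero _ _) (wt_ne_top _ _), one_mul]
            rw [e]
            calc _ = ((‖cubeInc S h x.1 x.2‖ₑ * ‖∫ z in cell x.1 x.2, G z‖ₑ) ^ 2) ^
                  (1 / 2 : ℝ) := by
                  rw [← ENNReal.rpow_two, ← ENNReal.rpow_mul]
                  norm_num
              _ ≤ _ := by
                  rw [mul_pow]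
                  gcongr
                  exact hI x.1 x.2 hx.1 hx.2 h0
        · rw [indicator_of_notMem hx]
          exact zero_le
    _ ≤ (∑' x, ((A x) ^ (1 / 2 : ℝ)) ^ 2) * ∑' x, ((b x) ^ (1 / 2 : ℝ)) ^ 2 := tsum_mul_sq_le _ _
    _ = (∑' x, A x) * ∑' x, b x := by
        congr 1 <;> refine tsum_congr fun x => ?_ <;>
        · rw [← ENNReal.rpow_two, ← ENNReal.rpow_mul]
          norm_num
    _ ≤ incSum s S h * ((∑' l, wt s l * β l) * B) := by
        gcongr
        exact le_rfl
    _ = _ := (mul_assoc _ _ _).symm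

/-- Averaging over triadic cubes is self-adjoint. -/
lemma integral_inner_cubeProj_comm (hS : MeasurableSet S) (hh : IntegrableOn h S)
    (hG : IntegrableOn G S) (k : ℤ) :
    ∫ z in S, (inner ℝ (cubeProj S h k z) (G z) : ℝ) =
      ∫ z in S, (inner ℝ (h z) (cubeProj S G k z) : ℝ) := by
  have key : ∀ {h G : SpaceTime d → Space d}, IntegrableOn h S → IntegrableOn G S → ∀ i,
      ∫ z in S ∩ cell k i, (inner ℝ (cubeProj S h k z) (G z) : ℝ) =
        {i | cell k i ⊆ S}.indicator (fun i => cubeVol d k *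
          (inner ℝ (⨍ z in cell k i, h z) (⨍ z in cell k i, G z) : ℝ)) i := by
    intro h G hh hG i
    by_cases hi : cell k i ⊆ S
    · rw [indicator_of_mem (s := {i | cell k i ⊆ S}) hi, inter_eq_self_of_subset_right hi,
        setIntegral_congr_fun (measurableSet_cell k i)
        (g := fun z => (inner ℝ (⨍ z in cell k i, h z) (G z) : ℝ))
        fun z hz => by simp only [cubeProj_of_mem hi hz], integral_inner (hG.mono_set hi),
        setAverage_eq (f := G), volume_real_cell, inner_smul_right,
        mul_inv_cancel_left₀ (cubeVol_pos d k).ne']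
    · rw [indicator_of_notMem (s := {i | cell k i ⊆ S}) hi,
        setIntegral_congr_fun (hS.inter (measurableSet_cell k i))
        (g := fun z => (0 : ℝ)) fun z hz => by
          simp only [cubeProj_of_mem' hi hz.2, inner_zero_left], integral_zero]
  have i1 := integrableOn_inner_cubeProj hh hG k
  have i2 := integrableOn_inner_cubeProj hG hh k
  have e : ∫ z in S, (inner ℝ (h z) (cubeProj S G k z) : ℝ) =
      ∫ z in S, (inner ℝ (cubeProj S G k z) (h z) : ℝ) :=
    integral_congr_ae (ae_of_all _ fun z => real_inner_comm _ _)
  rw [e, ← (hasSum_integral_cell k hS i1).tsum_eq, ← (hasSum_integral_cell k hS i2).tsum_eq]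
  refine tsum_congr fun i => ?_
  rw [key hh hG, key hG hh]
  refine congrArg (fun F : Idx d → ℝ => {i | cell k i ⊆ S}.indicator F i) (funext fun i => ?_)
  rw [real_inner_comm]

lemma norm_average_sub_le {V : Set (SpaceTime d)} (hV0 : volume V ≠ 0) (hV : volume V ≠ ⊤)
    (hh : IntegrableOn h V) {c : Space d} {δ : ℝ}
    (hc : ∀ z ∈ V, ‖h z - c‖ ≤ δ) :
    ‖(⨍ z in V, h z) - c‖ ≤ δ := by
  have hr : 0 < volume.real V := ENNReal.toReal_pos hV0 hV
  have hci : IntegrableOn (fun _ : SpaceTime d => c) V := integrableOn_const hV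
  have e : (⨍ z in V, h z) - c = (volume.real V)⁻¹ • ∫ z in V, (h z - c) := by
    rw [integral_sub hh hci, setIntegral_const, smul_sub, smul_smul, inv_mul_cancel₀ hr.ne',
      one_smul, setAverage_eq]
  rw [e, norm_smul, norm_inv, Real.norm_of_nonneg hr.le]
  have := norm_setIntegral_le_of_norm_le_const hV.lt_top hc
  rw [inv_mul_le_iff₀ hr, mul_comm]
  exact this

/-- Averages of continuous functions over small cubes converge. -/
lemma ae_tendsto_cubeProj (hS : IsOpen S) (hh : Continuous h) :
    ∀ᵐ y ∂(volume.restrict S), Tendsto (fun k => cubeProj S h k y) atBot (𝓝 (h y)) := by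
  filter_upwards [ae_restrict_of_ae ae_mem_cell, ae_restrict_mem hS.measurableSet] with y hy hyS
  rw [Metric.tendsto_nhds]
  intro ε hε
  have hV : S ∩ {z | ‖h z - h y‖ < ε / 2} ∈ 𝓝 y := by
    refine inter_mem (hS.mem_nhds hyS) ?_
    have : IsOpen {z | ‖h z - h y‖ < ε / 2} := isOpen_lt (by fun_prop) continuous_const
    refine this.mem_nhds ?_
    simpa using hε
  filter_upwards [eventually_cell_subset hV] with k hk
  have hk := hk _ (hy k)
  rw [cubeProj_of_mem (hk.trans inter_subset_left) (hy k), dist_eq_norm]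
  have hi : IntegrableOn h (cell k (idx k y)) volume := ((hh.locallyIntegrable (μ := volume)).integrableOn_isCompact
    (isBounded_cell k _).isCompact_closure).mono_set subset_closure
  exact lt_of_le_of_lt (norm_average_sub_le (volume_cell_ne_zero _ _)
    (isBounded_cell k (idx k y)).measure_lt_top.ne hi
    (fun z hz => (hk hz).2.le)) (half_lt_self hε)

lemma norm_cubeProj_le_of_bound {C : ℝ} (hC : 0 ≤ C) (hSv : ∀ z ∈ S, ‖h z‖ ≤ C)
    (k : ℤ) (y : SpaceTime d) : ‖cubeProj S h k y‖ ≤ C := by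
  rw [cubeProj]
  split_ifs with hi
  · have hr : 0 < volume.real (cell k (idx k y)) := by
      rw [volume_real_cell]; exact cubeVol_pos d k
    have := norm_setIntegral_le_of_norm_le_const
      ((isBounded_cell k (idx k y)).measure_lt_top (μ := volume)) fun z hz => hSv z (hi hz)
    rw [setAverage_eq, norm_smul, norm_inv, Real.norm_of_nonneg hr.le, inv_mul_le_iff₀ hr, mul_comm]
    exact this
  · simpa using hC

/-- Averages over small cubes approximate continuous functions. -/
lemma tendsto_integral_inner_cubeProj (hS : IsOpen S) (hb : Bornology.IsBounded S)
    (hh : Continuous h) (hG : IntegrableOn G S) :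
    Tendsto (fun k => ∫ z in S, (inner ℝ (cubeProj S h k z) (G z) : ℝ)) atBot
      (𝓝 (∫ z in S, (inner ℝ (h z) (G z) : ℝ))) := by
  obtain ⟨C, hC⟩ := (hb.isCompact_closure.image_of_continuousOn hh.norm.continuousOn).bddAbove
  have hC' : ∀ z ∈ S, ‖h z‖ ≤ max C 0 := fun z hz =>
    (hC (mem_image_of_mem _ (subset_closure hz))).trans (le_max_left _ _)
  refine tendsto_integral_filter_of_dominated_convergence (fun z => max C 0 * ‖G z‖)
    (Eventually.of_forall fun k => (measurable_cubeProj S h k).aestronglyMeasurable.inner hG.1)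
    (Eventually.of_forall fun k => ae_of_all _ fun z => ?_) (hG.norm.const_mul _) ?_
  · refine (norm_inner_le_norm _ _).trans ?_
    gcongr
    exact norm_cubeProj_le_of_bound (le_max_right _ _) hC' k z
  · filter_upwards [ae_tendsto_cubeProj hS hh] with y hy
    exact hy.inner tendsto_const_nhds

end Averages

/-! ### Solutions with a right-hand side on triadic cubes -/

section LocalEstimate

variable {d : ℕ} {a : SpaceTime d → Matrix (Fin d) (Fin d) ℝ} {Q S : Set (SpaceTime d)}
  {f G : SpaceTime d → Space d}

/-- The energy `∫_S G · s G`, with values in `[0, ∞]`. -/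
def energy (a : SpaceTime d → Matrix (Fin d) (Fin d) ℝ) (G : SpaceTime d → Space d)
    (S : Set (SpaceTime d)) : ℝ≥0∞ :=
  ∫⁻ z in S, ENNReal.ofReal (edens a G z)

lemma ofReal_integral_edens (ha : IsCoefficientField a) (h : IntegrableOn (edens a G) S) :
    ENNReal.ofReal (∫ z in S, edens a G z) = energy a G S :=
  ofReal_integral_eq_lintegral_ofReal h (ae_of_all _ (ha.edens_nonneg G))

lemma tsum_energy_le (hS : MeasurableSet S) (l : ℤ) :
    ∑' i, {i | cell l i ⊆ S}.indicator (fun i => energy a G (cell l i)) i ≤ energy a G S := by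
  unfold energy
  rw [lintegral_eq_tsum_cell l hS]
  refine ENNReal.tsum_le_tsum fun i => ?_
  by_cases hi : cell l i ⊆ S
  · rw [indicator_of_mem (s := {i | cell l i ⊆ S}) hi, inter_eq_self_of_subset_right hi]
  · rw [indicator_of_notMem (s := {i | cell l i ⊆ S}) hi]
    exact zero_le

/-- The weighted sum of the squared differences between the averages of `f` over the triadic cubes
and over their parents, for all parents contained in `S`. -/
def oscSum (s : ℝ) (S : Set (SpaceTime d)) (f : SpaceTime d → Space d) : ℝ≥0∞ :=
  ∑' x : ℤ × Idx d, {x : ℤ × Idx d | cell (x.1 + 1) (par x.2) ⊆ S}.indicator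
    (fun x => (wt s x.1)⁻¹ * ENNReal.ofReal (cubeVol d x.1) *
      ‖(⨍ z in cell x.1 x.2, f z) - ⨍ z in cell (x.1 + 1) (par x.2), f z‖ₑ ^ 2) x

lemma oscSum_mono (s : ℝ) {S' : Set (SpaceTime d)} (h : S ⊆ S') : oscSum s S f ≤ oscSum s S' f :=
  ENNReal.tsum_le_tsum fun x => indicator_le_indicator_of_subset
    (fun _ hx => Subset.trans hx h) (fun _ => zero_le) x

lemma tsum_oscSum_le (s : ℝ) (l : ℤ) (S : Set (SpaceTime d)) (f : SpaceTime d → Space d) :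
    ∑' i, {i | cell l i ⊆ S}.indicator (fun i => oscSum s (cell l i) f) i ≤ oscSum s S f := by
  set F : ℤ × Idx d → ℝ≥0∞ := fun x => (wt s x.1)⁻¹ * ENNReal.ofReal (cubeVol d x.1) *
      ‖(⨍ z in cell x.1 x.2, f z) - ⨍ z in cell (x.1 + 1) (par x.2), f z‖ₑ ^ 2 with hF
  have e : ∀ i, {i | cell l i ⊆ S}.indicator (fun i => oscSum s (cell l i) f) i =
      ∑' x, {i | cell l i ⊆ S}.indicator (fun i =>
        {x : ℤ × Idx d | cell (x.1 + 1) (par x.2) ⊆ cell l i}.indicator F x) i := fun i => by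
    by_cases hi : cell l i ⊆ S
    · simp only [indicator_of_mem (s := {i | cell l i ⊆ S}) hi]
      rfl
    · simp only [indicator_of_notMem (s := {i | cell l i ⊆ S}) hi, tsum_zero]
  simp only [e]
  rw [ENNReal.tsum_comm]
  refine ENNReal.tsum_le_tsum fun x => ?_
  -- at most one cube of scale `l` contains the parent of `x`
  rw [tsum_eq_single (idx l (ctr (x.1 + 1) (par x.2)))]
  · by_cases h1 : cell l (idx l (ctr (x.1 + 1) (par x.2))) ⊆ S
    · rw [indicator_of_mem (s := {i | cell l i ⊆ S}) h1]
      exact indicator_le_indicator_of_subset (fun y hy => Subset.trans hy h1)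
        (fun _ => zero_le) x
    · rw [indicator_of_notMem (s := {i | cell l i ⊆ S}) h1]
      exact zero_le
  · intro i hi
    have : x ∉ {x : ℤ × Idx d | cell (x.1 + 1) (par x.2) ⊆ cell l i} := fun hx =>
      hi (idx_eq_of_mem (hx (ctr_mem_cell _ _))).symm
    by_cases h1 : cell l i ⊆ S
    · rw [indicator_of_mem (s := {i | cell l i ⊆ S}) h1, indicator_of_notMem this]
    · rw [indicator_of_notMem (s := {i | cell l i ⊆ S}) h1]

lemma average_sub_const {V : Set (SpaceTime d)} (hV0 : volume V ≠ 0) (hV : volume V ≠ ⊤)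
    (hf : IntegrableOn f V) (c : Space d) : ⨍ z in V, (f z - c) = (⨍ z in V, f z) - c := by
  have hr : 0 < volume.real V := ENNReal.toReal_pos hV0 hV
  rw [setAverage_eq, setAverage_eq, integral_sub hf (integrableOn_const hV), setIntegral_const,
    smul_sub, smul_smul, inv_mul_cancel₀ hr.ne', one_smul]

lemma average_cell_sub_const {k : ℤ} {i : Idx d} (hf : IntegrableOn f (cell k i)) (c : Space d) :
    ⨍ z in cell k i, (f z - c) = (⨍ z in cell k i, f z) - c :=
  average_sub_const (volume_cell_ne_zero _ _) (isBounded_cell k i).measure_lt_top.ne hf c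

lemma cubeVol_lt {k n : ℤ} (h : k < n) : cubeVol d k < cubeVol d n := by
  obtain ⟨p, rfl⟩ := Int.le.dest h.le
  have hp : p ≠ 0 := by rintro rfl; simp at h
  rw [cubeVol_add]
  exact lt_mul_of_one_lt_left (cubeVol_pos d k)
    (one_lt_pow₀ (one_lt_pow₀ (by norm_num) (by omega)) hp)

lemma scale_le_of_subset {l n : ℤ} {i j : Idx d} (h : cell l i ⊆ cell n j) : l ≤ n := by
  by_contra! hl
  have := measure_mono (μ := volume) h
  rw [volume_cell, volume_cell, ENNReal.ofReal_le_ofReal_iff (cubeVol_pos d n).le] at this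
  exact absurd (cubeVol_lt (d := d) hl) this.not_gt

lemma par_subset_of_subset {l n : ℤ} {i j : Idx d} (h : cell l i ⊆ cell n j) (hl : l < n) :
    cell (l + 1) (par i) ⊆ cell n j :=
  cell_subset_of_inter (by omega) ⟨_, cell_subset_par l i (ctr_mem_cell l i), h (ctr_mem_cell l i)⟩

/-- On a cube `Q`, subtracting the mean of `f` turns the increments into differences of averages
over a cube and its parent, without a contribution of `Q` itself. -/
lemma cubeInc_cell {l n : ℤ} {i j : Idx d}
    (hf : IntegrableOn f (cell n j)) (h : cell l i ⊆ cell n j) :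
    (l < n → cubeInc (cell n j) (fun z => f z - ⨍ y in cell n j, f y) l i =
      (⨍ z in cell l i, f z) - ⨍ z in cell (l + 1) (par i), f z) ∧
    (¬ l < n → cubeInc (cell n j) (fun z => f z - ⨍ y in cell n j, f y) l i = 0) := by
  constructor
  · intro hl
    have hp := par_subset_of_subset h hl
    rw [cubeInc, if_pos hp, average_cell_sub_const (hf.mono_set h),
      average_cell_sub_const (hf.mono_set hp), sub_sub_sub_cancel_right]
  · intro hl
    obtain rfl : l = n := le_antisymm (scale_le_of_subset h) (not_lt.1 hl)
    have hij : i = j := (idx_eq_of_mem (ctr_mem_cell l i)).symm.trans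
      (idx_eq_of_mem (h (ctr_mem_cell l i)))
    have hp : ¬ cell (l + 1) (par i) ⊆ cell l j := fun hp => by
      have := scale_le_of_subset hp
      omega
    rw [cubeInc, if_neg hp, hij, average_cell_sub_const hf, sub_self, sub_zero]

lemma incSum_cell_le (s : ℝ) {n : ℤ} {j : Idx d} (hf : IntegrableOn f (cell n j)) :
    incSum s (cell n j) (fun z => f z - ⨍ y in cell n j, f y) ≤ oscSum s (cell n j) f := by
  refine ENNReal.tsum_le_tsum fun x => ?_
  by_cases hx : cell x.1 x.2 ⊆ cell n j
  · rw [indicator_of_mem (s := {x : ℤ × Idx d | cell x.1 x.2 ⊆ cell n j}) hx]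
    by_cases hl : x.1 < n
    · have hp : x ∈ {x : ℤ × Idx d | cell (x.1 + 1) (par x.2) ⊆ cell n j} :=
        par_subset_of_subset hx hl
      rw [indicator_of_mem hp, (cubeInc_cell hf hx).1 hl]
    · rw [(cubeInc_cell hf hx).2 hl]
      simp
  · rw [indicator_of_notMem (s := {x : ℤ × Idx d | cell x.1 x.2 ⊆ cell n j}) hx]
    exact zero_le

lemma ofReal_integral_edens_sub_le (ha : IsCoefficientField a) {G' : SpaceTime d → Space d}
    (hG : AEStronglyMeasurable G (volume.restrict Q))
    (hG' : AEStronglyMeasurable G' (volume.restrict Q)) (he : IntegrableOn (edens a G) Q)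
    (he' : IntegrableOn (edens a G') Q) :
    ENNReal.ofReal (∫ z in Q, edens a (G - G') z) ≤ 2 * energy a G Q + 2 * energy a G' Q := by
  have h0 : ∀ G : SpaceTime d → Space d, 0 ≤ ∫ z in Q, edens a G z := fun G =>
    integral_nonneg (ha.edens_nonneg G)
  have : ∫ z in Q, edens a (G - G') z ≤ 2 * (∫ z in Q, edens a G z) + 2 * ∫ z in Q, edens a G' z := by
    have i1 : IntegrableOn (fun z => 2 * edens a G z) Q := he.const_mul 2
    have i2 : IntegrableOn (fun z => 2 * edens a G' z) Q := he'.const_mul 2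
    rw [← integral_const_mul, ← integral_const_mul, ← integral_add i1 i2]
    exact integral_mono (integrableOn_edens_sub ha hG hG' he he') (i1.add i2) fun z =>
      bil_symPart_sub_self_le (ha.pos z) _ _
  refine (ENNReal.ofReal_le_ofReal this).trans_eq ?_
  rw [ENNReal.ofReal_add (by have := h0 G; positivity) (by have := h0 G'; positivity),
    ENNReal.ofReal_mul (by norm_num), ENNReal.ofReal_mul (by norm_num),
    ofReal_integral_edens ha he, ofReal_integral_edens ha he']
  norm_num

section Comparison

variable (ha : IsCoefficientField a) (hQ : Bornology.IsBounded Q)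
  {F F' : SpaceTime d → Space d} {u h' : SpaceTime d → ℝ} {G' : SpaceTime d → Space d}
  {V : Submodule ℝ (Space d)}

include ha hQ

/-- The difference of a solution and a corrector whose right-hand sides differ by a constant is a
solution of the homogeneous equation. -/
lemma IsWeakSolution.sub_corrector (hF : IntegrableOn F Q) (hF' : IntegrableOn F' Q)
    (hu : IsWeakSolution a F Q u G) (hc : IsCorrector a F' Q V h' G') (c : Space d)
    (hFF : ∀ᵐ z ∂(volume.restrict Q), F z = F' z + c) :
    IsWeakSolution a 0 Q (u - h') (G - G') := by
  have h1 : IsWeakSolution a F Q h' G' := (hc.isWeakSolution ha hQ).congr_rhs fun φ hφ => by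
    have i1 := integrableOn_inner hF' hφ.continuous_spaceGrad hφ.hasCompactSupport_spaceGrad
    have i2 : IntegrableOn (fun z => (inner ℝ c (spaceGrad φ z) : ℝ)) Q :=
      integrableOn_inner (integrableOn_const hQ.measure_lt_top.ne) hφ.continuous_spaceGrad
        hφ.hasCompactSupport_spaceGrad
    have i3 : IntegrableOn (spaceGrad φ) Q :=
      (hφ.continuous_spaceGrad.integrable_of_hasCompactSupport
        hφ.hasCompactSupport_spaceGrad).integrableOn
    have e : ∫ z in Q, (inner ℝ (F z) (spaceGrad φ z) : ℝ) =
        ∫ z in Q, ((inner ℝ (F' z) (spaceGrad φ z) : ℝ) + inner ℝ c (spaceGrad φ z)) := by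
      refine integral_congr_ae ?_
      filter_upwards [hFF] with z hz
      rw [hz, inner_add_left]
    rw [e, integral_add i1 i2, integral_inner i3, hφ.integral_spaceGrad, inner_zero_right, add_zero]
  have := hu.sub ha hQ hF hF h1
  rwa [sub_self] at this

/-- Subtracting a solution whose gradient has zero mean makes the equation homogeneous without
changing the mean of the gradient, so that the coarse-grained matrix controls it. -/
lemma enorm_integral_grad_sq_le_of_corrector (hQ0 : volume Q ≠ 0) (hF : IntegrableOn F Q)
    (hF' : IntegrableOn F' Q) (hu : IsWeakSolution a F Q u G) (hc : IsCorrector a F' Q ⊥ h' G')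
    (c : Space d) (hFF : ∀ᵐ z ∂(volume.restrict Q), F z = F' z + c) :
    ‖∫ z in Q, G z‖ₑ ^ 2 ≤ volume Q * specNorm (sStarInv a Q) *
      (2 * energy a G Q + 2 * energy a G' Q) := by
  have hs := hu.sub_corrector ha hQ hF hF' hc c hFF
  have h1 := norm_integral_grad_sq_le ha hQ hQ0 hs
  have e : ∫ z in Q, (G - G') z = ∫ z in Q, G z := by
    have := integral_sub hu.isWeakGradient.integrableOn_grad hc.integrableOn_grad
    rw [hc.integral_grad_eq_zero ha hQ, sub_zero] at this
    exact this
  rw [e] at h1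
  refine h1.trans ?_
  gcongr
  exact ofReal_integral_edens_sub_le ha hu.isWeakGradient.integrableOn_grad.1
    hc.integrableOn_grad.1 hu.energy hc.energy

/-- The same for the flux, with a corrector whose flux, rather than gradient, has zero mean. -/
lemma enorm_integral_flux_sq_le_of_corrector (hQ0 : volume Q ≠ 0) (hF : IntegrableOn F Q)
    (hF' : IntegrableOn F' Q) (hu : IsWeakSolution a F Q u G) (hc : IsCorrector a F' Q ⊤ h' G')
    (h0 : ∫ z in Q, F' z = 0)
    (c : Space d) (hFF : ∀ᵐ z ∂(volume.restrict Q), F z = F' z + c) :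
    ‖∫ z in Q, flux a G z‖ₑ ^ 2 ≤ volume Q * specNorm (bMat a Q) *
      (2 * energy a G Q + 2 * energy a G' Q) := by
  have hs := hu.sub_corrector ha hQ hF hF' hc c hFF
  have h1 := norm_integral_flux_sq_le ha hQ hQ0 hs
  have i1 := hu.integrableOn_flux ha hQ
  have i2 := (hc.isWeakSolution ha hQ).integrableOn_flux ha hQ
  have e0 : ∫ z in Q, flux a G' z = 0 := by
    refine ext_inner_left ℝ fun p => ?_
    rw [inner_zero_right, ← integral_inner i2 p]
    have h2 := hc.flux_eq (p := p) Submodule.mem_top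
    have h3 : ∫ z in Q, (inner ℝ (F' z) p : ℝ) = 0 := by
      have h4 := integral_inner (𝕜 := ℝ) hF' p
      rw [h0, inner_zero_right] at h4
      rw [← h4]
      exact integral_congr_ae (ae_of_all _ fun z => real_inner_comm _ _)
    rw [h3, neg_zero] at h2
    exact h2
  have e : ∫ z in Q, flux a (G - G') z = ∫ z in Q, flux a G z := by
    have h2 := integral_sub i1 i2
    rw [e0, sub_zero] at h2
    rw [← h2]
    refine integral_congr_ae (ae_of_all _ fun z => ?_)
    simp [flux]
  rw [e] at h1
  refine h1.trans ?_
  gcongr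
  exact ofReal_integral_edens_sub_le ha hu.isWeakGradient.integrableOn_grad.1
    hc.integrableOn_grad.1 hu.energy hc.energy

end Comparison

/-- Absorption of the energy of the corrector into the left-hand side of its estimate. -/
lemma le_four_mul_of_sq_le {E P : ℝ≥0∞} (hE : E ≠ ⊤) (hP : P ≠ ⊤)
    (h : E ^ 2 ≤ P * (2 * E + 8 * P)) : E ≤ 4 * P := by
  lift E to ℝ≥0 using hE
  lift P to ℝ≥0 using hP
  have h' : (E : ℝ) ^ 2 ≤ P * (2 * E + 8 * P) := by exact_mod_cast h
  have : (E : ℝ) ≤ 4 * P := by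
    by_contra! hlt
    nlinarith [E.coe_nonneg, P.coe_nonneg]
  exact_mod_cast this

section Existence

variable (ha : IsCoefficientField a) (hd : 0 < d) (s : ℝ) (σ : ℤ → ℝ≥0∞)

include ha hd

/-- Correctors for right-hand sides which are constant on triadic cubes of a small scale, with an
energy bound not depending on that scale: on the smaller cubes the solution is compared with
the correctors already constructed there. -/
theorem exists_isCorrector_cubeProj (m : ℕ) : ∀ (V : Submodule ℝ (Space d)) (n : ℤ) (j : Idx d)
    (_ : ∀ l i, cell l i ⊆ cell n j → specNorm (sStarInv a (cell l i)) ≤ σ l)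
    (_ : IntegrableOn f (cell n j)) (_ : (∑' l, wt s l * σ l) * oscSum s (cell n j) f ≠ ⊤),
    ∃ h G, IsCorrector a (cubeProj (cell n j) (fun z => f z - ⨍ y in cell n j, f y) (n - m))
      (cell n j) V h G ∧
      energy a G (cell n j) ≤ 4 * ((∑' l, wt s l * σ l) * oscSum s (cell n j) f) := by
  induction m using Nat.strong_induction_on with
  | _ m ih =>
  intro V n j hσ hf hfin
  set Sig := ∑' l, wt s l * σ l with hSig
  set Q := cell n j with hQdef
  set g : SpaceTime d → Space d := fun z => f z - ⨍ y in Q, f y with hg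
  have hQ : Bornology.IsBounded Q := isBounded_cell n j
  have hQm : MeasurableSet Q := measurableSet_cell n j
  have hgi : IntegrableOn g Q := hf.sub (integrableOn_const hQ.measure_lt_top.ne)
  have hPi := integrableOn_cubeProj (k := n - m) hQ.measure_lt_top.ne hgi
  obtain ⟨h, G, hc, hE⟩ := exists_isCorrector ha hQ hd hQm V hPi
    (HasDualWeight.of_bounded ha hQ (norm_cubeProj_le hgi (n - m)))
  -- the a priori finiteness of the energy, with no uniform bound, is what permits the absorption
  refine ⟨h, G, hc, le_four_mul_of_sq_le ?_ hfin ?_⟩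
  · rw [← ofReal_integral_edens ha hc.energy]
    exact ENNReal.ofReal_ne_top
  have h1 : energy a G Q ≤ ‖∫ z in Q, (inner ℝ (cubeProj Q g (n - m) z) (G z) : ℝ)‖ₑ := by
    rw [← ofReal_integral_edens ha hc.energy, ← enorm_neg]
    refine (ENNReal.ofReal_le_ofReal hE).trans ?_
    exact Real.ofReal_le_enorm _
  have hN : ∀ i, ¬ cell (n + 1) i ⊆ Q := fun i hi => by
    have := scale_le_of_subset hi
    omega
  have h2 := enorm_integral_inner_cubeProj_sq_le s hQm hgi hc.integrableOn_grad hN (n - m)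
    (by omega) σ (fun l i => 2 * energy a G (cell l i) + 8 * (Sig * oscSum s (cell l i) f))
    (2 * energy a G Q + 8 * (Sig * oscSum s Q f)) (fun l => ?_) (fun l i hl hi h0 => ?_)
  · calc energy a G Q ^ 2 ≤ _ := pow_le_pow_left' h1 2
      _ ≤ _ := h2
      _ ≤ oscSum s Q f * Sig * (2 * energy a G Q + 8 * (Sig * oscSum s Q f)) := by
        gcongr
        exact incSum_cell_le s hf
      _ = _ := by rw [mul_comm Sig]
  · have e : ∀ i, {i | cell l i ⊆ Q}.indicator
        (fun i => 2 * energy a G (cell l i) + 8 * (Sig * oscSum s (cell l i) f)) i =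
        2 * {i | cell l i ⊆ Q}.indicator (fun i => energy a G (cell l i)) i +
        8 * (Sig * {i | cell l i ⊆ Q}.indicator (fun i => oscSum s (cell l i) f) i) := fun i => by
      by_cases hi : cell l i ⊆ Q
      · simp only [indicator_of_mem (s := {i | cell l i ⊆ Q}) hi]
      · simp only [indicator_of_notMem (s := {i | cell l i ⊆ Q}) hi, mul_zero, add_zero]
    simp only [e]
    rw [ENNReal.tsum_add, ENNReal.tsum_mul_left, ENNReal.tsum_mul_left, ENNReal.tsum_mul_left]
    gcongr
    · exact tsum_energy_le hQm l
    · exact tsum_oscSum_le s l Q f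
  -- the mean of `G` over a smaller cube is bounded by the induction hypothesis, which gives
  -- a corrector there for the same right-hand side up to a constant
  · have hln : l < n := by
      by_contra hl'
      exact h0 ((cubeInc_cell hf hi).2 hl')
    have hsub : oscSum s (cell l i) f ≤ oscSum s Q f := oscSum_mono s hi
    have hfin' : Sig * oscSum s (cell l i) f ≠ ⊤ :=
      ne_top_of_le_ne_top hfin (by gcongr)
    obtain ⟨h', G', hc', hE'⟩ := ih (l - (n - m)).toNat (by omega) ⊥ l i
      (fun l' i' hi' => hσ l' i' (hi'.trans hi)) (hf.mono_set hi) hfin'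
    have ek : l - ((l - (n - m)).toNat : ℤ) = n - m := by omega
    rw [ek] at hc'
    have hgi' : IntegrableOn (fun z => f z - ⨍ y in cell l i, f y) (cell l i) :=
      (hf.mono_set hi).sub (integrableOn_const (isBounded_cell l i).measure_lt_top.ne)
    have key := enorm_integral_grad_sq_le_of_corrector ha (isBounded_cell l i)
      (volume_cell_ne_zero l i) (hPi.mono_set hi)
      (integrableOn_cubeProj (isBounded_cell l i).measure_lt_top.ne hgi' _)
      ((hc.isWeakSolution ha hQ).mono hi) hc' ((⨍ y in cell l i, f y) - ⨍ y in Q, f y) (by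
        filter_upwards [ae_restrict_of_ae ae_mem_cell,
          ae_restrict_mem (measurableSet_cell l i)] with y hy hyl
        have hs : cell (n - m) (idx (n - m) y) ⊆ cell l i :=
          cell_subset_of_inter hl ⟨y, hy _, hyl⟩
        rw [cubeProj_of_mem (hs.trans hi) (hy _), cubeProj_of_mem hs (hy _),
          average_cell_sub_const (hf.mono_set (hs.trans hi)),
          average_cell_sub_const (hf.mono_set (hs.trans hi))]
        abel)
    rw [volume_cell] at key
    refine key.trans (mul_le_mul' (mul_le_mul_right (hσ l i hi) _) (add_le_add_right ?_ _))
    calc 2 * energy a G' (cell l i) ≤ 2 * (4 * (Sig * oscSum s (cell l i) f)) := by gcongr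
      _ = _ := by rw [← mul_assoc]; norm_num

/-- Correctors for the right-hand side `f - (f)_Q` on a triadic cube `Q`. -/
theorem exists_isCorrector_cell (V : Submodule ℝ (Space d)) (n : ℤ) (j : Idx d)
    (hσ : ∀ l i, cell l i ⊆ cell n j → specNorm (sStarInv a (cell l i)) ≤ σ l)
    (hf : IntegrableOn f (cell n j)) (hfin : (∑' l, wt s l * σ l) * oscSum s (cell n j) f ≠ ⊤) :
    ∃ h G, IsCorrector a (fun z => f z - ⨍ y in cell n j, f y) (cell n j) V h G ∧
      energy a G (cell n j) ≤ 4 * ((∑' l, wt s l * σ l) * oscSum s (cell n j) f) := by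
  set P := 4 * ((∑' l, wt s l * σ l) * oscSum s (cell n j) f) with hP
  have hP' : P ≠ ⊤ := ENNReal.mul_ne_top (by norm_num) hfin
  have hQ := isBounded_cell n j
  have hgi : IntegrableOn (fun z => f z - ⨍ y in cell n j, f y) (cell n j) :=
    hf.sub (integrableOn_const hQ.measure_lt_top.ne)
  choose h G hc hE using fun m => exists_isCorrector_cubeProj ha hd s σ m V n j hσ hf hfin
  obtain ⟨h', G', hc', hE'⟩ := exists_isCorrector_limit ha hQ hd (measurableSet_cell n j) hgi
    (fun m : ℕ => integrableOn_cubeProj hQ.measure_lt_top.ne hgi (n - m)) hc (P := P.toReal)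
    (fun m => by
      have := hE m
      rw [← ofReal_integral_edens ha (hc m).energy] at this
      exact (ENNReal.ofReal_le_iff_le_toReal hP').1 this) (fun w => by
        have hw := w.continuous_grad
        have hwi : IntegrableOn w.grad (cell n j) := w.integrableOn_grad hQ
        have t1 : Tendsto (fun m : ℕ => n - (m : ℤ)) atTop atBot := by
          simp only [sub_eq_add_neg]
          exact tendsto_atBot_add_const_left _ _
            (tendsto_neg_atTop_atBot.comp tendsto_natCast_atTop_atTop)
        have t2 := (tendsto_integral_inner_cubeProj (isOpen_cell n j) hQ hw hgi).comp t1
        have e : ∀ F : SpaceTime d → Space d, ∫ z in cell n j, (inner ℝ (F z) (w.grad z) : ℝ) =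
            ∫ z in cell n j, (inner ℝ (w.grad z) (F z) : ℝ) := fun F =>
          integral_congr_ae (ae_of_all _ fun z => real_inner_comm _ _)
        rw [e]
        refine t2.congr fun m => ?_
        rw [Function.comp_apply, integral_inner_cubeProj_comm (measurableSet_cell n j) hwi hgi,
          ← e])
  refine ⟨h', G', hc', ?_⟩
  rw [← ofReal_integral_edens ha hc'.energy]
  exact ENNReal.ofReal_le_of_le_toReal hE'

variable {u : SpaceTime d → ℝ} {n : ℤ} {j : Idx d}
  (hσ : ∀ l i, cell l i ⊆ cell n j → specNorm (sStarInv a (cell l i)) ≤ σ l)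
  (hf : IntegrableOn f (cell n j)) (hfin : (∑' l, wt s l * σ l) * oscSum s (cell n j) f ≠ ⊤)
  (hu : IsWeakSolution a f (cell n j) u G)

include hσ hf hfin hu

/-- The mean of the gradient of a solution with right-hand side over a triadic cube, in terms of the
energy of the solution and of the oscillations of the right-hand side in that cube. -/
theorem enorm_integral_grad_sq_le :
    ‖∫ z in cell n j, G z‖ₑ ^ 2 ≤ ENNReal.ofReal (cubeVol d n) *
      specNorm (sStarInv a (cell n j)) *
      (2 * energy a G (cell n j) + 8 * ((∑' l, wt s l * σ l) * oscSum s (cell n j) f)) := by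
  obtain ⟨h', G', hc, hE⟩ := exists_isCorrector_cell ha hd s σ ⊥ n j hσ hf hfin
  have hQ := isBounded_cell n j
  have key := enorm_integral_grad_sq_le_of_corrector ha hQ (volume_cell_ne_zero n j) hf
    (hf.sub (integrableOn_const hQ.measure_lt_top.ne)) hu hc (⨍ y in cell n j, f y)
    (ae_of_all _ fun z => by simp)
  rw [volume_cell] at key
  refine key.trans (mul_le_mul_right (add_le_add_right ?_ _) _)
  calc 2 * energy a G' (cell n j) ≤ 2 * (4 * _) := mul_le_mul_right hE 2
    _ = _ := by rw [← mul_assoc]; norm_num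

/-- The mean of the flux of a solution with right-hand side over a triadic cube. -/
theorem enorm_integral_flux_sq_le :
    ‖∫ z in cell n j, flux a G z‖ₑ ^ 2 ≤ ENNReal.ofReal (cubeVol d n) *
      specNorm (bMat a (cell n j)) *
      (2 * energy a G (cell n j) + 8 * ((∑' l, wt s l * σ l) * oscSum s (cell n j) f)) := by
  obtain ⟨h', G', hc, hE⟩ := exists_isCorrector_cell ha hd s σ ⊤ n j hσ hf hfin
  have hQ := isBounded_cell n j
  have h0 : ∫ z in cell n j, (f z - ⨍ y in cell n j, f y) = 0 := by
    have h1 := average_cell_sub_const hf (⨍ y in cell n j, f y)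
    rw [sub_self, setAverage_eq, smul_eq_zero, volume_real_cell, inv_eq_zero] at h1
    exact h1.resolve_left (cubeVol_pos d n).ne'
  have key := enorm_integral_flux_sq_le_of_corrector ha hQ (volume_cell_ne_zero n j) hf
    (hf.sub (integrableOn_const hQ.measure_lt_top.ne)) hu hc h0 (⨍ y in cell n j, f y)
    (ae_of_all _ fun z => by simp)
  rw [volume_cell] at key
  refine key.trans (mul_le_mul_right (add_le_add_right ?_ _) _)
  calc 2 * energy a G' (cell n j) ≤ 2 * (4 * _) := mul_le_mul_right hE 2
    _ = _ := by rw [← mul_assoc]; norm_num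

end Existence

end LocalEstimate

/-! ### Besov norms and increments over triadic cubes -/

section Besov

variable {d : ℕ} {D V W : Set (SpaceTime d)} {f g : SpaceTime d → Space d} {m : ℤ}

/-- The concentric enlargement by one scale of the triadic cube of scale `k` and index `i`. -/
def bigCell (k : ℤ) (i : Idx d) : Set (SpaceTime d) := cube (ctr k i) (k + 1)

/-- The closed triadic cubes. -/
def closedCell (k : ℤ) (i : Idx d) : Set (SpaceTime d) :=
  {y | |y.1 - (3 : ℝ) ^ (2 * k) * i.1| ≤ (3 : ℝ) ^ (2 * k) / 2 ∧
    ∀ l, |y.2 l - (3 : ℝ) ^ k * i.2 l| ≤ (3 : ℝ) ^ k / 2}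

/-- A parabolic neighbourhood of `y`, of the size of the cubes of scale `k`. -/
def box (y : SpaceTime d) (k : ℤ) : Set (SpaceTime d) :=
  {w | |w.1 - y.1| < (3 : ℝ) ^ (2 * k) ∧ ∀ l, |w.2 l - y.2 l| < (3 : ℝ) ^ k}

lemma zpow_succ_three (k : ℤ) : (3 : ℝ) ^ (k + 1) = 3 * 3 ^ k := by
  rw [zpow_add₀ (by norm_num), zpow_one, mul_comm]

lemma zpow_two_succ_three (k : ℤ) : (3 : ℝ) ^ (2 * (k + 1)) = 9 * 3 ^ (2 * k) := by
  rw [mul_add, zpow_add₀ (by norm_num), mul_comm]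
  norm_num

lemma mem_bigCell {k : ℤ} {i : Idx d} {y : SpaceTime d} : y ∈ bigCell k i ↔
    |y.1 - (3 : ℝ) ^ (2 * k) * i.1| < 9 * (3 : ℝ) ^ (2 * k) / 2 ∧
      ∀ l, |y.2 l - (3 : ℝ) ^ k * i.2 l| < 3 * (3 : ℝ) ^ k / 2 := by
  simp only [bigCell, cube, Set.mem_ofPred_eq, zpow_succ_three, zpow_two_succ_three]
  rfl

lemma cell_subset_closedCell (k : ℤ) (i : Idx d) : cell k i ⊆ closedCell k i := fun _ hy =>
  ⟨hy.1.le, fun l => (hy.2 l).le⟩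

lemma box_subset_bigCell {k : ℤ} {i : Idx d} {y : SpaceTime d} (hy : y ∈ closedCell k i) :
    box y k ⊆ bigCell k i := by
  intro w hw
  rw [mem_bigCell]
  have h1 := pow_pos' (2 * k)
  have h2 := pow_pos' k
  refine ⟨?_, fun l => ?_⟩
  · have a1 := abs_le.1 hy.1
    have a2 := abs_lt.1 hw.1
    rw [abs_lt]
    constructor <;> linarith
  · have a1 := abs_le.1 (hy.2 l)
    have a2 := abs_lt.1 (hw.2 l)
    rw [abs_lt]
    constructor <;> linarith

lemma cell_subset_bigCell (k : ℤ) (i : Idx d) : cell k i ⊆ bigCell k i := by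
  intro y hy
  rw [mem_bigCell]
  rw [mem_cell] at hy
  have h1 := pow_pos' (2 * k)
  have h2 := pow_pos' k
  exact ⟨hy.1.trans_le (by linarith), fun l => (hy.2 l).trans_le (by linarith)⟩

lemma bigCell_subset_par (k : ℤ) (i : Idx d) : bigCell k i ⊆ bigCell (k + 1) (par i) := by
  intro y hy
  have hc := cell_subset_par k i (ctr_mem_cell k i)
  rw [mem_bigCell] at hy ⊢
  rw [mem_cell] at hc
  have h1 := pow_pos' (2 * k)
  have h2 := pow_pos' k
  have e1 : (ctr k i).1 = (3 : ℝ) ^ (2 * k) * i.1 := rfl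
  have e2 : ∀ l, (ctr k i).2 l = (3 : ℝ) ^ k * i.2 l := fun l => rfl
  rw [zpow_two_succ_three, e1] at hc
  simp only [zpow_succ_three, e2] at hc
  rw [zpow_two_succ_three]
  simp only [zpow_succ_three]
  refine ⟨?_, fun l => ?_⟩
  · have a1 := abs_lt.1 hy.1
    have a2 := abs_lt.1 hc.1
    rw [abs_lt]
    constructor <;> linarith
  · have a1 := abs_lt.1 (hy.2 l)
    have a2 := abs_lt.1 (hc.2 l)
    rw [abs_lt]
    constructor <;> linarith

lemma isClosed_closedCell (k : ℤ) (i : Idx d) : IsClosed (closedCell k i) := by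
  have : closedCell k i = {y : SpaceTime d | |y.1 - (3 : ℝ) ^ (2 * k) * i.1| ≤ (3 : ℝ) ^ (2 * k) / 2} ∩
      ⋂ l, {y : SpaceTime d | |y.2 l - (3 : ℝ) ^ k * i.2 l| ≤ (3 : ℝ) ^ k / 2} := by
    ext y; simp [closedCell]
  rw [this]
  exact (isClosed_le (by fun_prop) (by fun_prop)).inter (isClosed_iInter fun l =>
    isClosed_le (by fun_prop) (by fun_prop))

lemma abs_sub_le_of_floor {c : ℝ} (y : ℝ) (hc : 0 < c) : |y - c * ⌊y / c + 1 / 2⌋| ≤ c / 2 := by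
  have e : y = c * (y / c) := by field_simp
  have h1 := Int.floor_le (y / c + 1 / 2)
  have h2 := Int.lt_floor_add_one (y / c + 1 / 2)
  rw [abs_le]
  constructor <;> nlinarith

lemma mem_closedCell_idx (k : ℤ) (y : SpaceTime d) : y ∈ closedCell k (idx k y) :=
  ⟨abs_sub_le_of_floor _ (by positivity), fun l => abs_sub_le_of_floor _ (by positivity)⟩

lemma cell_inter_nonempty {k : ℤ} {i : Idx d} {y : SpaceTime d} (hy : y ∈ closedCell k i)
    (hD : IsOpen D) (hyD : y ∈ D) : (cell k i ∩ D).Nonempty := by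
  set F : ℝ → SpaceTime d := fun t => ctr k i + t • (y - ctr k i) with hF
  have hFc : Continuous F := by fun_prop
  have h1 : F 1 = y := by simp [hF]
  have hev : ∀ᶠ t in 𝓝 (1 : ℝ), F t ∈ D := hFc.continuousAt.preimage_mem_nhds
    (by rw [h1]; exact hD.mem_nhds hyD)
  have := right_nhdsWithin_Ioo_neBot (zero_lt_one' ℝ)
  obtain ⟨t, ht1, htD⟩ := ((eventually_mem_nhdsWithin (s := Ioo (0 : ℝ) 1)).and
    ((hev.filter_mono nhdsWithin_le_nhds : ∀ᶠ t in 𝓝[Ioo 0 1] (1 : ℝ), F t ∈ D))).exists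
  refine ⟨F t, ?_, htD⟩
  have key : ∀ {x c : ℝ} (_ : 0 < c) (_ : |x| ≤ c / 2), |t * x| < c / 2 := fun {x c} hc hx => by
    rw [abs_mul, abs_of_pos ht1.1]
    rcases (abs_nonneg x).eq_or_lt with h | h
    · rw [← h, mul_zero]; linarith
    · nlinarith [ht1.2]
  constructor
  · have : (F t).1 - (ctr k i).1 = t * (y.1 - (ctr k i).1) := by simp [hF]
    rw [this]
    exact key (pow_pos' _) hy.1
  · intro l
    have : (F t).2 l - (ctr k i).2 l = t * (y.2 l - (ctr k i).2 l) := by simp [hF]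
    rw [this]
    exact key (pow_pos' _) (hy.2 l)

lemma cell_zero (k : ℤ) : cell k (0 : Idx d) = cube 0 k := by
  have : ctr k (0 : Idx d) = 0 := by
    refine Prod.ext (by simp [ctr]) ?_
    ext l
    simp [ctr]
  rw [cell, this]

/-! #### Jensen's inequality for mean square deviations -/

lemma volume_mul_enorm_average_sub_sq_le (hV0 : volume V ≠ 0) (hV : volume V ≠ ⊤)
    (hg : IntegrableOn g V) (c : Space d) :
    volume V * ‖(⨍ z in V, g z) - c‖ₑ ^ 2 ≤ ∫⁻ z in V, ‖g z - c‖ₑ ^ 2 := by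
  have hm : AEMeasurable (fun z => ‖g z - c‖ₑ) (volume.restrict V) :=
    (hg.1.sub aestronglyMeasurable_const).enorm
  have h1 : volume V * ‖(⨍ z in V, g z) - c‖ₑ ≤ ∫⁻ z in V, ‖g z - c‖ₑ := by
    rw [← average_sub_const hV0 hV hg, setAverage_eq, enorm_smul, ← mul_assoc]
    have e : volume V * ‖(volume.real V)⁻¹‖ₑ = 1 := by
      have hr : 0 < volume.real V := ENNReal.toReal_pos hV0 hV
      rw [Real.enorm_of_nonneg (by positivity), ENNReal.ofReal_inv_of_pos hr, Measure.real,
        ENNReal.ofReal_toReal hV, ENNReal.mul_inv_cancel hV0 hV]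
    rw [e, one_mul]
    exact enorm_integral_le_lintegral_enorm _
  have h2 : (∫⁻ z in V, ‖g z - c‖ₑ) ^ 2 ≤ (∫⁻ z in V, ‖g z - c‖ₑ ^ 2) * volume V := by
    have := ENNReal.lintegral_mul_le_Lp_mul_Lq (volume.restrict V) (p := 2) (q := 2)
      (by constructor <;> norm_num) hm (g := fun _ => 1) aemeasurable_const
    simp only [Pi.mul_apply, mul_one, ENNReal.rpow_two, one_pow, lintegral_const,
      Measure.restrict_apply_univ, one_mul] at this
    calc _ ≤ ((∫⁻ z in V, ‖g z - c‖ₑ ^ 2) ^ (1 / 2 : ℝ) * volume V ^ (1 / 2 : ℝ)) ^ 2 :=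
          pow_le_pow_left' this 2
      _ = _ := by
          rw [mul_pow, ← ENNReal.rpow_two, ← ENNReal.rpow_two, ← ENNReal.rpow_mul,
            ← ENNReal.rpow_mul]
          norm_num
  have h3 : (volume V * ‖(⨍ z in V, g z) - c‖ₑ) ^ 2 ≤
      (∫⁻ z in V, ‖g z - c‖ₑ ^ 2) * volume V := (pow_le_pow_left' h1 2).trans h2
  have h4 : volume V * (volume V * ‖(⨍ z in V, g z) - c‖ₑ ^ 2) ≤
      volume V * ∫⁻ z in V, ‖g z - c‖ₑ ^ 2 := by
    rw [mul_comm (volume V) (∫⁻ z in V, ‖g z - c‖ₑ ^ 2)]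
    refine le_trans (le_of_eq ?_) h3
    ring
  exact (ENNReal.mul_le_mul_iff_right hV0 hV).1 h4

lemma volume_mul_meanSqDev (hV0 : volume V ≠ 0) (hV : volume V ≠ ⊤) :
    volume V * meanSqDev V g = ∫⁻ z in V, ‖g z - ⨍ y in V, g y‖ₑ ^ 2 := by
  rw [meanSqDev, setLAverage_eq, ENNReal.mul_div_cancel hV0 hV]

lemma enorm_average_sub_average_le (hV0 : volume V ≠ 0) (hVW : V ⊆ W) (hW : volume W ≠ ⊤)
    (hg : IntegrableOn g W) {κ : ℝ≥0∞} (hκ : volume W ≤ κ * volume V) :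
    ‖(⨍ z in V, g z) - ⨍ z in W, g z‖ₑ ≤ (κ * meanSqDev W g) ^ (1 / 2 : ℝ) := by
  have hV : volume V ≠ ⊤ := ne_top_of_le_ne_top hW (measure_mono hVW)
  have hW0 : volume W ≠ 0 := fun h => hV0 (measure_mono_null hVW h)
  have h1 : volume V * ‖(⨍ z in V, g z) - ⨍ z in W, g z‖ₑ ^ 2 ≤
      volume V * (κ * meanSqDev W g) := by
    calc _ ≤ ∫⁻ z in V, ‖g z - ⨍ y in W, g y‖ₑ ^ 2 :=
          volume_mul_enorm_average_sub_sq_le hV0 hV (hg.mono_set hVW) _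
      _ ≤ ∫⁻ z in W, ‖g z - ⨍ y in W, g y‖ₑ ^ 2 := lintegral_mono_set hVW
      _ = volume W * meanSqDev W g := (volume_mul_meanSqDev hW0 hW).symm
      _ ≤ (κ * volume V) * meanSqDev W g := by gcongr
      _ = _ := by ring
  have h2 := (ENNReal.mul_le_mul_iff_right hV0 hV).1 h1
  calc _ = (‖(⨍ z in V, g z) - ⨍ z in W, g z‖ₑ ^ 2) ^ (1 / 2 : ℝ) := by
        rw [← ENNReal.rpow_two, ← ENNReal.rpow_mul]
        norm_num
    _ ≤ _ := by gcongr

/-! #### The sum of all mean square deviations -/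

/-- The Besov semi-norm, written as a sum over triadic cubes meeting `D`. -/
def devSum (s : ℝ) (m : ℤ) (D : Set (SpaceTime d)) (g : SpaceTime d → Space d) : ℝ≥0∞ :=
  ∑' x : ℤ × Idx d, {x : ℤ × Idx d | x.1 < m ∧ (cell x.1 x.2 ∩ D).Nonempty}.indicator
    (fun x => (wt s x.1)⁻¹ * ENNReal.ofReal (cubeVol d x.1) *
      meanSqDev (bigCell x.1 x.2 ∩ D) g) x

lemma latticeNear_eq_image (k : ℤ) (D : Set (SpaceTime d)) :
    latticeNear k D = ctr k '' {i | (cell k i ∩ D).Nonempty} := by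
  ext z
  constructor
  · rintro ⟨hz, hn⟩
    rw [← range_ctr] at hz
    obtain ⟨i, rfl⟩ := hz
    exact ⟨i, hn, rfl⟩
  · rintro ⟨i, hi, rfl⟩
    exact ⟨by rw [← range_ctr]; exact mem_range_self i, hi⟩

lemma encard_mul_cubeVol_le {k : ℤ} (hk : k ≤ m) (hDm : D ⊆ cube 0 m) :
    ({i | (cell k i ∩ D).Nonempty}.encard : ℝ≥0∞) * ENNReal.ofReal (cubeVol d k) ≤
      ENNReal.ofReal (cubeVol d m) := by
  rw [← volume_cube 0 m, ← ENNReal.tsum_set_const, ← cell_zero m, tsum_subtype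
    {i | (cell k i ∩ D).Nonempty} fun _ => ENNReal.ofReal (cubeVol d k)]
  have := lintegral_eq_tsum_cell k (measurableSet_cell m (0 : Idx d)) fun _ => 1
  simp only [lintegral_const, one_mul, Measure.restrict_apply_univ] at this
  rw [this]
  refine ENNReal.tsum_le_tsum fun i => ?_
  by_cases hi : (cell k i ∩ D).Nonempty
  · rw [indicator_of_mem (s := {i | (cell k i ∩ D).Nonempty}) hi]
    have hsub : cell k i ⊆ cell m 0 := by
      refine cell_subset_of_inter hk (hi.mono (inter_subset_inter_right _ ?_))
      rwa [cell_zero]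
    rw [inter_eq_self_of_subset_right hsub, volume_cell]
  · rw [indicator_of_notMem (s := {i | (cell k i ∩ D).Nonempty}) hi]
    exact zero_le

lemma wt_add_one (s : ℝ) (k : ℤ) : wt s (k + 1) = (3 : ℝ≥0∞) ^ (2 * s) * wt s k := by
  rw [wt, wt, ← ENNReal.rpow_add _ _ (by norm_num) (by norm_num)]
  congr 1
  push_cast
  ring

lemma sq_rpow_half (x : ℝ≥0∞) : (x ^ (1 / 2 : ℝ)) ^ 2 = x := by
  rw [← ENNReal.rpow_two, ← ENNReal.rpow_mul]
  norm_num

lemma devSum_eq (s : ℝ) (m : ℤ) (D : Set (SpaceTime d)) (g : SpaceTime d → Space d) :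
    devSum s m D g = ∑' k, (Iio m).indicator (fun k => (wt s k)⁻¹ * ENNReal.ofReal (cubeVol d k) *
      ∑' i, {i | (cell k i ∩ D).Nonempty}.indicator
        (fun i => meanSqDev (bigCell k i ∩ D) g) i) k := by
  rw [devSum, ENNReal.tsum_prod']
  refine tsum_congr fun k => ?_
  by_cases hk : k < m
  · rw [indicator_of_mem (s := Iio m) hk, ← ENNReal.tsum_mul_left]
    refine tsum_congr fun i => ?_
    by_cases hi : (cell k i ∩ D).Nonempty
    · rw [indicator_of_mem (s := {i | (cell k i ∩ D).Nonempty}) hi, indicator_of_mem]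
      exact ⟨hk, hi⟩
    · rw [indicator_of_notMem (s := {i | (cell k i ∩ D).Nonempty}) hi, mul_zero,
        indicator_of_notMem]
      exact fun h => hi h.2
  · rw [indicator_of_notMem (s := Iio m) hk]
    refine ENNReal.tsum_eq_zero.2 fun i => ?_
    rw [indicator_of_notMem]
    exact fun h => hk h.1

/-- The Besov semi-norm controls the sum of all mean square deviations. -/
lemma devSum_le (s : ℝ) (hDm : D ⊆ cube 0 m) (hD0 : D.Nonempty) (hDo : IsOpen D) :
    devSum s m D g ≤ (3 : ℝ≥0∞) ^ (2 * s) * ENNReal.ofReal (cubeVol d m) *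
      besovSeminorm m D s g ^ 2 := by
  set X : ℤ → ℝ≥0∞ := fun k => ∑' i, {i | (cell k i ∩ D).Nonempty}.indicator
        (fun i => meanSqDev (bigCell k i ∩ D) g) i with hX
  set N : ℤ → ℝ≥0∞ := fun k => ({i | (cell k i ∩ D).Nonempty}.encard : ℝ≥0∞) with hN
  have e1 : besovSeminorm m D s g ^ 2 =
      ∑' k, (Iio m).indicator (fun k => (wt s (k + 1))⁻¹ * (X k / N k)) k := by
    rw [besovSeminorm, sq_rpow_half, tsum_subtype (Iic m) fun j =>
      (3 : ℝ≥0∞) ^ (-(2 * s * (j : ℝ))) *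
        ((∑' z : latticeNear (j - 1) D, meanSqDev (cube (z : SpaceTime d) j ∩ D) g) /
          ((latticeNear (j - 1) D).encard : ℝ≥0∞)), ← (Equiv.addRight (1 : ℤ)).tsum_eq]
    refine tsum_congr fun k => ?_
    simp only [Equiv.coe_addRight]
    by_cases hk : k < m
    · rw [indicator_of_mem (s := Iio m) hk, indicator_of_mem (s := Iic m) (Int.add_one_le_iff.2 hk),
        ENNReal.rpow_neg, add_sub_cancel_right]
      have e2 : ∑' z : latticeNear k D, meanSqDev (cube (z : SpaceTime d) (k + 1) ∩ D) g = X k := by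
        rw [latticeNear_eq_image, tsum_image (fun z => meanSqDev (cube z (k + 1) ∩ D) g)
          (ctr_injective k).injOn, hX]
        exact tsum_subtype {i | (cell k i ∩ D).Nonempty}
          fun i => meanSqDev (bigCell k i ∩ D) g
      have e3 : ((latticeNear k D).encard : ℝ≥0∞) = N k := by
        rw [latticeNear_eq_image, (ctr_injective k).injOn.encard_image]
      rw [e2, e3]
      rfl
    · rw [indicator_of_notMem (s := Iio m) hk,
        indicator_of_notMem (s := Iic m) (fun h => hk (Int.add_one_le_iff.1 h))]
  -- the average over the `N k` cubes becomes a sum, as these cubes fit into `□_m`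
  rw [e1, devSum_eq, ← ENNReal.tsum_mul_left]
  refine ENNReal.tsum_le_tsum fun k => ?_
  by_cases hk : k < m
  · rw [indicator_of_mem (s := Iio m) hk, indicator_of_mem (s := Iio m) hk]
    have h1 : N k * ENNReal.ofReal (cubeVol d k) ≤ ENNReal.ofReal (cubeVol d m) :=
      encard_mul_cubeVol_le hk.le hDm
    have hv : ENNReal.ofReal (cubeVol d k) ≠ 0 := by simpa using cubeVol_pos d k
    have hNt : N k ≠ ⊤ := fun h => by
      rw [h, ENNReal.top_mul hv] at h1
      exact ENNReal.ofReal_ne_top (top_le_iff.1 h1)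
    have hN0 : N k ≠ 0 := by
      obtain ⟨y, hy⟩ := hD0
      have hne : {i | (cell k i ∩ D).Nonempty}.encard ≠ 0 :=
        Set.encard_ne_zero.2 ⟨idx k y, cell_inter_nonempty (mem_closedCell_idx k y) hDo hy⟩
      rw [hN]
      simpa using hne
    rw [wt_add_one, ENNReal.mul_inv (Or.inr (wt_ne_top _ _)) (Or.inr (wt_ne_zero _ _))]
    have h3 : (3 : ℝ≥0∞) ^ (2 * s) * ((3 : ℝ≥0∞) ^ (2 * s))⁻¹ = 1 :=
      ENNReal.mul_inv_cancel (ENNReal.rpow_pos (by norm_num) (by norm_num)).ne'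
        (ENNReal.rpow_ne_top_of_ne_zero (by norm_num) (by norm_num))
    calc (wt s k)⁻¹ * ENNReal.ofReal (cubeVol d k) * X k
        = (wt s k)⁻¹ * (N k * ENNReal.ofReal (cubeVol d k)) * (X k / N k) := by
          rw [mul_comm (N k), mul_assoc, mul_assoc, mul_assoc, ENNReal.mul_div_cancel hN0 hNt]
      _ ≤ (wt s k)⁻¹ * ENNReal.ofReal (cubeVol d m) * (X k / N k) := by gcongr
      _ = ((3 : ℝ≥0∞) ^ (2 * s) * ((3 : ℝ≥0∞) ^ (2 * s))⁻¹) *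
          ((wt s k)⁻¹ * ENNReal.ofReal (cubeVol d m) * (X k / N k)) := by rw [h3, one_mul]
      _ = _ := by ring
  · rw [indicator_of_notMem (s := Iio m) hk, indicator_of_notMem (s := Iio m) hk, mul_zero]

end Besov

/-! ### A Hardy inequality for increments over triadic cubes -/

section Hardy

variable {d : ℕ} {D : Set (SpaceTime d)} {f g : SpaceTime d → Space d} {m : ℤ} {κ : ℝ≥0}

/-- The quantitative regularity of a domain, relative to the triadic cubes of scale below `m`:
`D` has density at least `κ⁻¹` around its points at all scales, and the cubes of scale `k` which are
maximal in `D` and lie in one cube of scale `k + n` fill a fraction at most `κ 3⁻ⁿ` of it. -/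
structure IsRegularDomain (D : Set (SpaceTime d)) (m : ℤ) (κ : ℝ≥0) : Prop where
  isOpen : IsOpen D
  isPreconnected : IsPreconnected D
  nonempty : D.Nonempty
  subset : D ⊆ cube 0 m
  one_le : 1 ≤ κ
  not_subset : ∀ i, ¬ cell m i ⊆ D
  thick : ∀ k < m, ∀ y ∈ D, ENNReal.ofReal (cubeVol d (k + 1)) ≤ κ * volume (box y k ∩ D)
  layer : ∀ (n : ℕ) (k : ℤ) (p : Idx d), k + n < m →
    ∑' i, {i | (cell k i ⊆ D ∧ ¬ cell (k + 1) (par i) ⊆ D) ∧ par^[n] i = p}.indicator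
      (fun _ => ENNReal.ofReal (cubeVol d k)) i ≤
        κ * ((3 : ℝ≥0∞) ^ n)⁻¹ * ENNReal.ofReal (cubeVol d (k + n))

/-- The number of triadic subcubes of a cube at the next smaller scale. -/
def tri (d : ℕ) : ℝ≥0 := 3 ^ (d + 2)

lemma ofReal_cubeVol_add_one (k : ℤ) : ENNReal.ofReal (cubeVol d (k + 1)) =
    tri d * ENNReal.ofReal (cubeVol d k) := by
  rw [cubeVol_add_one, ENNReal.ofReal_mul (by positivity), tri, ENNReal.ofReal_pow (by norm_num)]
  norm_num

lemma ofReal_cubeVol_ne_zero (k : ℤ) : ENNReal.ofReal (cubeVol d k) ≠ 0 := by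
  simpa using cubeVol_pos d k

/-- The index at scale `k` of the cube concentric to the cube of scale `k + 1` and index `p`. -/
def mid (p : Idx d) : Idx d := (9 * p.1, fun l => 3 * p.2 l)

lemma mid_injective : Function.Injective (mid (d := d)) := fun p p' h => by
  simp only [mid, Prod.mk.injEq, funext_iff] at h
  refine Prod.ext (by omega) (funext fun l => ?_)
  have := h.2 l
  omega

lemma bigCell_mid (k : ℤ) (p : Idx d) : bigCell k (mid p) = cell (k + 1) p := by
  have : ctr k (mid p) = ctr (k + 1) p := by
    refine Prod.ext ?_ ?_
    · simp only [ctr, mid, zpow_two_succ_three]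
      push_cast
      ring
    · ext l
      simp only [ctr, mid, zpow_succ_three]
      push_cast
      ring
  rw [bigCell, this, cell]

/-- The differences of averages over cubes and their parents are controlled by the mean square
deviations on the parents. -/
lemma oscSum_le_devSum (s : ℝ) (hDm : D ⊆ cube 0 m) (hf : IntegrableOn f D) :
    oscSum s D f ≤ tri d * devSum s m D f := by
  classical
  rw [devSum_eq, oscSum, ENNReal.tsum_prod', ← ENNReal.tsum_mul_left]
  refine ENNReal.tsum_le_tsum fun k => ?_
  set F : SpaceTime d → ℝ≥0∞ := fun y => if cell (k + 1) (idx (k + 1) y) ⊆ D then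
    ‖f y - ⨍ z in cell (k + 1) (idx (k + 1) y), f z‖ₑ ^ 2 else 0 with hF
  have h1 : ∀ i, {x : ℤ × Idx d | cell (x.1 + 1) (par x.2) ⊆ D}.indicator
      (fun x => (wt s x.1)⁻¹ * ENNReal.ofReal (cubeVol d x.1) *
      ‖(⨍ z in cell x.1 x.2, f z) - ⨍ z in cell (x.1 + 1) (par x.2), f z‖ₑ ^ 2) (k, i) ≤
      (wt s k)⁻¹ * ∫⁻ y in cell k i, F y := fun i => by
    by_cases hi : cell (k + 1) (par i) ⊆ D
    · have hi' : (k, i) ∈ {x : ℤ × Idx d | cell (x.1 + 1) (par x.2) ⊆ D} := hi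
      rw [indicator_of_mem hi', mul_assoc, setLIntegral_congr_fun (measurableSet_cell k i)
        (g := fun y => ‖f y - ⨍ z in cell (k + 1) (par i), f z‖ₑ ^ 2) fun y hy => by
          simp only [hF]; rw [idx_add_one_of_mem hy, if_pos hi]]
      gcongr
      have := volume_mul_enorm_average_sub_sq_le (volume_cell_ne_zero k i)
        (isBounded_cell k i).measure_lt_top.ne (hf.mono_set ((cell_subset_par k i).trans hi))
        (⨍ z in cell (k + 1) (par i), f z)
      rwa [volume_cell] at this
    · have hi' : (k, i) ∉ {x : ℤ × Idx d | cell (x.1 + 1) (par x.2) ⊆ D} := hi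
      rw [indicator_of_notMem hi']
      exact zero_le
  have h2 : ∑' i : Idx d, ∫⁻ y in cell k i, F y = ∑' p : Idx d, ∫⁻ y in cell (k + 1) p, F y := by
    have a1 := lintegral_eq_tsum_cell k MeasurableSet.univ F
    have a2 := lintegral_eq_tsum_cell (k + 1) MeasurableSet.univ F
    simp only [univ_inter] at a1 a2
    rw [← a1, ← a2]
  -- a parent cube in `D` is the enlargement of the cube of scale `k` at its centre
  have h3 : ∀ p, (wt s k)⁻¹ * ∫⁻ y in cell (k + 1) p, F y ≤
      tri d * (Iio m).indicator (fun k => (wt s k)⁻¹ * ENNReal.ofReal (cubeVol d k) *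
        {i | (cell k i ∩ D).Nonempty}.indicator
          (fun i => meanSqDev (bigCell k i ∩ D) f) (mid p)) k := fun p => by
    by_cases hp : cell (k + 1) p ⊆ D
    · have hk : k < m := by
        have : cell (k + 1) p ⊆ cell m 0 := by rw [cell_zero]; exact hp.trans hDm
        have := scale_le_of_subset this
        omega
      have hn : (cell k (mid p) ∩ D).Nonempty :=
        ⟨_, ctr_mem_cell k (mid p), hp (bigCell_mid k p ▸
          cell_subset_bigCell k (mid p) (ctr_mem_cell k (mid p)))⟩
      rw [setLIntegral_congr_fun (measurableSet_cell (k + 1) p)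
        (g := fun y => ‖f y - ⨍ z in cell (k + 1) p, f z‖ₑ ^ 2) fun y hy => by
          simp only [hF]; rw [idx_eq_of_mem hy, if_pos hp],
        indicator_of_mem (s := Iio m) hk,
        indicator_of_mem (s := {i | (cell k i ∩ D).Nonempty}) hn, bigCell_mid,
        inter_eq_self_of_subset_left hp, ← volume_mul_meanSqDev (volume_cell_ne_zero _ _)
        (isBounded_cell (k + 1) p).measure_lt_top.ne, volume_cell, ofReal_cubeVol_add_one]
      apply le_of_eq
      ring
    · rw [setLIntegral_congr_fun (measurableSet_cell (k + 1) p)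
        (g := fun y => 0) fun y hy => by
          simp only [hF]; rw [idx_eq_of_mem hy, if_neg hp]]
      simp
  refine (ENNReal.tsum_le_tsum h1).trans ?_
  rw [ENNReal.tsum_mul_left, h2, ← ENNReal.tsum_mul_left]
  refine (ENNReal.tsum_le_tsum h3).trans ?_
  rw [ENNReal.tsum_mul_left]
  gcongr
  by_cases hk : k < m
  · simp only [indicator_of_mem (s := Iio m) hk]
    rw [ENNReal.tsum_mul_left]
    exact mul_le_mul_right (ENNReal.tsum_comp_le_tsum_of_injective mid_injective
      ({i | (cell k i ∩ D).Nonempty}.indicator fun i => meanSqDev (bigCell k i ∩ D) f)) _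
  · simp only [indicator_of_notMem (s := Iio m) hk, tsum_zero]
    exact zero_le

/-- The maximal triadic cubes contained in `D`. -/
def maxCubes (D : Set (SpaceTime d)) : Set (ℤ × Idx d) :=
  {x | cell x.1 x.2 ⊆ D ∧ ¬ cell (x.1 + 1) (par x.2) ⊆ D}

lemma wt_add_nat (s : ℝ) (k : ℤ) (n : ℕ) :
    wt s (k + n) = ((3 : ℝ≥0∞) ^ (2 * s)) ^ n * wt s k := by
  induction n with
  | zero => simp
  | succ n ih =>
    rw [Nat.cast_succ, ← add_assoc, wt_add_one, ih, pow_succ]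
    ring

/-- Sums over maximal cubes of functions of an ancestor. -/
lemma IsRegularDomain.tsum_maxCubes_le (hD : IsRegularDomain D m κ) (s : ℝ)
    (H : ℤ → Idx d → ℝ≥0∞) (n : ℕ) :
    ∑' x, (maxCubes D).indicator (fun x => if x.1 + n < m then
      (wt s x.1)⁻¹ * ENNReal.ofReal (cubeVol d x.1) * H (x.1 + n) (par^[n] x.2) else 0) x ≤
    κ * ((3 : ℝ≥0∞) ^ (2 * s) / 3) ^ n *
      ∑' x : ℤ × Idx d, {x : ℤ × Idx d | x.1 < m ∧ (cell x.1 x.2 ∩ D).Nonempty}.indicator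
        (fun x => (wt s x.1)⁻¹ * ENNReal.ofReal (cubeVol d x.1) * H x.1 x.2) x := by
  rw [ENNReal.tsum_prod', ENNReal.tsum_prod']
  -- shift the scale on the right by `n`, and group the maximal cubes by their ancestor `p`
  conv_rhs => rw [← (Equiv.addRight (n : ℤ)).tsum_eq, ← ENNReal.tsum_mul_left]
  refine ENNReal.tsum_le_tsum fun k => ?_
  simp only [Equiv.coe_addRight]
  by_cases hk : k + n < m
  swap
  · refine le_of_eq_of_le (ENNReal.tsum_eq_zero.2 fun i => ?_) zero_le
    by_cases hi : (k, i) ∈ maxCubes D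
    · rw [indicator_of_mem hi, if_neg hk]
    · rw [indicator_of_notMem hi]
  set A : Idx d → Idx d → ℝ≥0∞ := fun i p => {i | (cell k i ⊆ D ∧ ¬ cell (k + 1) (par i) ⊆ D) ∧
    par^[n] i = p}.indicator (fun _ => ENNReal.ofReal (cubeVol d k)) i with hA
  have h1 : ∀ i, (maxCubes D).indicator (fun x => if x.1 + n < m then
      (wt s x.1)⁻¹ * ENNReal.ofReal (cubeVol d x.1) * H (x.1 + n) (par^[n] x.2) else 0) (k, i) =
      ∑' p, A i p * ((wt s k)⁻¹ * H (k + n) p) := fun i => by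
    rw [tsum_eq_single (par^[n] i)]
    · by_cases hi : (k, i) ∈ maxCubes D
      · have hi' : i ∈ {i' | (cell k i' ⊆ D ∧ ¬ cell (k + 1) (par i') ⊆ D) ∧
            par^[n] i' = par^[n] i} := ⟨hi, rfl⟩
        rw [indicator_of_mem hi, if_pos hk, hA]
        simp only []
        rw [indicator_of_mem hi']
        ring
      · have hi' : i ∉ {i' | (cell k i' ⊆ D ∧ ¬ cell (k + 1) (par i') ⊆ D) ∧
            par^[n] i' = par^[n] i} := fun h => hi h.1
        rw [indicator_of_notMem hi, hA]
        simp only []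
        rw [indicator_of_notMem hi', zero_mul]
    · intro p hp
      have hi' : i ∉ {i' | (cell k i' ⊆ D ∧ ¬ cell (k + 1) (par i') ⊆ D) ∧
            par^[n] i' = p} := fun h => hp h.2.symm
      rw [hA]
      simp only []
      rw [indicator_of_notMem hi', zero_mul]
  simp only [h1]
  rw [ENNReal.tsum_comm, ← ENNReal.tsum_mul_left]
  refine ENNReal.tsum_le_tsum fun p => ?_
  rw [ENNReal.tsum_mul_right]
  by_cases hp : (cell (k + n) p ∩ D).Nonempty
  · have hp' : (k + (n : ℤ), p) ∈ {x : ℤ × Idx d | x.1 < m ∧ (cell x.1 x.2 ∩ D).Nonempty} :=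
      ⟨hk, hp⟩
    rw [indicator_of_mem hp']
    simp only []
    have h2 : (wt s k)⁻¹ = ((3 : ℝ≥0∞) ^ (2 * s)) ^ n * (wt s (k + n))⁻¹ := by
      have h3 : (3 : ℝ≥0∞) ^ (2 * s) ≠ 0 := (ENNReal.rpow_pos (by norm_num) (by norm_num)).ne'
      have h3' : (3 : ℝ≥0∞) ^ (2 * s) ≠ ⊤ :=
        ENNReal.rpow_ne_top_of_ne_zero (by norm_num) (by norm_num)
      rw [wt_add_nat, ENNReal.mul_inv (Or.inr (wt_ne_top _ _)) (Or.inr (wt_ne_zero _ _)),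
        ← mul_assoc, ENNReal.mul_inv_cancel (pow_ne_zero _ h3) (ENNReal.pow_ne_top h3'), one_mul]
    calc (∑' i, A i p) * ((wt s k)⁻¹ * H (k + n) p)
        ≤ (κ * ((3 : ℝ≥0∞) ^ n)⁻¹ * ENNReal.ofReal (cubeVol d (k + n))) *
          ((wt s k)⁻¹ * H (k + n) p) := by
          gcongr
          exact hD.layer n k p hk
      _ = _ := by
          rw [h2, div_eq_mul_inv, mul_pow, ENNReal.inv_pow]
          ring
  · have : ∀ i, A i p = 0 := fun i => by
      rw [hA]
      simp only []
      rw [indicator_of_notMem]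
      rintro ⟨⟨h1, -⟩, rfl⟩
      exact hp ⟨ctr k i, iterate_par_subset k n i (ctr_mem_cell k i), h1 (ctr_mem_cell k i)⟩
    simp only [this, tsum_zero, zero_mul]
    exact zero_le

/-! #### Comparison of averages near the boundary -/

lemma volume_bigCell_inter_le (k : ℤ) (i : Idx d) : volume (bigCell k i ∩ D) ≤
    ENNReal.ofReal (cubeVol d (k + 1)) := by
  rw [← volume_cube (ctr k i) (k + 1)]
  exact measure_mono inter_subset_left

lemma bigCell_inter_ne_top (k : ℤ) (i : Idx d) : volume (bigCell k i ∩ D) ≠ ⊤ :=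
  ne_top_of_le_ne_top ENNReal.ofReal_ne_top (volume_bigCell_inter_le k i)

lemma IsRegularDomain.box_ne_zero (hD : IsRegularDomain D m κ) {k : ℤ} (hk : k < m)
    {y : SpaceTime d} (hy : y ∈ D) : volume (box y k ∩ D) ≠ 0 := fun h => by
  have := hD.thick k hk y hy
  rw [h, mul_zero] at this
  exact ofReal_cubeVol_ne_zero _ (nonpos_iff_eq_zero.1 this)

/-- The averages of `g` over two enlarged cubes which both contain the box around `y` are compared
through the average over that box, which has positive density in `D`. -/
lemma IsRegularDomain.enorm_sub_box_le (hD : IsRegularDomain D m κ) (hg : IntegrableOn g D)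
    {k : ℤ} (hk : k < m) {y : SpaceTime d} (hy : y ∈ D) {i : Idx d} (hi : y ∈ closedCell k i) :
    ‖(⨍ z in box y k ∩ D, g z) - ⨍ z in bigCell k i ∩ D, g z‖ₑ ≤
      (κ * meanSqDev (bigCell k i ∩ D) g) ^ (1 / 2 : ℝ) :=
  enorm_average_sub_average_le (hD.box_ne_zero hk hy)
    (inter_subset_inter_left _ (box_subset_bigCell hi)) (bigCell_inter_ne_top k i)
    (hg.mono_set inter_subset_right) ((volume_bigCell_inter_le k i).trans (hD.thick k hk y hy))

/-- Telescoping over the ancestors of a cube contained in `D`. -/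
lemma IsRegularDomain.enorm_average_cell_le (hD : IsRegularDomain D m κ) (hg : IntegrableOn g D)
    {k : ℤ} {i : Idx d} (hi : cell k i ⊆ D) (n : ℕ) (hn : k + n < m) :
    ‖⨍ z in cell k i, g z‖ₑ ≤ ∑ j ∈ Finset.range (n + 1),
      (tri d * κ * meanSqDev (bigCell (k + j) (par^[j] i) ∩ D) g) ^ (1 / 2 : ℝ) +
      ‖⨍ z in bigCell (k + n) (par^[n] i) ∩ D, g z‖ₑ := by
  have hκ : (1 : ℝ≥0∞) ≤ κ := by exact_mod_cast hD.one_le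
  have tr : ∀ x y : Space d, ‖x‖ₑ ≤ ‖x - y‖ₑ + ‖y‖ₑ := fun x y => by
    simpa using enorm_add_le (x - y) y
  induction n with
  | zero =>
    simp only [zero_add, Finset.sum_range_one, Nat.cast_zero, add_zero, Function.iterate_zero, id]
    refine (tr _ (⨍ z in bigCell k i ∩ D, g z)).trans (add_le_add_left ?_ _)
    refine enorm_average_sub_average_le (volume_cell_ne_zero k i)
      (subset_inter (cell_subset_bigCell k i) hi) (bigCell_inter_ne_top k i)
      (hg.mono_set inter_subset_right) ((volume_bigCell_inter_le k i).trans ?_)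
    rw [volume_cell, ofReal_cubeVol_add_one]
    gcongr
    exact le_mul_of_one_le_right' hκ
  | succ n ih =>
    refine (ih (by push_cast at hn; omega)).trans ?_
    rw [Finset.sum_range_succ _ (n + 1), add_assoc]
    gcongr
    refine (tr _ _).trans (add_le_add_left ?_ _)
    have hy : ctr k i ∈ cell (k + n) (par^[n] i) := iterate_par_subset k n i (ctr_mem_cell k i)
    have hkn : k + (n : ℤ) < m := by push_cast at hn; omega
    have hth := hD.thick (k + n) hkn (ctr k i) (hi (ctr_mem_cell k i))
    have hsub := inter_subset_inter_left D (box_subset_bigCell (cell_subset_closedCell _ _ hy))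
    have e1 : k + ((n + 1 : ℕ) : ℤ) = (k + n) + 1 := by push_cast; ring
    rw [Function.iterate_succ_apply', e1]
    refine enorm_average_sub_average_le
      (fun h => hD.box_ne_zero hkn (hi (ctr_mem_cell k i)) (measure_mono_null hsub h))
      (inter_subset_inter_left _ (bigCell_subset_par _ _)) (bigCell_inter_ne_top _ _)
      (hg.mono_set inter_subset_right) ((volume_bigCell_inter_le _ _).trans ?_)
    rw [ofReal_cubeVol_add_one, mul_assoc]
    gcongr
    exact hth.trans (by gcongr)

/-! #### Comparison of averages at the scale of the domain -/

/-- If every proper non-empty subset of a finite index set is left by a step of length at most `δ`,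
then all distances are at most the number of indices times `δ`. -/
lemma edist_le_card_mul {ι E : Type*} [PseudoEMetricSpace E] (I : Finset ι) (b : ι → E) (δ : ℝ≥0∞)
    (h : ∀ A ⊆ I, A.Nonempty → A ≠ I → ∃ i ∈ A, ∃ i' ∈ I, i' ∉ A ∧ edist (b i) (b i') ≤ δ)
    {i i₀ : ι} (hi : i ∈ I) (hi₀ : i₀ ∈ I) : edist (b i₀) (b i) ≤ I.card * δ := by
  classical
  set A : ℕ → Finset ι := fun n => I.filter fun i => edist (b i₀) (b i) ≤ n * δ with hA
  have h0 : ∀ n, i₀ ∈ A n := fun n => by simp [hA, hi₀]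
  have key : ∀ n : ℕ, A n = I ∨ n < (A n).card := fun n => by
    induction n with
    | zero => exact Or.inr (Finset.card_pos.2 ⟨i₀, h0 0⟩)
    | succ n ih =>
      have hmono : A n ⊆ A (n + 1) := fun j hj => by
        simp only [hA, Finset.mem_filter] at hj ⊢
        exact ⟨hj.1, hj.2.trans (by gcongr; simp)⟩
      by_cases hI : A n = I
      · exact Or.inl (le_antisymm (Finset.filter_subset _ _) (hI ▸ hmono))
      · obtain ⟨j, hj, j', hj', hjn, hjj⟩ := h (A n) (Finset.filter_subset _ _) ⟨i₀, h0 n⟩ hI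
        refine Or.inr (lt_of_le_of_lt (Nat.succ_le_of_lt (ih.resolve_left hI))
          (Finset.card_lt_card ⟨hmono, fun hss => hjn (hss ?_)⟩))
        simp only [hA, Finset.mem_filter] at hj ⊢
        refine ⟨hj', (edist_triangle _ (b j) _).trans ?_⟩
        push_cast
        rw [add_mul, one_mul]
        exact add_le_add hj.2 hjj
  have hfull : A I.card = I := (key I.card).resolve_right
    (not_lt.2 (Finset.card_le_card (Finset.filter_subset _ _)))
  have : i ∈ A I.card := by rw [hfull]; exact hi
  exact (Finset.mem_filter.1 this).2

/-- In a connected open set, the closed cubes meeting it form a connected chain. -/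
lemma exists_adjacent (hDo : IsOpen D) (hDc : IsPreconnected D) {k : ℤ} {I : Finset (Idx d)}
    (hI : ∀ i, i ∈ I ↔ (cell k i ∩ D).Nonempty) {A : Finset (Idx d)} (hA : A ⊆ I)
    (hA0 : A.Nonempty) (hAI : A ≠ I) :
    ∃ i ∈ A, ∃ i' ∈ I, i' ∉ A ∧ ∃ y ∈ D, y ∈ closedCell k i ∧ y ∈ closedCell k i' := by
  classical
  have hcl : ∀ B : Finset (Idx d), IsClosed (⋃ i ∈ B, closedCell k i) := fun B =>
    B.finite_toSet.isClosed_biUnion fun i _ => isClosed_closedCell k i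
  obtain ⟨i₁, hi₁⟩ := hA0
  obtain ⟨i₂, hi₂, hi₂A⟩ : ∃ i ∈ I, i ∉ A := by
    by_contra! hh
    exact hAI (le_antisymm hA hh)
  obtain ⟨y₁, hy₁, hyD₁⟩ := (hI i₁).1 (hA hi₁)
  obtain ⟨y₂, hy₂, hyD₂⟩ := (hI i₂).1 hi₂
  obtain ⟨y, hyD, hy1, hy2⟩ := isPreconnected_closed_iff.1 hDc (⋃ i ∈ A, closedCell k i)
    (⋃ i ∈ I \ A, closedCell k i) (hcl A) (hcl _) (fun y hy => by
      have hyI : idx k y ∈ I := (hI _).2 (cell_inter_nonempty (mem_closedCell_idx k y) hDo hy)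
      by_cases h : idx k y ∈ A
      · exact Or.inl (mem_biUnion (x := idx k y) (by exact_mod_cast h) (mem_closedCell_idx k y))
      · exact Or.inr (mem_iUnion₂.2 ⟨idx k y, Finset.mem_sdiff.2 ⟨hyI, h⟩, mem_closedCell_idx k y⟩))
    ⟨y₁, hyD₁, mem_iUnion₂.2 ⟨i₁, hi₁, cell_subset_closedCell _ _ hy₁⟩⟩
    ⟨y₂, hyD₂, mem_iUnion₂.2 ⟨i₂, Finset.mem_sdiff.2 ⟨hi₂, hi₂A⟩, cell_subset_closedCell _ _ hy₂⟩⟩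
  obtain ⟨i, hi, hyi⟩ := mem_iUnion₂.1 hy1
  obtain ⟨i', hi', hyi'⟩ := mem_iUnion₂.1 hy2
  exact ⟨i, hi, i', (Finset.mem_sdiff.1 hi').1, (Finset.mem_sdiff.1 hi').2, y, hyD, hyi, hyi'⟩

lemma add_sq_le_two_mul (x y : ℝ≥0∞) : (x + y) ^ 2 ≤ 2 * x ^ 2 + 2 * y ^ 2 := by
  by_cases hx : x = ⊤
  · simp [hx]
  by_cases hy : y = ⊤
  · simp [hy]
  lift x to ℝ≥0 using hx
  lift y to ℝ≥0 using hy
  have : ((x : ℝ) + y) ^ 2 ≤ 2 * (x : ℝ) ^ 2 + 2 * (y : ℝ) ^ 2 := by nlinarith [sq_nonneg ((x : ℝ) - y)]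
  exact_mod_cast this

end Hardy

section HardyInequality

variable {d : ℕ} {D : Set (SpaceTime d)} {f g : SpaceTime d → Space d} {m : ℤ} {κ : ℝ≥0}

/-- The triadic cubes of scale `k` which meet `D`. -/
abbrev nearCubes (D : Set (SpaceTime d)) (k : ℤ) : Set (Idx d) := {i | (cell k i ∩ D).Nonempty}

lemma finite_nearCubes (hDm : D ⊆ cube 0 m) {k : ℤ} (hk : k ≤ m) : (nearCubes D k).Finite := by
  have := encard_mul_cubeVol_le hk hDm
  by_contra h
  rw [Set.encard_eq_top_iff.2 h] at this
  simp only [ENat.toENNReal_top, ENNReal.top_mul (ofReal_cubeVol_ne_zero k)] at this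
  exact ENNReal.ofReal_ne_top (top_le_iff.1 this)

lemma card_nearCubes_le (hDm : D ⊆ cube 0 m) {I : Finset (Idx d)}
    (hI : ∀ i, i ∈ I ↔ (cell (m - 1) i ∩ D).Nonempty) : (I.card : ℝ≥0∞) ≤ tri d := by
  have h1 := encard_mul_cubeVol_le (k := m - 1) (by omega) hDm
  have e : {i | (cell (m - 1) i ∩ D).Nonempty} = (I : Set (Idx d)) := by
    ext i; simp [hI]
  have e2 := ofReal_cubeVol_add_one (d := d) (m - 1)
  rw [sub_add_cancel] at e2
  rw [e, Set.encard_coe_eq_coe_finsetCard, e2] at h1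
  exact (ENNReal.mul_le_mul_iff_left (ofReal_cubeVol_ne_zero (m - 1)) ENNReal.ofReal_ne_top).1
    (by exact_mod_cast h1)

lemma IsRegularDomain.volume_ne_zero (hD : IsRegularDomain D m κ) : volume D ≠ 0 := fun h => by
  obtain ⟨y, hy⟩ := hD.nonempty
  exact hD.box_ne_zero (k := m - 1) (by omega) hy (measure_mono_null inter_subset_right h)

lemma IsRegularDomain.volume_ne_top (hD : IsRegularDomain D m κ) : volume D ≠ ⊤ :=
  ((isBounded_cube 0 m).subset hD.subset).measure_lt_top.ne

/-- The averages over the cubes at the scale of the domain are controlled by the average over the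
domain and the mean square deviations at that scale. -/
lemma IsRegularDomain.enorm_average_bigCell_sq_le (hD : IsRegularDomain D m κ)
    (hg : IntegrableOn g D) {i₀ : Idx d} (hi₀ : (cell (m - 1) i₀ ∩ D).Nonempty) :
    ‖⨍ z in bigCell (m - 1) i₀ ∩ D, g z‖ₑ ^ 2 ≤ 2 * ‖⨍ z in D, g z‖ₑ ^ 2 +
      (4 + 16 * tri d ^ 3 * κ) * ∑' i, (nearCubes D (m - 1)).indicator
        (fun i => meanSqDev (bigCell (m - 1) i ∩ D) g) i := by
  classical
  set E : ℝ≥0∞ := ∑' i, (nearCubes D (m - 1)).indicator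
        (fun i => meanSqDev (bigCell (m - 1) i ∩ D) g) i with hE
  set b : Idx d → Space d := fun i => ⨍ z in bigCell (m - 1) i ∩ D, g z with hb
  have hfin := finite_nearCubes (k := m - 1) hD.subset (by omega)
  set I := hfin.toFinset with hIdef
  have hI : ∀ i, i ∈ I ↔ (cell (m - 1) i ∩ D).Nonempty := fun i => hfin.mem_toFinset
  have hcard := card_nearCubes_le hD.subset hI
  have hEi : ∀ i ∈ I, meanSqDev (bigCell (m - 1) i ∩ D) g ≤ E := fun i hi => by
    have := ENNReal.le_tsum (f := (nearCubes D (m - 1)).indicator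
        (fun i => meanSqDev (bigCell (m - 1) i ∩ D) g)) i
    rwa [indicator_of_mem (s := nearCubes D (m - 1)) ((hI i).1 hi)] at this
  have hEsum : ∑ i ∈ I, meanSqDev (bigCell (m - 1) i ∩ D) g ≤ E := by
    refine le_trans (Finset.sum_le_sum fun i hi => ?_) (ENNReal.sum_le_tsum I)
    rw [indicator_of_mem (s := nearCubes D (m - 1)) ((hI i).1 hi)]
  set δ : ℝ≥0∞ := 2 * (κ * E) ^ (1 / 2 : ℝ) with hδ
  have hδ2 : δ ^ 2 = 4 * (κ * E) := by rw [hδ, mul_pow, sq_rpow_half]; norm_num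
  -- `D` is connected, so any two of the cubes that meet it are joined by a chain of adjacent ones
  have hdist : ∀ i ∈ I, edist (b i₀) (b i) ≤ tri d * δ := fun i hi => by
    refine (edist_le_card_mul I b δ (fun A hA hA0 hAI => ?_) hi ((hI i₀).2 hi₀)).trans
      (by gcongr)
    obtain ⟨j, hj, j', hj', hjn, y, hyD, hy, hy'⟩ :=
      exists_adjacent hD.isOpen hD.isPreconnected hI hA hA0 hAI
    refine ⟨j, hj, j', hj', hjn, ?_⟩
    have h1 := hD.enorm_sub_box_le hg (k := m - 1) (by omega) hyD hy
    have h2 := hD.enorm_sub_box_le hg (k := m - 1) (by omega) hyD hy'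
    refine (edist_triangle_left _ _ (⨍ z in box y (m - 1) ∩ D, g z)).trans ?_
    rw [edist_eq_enorm_sub, edist_eq_enorm_sub, hδ, two_mul]
    refine add_le_add (h1.trans ?_) (h2.trans ?_)
    · gcongr; exact hEi j (hA hj)
    · gcongr; exact hEi j' hj'
  have hint : volume D * ‖(⨍ z in D, g z) - b i₀‖ₑ ^ 2 ≤
      volume D * (2 * E + 8 * tri d ^ 3 * κ * E) := by
    calc volume D * ‖(⨍ z in D, g z) - b i₀‖ₑ ^ 2
        ≤ ∫⁻ z in D, ‖g z - b i₀‖ₑ ^ 2 :=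
          volume_mul_enorm_average_sub_sq_le hD.volume_ne_zero hD.volume_ne_top hg _
      _ = ∑' i, ∫⁻ z in D ∩ cell (m - 1) i, ‖g z - b i₀‖ₑ ^ 2 :=
          lintegral_eq_tsum_cell (m - 1) hD.isOpen.measurableSet _
      _ = ∑ i ∈ I, ∫⁻ z in D ∩ cell (m - 1) i, ‖g z - b i₀‖ₑ ^ 2 := by
          refine tsum_eq_sum fun i hi => ?_
          rw [hI, not_nonempty_iff_eq_empty, inter_comm] at hi
          rw [hi]
          simp
      _ ≤ ∑ i ∈ I, volume D * (2 * meanSqDev (bigCell (m - 1) i ∩ D) g +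
            8 * tri d ^ 2 * κ * E) := by
          refine Finset.sum_le_sum fun i hi => ?_
          obtain ⟨y, hyi, hyD⟩ := (hI i).1 hi
          have hV0 : volume (bigCell (m - 1) i ∩ D) ≠ 0 := fun h =>
            hD.box_ne_zero (k := m - 1) (by omega) hyD (measure_mono_null
              (inter_subset_inter_left _ (box_subset_bigCell (cell_subset_closedCell _ _ hyi))) h)
          calc ∫⁻ z in D ∩ cell (m - 1) i, ‖g z - b i₀‖ₑ ^ 2
              ≤ ∫⁻ z in bigCell (m - 1) i ∩ D, ‖g z - b i₀‖ₑ ^ 2 :=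
                lintegral_mono_set (by
                  rw [inter_comm]
                  exact inter_subset_inter_left _ (cell_subset_bigCell _ _))
            _ ≤ ∫⁻ z in bigCell (m - 1) i ∩ D,
                  (2 * ‖g z - b i‖ₑ ^ 2 + 2 * (tri d * δ) ^ 2) := by
                refine lintegral_mono fun z => ?_
                have e : g z - b i₀ = (g z - b i) + (b i - b i₀) := by abel
                rw [e]
                refine (pow_le_pow_left' (enorm_add_le _ _) 2).trans
                  ((add_sq_le_two_mul _ _).trans ?_)
                gcongr
                have := hdist i hi
                rwa [edist_comm, edist_eq_enorm_sub] at this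
            _ = volume (bigCell (m - 1) i ∩ D) * (2 * meanSqDev (bigCell (m - 1) i ∩ D) g +
                  8 * tri d ^ 2 * κ * E) := by
                rw [lintegral_add_right _ measurable_const, lintegral_const_mul' _ _ (by norm_num),
                  ← volume_mul_meanSqDev hV0 (bigCell_inter_ne_top _ _), lintegral_const,
                  Measure.restrict_apply_univ, mul_pow, hδ2]
                ring
            _ ≤ _ := by
                gcongr
                exact inter_subset_right
      _ = volume D * (2 * ∑ i ∈ I, meanSqDev (bigCell (m - 1) i ∩ D) g +
            I.card * (8 * tri d ^ 2 * κ * E)) := by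
          rw [← Finset.mul_sum, Finset.sum_add_distrib, Finset.sum_const, nsmul_eq_mul,
            ← Finset.mul_sum]
      _ ≤ volume D * (2 * E + tri d * (8 * tri d ^ 2 * κ * E)) := by gcongr
      _ = _ := by ring
  have h2 := (ENNReal.mul_le_mul_iff_right hD.volume_ne_zero hD.volume_ne_top).1 hint
  have e : b i₀ = (⨍ z in D, g z) + (b i₀ - ⨍ z in D, g z) := by abel
  change ‖b i₀‖ₑ ^ 2 ≤ _
  calc ‖b i₀‖ₑ ^ 2 ≤ (‖⨍ z in D, g z‖ₑ + ‖b i₀ - ⨍ z in D, g z‖ₑ) ^ 2 := by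
        conv_lhs => rw [e]
        exact pow_le_pow_left' (enorm_add_le _ _) 2
    _ ≤ 2 * ‖⨍ z in D, g z‖ₑ ^ 2 + 2 * ‖b i₀ - ⨍ z in D, g z‖ₑ ^ 2 := add_sq_le_two_mul _ _
    _ ≤ 2 * ‖⨍ z in D, g z‖ₑ ^ 2 + 2 * (2 * E + 8 * tri d ^ 3 * κ * E) := by
        rw [← edist_eq_enorm_sub (b i₀), edist_comm, edist_eq_enorm_sub]
        gcongr
    _ = _ := by ring

/-- Cauchy-Schwarz against a geometric series. -/
lemma tsum_geometric_sq_le (ρ : ℝ≥0∞) (h0 : ρ ≠ 0) (h1 : ρ ≠ ⊤) (t : ℕ → ℝ≥0∞) :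
    (∑' n, t n) ^ 2 ≤ (∑' n, ρ ^ n) * ∑' n, (ρ ^ n)⁻¹ * t n ^ 2 := by
  have e1 : ∀ n, t n = (ρ ^ n) ^ (1 / 2 : ℝ) * (((ρ ^ n)⁻¹) ^ (1 / 2 : ℝ) * t n) := fun n => by
    rw [← mul_assoc, ← ENNReal.mul_rpow_of_nonneg _ _ (by norm_num),
      ENNReal.mul_inv_cancel (pow_ne_zero _ h0) (ENNReal.pow_ne_top h1), ENNReal.one_rpow, one_mul]
  calc (∑' n, t n) ^ 2 = (∑' n, (ρ ^ n) ^ (1 / 2 : ℝ) * (((ρ ^ n)⁻¹) ^ (1 / 2 : ℝ) * t n)) ^ 2 := by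
        congr 1
        exact tsum_congr e1
    _ ≤ _ := tsum_mul_sq_le _ _
    _ = _ := by
        simp only [mul_pow, sq_rpow_half]

/-- The ratio `3^{(2s-1)/2}` of the geometric series in the Hardy inequality. -/
def hardyRatio (s : ℝ) : ℝ≥0∞ := (3 : ℝ≥0∞) ^ ((2 * s - 1) / 2)

lemma hardyRatio_sq (s : ℝ) : hardyRatio s ^ 2 = (3 : ℝ≥0∞) ^ (2 * s) / 3 := by
  rw [hardyRatio, ← ENNReal.rpow_two, ← ENNReal.rpow_mul]
  conv_rhs => rw [div_eq_mul_inv, ← ENNReal.rpow_neg_one, ← ENNReal.rpow_add _ _ (by norm_num) (by norm_num)]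
  congr 1
  ring

lemma hardyRatio_ne_zero (s : ℝ) : hardyRatio s ≠ 0 :=
  (ENNReal.rpow_pos (by norm_num) (by norm_num)).ne'

lemma hardyRatio_ne_top (s : ℝ) : hardyRatio s ≠ ⊤ :=
  ENNReal.rpow_ne_top_of_ne_zero (by norm_num) (by norm_num)

lemma tsum_hardyRatio_ne_top {s : ℝ} (hs : s < 1 / 2) : ∑' n, hardyRatio s ^ n ≠ ⊤ := by
  rw [ENNReal.tsum_geometric]
  refine ENNReal.inv_ne_top.2 (tsub_pos_of_lt ?_).ne'
  exact ENNReal.rpow_lt_one_of_one_lt_of_neg (by norm_num) (by linarith)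

open Classical in
/-- The sum over the maximal cubes: the Hardy inequality, for `s < 1/2`. -/
lemma IsRegularDomain.tsum_maxCubes_average_le (hD : IsRegularDomain D m κ) (s : ℝ)
    (hg : IntegrableOn g D) :
    ∑' x, (maxCubes D).indicator (fun x => (wt s x.1)⁻¹ * ENNReal.ofReal (cubeVol d x.1) *
      ‖⨍ z in cell x.1 x.2, g z‖ₑ ^ 2) x ≤
    (∑' n, hardyRatio s ^ n) ^ 2 * κ * ((2 * (tri d * κ) + 2 * (tri d * (4 + 16 * tri d ^ 3 * κ))) *
      devSum s m D g + 4 * ((wt s (m - 1))⁻¹ * ENNReal.ofReal (cubeVol d m) *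
        ‖⨍ z in D, g z‖ₑ ^ 2)) := by
  set S := ∑' n, hardyRatio s ^ n with hS
  set E : ℝ≥0∞ := ∑' i, (nearCubes D (m - 1)).indicator
        (fun i => meanSqDev (bigCell (m - 1) i ∩ D) g) i with hE
  set K2 : ℝ≥0∞ := 2 * ‖⨍ z in D, g z‖ₑ ^ 2 + (4 + 16 * tri d ^ 3 * κ) * E with hK2
  set h : ℤ → Idx d → ℝ≥0∞ := fun l p =>
    (tri d * κ * meanSqDev (bigCell l p ∩ D) g) ^ (1 / 2 : ℝ) +
      if l = m - 1 then K2 ^ (1 / 2 : ℝ) else 0 with hh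
  set R : ℝ≥0∞ := ∑' x : ℤ × Idx d, {x : ℤ × Idx d | x.1 < m ∧ (cell x.1 x.2 ∩ D).Nonempty}.indicator
        (fun x => (wt s x.1)⁻¹ * ENNReal.ofReal (cubeVol d x.1) * h x.1 x.2 ^ 2) x with hR
  -- the average over a maximal cube is bounded by a sum over its ancestors
  have h1 : ∀ x ∈ maxCubes D, ‖⨍ z in cell x.1 x.2, g z‖ₑ ≤
      ∑' n : ℕ, if x.1 + n < m then h (x.1 + n) (par^[n] x.2) else 0 := fun x hx => by
    have hxm : x.1 < m := by
      by_contra! hge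
      have h2 : cell x.1 x.2 ⊆ cell m 0 := by rw [cell_zero]; exact hx.1.trans hD.subset
      have h3 := scale_le_of_subset h2
      obtain h4 : x.1 = m := le_antisymm h3 hge
      exact hD.not_subset x.2 (h4 ▸ hx.1)
    obtain ⟨N, hN⟩ := Int.le.dest (show x.1 ≤ m - 1 by omega)
    have hN' : x.1 + (N : ℤ) = m - 1 := hN
    have hlt : x.1 + (N : ℤ) < m := by omega
    refine (hD.enorm_average_cell_le hg hx.1 N hlt).trans ?_
    have hnear : (cell (m - 1) (par^[N] x.2) ∩ D).Nonempty := by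
      rw [← hN']
      exact ⟨_, iterate_par_subset x.1 N x.2 (ctr_mem_cell _ _), hx.1 (ctr_mem_cell _ _)⟩
    have hK : ‖⨍ z in bigCell (x.1 + N) (par^[N] x.2) ∩ D, g z‖ₑ ≤ K2 ^ (1 / 2 : ℝ) := by
      rw [hN']
      have := hD.enorm_average_bigCell_sq_le hg hnear
      calc _ = (‖⨍ z in bigCell (m - 1) (par^[N] x.2) ∩ D, g z‖ₑ ^ 2) ^ (1 / 2 : ℝ) := by
            rw [← ENNReal.rpow_two, ← ENNReal.rpow_mul]
            norm_num
        _ ≤ _ := by gcongr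
    refine (add_le_add_right hK _).trans ?_
    refine le_trans ?_ (ENNReal.sum_le_tsum (Finset.range (N + 1)))
    rw [Finset.sum_range_succ, Finset.sum_range_succ _ N, if_pos hlt, add_assoc]
    refine add_le_add (Finset.sum_le_sum fun j hj => ?_) ?_
    · have := Finset.mem_range.1 hj
      rw [if_pos (by omega)]
      exact le_self_add
    · rw [hh]
      simp only []
      rw [if_pos hN']
  have h2 : ∀ x, (maxCubes D).indicator (fun x => (wt s x.1)⁻¹ * ENNReal.ofReal (cubeVol d x.1) *
      ‖⨍ z in cell x.1 x.2, g z‖ₑ ^ 2) x ≤ ∑' n : ℕ, S * (hardyRatio s ^ n)⁻¹ *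
      (maxCubes D).indicator (fun x => if x.1 + n < m then
      (wt s x.1)⁻¹ * ENNReal.ofReal (cubeVol d x.1) * h (x.1 + n) (par^[n] x.2) ^ 2 else 0) x :=
    fun x => by
    by_cases hx : x ∈ maxCubes D
    · simp only [indicator_of_mem hx]
      calc _ ≤ (wt s x.1)⁻¹ * ENNReal.ofReal (cubeVol d x.1) * (S * ∑' n : ℕ,
            (hardyRatio s ^ n)⁻¹ * (if x.1 + n < m then h (x.1 + n) (par^[n] x.2) else 0) ^ 2) := by
            gcongr
            exact (pow_le_pow_left' (h1 x hx) 2).trans (tsum_geometric_sq_le _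
              (hardyRatio_ne_zero s) (hardyRatio_ne_top s) _)
        _ = _ := by
            rw [← ENNReal.tsum_mul_left, ← ENNReal.tsum_mul_left]
            refine tsum_congr fun n => ?_
            split_ifs
            · ring
            · simp
    · rw [indicator_of_notMem hx]
      exact zero_le
  -- the loss `ρ⁻ⁿ` of Cauchy-Schwarz is beaten by the gain `ρ²ⁿ` from the layer condition
  have h3 : ∀ n : ℕ, ∑' x, S * (hardyRatio s ^ n)⁻¹ *
      (maxCubes D).indicator (fun x => if x.1 + n < m then
      (wt s x.1)⁻¹ * ENNReal.ofReal (cubeVol d x.1) * h (x.1 + n) (par^[n] x.2) ^ 2 else 0) x ≤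
      S * κ * R * hardyRatio s ^ n := fun n => by
    rw [ENNReal.tsum_mul_left]
    have h4 := hD.tsum_maxCubes_le s (fun l p => h l p ^ 2) n
    rw [← hardyRatio_sq] at h4
    calc _ ≤ S * (hardyRatio s ^ n)⁻¹ * (κ * (hardyRatio s ^ 2) ^ n * R) := by gcongr
      _ = S * κ * R * ((hardyRatio s ^ n)⁻¹ * hardyRatio s ^ n) * hardyRatio s ^ n := by
          rw [← pow_mul, mul_comm 2 n, pow_mul]
          ring
      _ = _ := by
          rw [ENNReal.inv_mul_cancel (pow_ne_zero _ (hardyRatio_ne_zero s))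
            (ENNReal.pow_ne_top (hardyRatio_ne_top s)), mul_one]
  have h5 : R ≤ 2 * (tri d * κ) * devSum s m D g +
      2 * ((wt s (m - 1))⁻¹ * ENNReal.ofReal (cubeVol d m) * K2) := by
    have a1 : R ≤ ∑' x : ℤ × Idx d,
        (2 * (tri d * κ) * {x : ℤ × Idx d | x.1 < m ∧ (cell x.1 x.2 ∩ D).Nonempty}.indicator
        (fun x => (wt s x.1)⁻¹ * ENNReal.ofReal (cubeVol d x.1) *
          meanSqDev (bigCell x.1 x.2 ∩ D) g) x +
        2 * (if x.1 = m - 1 then (nearCubes D (m - 1)).indicator (fun _ => (wt s (m - 1))⁻¹ *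
          ENNReal.ofReal (cubeVol d (m - 1)) * K2) x.2 else 0)) := by
      refine ENNReal.tsum_le_tsum fun x => ?_
      by_cases hx : x ∈ {x : ℤ × Idx d | x.1 < m ∧ (cell x.1 x.2 ∩ D).Nonempty}
      · rw [indicator_of_mem hx, indicator_of_mem hx]
        have b1 : h x.1 x.2 ^ 2 ≤ 2 * (tri d * κ * meanSqDev (bigCell x.1 x.2 ∩ D) g) +
            2 * (if x.1 = m - 1 then K2 else 0) := by
          refine (add_sq_le_two_mul _ _).trans ?_
          rw [sq_rpow_half]
          split_ifs
          · rw [sq_rpow_half]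
          · simp
        refine (mul_le_mul_right b1 _).trans (le_of_eq ?_)
        by_cases hxm : x.1 = m - 1
        · have : x.2 ∈ nearCubes D (m - 1) := by
            have := hx.2
            rwa [hxm] at this
          rw [if_pos hxm, if_pos hxm, indicator_of_mem this, hxm]
          ring
        · rw [if_neg hxm, if_neg hxm]
          ring
      · rw [indicator_of_notMem hx]
        exact zero_le
    refine a1.trans ?_
    rw [ENNReal.tsum_add, ENNReal.tsum_mul_left, ENNReal.tsum_mul_left]
    refine add_le_add le_rfl (mul_le_mul_right ?_ 2)
    rw [ENNReal.tsum_prod', tsum_eq_single (m - 1) (fun k hk => by simp [hk])]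
    simp only [if_true]
    rw [← tsum_subtype (nearCubes D (m - 1)) fun _ => (wt s (m - 1))⁻¹ *
          ENNReal.ofReal (cubeVol d (m - 1)) * K2, ENNReal.tsum_set_const]
    calc _ = (wt s (m - 1))⁻¹ * (((nearCubes D (m - 1)).encard : ℝ≥0∞) *
          ENNReal.ofReal (cubeVol d (m - 1))) * K2 := by ring
      _ ≤ _ := by
        gcongr
        exact encard_mul_cubeVol_le (by omega) hD.subset
  have h6 : (wt s (m - 1))⁻¹ * ENNReal.ofReal (cubeVol d m) * E ≤ tri d * devSum s m D g := by
    have e2 := ofReal_cubeVol_add_one (d := d) (m - 1)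
    rw [sub_add_cancel] at e2
    rw [e2, devSum_eq]
    have := ENNReal.le_tsum (f := (Iio m).indicator (fun k => (wt s k)⁻¹ *
      ENNReal.ofReal (cubeVol d k) * ∑' i, {i | (cell k i ∩ D).Nonempty}.indicator
        (fun i => meanSqDev (bigCell k i ∩ D) g) i)) (m - 1)
    rw [indicator_of_mem (s := Iio m) (by simp)] at this
    calc _ = tri d * ((wt s (m - 1))⁻¹ * ENNReal.ofReal (cubeVol d (m - 1)) * E) := by ring
      _ ≤ _ := by gcongr
  calc _ ≤ ∑' x, ∑' n : ℕ, S * (hardyRatio s ^ n)⁻¹ *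
      (maxCubes D).indicator (fun x => if x.1 + n < m then
      (wt s x.1)⁻¹ * ENNReal.ofReal (cubeVol d x.1) * h (x.1 + n) (par^[n] x.2) ^ 2 else 0) x :=
        ENNReal.tsum_le_tsum h2
    _ ≤ ∑' n : ℕ, S * κ * R * hardyRatio s ^ n := by
        rw [ENNReal.tsum_comm]
        exact ENNReal.tsum_le_tsum h3
    _ = S ^ 2 * κ * R := by
        rw [ENNReal.tsum_mul_left]
        ring
    _ ≤ S ^ 2 * κ * (2 * (tri d * κ) * devSum s m D g +
      (2 * ((4 + 16 * tri d ^ 3 * κ) * ((wt s (m - 1))⁻¹ * ENNReal.ofReal (cubeVol d m) * E)) +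
        4 * ((wt s (m - 1))⁻¹ * ENNReal.ofReal (cubeVol d m) * ‖⨍ z in D, g z‖ₑ ^ 2))) := by
        gcongr
        refine h5.trans (le_of_eq ?_)
        rw [hK2]
        ring
    _ ≤ S ^ 2 * κ * (2 * (tri d * κ) * devSum s m D g +
      (2 * ((4 + 16 * tri d ^ 3 * κ) * (tri d * devSum s m D g)) +
        4 * ((wt s (m - 1))⁻¹ * ENNReal.ofReal (cubeVol d m) * ‖⨍ z in D, g z‖ₑ ^ 2))) := by
        gcongr
    _ = _ := by ring

/-- The increments over cubes whose parent leaves `D` are the averages over the maximal cubes. -/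
lemma incSum_le (s : ℝ) : incSum s D g ≤ oscSum s D g +
    ∑' x, (maxCubes D).indicator (fun x => (wt s x.1)⁻¹ * ENNReal.ofReal (cubeVol d x.1) *
      ‖⨍ z in cell x.1 x.2, g z‖ₑ ^ 2) x := by
  rw [incSum, oscSum, ← ENNReal.tsum_add]
  refine ENNReal.tsum_le_tsum fun x => ?_
  by_cases hx : cell x.1 x.2 ⊆ D
  · rw [indicator_of_mem (s := {x : ℤ × Idx d | cell x.1 x.2 ⊆ D}) hx, cubeInc]
    by_cases hp : cell (x.1 + 1) (par x.2) ⊆ D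
    · rw [if_pos hp, indicator_of_mem (s := {x : ℤ × Idx d | cell (x.1 + 1) (par x.2) ⊆ D}) hp]
      exact le_self_add
    · rw [if_neg hp, indicator_of_mem (s := maxCubes D) ⟨hx, hp⟩, sub_zero]
      exact le_add_self
  · rw [indicator_of_notMem (s := {x : ℤ × Idx d | cell x.1 x.2 ⊆ D}) hx]
    exact zero_le

/-- The increments of a function over the triadic cubes in a regular domain are controlled by its
Besov norm. -/
theorem exists_incSum_le (d : ℕ) (κ : ℝ≥0) {s : ℝ} (hs' : s < 1 / 2) :
    ∃ C : ℝ≥0, ∀ (D : Set (SpaceTime d)) (m : ℤ), IsRegularDomain D m κ →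
      ∀ g : SpaceTime d → Space d, IntegrableOn g D →
        incSum s D g ≤ C * ENNReal.ofReal (cubeVol d m) * besovNorm m D s g ^ 2 ∧
        oscSum s D g ≤ C * ENNReal.ofReal (cubeVol d m) * besovNorm m D s g ^ 2 := by
  set S := ∑' n, hardyRatio s ^ n with hS
  have hSt : S ≠ ⊤ := tsum_hardyRatio_ne_top hs'
  have h3t : (3 : ℝ≥0∞) ^ (2 * s) ≠ ⊤ := ENNReal.rpow_ne_top_of_ne_zero (by norm_num) (by norm_num)
  set c1 : ℝ≥0∞ := tri d * (3 : ℝ≥0∞) ^ (2 * s) with hc1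
  have hc1t : c1 ≠ ⊤ := by finiteness
  set c2 : ℝ≥0∞ := S ^ 2 * κ * ((2 * (tri d * κ) + 2 * (tri d * (4 + 16 * tri d ^ 3 * κ))) *
    (3 : ℝ≥0∞) ^ (2 * s) + 4 * (3 : ℝ≥0∞) ^ (2 * s)) with hc2
  have hc2t : c2 ≠ ⊤ := by finiteness
  refine ⟨(c1 + c2).toNNReal, fun D m hD g hg => ?_⟩
  rw [ENNReal.coe_toNNReal (by finiteness)]
  set B := besovNorm m D s g with hB
  set v := ENNReal.ofReal (cubeVol d m) with hv
  have hdev : devSum s m D g ≤ (3 : ℝ≥0∞) ^ (2 * s) * v * B ^ 2 := by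
    refine (devSum_le s hD.subset hD.nonempty hD.isOpen).trans ?_
    gcongr
    exact le_add_self
  have hav : (wt s (m - 1))⁻¹ * v * ‖⨍ z in D, g z‖ₑ ^ 2 ≤ (3 : ℝ≥0∞) ^ (2 * s) * v * B ^ 2 := by
    have e1 : wt s m = (3 : ℝ≥0∞) ^ (2 * s) * wt s (m - 1) := by
      have := wt_add_one s (m - 1)
      rwa [sub_add_cancel] at this
    have h3 : (3 : ℝ≥0∞) ^ (2 * s) ≠ 0 := (ENNReal.rpow_pos (by norm_num) (by norm_num)).ne'
    have e2 : (wt s (m - 1))⁻¹ = (3 : ℝ≥0∞) ^ (2 * s) * (wt s m)⁻¹ := by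
      rw [e1, ENNReal.mul_inv (Or.inl h3) (Or.inl h3t), ← mul_assoc, ENNReal.mul_inv_cancel h3 h3t,
        one_mul]
    have e3 : (wt s m)⁻¹ = ((3 : ℝ≥0∞) ^ (-(s * (m : ℝ)))) ^ 2 := by
      rw [wt, ← ENNReal.rpow_neg, ← ENNReal.rpow_two, ← ENNReal.rpow_mul]
      congr 1
      ring
    calc _ = (3 : ℝ≥0∞) ^ (2 * s) * v * ((3 : ℝ≥0∞) ^ (-(s * (m : ℝ))) * ‖⨍ z in D, g z‖ₑ) ^ 2 := by
          rw [e2, e3]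
          ring
      _ ≤ _ := by
          gcongr
          exact le_self_add
  have hosc : oscSum s D g ≤ c1 * v * B ^ 2 := by
    calc _ ≤ tri d * devSum s m D g := oscSum_le_devSum s hD.subset hg
      _ ≤ tri d * ((3 : ℝ≥0∞) ^ (2 * s) * v * B ^ 2) := by gcongr
      _ = _ := by rw [hc1]; ring
  have hmax := hD.tsum_maxCubes_average_le s hg
  constructor
  · refine (incSum_le s).trans ?_
    calc _ ≤ c1 * v * B ^ 2 + S ^ 2 * κ * ((2 * (tri d * κ) +
          2 * (tri d * (4 + 16 * tri d ^ 3 * κ))) * ((3 : ℝ≥0∞) ^ (2 * s) * v * B ^ 2) +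
          4 * ((3 : ℝ≥0∞) ^ (2 * s) * v * B ^ 2)) := by
          refine add_le_add hosc (hmax.trans ?_)
          gcongr
      _ = _ := by rw [hc2]; ring
  · refine hosc.trans ?_
    gcongr
    exact le_self_add

end HardyInequality

/-! ### Lipschitz domains: interior balls and boundary layers -/

section Lipschitz

open Metric

variable {d : ℕ} {U : Set (Space d)}

/-- Around its boundary points a bounded Lipschitz domain is, on balls of a common radius, the
positivity set of a Lipschitz function which increases at unit speed in some direction. -/
lemma IsBoundedLipschitzDomain.exists_chart (hU : IsBoundedLipschitzDomain U) :
    ∃ δ : ℝ, 0 < δ ∧ ∃ L : ℝ, 1 ≤ L ∧ ∀ x ∈ frontier U, ∃ (n : Space d) (ψ : Space d → ℝ),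
      ‖n‖ = 1 ∧ (∀ y z, |ψ y - ψ z| ≤ L * ‖y - z‖) ∧ (∀ y (t : ℝ), ψ (y + t • n) = ψ y + t) ∧
      ∀ y ∈ ball x δ, (y ∈ U ↔ 0 < ψ y) := by
  have hc : IsCompact (frontier U) :=
    hU.isBounded.isCompact_closure.of_isClosed_subset isClosed_frontier frontier_subset_closure
  choose! ρ hρ n hn K γ hγ hUγ using hU.boundary
  obtain ⟨t, ht, hcov⟩ := hc.elim_nhds_subcover (fun x => ball x (ρ x / 2))
    fun x hx => ball_mem_nhds _ (half_pos (hρ x hx))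
  have e1 : ∀ᶠ δ : ℝ in 𝓝[>] 0, ∀ x ∈ t, δ ≤ ρ x / 2 := by
    rw [Filter.eventually_all_finset]
    exact fun x hx => (eventually_le_nhds (half_pos (hρ x (ht x hx)))).filter_mono
      nhdsWithin_le_nhds
  obtain ⟨δ, hδ, hδ0⟩ := (e1.and self_mem_nhdsWithin).exists
  have e2 : ∀ᶠ L : ℝ in atTop, ∀ x ∈ t, 1 + 2 * (K x : ℝ) ≤ L := by
    rw [Filter.eventually_all_finset]
    exact fun x _ => eventually_ge_atTop _
  obtain ⟨L, hL, hL1⟩ := (e2.and (eventually_ge_atTop 1)).exists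
  refine ⟨δ, hδ0, L, hL1, fun x hx => ?_⟩
  obtain ⟨c, hct, hxc⟩ := mem_iUnion₂.1 (hcov hx)
  have hcf := ht c hct
  have hn1 := hn c hcf
  refine ⟨n c, fun y => inner ℝ (n c) y - γ c (y - (inner ℝ (n c) y : ℝ) • n c), hn1,
    fun y z => ?_, fun y s => ?_, fun y hy => ?_⟩
  · have h1 : |(inner ℝ (n c) y : ℝ) - inner ℝ (n c) z| ≤ ‖y - z‖ := by
      rw [← inner_sub_right]
      simpa [hn1] using abs_real_inner_le_norm (n c) (y - z)
    have h2 := (hγ c hcf).dist_le_mul (y - (inner ℝ (n c) y : ℝ) • n c)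
      (z - (inner ℝ (n c) z : ℝ) • n c)
    have h3 : dist (y - (inner ℝ (n c) y : ℝ) • n c) (z - (inner ℝ (n c) z : ℝ) • n c) ≤
        2 * ‖y - z‖ := by
      have e : y - (inner ℝ (n c) y : ℝ) • n c - (z - (inner ℝ (n c) z : ℝ) • n c) =
          (y - z) - ((inner ℝ (n c) y : ℝ) - inner ℝ (n c) z) • n c := by
        rw [sub_smul]; abel
      rw [dist_eq_norm, e]
      refine (norm_sub_le _ _).trans ?_
      rw [norm_smul, hn1, mul_one, Real.norm_eq_abs]
      linarith
    rw [Real.dist_eq] at h2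
    have hK : (0 : ℝ) ≤ K c := (K c).2
    have h4 := h2.trans (mul_le_mul_of_nonneg_left h3 hK)
    have h5 := hL c hct
    have h6 := norm_nonneg (y - z)
    rw [abs_le] at h1 h4 ⊢
    constructor <;> nlinarith
  · have hinner : (inner ℝ (n c) (y + s • n c) : ℝ) = inner ℝ (n c) y + s := by
      rw [inner_add_right, inner_smul_right, real_inner_self_eq_norm_sq, hn1]
      ring
    simp only [hinner]
    have e : y + s • n c - ((inner ℝ (n c) y : ℝ) + s) • n c = y - (inner ℝ (n c) y : ℝ) • n c := by
      rw [add_smul]; abel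
    rw [e]
    ring
  · have hyc : y ∈ ball c (ρ c) := by
      rw [mem_ball] at hxc hy ⊢
      have := hδ c hct
      linarith [dist_triangle y x c]
    rw [hUγ c hcf y hyc, sub_pos]

/-- A connected set which meets `s` and its complement meets the boundary of `s`. -/
lemma exists_mem_frontier {X : Type*} [TopologicalSpace X] {s t : Set X} (ht : IsPreconnected t)
    {x y : X} (hx : x ∈ t) (hxs : x ∈ s) (hy : y ∈ t) (hys : y ∉ s) : ∃ z ∈ t, z ∈ frontier s := by
  by_contra! h
  have hsub : t ⊆ interior s ∪ interior sᶜ := fun z hz => by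
    rw [← compl_frontier_eq_union_interior]
    exact h z hz
  obtain ⟨z, -, hz1, hz2⟩ := ht _ _ isOpen_interior isOpen_interior hsub
    ⟨x, hx, (hsub hx).resolve_right fun h' => interior_subset h' hxs⟩
    ⟨y, hy, (hsub hy).resolve_left fun h' => hys (interior_subset h')⟩
  exact interior_subset hz2 (interior_subset hz1)

/-- Around each of its points, a bounded Lipschitz domain contains balls of comparable radius. -/
lemma IsBoundedLipschitzDomain.exists_ball_subset (hU : IsBoundedLipschitzDomain U) :
    ∃ δ : ℝ, 0 < δ ∧ ∃ c : ℝ, 0 < c ∧ ∀ x ∈ U, ∀ ρ, 0 < ρ → ρ ≤ δ →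
      ∃ x', ball x' (c * ρ) ⊆ ball x ρ ∩ U := by
  obtain ⟨δ, hδ, L, hL, h⟩ := hU.exists_chart
  refine ⟨δ / 2, half_pos hδ, (4 * L)⁻¹, by positivity, fun x hx ρ hρ hρδ => ?_⟩
  have hcρ : (4 * L)⁻¹ * ρ ≤ ρ / 4 := by
    rw [inv_mul_le_iff₀ (by positivity)]
    nlinarith
  by_cases hb : ball x (ρ / 2) ⊆ U
  · exact ⟨x, subset_inter (ball_subset_ball (by linarith))
      ((ball_subset_ball (by linarith)).trans hb)⟩
  · obtain ⟨q, hq, hqU⟩ := not_subset.1 hb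
    obtain ⟨x₀, hx₀, hx₀f⟩ := exists_mem_frontier (convex_ball x (ρ / 2)).isPreconnected
      (mem_ball_self (half_pos hρ)) hx hq hqU
    obtain ⟨n, ψ, hn, hψ, hψn, hψU⟩ := h x₀ hx₀f
    rw [mem_ball] at hx₀
    have hxU := (hψU x (by rw [mem_ball, dist_comm]; linarith)).1 hx
    refine ⟨x + (ρ / 2) • n, fun y hy => ?_⟩
    rw [mem_ball, dist_eq_norm] at hy
    have h1 : dist y x < ρ := by
      have e : y - x = (y - (x + (ρ / 2) • n)) + (ρ / 2) • n := by abel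
      rw [dist_eq_norm, e]
      refine (norm_add_le _ _).trans_lt ?_
      rw [norm_smul, hn, Real.norm_of_nonneg (by positivity)]
      linarith
    refine ⟨h1, (hψU y ?_).2 ?_⟩
    · rw [mem_ball]
      have := dist_triangle y x x₀
      rw [dist_comm x x₀] at this
      linarith
    · have h2 := hψ y (x + (ρ / 2) • n)
      rw [hψn] at h2
      have h3 : L * ‖y - (x + (ρ / 2) • n)‖ ≤ ρ / 4 := by
        have : L * ((4 * L)⁻¹ * ρ) = ρ / 4 := by field_simp
        rw [← this]
        gcongr
      have h4 := abs_le.1 (h2.trans h3)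
      linarith

/-- The points of `U` at distance at most `η` from the complement. -/
def boundaryLayer (U : Set (Space d)) (η : ℝ) : Set (Space d) := {y | y ∈ U ∧ ∃ q ∉ U, dist y q ≤ η}

lemma volume_ball_space (x : Space d) {ρ : ℝ} (hρ : 0 < ρ) :
    volume (ball x ρ) = ENNReal.ofReal (ρ ^ d) * volume (ball (0 : Space d) 1) := by
  rw [Measure.addHaar_ball_of_pos _ _ hρ, finrank_euclideanSpace_fin]

/-- The layers `0 < ψ ≤ θ` are thin, since they have many disjoint translates. -/
lemma volume_layer_le {n : Space d} {ψ : Space d → ℝ} (hn : ‖n‖ = 1)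
    (hψn : ∀ y (t : ℝ), ψ (y + t • n) = ψ y + t) (hψ : Continuous ψ) (x : Space d) {ρ θ : ℝ}
    (hρ : 0 < ρ) (hθ : 0 < θ) :
    volume {y | y ∈ ball x ρ ∧ 0 < ψ y ∧ ψ y ≤ θ} ≤
      ENNReal.ofReal (2 * (θ / ρ) * (2 * ρ) ^ d) * volume (ball (0 : Space d) 1) := by
  set A := {y | y ∈ ball x ρ ∧ 0 < ψ y ∧ ψ y ≤ θ} with hA
  set vB := volume (ball (0 : Space d) 1)
  have hAm : MeasurableSet A :=
    measurableSet_ball.inter ((isOpen_lt continuous_const hψ).measurableSet.inter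
      (isClosed_le hψ continuous_const).measurableSet)
  rcases lt_or_ge ρ θ with hlt | hge
  · calc volume A ≤ volume (ball x ρ) := measure_mono fun y hy => hy.1
      _ = ENNReal.ofReal (ρ ^ d) * vB := volume_ball_space x hρ
      _ ≤ _ := by
        gcongr
        have h1 : ρ ^ d ≤ (2 * ρ) ^ d := by gcongr; linarith
        have h2 : 1 ≤ 2 * (θ / ρ) := by
          rw [← mul_div_assoc, one_le_div hρ]
          linarith
        have h3 : 0 < (2 * ρ) ^ d := by positivity
        nlinarith
  · set N := ⌊ρ / θ⌋₊ with hN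
    have hN1 : 1 ≤ N := Nat.one_le_floor_iff _ |>.2 ((one_le_div hθ).2 hge)
    have hNle : (N : ℝ) * θ ≤ ρ := by
      have := Nat.floor_le (show 0 ≤ ρ / θ by positivity)
      rwa [le_div_iff₀ hθ] at this
    have hNge : ρ / θ ≤ 2 * N := by
      have := (Nat.lt_floor_add_one (ρ / θ)).le
      have h1 : (1 : ℝ) ≤ N := by exact_mod_cast hN1
      linarith
    -- translates of the layer by multiples of `θ` in the direction `n`
    set B : ℕ → Set (Space d) := fun j => (fun y => (-((j : ℝ) * θ) • n) + y) ⁻¹' A with hB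
    have hBv : ∀ j, volume (B j) = volume A := fun j => measure_preimage_add _ _ _
    have hBm : ∀ j, MeasurableSet (B j) := fun j => (measurable_const_add _) hAm
    have hψB : ∀ {j y}, y ∈ B j → (j : ℝ) * θ < ψ y ∧ ψ y ≤ (j + 1) * θ := fun {j y} hy => by
      have h1 : ψ (-((j : ℝ) * θ) • n + y) = ψ y - j * θ := by
        rw [add_comm, hψn]; ring
      have h2 := hy.2
      rw [h1] at h2
      constructor <;> linarith [h2.1, h2.2]
    have hdisj : Pairwise (Function.onFun Disjoint B) := fun i j hij => by
      rw [Function.onFun, Set.disjoint_left]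
      intro y hi hj
      have h1 := hψB hi
      have h2 := hψB hj
      rcases lt_or_gt_of_ne hij with h | h
      · have : ((i : ℝ) + 1) ≤ j := by exact_mod_cast h
        nlinarith
      · have : ((j : ℝ) + 1) ≤ i := by exact_mod_cast h
        nlinarith
    have hsub : ⋃ j ∈ Finset.range N, B j ⊆ ball x (2 * ρ) := by
      refine iUnion₂_subset fun j hj y hy => ?_
      have h1 : dist (-((j : ℝ) * θ) • n + y) x < ρ := hy.1
      have h2 : (j : ℝ) * θ ≤ ρ := by
        have : (j : ℝ) ≤ N := by exact_mod_cast (Finset.mem_range.1 hj).le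
        nlinarith
      have e : y - x = (-((j : ℝ) * θ) • n + y - x) + ((j : ℝ) * θ) • n := by
        rw [neg_smul]; abel
      rw [mem_ball, dist_eq_norm, e]
      rw [dist_eq_norm] at h1
      refine (norm_add_le _ _).trans_lt ?_
      rw [norm_smul, hn, Real.norm_of_nonneg (by positivity)]
      linarith
    have hle : (N : ℝ≥0∞) * volume A ≤ ENNReal.ofReal ((2 * ρ) ^ d) * vB := by
      calc (N : ℝ≥0∞) * volume A = ∑ j ∈ Finset.range N, volume (B j) := by
            simp [hBv]
        _ = volume (⋃ j ∈ Finset.range N, B j) :=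
            (measure_biUnion_finset (fun i _ j _ hij => hdisj hij) fun j _ => hBm j).symm
        _ ≤ volume (ball x (2 * ρ)) := measure_mono hsub
        _ = _ := volume_ball_space x (by positivity)
    have hN2 : ENNReal.ofReal (2 * (θ / ρ)) * (N : ℝ≥0∞) ≥ 1 := by
      rw [← ENNReal.ofReal_natCast, ← ENNReal.ofReal_mul (by positivity), ge_iff_le,
        ENNReal.one_le_ofReal]
      have : θ / ρ * (ρ / θ) = 1 := by field_simp
      have h0 : 0 < θ / ρ := by positivity
      nlinarith
    calc volume A ≤ (ENNReal.ofReal (2 * (θ / ρ)) * (N : ℝ≥0∞)) * volume A :=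
          le_mul_of_one_le_left' hN2
      _ = ENNReal.ofReal (2 * (θ / ρ)) * ((N : ℝ≥0∞) * volume A) := mul_assoc _ _ _
      _ ≤ ENNReal.ofReal (2 * (θ / ρ)) * (ENNReal.ofReal ((2 * ρ) ^ d) * vB) := by gcongr
      _ = _ := by
        rw [← mul_assoc, ← ENNReal.ofReal_mul (by positivity)]

/-- Boundary layers in small balls. -/
lemma IsBoundedLipschitzDomain.exists_volume_layer_le (hU : IsBoundedLipschitzDomain U) :
    ∃ δ : ℝ, 0 < δ ∧ ∃ C : ℝ, 0 < C ∧ ∀ x ρ η, 0 < ρ → ρ ≤ δ → 0 < η →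
      volume (boundaryLayer U η ∩ ball x ρ) ≤ ENNReal.ofReal (C * (η / ρ) * ρ ^ d) := by
  obtain ⟨δ, hδ, L, hL, h⟩ := hU.exists_chart
  set vB := volume (ball (0 : Space d) 1) with hvB
  have hvBt : vB ≠ ⊤ := measure_ball_lt_top.ne
  have hvB0 : 0 < vB.toReal := ENNReal.toReal_pos (measure_ball_pos _ _ one_pos).ne' hvBt
  have hvBe : vB = ENNReal.ofReal vB.toReal := (ENNReal.ofReal_toReal hvBt).symm
  refine ⟨δ / 4, by positivity, 2 * L * 2 ^ d * vB.toReal, by positivity,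
    fun x ρ η hρ hρδ hη => ?_⟩
  rcases lt_or_ge ρ η with hlt | hge
  · calc volume (boundaryLayer U η ∩ ball x ρ) ≤ volume (ball x ρ) := measure_mono inter_subset_right
      _ = ENNReal.ofReal (ρ ^ d * vB.toReal) := by
        rw [volume_ball_space x hρ, ← hvB, ENNReal.ofReal_mul (by positivity), ← hvBe]
      _ ≤ _ := by
        apply ENNReal.ofReal_le_ofReal
        have h1 : 1 ≤ η / ρ := (one_le_div hρ).2 hlt.le
        have h2 : (1 : ℝ) ≤ 2 ^ d := one_le_pow₀ (by norm_num)
        have h3 : 0 < ρ ^ d * vB.toReal := by positivity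
        have h4 : 1 ≤ 2 * L * 2 ^ d * (η / ρ) := by
          have : 1 ≤ L * 2 ^ d := one_le_mul_of_one_le_of_one_le hL h2
          have := one_le_mul_of_one_le_of_one_le this h1
          nlinarith
        calc ρ ^ d * vB.toReal ≤ (2 * L * 2 ^ d * (η / ρ)) * (ρ ^ d * vB.toReal) :=
              le_mul_of_one_le_left h3.le h4
          _ = _ := by ring
  · rcases (boundaryLayer U η ∩ ball x ρ).eq_empty_or_nonempty with he | ⟨y₀, ⟨hy₀U, q₀, hq₀, hyq₀⟩, hy₀⟩
    · rw [he]; simp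
    obtain ⟨x₀, hx₀, hx₀f⟩ := exists_mem_frontier (convex_closedBall y₀ η).isPreconnected
      (mem_closedBall_self hη.le) hy₀U (by rwa [mem_closedBall, dist_comm] : q₀ ∈ _) hq₀
    obtain ⟨n, ψ, hn, hψ, hψn, hψU⟩ := h x₀ hx₀f
    have hψc : Continuous ψ := by
      refine (LipschitzWith.of_dist_le_mul (K := ⟨L, by linarith⟩) fun y z => ?_).continuous
      rw [Real.dist_eq, dist_eq_norm]
      exact hψ y z
    rw [mem_closedBall] at hx₀
    have hsub : boundaryLayer U η ∩ ball x ρ ⊆ {y | y ∈ ball x ρ ∧ 0 < ψ y ∧ ψ y ≤ L * η} := by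
      rintro y ⟨⟨hyU, q, hq, hyq⟩, hy⟩
      rw [mem_ball] at hy hy₀
      have h1 : dist y x₀ < 2 * ρ + η := by
        have a1 := dist_triangle y y₀ x₀
        have a2 := dist_triangle y x y₀
        rw [dist_comm x y₀] at a2
        rw [dist_comm x₀ y₀] at hx₀
        linarith
      have h2 := (hψU y (by rw [mem_ball]; linarith)).1 hyU
      have h3 : ¬ 0 < ψ q := fun h0 => hq ((hψU q (by
        rw [mem_ball]
        have := dist_triangle q y x₀
        rw [dist_comm q y] at this
        linarith)).2 h0)
      refine ⟨hy, h2, ?_⟩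
      have h4 := (abs_le.1 (hψ y q)).2
      rw [← dist_eq_norm] at h4
      nlinarith
    calc _ ≤ _ := measure_mono hsub
      _ ≤ ENNReal.ofReal (2 * (L * η / ρ) * (2 * ρ) ^ d) * vB :=
        volume_layer_le hn hψn hψc x hρ (by positivity)
      _ = _ := by
        conv_lhs => rw [hvBe, ← ENNReal.ofReal_mul (by positivity)]
        congr 1
        rw [mul_pow]
        ring

/-- Boundary layers in balls of bounded radius. -/
lemma IsBoundedLipschitzDomain.exists_volume_layer_le' (hU : IsBoundedLipschitzDomain U)
    (hd : 0 < d) (R : ℝ) :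
    ∃ C : ℝ, 0 < C ∧ ∀ x ρ η, 0 < ρ → ρ ≤ R → 0 < η →
      volume (boundaryLayer U η ∩ ball x ρ) ≤ ENNReal.ofReal (C * (η / ρ) * ρ ^ d) := by
  obtain ⟨δ, hδ, C, hC, h⟩ := hU.exists_volume_layer_le
  obtain ⟨t, htf, ht⟩ := Metric.totallyBounded_iff.1
    (hU.isBounded.isCompact_closure.totallyBounded.subset subset_closure) δ hδ
  refine ⟨(t.ncard + 1) * C, by positivity, fun x ρ η hρ hρR hη => ?_⟩
  rcases le_or_gt ρ δ with hle | hgt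
  · refine (h x ρ η hρ hle hη).trans (ENNReal.ofReal_le_ofReal ?_)
    have : 0 ≤ (t.ncard : ℝ) * (C * (η / ρ) * ρ ^ d) := by positivity
    linarith
  · have hcov : boundaryLayer U η ∩ ball x ρ ⊆ ⋃ c ∈ htf.toFinset, boundaryLayer U η ∩ ball c δ := by
      rintro y ⟨hy, -⟩
      obtain ⟨c, hc, hyc⟩ := mem_iUnion₂.1 (ht hy.1)
      exact mem_iUnion₂.2 ⟨c, htf.mem_toFinset.2 hc, hy, hyc⟩
    have hmono : δ ^ d / δ ≤ ρ ^ d / ρ := by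
      obtain ⟨e, rfl⟩ : ∃ e, d = e + 1 := ⟨d - 1, by omega⟩
      rw [pow_succ, pow_succ, mul_div_assoc, mul_div_assoc, div_self hδ.ne', div_self hρ.ne',
        mul_one, mul_one]
      gcongr
    calc _ ≤ volume (⋃ c ∈ htf.toFinset, boundaryLayer U η ∩ ball c δ) := measure_mono hcov
      _ ≤ ∑ c ∈ htf.toFinset, volume (boundaryLayer U η ∩ ball c δ) :=
        measure_biUnion_finset_le _ _
      _ ≤ ∑ _c ∈ htf.toFinset, ENNReal.ofReal (C * (η / δ) * δ ^ d) :=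
        Finset.sum_le_sum fun c _ => h c δ η hδ le_rfl hη
      _ = ENNReal.ofReal (t.ncard * (C * (η / δ) * δ ^ d)) := by
        rw [Finset.sum_const, nsmul_eq_mul, ENNReal.ofReal_mul (p := (t.ncard : ℝ)) (by positivity),
          ENNReal.ofReal_natCast, Set.ncard_eq_toFinset_card t htf]
      _ ≤ _ := by
        apply ENNReal.ofReal_le_ofReal
        calc (t.ncard : ℝ) * (C * (η / δ) * δ ^ d) = t.ncard * C * η * (δ ^ d / δ) := by ring
          _ ≤ (t.ncard + 1) * C * η * (ρ ^ d / ρ) := by gcongr; linarith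
          _ = _ := by ring

end Lipschitz

/-! ### Regularity of space-time cylinders -/

section Cylinder

open Metric

variable {d : ℕ} {U : Set (Space d)}

lemma zpow_two_mul_three (k : ℤ) : (3 : ℝ) ^ (2 * k) = (3 ^ k) ^ 2 := by
  rw [mul_comm, zpow_mul]
  norm_cast

lemma norm_apply_le (x : Space d) (l : Fin d) : |x l| ≤ ‖x‖ := by
  simpa using PiLp.norm_apply_le x l

/-- The smallest cube containing a cylinder is comparable to the cylinder. -/
lemma zpow_lt_of_isLeast {T R r : ℝ} (hT : 0 < T) (hR : 0 ≤ R) (hUR : ∀ x ∈ U, ‖x‖ ≤ R) (hr : 0 < r)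
    {m : ℤ} (hm : IsLeast {n : ℤ | Ioo 0 (r ^ 2 * T) ×ˢ (r • U) ⊆ cube 0 n} m) :
    (3 : ℝ) ^ (m - 1) < (2 * T + 2 * R + 1) * r := by
  by_contra! h
  have hsub : Ioo 0 (r ^ 2 * T) ×ˢ (r • U) ⊆ cube 0 (m - 1) := by
    rintro ⟨t, y⟩ ⟨⟨ht0, ht⟩, x, hx, rfl⟩
    dsimp only at ht0 ht
    refine ⟨?_, fun l => ?_⟩
    · rw [zpow_two_mul_three]
      simp only [Prod.fst_zero, sub_zero]
      rw [abs_of_pos ht0]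
      have h1 : ((2 * T + 1) * r) ^ 2 ≤ ((3 : ℝ) ^ (m - 1)) ^ 2 := by
        refine pow_le_pow_left₀ (by positivity) (le_trans ?_ h) 2
        gcongr
        linarith
      nlinarith [mul_pos (pow_pos hr 2) hT, pow_pos hr 2, sq_nonneg (T * r)]
    · have h1 : |(r • x) l| ≤ r * R := by
        refine (norm_apply_le _ l).trans ?_
        rw [norm_smul, Real.norm_of_nonneg hr.le]
        exact mul_le_mul_of_nonneg_left (hUR x hx) hr.le
      have h2 : |(r • x) l - (0 : SpaceTime d).2 l| = |(r • x) l| := by simp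
      dsimp only
      rw [h2]
      nlinarith [mul_pos hT hr]
  have := hm.2 hsub
  omega

lemma ball_smul_subset {r : ℝ} (hr : 0 < r) (x : Space d) (ρ : ℝ) :
    ball (r • x) (r * ρ) = r • ball x ρ := by
  rw [_root_.smul_ball hr.ne', Real.norm_of_nonneg hr.le]

/-- Space-time cylinders have a positive density around their points. -/
lemma exists_volume_box_inter (hU : IsBoundedLipschitzDomain U) {T : ℝ} (hT : 0 < T) {C₀ : ℝ}
    (hC₀ : 0 < C₀) : ∃ κ : ℝ, 0 < κ ∧ ∀ r : ℝ, 0 < r → ∀ k : ℤ, (3 : ℝ) ^ k < C₀ * r →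
      ∀ y ∈ Ioo 0 (r ^ 2 * T) ×ˢ (r • U), ENNReal.ofReal (cubeVol d (k + 1)) ≤
        ENNReal.ofReal κ * volume (box y k ∩ Ioo 0 (r ^ 2 * T) ×ˢ (r • U)) := by
  obtain ⟨δ, hδ, c, hc, h⟩ := hU.exists_ball_subset
  set B := (volume (ball (0 : Space d) 1)).toReal with hB
  have hBe : volume (ball (0 : Space d) 1) = ENNReal.ofReal B :=
    (ENNReal.ofReal_toReal measure_ball_lt_top.ne).symm
  have hBpos : 0 < B := ENNReal.toReal_pos (measure_ball_pos _ _ one_pos).ne' measure_ball_lt_top.ne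
  set θ := min 1 (δ / C₀) with hθ
  set τ := min 1 (T / C₀ ^ 2) with hτ
  have hθpos : 0 < θ := lt_min one_pos (by positivity)
  have hτpos : 0 < τ := lt_min one_pos (by positivity)
  refine ⟨3 ^ (d + 2) / (τ * (c * θ) ^ d * B), by positivity, ?_⟩
  rintro r hr k hk ⟨t, _⟩ ⟨⟨ht0, ht⟩, x, hx, rfl⟩
  dsimp only at ht0 ht
  set q : ℝ := 3 ^ k with hq
  have hqpos : 0 < q := pow_pos' k
  obtain ⟨x', hx'⟩ := h x hx (θ * q / r) (by positivity) (by
    rw [div_le_iff₀ hr]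
    calc θ * q ≤ δ / C₀ * (C₀ * r) := by gcongr; exact min_le_right _ _
      _ = δ * r := by field_simp)
  -- the time interval is cut at the ends of the cylinder, which keeps half of its length or all of
  -- the height of the cylinder
  have hsub : Ioo (max 0 (t - q ^ 2)) (min (r ^ 2 * T) (t + q ^ 2)) ×ˢ
      ball (r • x') (r * (c * (θ * q / r))) ⊆
      box (t, r • x) k ∩ Ioo 0 (r ^ 2 * T) ×ˢ (r • U) := by
    rintro ⟨t', y⟩ ⟨⟨h1, h2⟩, hy⟩
    rw [ball_smul_subset hr] at hy
    have h3 : y ∈ ball (r • x) q ∧ y ∈ r • U := by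
      obtain ⟨w, hw, rfl⟩ := hy
      refine ⟨?_, smul_mem_smul_set (hx' hw).2⟩
      have h4 : r • w ∈ ball (r • x) (r * (θ * q / r)) := by
        rw [ball_smul_subset hr]
        exact smul_mem_smul_set (hx' hw).1
      refine ball_subset_ball ?_ h4
      calc r * (θ * q / r) = θ * q := by field_simp
        _ ≤ 1 * q := by gcongr; exact min_le_left _ _
        _ = q := one_mul q
    simp only [max_lt_iff, lt_min_iff] at h1 h2
    refine ⟨⟨?_, fun l => ?_⟩, ⟨h1.1, h2.1⟩, h3.2⟩
    · rw [zpow_two_mul_three, ← hq, abs_lt]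
      dsimp only
      constructor <;> linarith
    · have h4 := h3.1
      rw [mem_ball, dist_eq_norm] at h4
      exact (norm_apply_le (y - r • x) l).trans_lt h4
  have hlen : τ * q ^ 2 ≤ min (r ^ 2 * T) (t + q ^ 2) - max 0 (t - q ^ 2) := by
    have h1 : τ * q ^ 2 ≤ q ^ 2 := by
      calc τ * q ^ 2 ≤ 1 * q ^ 2 := by gcongr; exact min_le_left _ _
        _ = _ := one_mul _
    have h2 : τ * q ^ 2 ≤ r ^ 2 * T := by
      calc τ * q ^ 2 ≤ T / C₀ ^ 2 * (C₀ * r) ^ 2 := by gcongr; exact min_le_right _ _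
        _ = _ := by field_simp
    rcases min_cases (r ^ 2 * T) (t + q ^ 2) with h3 | h3 <;>
      rcases max_cases 0 (t - q ^ 2) with h4 | h4 <;> nlinarith [sq_nonneg q]
  refine le_trans ?_ (mul_le_mul_right (measure_mono hsub) _)
  rw [Measure.volume_eq_prod, Measure.prod_prod, Real.volume_Ioo,
    volume_ball_space _ (by positivity), hBe]
  rw [← ENNReal.ofReal_mul (by positivity),
    ← ENNReal.ofReal_mul (le_trans (by positivity) hlen), ← ENNReal.ofReal_mul (by positivity)]
  refine ENNReal.ofReal_le_ofReal ?_
  have e : r * (c * (θ * q / r)) = c * θ * q := by field_simp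
  rw [e]
  calc cubeVol d (k + 1) = 3 ^ (d + 2) / (τ * (c * θ) ^ d * B) *
        (τ * q ^ 2 * ((c * θ * q) ^ d * B)) := by
        rw [cubeVol_add_one, cubeVol, zpow_two_mul_three, ← hq, mul_pow (c * θ) q d]
        field_simp
    _ ≤ _ := by gcongr

end Cylinder

section Cylinder

open Metric

variable {d : ℕ} {U : Set (Space d)}

lemma boundaryLayer_smul_inter_subset {r : ℝ} (hr : 0 < r) (x : Space d) (η ρ : ℝ) :
    boundaryLayer (r • U) η ∩ ball x ρ ⊆
      r • (boundaryLayer U (η / r) ∩ ball (r⁻¹ • x) (ρ / r)) := by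
  rintro y ⟨⟨⟨w, hw, rfl⟩, z, hz, hwz⟩, hy⟩
  dsimp only at hwz hy
  refine smul_mem_smul_set ⟨⟨hw, r⁻¹ • z, fun h => hz ?_, ?_⟩, ?_⟩
  · exact (mem_smul_set_iff_inv_smul_mem₀ hr.ne' U z).2 h
  · have : dist w (r⁻¹ • z) = dist (r • w) z / r := by
      conv_rhs => rw [← smul_inv_smul₀ hr.ne' z, dist_smul₀, Real.norm_of_nonneg hr.le]
      field_simp
    rw [this]
    gcongr
  · rw [mem_ball] at hy ⊢
    have : dist w (r⁻¹ • x) = dist (r • w) x / r := by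
      conv_rhs => rw [← smul_inv_smul₀ hr.ne' x, dist_smul₀, Real.norm_of_nonneg hr.le]
      field_simp
    rw [this]
    gcongr

/-- The spatial part of a parabolic cube. -/
def spaceCube (x : Space d) (k : ℤ) : Set (Space d) :=
  WithLp.ofLp ⁻¹' univ.pi fun l => ball (x l) ((3 : ℝ) ^ k / 2)

lemma volume_spaceCube (x : Space d) (k : ℤ) :
    volume (spaceCube x k) = ENNReal.ofReal (((3 : ℝ) ^ k) ^ d) := by
  rw [spaceCube, (PiLp.volume_preserving_ofLp (Fin d)).measure_preimage
    (MeasurableSet.univ_pi fun l => measurableSet_ball).nullMeasurableSet, volume_pi_pi]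
  simp only [Real.volume_ball]
  rw [Finset.prod_const, Finset.card_univ, Fintype.card_fin, ← ENNReal.ofReal_pow (by positivity)]
  congr 3
  ring

/-- The part of a parabolic cube that lies near the boundary of a cylinder is small. -/
lemma exists_volume_layer_cylinder (hU : IsBoundedLipschitzDomain U) (hd : 0 < d) (T : ℝ)
    (C₀ : ℝ) : ∃ κ : ℝ, 0 ≤ κ ∧ ∀ r : ℝ, 0 < r → ∀ (n : ℕ) (k : ℤ) (p : Idx d),
      (3 : ℝ) ^ (k + n) < C₀ * r →
      volume (cell (k + n) p ∩ {y | y ∈ Ioo 0 (r ^ 2 * T) ×ˢ (r • U) ∧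
        ∃ w ∉ Ioo 0 (r ^ 2 * T) ×ˢ (r • U), dist y.1 w.1 ≤ (3 : ℝ) ^ (2 * (k + 1)) ∧
          dist y.2 w.2 ≤ (3 : ℝ) ^ (k + 1) * √d}) ≤
        ENNReal.ofReal (κ * (3 ^ n)⁻¹ * cubeVol d (k + n)) := by
  obtain ⟨C, hC, h⟩ := hU.exists_volume_layer_le' hd (2 * (C₀ * √d))
  refine ⟨18 + C * (3 / 2) * (2 * √d) ^ d, by positivity, fun r hr n k p hk => ?_⟩
  set L := r ^ 2 * T with hL
  set q : ℝ := 3 ^ k with hq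
  set Q : ℝ := 3 ^ (k + n) with hQ
  have hqpos : 0 < q := pow_pos' k
  have hQpos : 0 < Q := pow_pos' _
  have hQq : Q = 3 ^ n * q := by
    rw [hQ, zpow_add₀ (by norm_num), zpow_natCast, mul_comm]
  have hd' : 0 < √(d : ℝ) := Real.sqrt_pos.2 (by exact_mod_cast hd)
  set x := (ctr (k + n) p).2 with hx
  have hsub : cell (k + n) p ∩ {y | y ∈ Ioo 0 L ×ˢ (r • U) ∧
        ∃ w ∉ Ioo 0 L ×ˢ (r • U), dist y.1 w.1 ≤ (3 : ℝ) ^ (2 * (k + 1)) ∧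
          dist y.2 w.2 ≤ (3 : ℝ) ^ (k + 1) * √d} ⊆
      (Icc 0 (9 * q ^ 2) ∪ Icc (L - 9 * q ^ 2) L) ×ˢ spaceCube x (k + n) ∪
      ball (ctr (k + n) p).1 ((3 : ℝ) ^ (2 * (k + n)) / 2) ×ˢ
        (boundaryLayer (r • U) (3 * q * √d) ∩ ball x (2 * (Q * √d))) := by
    rintro y ⟨hy, ⟨⟨hy0, hyL⟩, hyU⟩, w, hw, h1, h2⟩
    have hy' := hy
    rw [cell, cube_eq_prod] at hy'
    rw [zpow_two_succ_three, zpow_two_mul_three, Real.dist_eq, abs_le] at h1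
    rw [zpow_succ_three] at h2
    by_cases hwU : w.2 ∈ r • U
    · left
      refine ⟨?_, hy'.2⟩
      have : ¬ w.1 ∈ Ioo 0 L := fun h' => hw ⟨h', hwU⟩
      rw [mem_Ioo, not_and_or, not_lt, not_lt] at this
      rcases this with h3 | h3
      · exact Or.inl ⟨hy0.le, by linarith⟩
      · exact Or.inr ⟨by linarith, hyL.le⟩
    · right
      refine ⟨hy'.1, ⟨hyU, w.2, hwU, h2⟩, ?_⟩
      have := (dist_le_of_mem_cube hy (ctr_mem_cell (k + n) p)).2
      rw [mem_ball]
      refine this.trans_lt ?_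
      have : 0 < Q * √d := by positivity
      linarith
  have hlayer : volume (boundaryLayer (r • U) (3 * q * √d) ∩ ball x (2 * (Q * √d))) ≤
      ENNReal.ofReal (C * (3 / 2 * (3 ^ n)⁻¹) * (2 * √d) ^ d * Q ^ d) := by
    refine (measure_mono (boundaryLayer_smul_inter_subset hr _ _ _)).trans ?_
    rw [Measure.addHaar_smul, finrank_euclideanSpace_fin, abs_of_pos (by positivity)]
    refine (mul_le_mul_right (h _ _ _ (by positivity) ?_ (by positivity)) _).trans ?_
    · rw [div_le_iff₀ hr]
      nlinarith
    · rw [← ENNReal.ofReal_mul (by positivity)]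
      refine ENNReal.ofReal_le_ofReal (le_of_eq ?_)
      have e : 3 * q * √d / r / (2 * (Q * √d) / r) = 3 / 2 * (3 ^ n)⁻¹ := by
        rw [hQq]
        field_simp
      rw [e, div_pow]
      have e2 : (2 * (Q * √(d : ℝ))) ^ d = (2 * √d) ^ d * Q ^ d := by
        rw [← mul_pow]
        ring
      rw [e2]
      field_simp
  refine (measure_mono hsub).trans ((measure_union_le _ _).trans ?_)
  rw [Measure.volume_eq_prod, Measure.prod_prod, Measure.prod_prod, volume_spaceCube,
    Real.volume_ball]
  have ht : volume (Icc 0 (9 * q ^ 2) ∪ Icc (L - 9 * q ^ 2) L) ≤ ENNReal.ofReal (18 * q ^ 2) := by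
    refine (measure_union_le _ _).trans ?_
    rw [Real.volume_Icc, Real.volume_Icc, ← ENNReal.ofReal_add (by rw [sub_zero]; positivity)
      (by rw [sub_sub_cancel]; positivity)]
    refine ENNReal.ofReal_le_ofReal (le_of_eq ?_)
    ring
  refine (add_le_add (mul_le_mul' ht le_rfl) (mul_le_mul' le_rfl hlayer)).trans ?_
  rw [← ENNReal.ofReal_mul (by positivity), ← ENNReal.ofReal_mul (by positivity),
    ← ENNReal.ofReal_add (by positivity) (by positivity)]
  refine ENNReal.ofReal_le_ofReal ?_
  rw [cubeVol, zpow_two_mul_three, ← hQ]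
  have h3 : q ^ 2 ≤ (3 ^ n)⁻¹ * Q ^ 2 := by
    have e : (3 ^ n)⁻¹ * Q ^ 2 = 3 ^ n * q ^ 2 := by
      rw [hQq]
      field_simp
    rw [e]
    have : (1 : ℝ) ≤ 3 ^ n := one_le_pow₀ (by norm_num)
    nlinarith [sq_nonneg q]
  calc _ = 18 * q ^ 2 * Q ^ d +
        C * (3 / 2) * (2 * √d) ^ d * ((3 ^ n)⁻¹ * (Q ^ 2 * Q ^ d)) := by ring
    _ ≤ 18 * ((3 ^ n)⁻¹ * Q ^ 2) * Q ^ d +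
        C * (3 / 2) * (2 * √d) ^ d * ((3 ^ n)⁻¹ * (Q ^ 2 * Q ^ d)) := by gcongr
    _ = _ := by ring

/-- Space-time cylinders over a Lipschitz domain are regular domains, with a constant which does not
change under parabolic dilations. -/
theorem exists_isRegularDomain (hU : IsBoundedLipschitzDomain U) (hd : 0 < d) {T : ℝ}
    (hT : 0 < T) : ∃ κ : ℝ≥0, ∀ r : ℝ, 0 < r → ∀ m : ℤ,
      IsLeast {n : ℤ | Ioo 0 (r ^ 2 * T) ×ˢ (r • U) ⊆ cube 0 n} m →
      IsRegularDomain (Ioo 0 (r ^ 2 * T) ×ˢ (r • U)) m κ := by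
  obtain ⟨R, hR⟩ := hU.isBounded.exists_norm_le
  have hR0 : 0 ≤ R := by
    obtain ⟨x, hx⟩ := hU.isConnected.nonempty
    exact (norm_nonneg x).trans (hR x hx)
  set C₀ := 2 * T + 2 * R + 1
  have hC₀ : 0 < C₀ := by positivity
  obtain ⟨κ₁, hκ₁, h1⟩ := exists_volume_box_inter hU hT hC₀
  obtain ⟨κ₂, hκ₂, h2⟩ := exists_volume_layer_cylinder hU hd T C₀
  refine ⟨1 + κ₁.toNNReal + κ₂.toNNReal, fun r hr m hm => ?_⟩
  have hlt : ∀ k < m, (3 : ℝ) ^ k < C₀ * r := fun k hk =>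
    (zpow_le_zpow_right₀ (by norm_num) (by omega)).trans_lt (zpow_lt_of_isLeast hT hR0 hR hr hm)
  set D := Ioo 0 (r ^ 2 * T) ×ˢ (r • U) with hD
  have hDo : IsOpen D := isOpen_Ioo.prod (hU.isOpen.smul₀ hr.ne')
  refine ⟨hDo, ?_, ?_, hm.1, ?_, ?_, ?_, ?_⟩
  · refine isPreconnected_Ioo.prod ?_
    exact hU.isConnected.isPreconnected.image _ (continuous_const_smul r).continuousOn
  · exact (nonempty_Ioo.2 (by positivity)).prod (hU.isConnected.nonempty.smul_set)
  · rw [add_assoc]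
    exact le_self_add
  · intro i hi
    -- a cube of the scale of `D` inside `D` is centred at the origin, which is not in `D`
    have h0 : cell m i ⊆ cell m 0 := cell_zero (d := d) m ▸ hi.trans hm.1
    have hi0 : i = 0 := by
      by_contra hne
      exact (disjoint_cell hne).le_bot ⟨ctr_mem_cell m i, h0 (ctr_mem_cell m i)⟩
    have h3 := (hi (ctr_mem_cell m i)).1
    simp [hi0, ctr] at h3
  · intro k hk y hy
    refine (h1 r hr k (hlt k hk) y hy).trans ?_
    refine mul_le_mul' ?_ le_rfl
    rw [ENNReal.ofReal]
    exact_mod_cast (le_add_self : κ₁.toNNReal ≤ 1 + κ₁.toNNReal).trans le_self_add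
  · intro n k p hkn
    set A := {i | (cell k i ⊆ D ∧ ¬ cell (k + 1) (par i) ⊆ D) ∧ par^[n] i = p} with hA
    have e : ∑' i, A.indicator (fun _ => ENNReal.ofReal (cubeVol d k)) i =
        volume (⋃ i ∈ A, cell k i) := by
      rw [measure_biUnion (to_countable A) (fun i _ j _ hij => disjoint_cell hij)
        (fun i _ => measurableSet_cell k i), ← tsum_subtype]
      simp only [volume_cell]
    rw [e]
    refine (measure_mono (iUnion₂_subset fun i hi y hy => ?_)).trans
      ((h2 r hr n k p (hlt _ hkn)).trans ?_)
    · obtain ⟨⟨hi1, hi2⟩, rfl⟩ := hi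
      obtain ⟨w, hw, hwD⟩ := not_subset.1 hi2
      exact ⟨iterate_par_subset k n i hy, hi1 hy, w, hwD,
        dist_le_of_mem_cube (cell_subset_par k i hy) hw⟩
    · rw [ENNReal.ofReal_mul (by positivity), ENNReal.ofReal_mul hκ₂,
        ENNReal.ofReal_inv_of_pos (by positivity), ENNReal.ofReal_pow (by norm_num)]
      refine mul_le_mul' (mul_le_mul' ?_ ?_) le_rfl
      · rw [ENNReal.ofReal]
        exact_mod_cast le_add_self
      · norm_num

end Cylinder

/-! ### The coarse-grained Poincaré inequality -/

section Poincare

variable {d : ℕ} {a : SpaceTime d → Matrix (Fin d) (Fin d) ℝ} {D : Set (SpaceTime d)} {m : ℤ}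
  {κ : ℝ≥0} {f F G : SpaceTime d → Space d} {u : SpaceTime d → ℝ}

lemma energy_eq_mul_energyNorm_sq (h0 : volume D ≠ 0) (h : volume D ≠ ⊤) :
    energy a G D = volume D * energyNorm a D G ^ 2 := by
  rw [energyNorm, sq_rpow_half, setLAverage_eq, ENNReal.mul_div_cancel h0 h]
  rfl

lemma IsRegularDomain.ofReal_cubeVol_le (hD : IsRegularDomain D m κ) :
    ENNReal.ofReal (cubeVol d m) ≤ κ * volume D := by
  obtain ⟨y, hy⟩ := hD.nonempty
  have := hD.thick (m - 1) (by omega) y hy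
  rw [sub_add_cancel] at this
  exact this.trans (mul_le_mul_right (measure_mono inter_subset_right) _)

/-- The integral of `F · g` is the limit of those of `F` against piecewise constant approximations
of `g`, which only see the integrals of `F` over triadic cubes. -/
lemma enorm_integral_inner_sq_le (hD : IsRegularDomain D m κ) {s : ℝ} {β : ℤ → ℝ≥0∞} {Y : ℝ≥0∞}
    (hF : IntegrableOn F D) (hY : Y * oscSum s D f ≠ ⊤)
    (hI : ∀ n j, cell n j ⊆ D → Y * oscSum s (cell n j) f ≠ ⊤ → ‖∫ z in cell n j, F z‖ₑ ^ 2 ≤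
      ENNReal.ofReal (cubeVol d n) * β n *
        (2 * energy a G (cell n j) + 8 * (Y * oscSum s (cell n j) f)))
    {g : SpaceTime d → Space d} (hg : Continuous g) (hgi : IntegrableOn g D) :
    ‖∫ z in D, (inner ℝ (F z) (g z) : ℝ)‖ₑ ^ 2 ≤
      incSum s D g * (∑' l, wt s l * β l) * (2 * energy a G D + 8 * (Y * oscSum s D f)) := by
  simp only [real_inner_comm (g _) (F _)]
  have hlim := tendsto_integral_inner_cubeProj hD.isOpen
    ((isBounded_cube 0 m).subset hD.subset) hg hF
  refine le_of_tendsto (((ENNReal.continuous_pow 2).tendsto _).comp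
    ((continuous_enorm.tendsto _).comp hlim)) ?_
  filter_upwards [eventually_le_atBot m] with k hk
  refine enorm_integral_inner_cubeProj_sq_le s hD.isOpen.measurableSet hgi hF hD.not_subset k hk β
    (fun l i => 2 * energy a G (cell l i) + 8 * (Y * oscSum s (cell l i) f)) _ (fun l => ?_)
    fun l i _ hi _ => hI l i hi (ne_top_of_le_ne_top hY (mul_le_mul_right (oscSum_mono s hi) _))
  have e : ∀ i, {i | cell l i ⊆ D}.indicator
      (fun i => 2 * energy a G (cell l i) + 8 * (Y * oscSum s (cell l i) f)) i =
      2 * {i | cell l i ⊆ D}.indicator (fun i => energy a G (cell l i)) i +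
        8 * (Y * {i | cell l i ⊆ D}.indicator (fun i => oscSum s (cell l i) f) i) := fun i => by
    by_cases hi : cell l i ⊆ D
    · simp only [indicator_of_mem (s := {i | cell l i ⊆ D}) hi]
    · simp only [indicator_of_notMem (s := {i | cell l i ⊆ D}) hi, mul_zero, add_zero]
  rw [tsum_congr e, ENNReal.tsum_add, ENNReal.tsum_mul_left, ENNReal.tsum_mul_left,
    ENNReal.tsum_mul_left]
  have h1 := tsum_energy_le (a := a) (G := G) hD.isOpen.measurableSet l
  have h2 := tsum_oscSum_le s l D f
  gcongr

lemma add_sq_le_sq_add (x y : ℝ≥0∞) : x ^ 2 + y ^ 2 ≤ (x + y) ^ 2 := by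
  rw [add_sq]
  gcongr
  exact le_self_add

/-- Bounds for the integrals of `F` over triadic cubes in terms of the local energy and the local
oscillations of `f` give a bound in a space of negative regularity. -/
theorem exists_besovDualNorm_le (d : ℕ) (κ : ℝ≥0) {s : ℝ} (hs' : s < 1 / 2) :
    ∃ C : ℝ≥0, ∀ (D : Set (SpaceTime d)) (m : ℤ), IsRegularDomain D m κ →
      ∀ (a : SpaceTime d → Matrix (Fin d) (Fin d) ℝ) (f F G : SpaceTime d → Space d)
        (β : ℤ → ℝ≥0∞) (Y : ℝ≥0∞), IntegrableOn f D → IntegrableOn F D →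
      ∑' l, wt s l * β l ≠ 0 →
      (∀ n j, cell n j ⊆ D → Y * oscSum s (cell n j) f ≠ ⊤ → ‖∫ z in cell n j, F z‖ₑ ^ 2 ≤
        ENNReal.ofReal (cubeVol d n) * β n *
          (2 * energy a G (cell n j) + 8 * (Y * oscSum s (cell n j) f))) →
      besovDualNorm m D s F ≤ C * (∑' l, wt s l * β l) ^ (1 / 2 : ℝ) *
        (energyNorm a D G + Y ^ (1 / 2 : ℝ) * besovNorm m D s f) := by
  obtain ⟨C, hC⟩ := exists_incSum_le d κ hs'
  refine ⟨4 * (C * κ + 1), fun D m hD a f F G β Y hf hF hX hI => ?_⟩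
  set X := ∑' l, wt s l * β l
  set V := volume D with hV
  have hV0 : V ≠ 0 := hD.volume_ne_zero
  have hVt : V ≠ ⊤ := hD.volume_ne_top
  set A : ℝ≥0∞ := C * κ with hA
  have hAv : C * ENNReal.ofReal (cubeVol d m) ≤ A * V := by
    rw [hA, mul_assoc]
    exact mul_le_mul_right hD.ofReal_cubeVol_le _
  set c : ℝ≥0∞ := 4 * (A + 1) with hc
  have hc' : ((4 * (C * κ + 1) : ℝ≥0) : ℝ≥0∞) = c := by
    rw [hc, hA]
    push_cast
    rfl
  rw [hc']
  set φ := besovNorm m D s f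
  have hosc : oscSum s D f ≤ A * V * φ ^ 2 := (hC D m hD f hf).2.trans (mul_le_mul_left hAv _)
  by_cases hY : Y * oscSum s D f = ⊤
  -- the right-hand side is infinite, since `0 * ⊤` does not occur in it: `hX` keeps its prefactor
  -- away from zero
  · have h1 : Y * (A * V * φ ^ 2) = ⊤ := top_le_iff.1 (hY ▸ mul_le_mul_right hosc Y)
    have h2 : Y * φ ^ 2 = ⊤ := by
      have e : Y * (A * V * φ ^ 2) = A * V * (Y * φ ^ 2) := by ring
      rw [e] at h1
      by_contra h
      exact ENNReal.mul_ne_top (ENNReal.mul_ne_top (by finiteness) hVt) h h1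
    have h3 : Y ^ (1 / 2 : ℝ) * φ = ⊤ := by
      have e : (Y ^ (1 / 2 : ℝ) * φ) ^ 2 = Y * φ ^ 2 := by rw [mul_pow, sq_rpow_half]
      by_contra h
      exact ENNReal.pow_ne_top h (e.trans h2)
    rw [h3, add_top, ENNReal.mul_top]
    · exact le_top
    · refine mul_ne_zero (by simp [hc]) ?_
      rw [Ne, ENNReal.rpow_eq_zero_iff]
      simp [hX]
  refine iSup_le fun g => iSup_le fun hg => iSup_le fun hg1 => ?_
  have hgi : IntegrableOn g D :=
    (hg.continuous.continuousOn.integrableOn_compact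
      ((isBounded_cube 0 m).subset hD.subset).isCompact_closure).mono_set subset_closure
  have hinc : incSum s D g ≤ A * V := by
    refine (hC D m hD g hgi).1.trans ((mul_le_mul' hAv (pow_le_one₀ zero_le hg1)).trans_eq ?_)
    rw [mul_one]
  have key := enorm_integral_inner_sq_le hD hF hY hI hg.continuous hgi
  rw [energy_eq_mul_energyNorm_sq hV0 hVt, ← hV] at key
  set e := energyNorm a D G
  set b := ‖∫ z in D, (inner ℝ (F z) (g z) : ℝ)‖ₑ with hb
  have hb' : b ≤ V * (c * X ^ (1 / 2 : ℝ) * (e + Y ^ (1 / 2 : ℝ) * φ)) := by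
    rw [← ENNReal.pow_le_pow_left_iff two_ne_zero]
    have hA1 : A ≤ A + 1 := le_self_add
    have h1A : 1 ≤ A + 1 := le_add_self
    have h2A : A * 2 ≤ c ^ 2 := by
      calc A * 2 ≤ (A + 1) * (A + 1) * 16 := by
            gcongr
            · exact hA1.trans (le_mul_of_one_le_right' h1A)
            · norm_num
        _ = c ^ 2 := by rw [hc]; ring
    have h8A : A * A * 8 ≤ c ^ 2 := by
      calc A * A * 8 ≤ (A + 1) * (A + 1) * 16 := by
            gcongr
            norm_num
        _ = c ^ 2 := by rw [hc]; ring
    calc b ^ 2 ≤ A * V * X * (2 * (V * e ^ 2) + 8 * (Y * (A * V * φ ^ 2))) := by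
          refine key.trans ?_
          gcongr
      _ = V ^ 2 * X * (A * 2 * e ^ 2 + A * A * 8 * (Y * φ ^ 2)) := by ring
      _ ≤ V ^ 2 * X * (c ^ 2 * e ^ 2 + c ^ 2 * (Y * φ ^ 2)) := by gcongr
      _ = V ^ 2 * X * c ^ 2 * (e ^ 2 + (Y ^ (1 / 2 : ℝ) * φ) ^ 2) := by
          rw [mul_pow (Y ^ (1 / 2 : ℝ)), sq_rpow_half]
          ring
      _ ≤ V ^ 2 * X * c ^ 2 * (e + Y ^ (1 / 2 : ℝ) * φ) ^ 2 := by
          gcongr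
          exact add_sq_le_sq_add _ _
      _ = _ := by
          rw [mul_pow V, mul_pow (c * X ^ (1 / 2 : ℝ)), mul_pow c, sq_rpow_half]
          ring
  have h1 : ENNReal.ofReal (⨍ z in D, (inner ℝ (F z) (g z) : ℝ)) ≤ V⁻¹ * b := by
    rw [setAverage_eq, smul_eq_mul]
    refine (Real.ofReal_le_enorm _).trans_eq ?_
    rw [enorm_mul, ← hb, Measure.real, ← ENNReal.toReal_inv,
      Real.enorm_of_nonneg ENNReal.toReal_nonneg,
      ENNReal.ofReal_toReal (ENNReal.inv_ne_top.2 hV0)]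
  refine h1.trans ((mul_le_mul_right hb' _).trans_eq ?_)
  rw [← mul_assoc, ENNReal.inv_mul_cancel hV0 hVt, one_mul]

end Poincare

section Ellipticity

variable {d : ℕ} {a : SpaceTime d → Matrix (Fin d) (Fin d) ℝ} {D : Set (SpaceTime d)} {m : ℤ}
  {κ : ℝ≥0} {f G : SpaceTime d → Space d} {u : SpaceTime d → ℝ}

/-- The maximal size `max_{z ∈ Z_k ∩ □_m} |M(z + □_k)|` of a matrix-valued function `M` of cubes,
set to zero for the scales above `m`. -/
def maxNorm (M : Set (SpaceTime d) → Matrix (Fin d) (Fin d) ℝ) (m k : ℤ) : ℝ≥0∞ :=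
  (Iic m).indicator (fun k => ⨆ z ∈ lattice d k ∩ cube 0 m, specNorm (M (cube z k))) k

/-- The multiscale sum `∑_{k ≤ m} 3^{2s(k-m)} max_{z ∈ Z_k ∩ □_m} |M(z + □_k)|`. -/
def multiscale (M : Set (SpaceTime d) → Matrix (Fin d) (Fin d) ℝ) (s : ℝ) (m : ℤ) : ℝ≥0∞ :=
  ∑' k : ℤ, (3 : ℝ≥0∞) ^ (s * 2 * ((k : ℝ) - (m : ℝ))) * maxNorm M m k

variable (M : Set (SpaceTime d) → Matrix (Fin d) (Fin d) ℝ)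

lemma multiscale_eq (s : ℝ) (m : ℤ) : multiscale M s m =
    ∑' k : Iic m, (3 : ℝ≥0∞) ^ (s * 2 * (((k : ℤ) : ℝ) - (m : ℝ))) *
      ⨆ z ∈ lattice d k ∩ cube 0 m, specNorm (M (cube z k)) ^ ((2 : ℝ) / 2) := by
  rw [tsum_subtype (Iic m) fun k : ℤ => (3 : ℝ≥0∞) ^ (s * 2 * ((k : ℝ) - (m : ℝ))) *
      ⨆ z ∈ lattice d k ∩ cube 0 m, specNorm (M (cube z k)) ^ ((2 : ℝ) / 2)]
  refine tsum_congr fun k => ?_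
  rw [indicator_mul_right, maxNorm]
  simp

lemma LambdaUpper_eq (s : ℝ) (m : ℤ) : LambdaUpper a s 2 m = multiscale (bMat a) s m := by
  rw [LambdaUpper, multiscale_eq, div_self two_ne_zero, ENNReal.rpow_one]

lemma lambdaLower_eq (s : ℝ) (m : ℤ) :
    lambdaLower a s 2 m = (multiscale (sStarInv a) s m)⁻¹ := by
  rw [lambdaLower, multiscale_eq, div_self two_ne_zero, ENNReal.rpow_neg_one]

lemma tsum_wt_mul_maxNorm (s : ℝ) (m : ℤ) :
    ∑' k, wt s k * maxNorm M m k = (3 : ℝ≥0∞) ^ (2 * s * (m : ℝ)) * multiscale M s m := by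
  rw [multiscale, ← ENNReal.tsum_mul_left]
  refine tsum_congr fun k => ?_
  rw [← mul_assoc, ← ENNReal.rpow_add _ _ (by norm_num) (by norm_num), wt]
  congr 2
  ring

/-- A lower exponent raises the weights of the scales below `m`: `λ_{s-ε}⁻¹` bounds `λ_s⁻¹`. -/
lemma multiscale_anti {s s' : ℝ} (h : s' ≤ s) (m : ℤ) : multiscale M s m ≤ multiscale M s' m := by
  refine ENNReal.tsum_le_tsum fun k => ?_
  by_cases hk : k ≤ m
  · have hk' : (k : ℝ) ≤ m := by exact_mod_cast hk
    refine mul_le_mul_left (ENNReal.rpow_le_rpow_of_exponent_le (by norm_num) ?_) _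
    nlinarith
  · rw [maxNorm, indicator_of_notMem (by simpa using hk)]
    simp

lemma specNorm_le_maxNorm {k : ℤ} {i : Idx d} (h : cell k i ⊆ cube 0 m) :
    specNorm (M (cell k i)) ≤ maxNorm M m k := by
  have hk : k ≤ m := scale_le_of_subset (j := 0) ((cell_zero (d := d) m).symm ▸ h)
  rw [maxNorm, indicator_of_mem (mem_Iic.2 hk)]
  exact le_iSup₂ (f := fun z (_ : z ∈ lattice d k ∩ cube 0 m) => specNorm (M (cube z k)))
    (ctr k i) ⟨range_ctr (d := d) k ▸ mem_range_self i, h (ctr_mem_cell k i)⟩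

/-- The multiscale sum does not vanish, which excludes products `0 * ⊤` in the estimates. -/
lemma multiscale_ne_zero {s : ℝ} (h : specNorm (M (cube 0 m)) ≠ 0) : multiscale M s m ≠ 0 := by
  rw [multiscale, Ne, ENNReal.tsum_eq_zero]
  push Not
  refine ⟨m, mul_ne_zero (ENNReal.rpow_pos (by norm_num) (by norm_num)).ne' ?_⟩
  rw [← cell_zero] at h
  exact (h.bot_lt.trans_le (specNorm_le_maxNorm M (cell_zero (d := d) m).subset)).ne'

/-- The coarse-grained Poincaré inequality in a regular domain, for the gradient and for the
flux. -/
theorem exists_coarse_poincare (hd : 0 < d) (κ : ℝ≥0) {s : ℝ} (hs' : s < 1 / 2) :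
    ∃ C : ℝ≥0, ∀ (D : Set (SpaceTime d)) (m : ℤ), IsRegularDomain D m κ →
      ∀ a : SpaceTime d → Matrix (Fin d) (Fin d) ℝ, IsCoefficientField a →
      ∀ f : SpaceTime d → Space d, IntegrableOn f D → ∀ u G, IsWeakSolution a f D u G →
      (besovDualNorm m D s G ≤
        C * ((3 : ℝ≥0∞) ^ (2 * s * (m : ℝ)) * multiscale (sStarInv a) s m) ^ (1 / 2 : ℝ) *
        (energyNorm a D G + ((3 : ℝ≥0∞) ^ (2 * s * (m : ℝ)) * multiscale (sStarInv a) s m) ^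
          (1 / 2 : ℝ) * besovNorm m D s f)) ∧
      (besovDualNorm m D s (flux a G) ≤
        C * ((3 : ℝ≥0∞) ^ (2 * s * (m : ℝ)) * multiscale (bMat a) s m) ^ (1 / 2 : ℝ) *
        (energyNorm a D G + ((3 : ℝ≥0∞) ^ (2 * s * (m : ℝ)) * multiscale (sStarInv a) s m) ^
          (1 / 2 : ℝ) * besovNorm m D s f)) := by
  obtain ⟨C, hC⟩ := exists_besovDualNorm_le d κ hs'
  refine ⟨C, fun D m hD a ha f hf u G hu => ?_⟩
  have h0 := sStarInv_bMat_ne_zero ha (isBounded_cube (0 : SpaceTime d) m)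
    (isOpen_cube 0 m).measurableSet hd
    (by rw [volume_cube]; exact (ENNReal.ofReal_pos.2 (cubeVol_pos d m)).ne')
  have h3 : (3 : ℝ≥0∞) ^ (2 * s * (m : ℝ)) ≠ 0 := (ENNReal.rpow_pos (by norm_num) (by norm_num)).ne'
  have hDb := (isBounded_cube 0 m).subset hD.subset
  simp only [← tsum_wt_mul_maxNorm]
  have hσ : ∀ n j, cell n j ⊆ D → ∀ l i, cell l i ⊆ cell n j →
      specNorm (sStarInv a (cell l i)) ≤ maxNorm (sStarInv a) m l := fun n j hj l i hi =>
    specNorm_le_maxNorm _ (hi.trans (hj.trans hD.subset))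
  constructor
  · refine hC D m hD a f G G (maxNorm (sStarInv a) m) _ hf hu.isWeakGradient.integrableOn_grad ?_
      fun n j hj hfin => ?_
    · rw [tsum_wt_mul_maxNorm]
      exact mul_ne_zero h3 (multiscale_ne_zero _ h0.1)
    · refine (enorm_integral_grad_sq_le ha hd s _ (hσ n j hj) (hf.mono_set hj) hfin
        (hu.mono hj)).trans ?_
      gcongr
      exact hσ n j hj n j Subset.rfl
  · refine hC D m hD a f (flux a G) G (maxNorm (bMat a) m) _ hf (hu.integrableOn_flux ha hDb) ?_
      fun n j hj hfin => ?_
    · rw [tsum_wt_mul_maxNorm]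
      exact mul_ne_zero h3 (multiscale_ne_zero _ h0.2)
    · refine (enorm_integral_flux_sq_le ha hd s _ (hσ n j hj) (hf.mono_set hj) hfin
        (hu.mono hj)).trans ?_
      gcongr
      exact specNorm_le_maxNorm _ (hj.trans hD.subset)

end Ellipticity

end CoarseParabolic

end

theorem proposition5p1 (d : ℕ) (hd : 0 < d) (s ε : ℝ) (hs : 0 < s) (hs' : s < 1 / 2)
    (hε : 0 < ε) (hε' : ε < s) (T : ℝ) (hT : 0 < T) (U : Set (CoarseParabolic.Space d))
    (hU : CoarseParabolic.IsBoundedLipschitzDomain U) :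
    ∃ C : ℝ≥0, ∀ r : ℝ, 0 < r → ∀ D : Set (CoarseParabolic.SpaceTime d),
      D = Set.Ioo 0 (r ^ 2 * T) ×ˢ (r • U) →
      ∀ m : ℤ, IsLeast {n : ℤ | D ⊆ CoarseParabolic.cube 0 n} m →
      ∀ a : CoarseParabolic.SpaceTime d → Matrix (Fin d) (Fin d) ℝ,
      CoarseParabolic.IsCoefficientField a →
      ∀ f : CoarseParabolic.SpaceTime d → CoarseParabolic.Space d, IntegrableOn f D →
      ∀ (u : CoarseParabolic.SpaceTime d → ℝ)
        (G : CoarseParabolic.SpaceTime d → CoarseParabolic.Space d),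
      CoarseParabolic.IsWeakSolution a f D u G →
      CoarseParabolic.besovDualNorm m D s G ≤
          C * (3 : ℝ≥0∞) ^ (s * (m : ℝ))
            * CoarseParabolic.lambdaLower a (s - ε) 2 m ^ (-(1 / 2) : ℝ)
            * CoarseParabolic.energyNorm a D G
          + C * (3 : ℝ≥0∞) ^ (2 * s * (m : ℝ))
            * (CoarseParabolic.lambdaLower a (s - ε) 2 m)⁻¹
            * CoarseParabolic.besovNorm m D s f ∧
      CoarseParabolic.besovDualNorm m D s (fun z => Matrix.toEuclideanLin (a z) (G z)) ≤
          C * (3 : ℝ≥0∞) ^ (s * (m : ℝ))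
            * CoarseParabolic.LambdaUpper a s 2 m ^ (1 / 2 : ℝ)
            * CoarseParabolic.energyNorm a D G
          + C * (CoarseParabolic.LambdaUpper a s 2 m ^ (1 / 2 : ℝ)
              / CoarseParabolic.lambdaLower a (s - ε) 2 m ^ (1 / 2 : ℝ))
            * (3 : ℝ≥0∞) ^ (2 * s * (m : ℝ))
            * CoarseParabolic.besovNorm m D s f := by
  open CoarseParabolic in
  obtain ⟨κ, hκ⟩ := exists_isRegularDomain hU hd hT
  obtain ⟨C, hC⟩ := exists_coarse_poincare hd κ hs'
  refine ⟨C, ?_⟩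
  rintro r hr D rfl m hm a ha f hf u G hu
  obtain ⟨h1, h2⟩ := hC _ m (hκ r hr m hm) a ha f hf u G hu
  have h3 : ((3 : ℝ≥0∞) ^ (2 * s * (m : ℝ))) ^ (1 / 2 : ℝ) = 3 ^ (s * (m : ℝ)) := by
    rw [← ENNReal.rpow_mul]
    ring_nf
  have h4 : (3 : ℝ≥0∞) ^ (2 * s * (m : ℝ)) = 3 ^ (s * (m : ℝ)) * 3 ^ (s * (m : ℝ)) := by
    rw [← ENNReal.rpow_add _ _ (by norm_num) (by norm_num)]
    ring_nf
  have hle := multiscale_anti (sStarInv a) (sub_le_self s hε.le) m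
  rw [LambdaUpper_eq, lambdaLower_eq, ENNReal.rpow_neg, ENNReal.inv_rpow, inv_inv, inv_inv, h4,
    div_eq_mul_inv (_ : ℝ≥0∞), inv_inv]
  simp only [ENNReal.mul_rpow_of_nonneg _ _ (show (0 : ℝ) ≤ 1 / 2 by norm_num), h3] at h1 h2
  set M := multiscale (sStarInv a) s m
  set M' := multiscale (sStarInv a) (s - ε) m
  have hle' : M ^ (1 / 2 : ℝ) ≤ M' ^ (1 / 2 : ℝ) := by gcongr
  constructor
  · refine h1.trans ?_
    have hM : M' = M' ^ (1 / 2 : ℝ) * M' ^ (1 / 2 : ℝ) := by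
      rw [← sq, sq_rpow_half]
    calc _ ≤ C * (3 ^ (s * (m : ℝ)) * M' ^ (1 / 2 : ℝ)) * (energyNorm a _ G +
          3 ^ (s * (m : ℝ)) * M' ^ (1 / 2 : ℝ) * besovNorm m _ s f) := by gcongr
      _ = _ := by
          generalize M' ^ (1 / 2 : ℝ) = N at hM ⊢
          rw [hM]
          ring
  · refine h2.trans ?_
    calc _ ≤ C * (3 ^ (s * (m : ℝ)) * multiscale (bMat a) s m ^ (1 / 2 : ℝ)) * (energyNorm a _ G +
          3 ^ (s * (m : ℝ)) * M' ^ (1 / 2 : ℝ) * besovNorm m _ s f) := by gcongr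
      _ = _ := by ring
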